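/- **Setting.** Let $m,\sigma,R>0$ (molecular mass, molecular diameter, specific gas constant), let $D\subset\mathbb R^3$ be an open set whose boundary is $C^1$ up to a set of zero area (two-dimensional Hausdorff measure), and let $\chi_D$ be its indicator function; $D=\mathbb R^3$ is allowed. Let $\mathcal S$ be continuous and non-negative on $[0,x_{\max})$, $x_{\max}\le\infty$. Put $\langle\,\cdot\,\rangle=\int_{\mathbb R^3}\cdot\,d\boldsymbol\xi$, let $\theta$ be the Heaviside function ($\theta(0)=1$), $d\Omega$ the solid-angle measure on the unit sphere $\mathbb S^2$, and for $\boldsymbol\alpha\in\mathbb S^2$ $$V_\alpha=(\boldsymbol\xi_*-\boldsymbol\xi)\cdot\boldsymbol\alpha,\quad \boldsymbol\xi'=\boldsymbol\xi+V_\alpha\boldsymbol\alpha,\quad \boldsymbol\xi_*'=\boldsymbol\xi_*-V_\alpha\boldsymbol\alpha .$$ Let $f(t,\mathbf X,\boldsymbol\xi)$ be a distribution function on $I\times D\times\mathbb R^3$, $I\subset\mathbb R$ open. The argument $t$ is suppressed. Put $\mathbf X^{s}=\mathbf X+s\boldsymbol\alpha$ and $$\rho=\langle f\rangle,\quad v_i=\tfrac1\rho\langle\xi_i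 f\rangle,\quad e=\tfrac1{2\rho}\langle|\boldsymbol\xi-\mathbf v|^2f\rangle,\quad \mathcal R(\mathbf X)=\tfrac1m\int_D\rho(\mathbf Y)\,\theta(\sigma-|\mathbf Y-\mathbf X|)\,d\mathbf Y,$$ $$g(\mathbf X,\mathbf Y)=[\mathcal S(\mathcal R(\mathbf X))+\mathcal S(\mathcal R(\mathbf Y))]\chi_D(\mathbf X)\chi_D(\mathbf Y).$$ Assume that $f$ solves the Enskog equation $\partial_t f+\xi_i\,\partial f/\partial X_i=J(f)$ on $I\times D\times\mathbb R^3$, where $$J(f)=\frac{\sigma^2}{m}\iint\Big[g(\mathbf X^{\sigma},\mathbf X)f(\mathbf X^{\sigma},\boldsymbol\xi_*')f(\mathbf X,\boldsymbol\xi')-g(\mathbf X^{-\sigma},\mathbf X)f(\mathbf X^{-\sigma},\boldsymbol\xi_*)f(\mathbf X,\boldsymbol\xi)\Big]V_\alpha\theta(V_\alpha)\,d\boldsymbol\xi_*\,d\Omega(\boldsymbol\alpha),$$ that $\mathcal R<x_{\max}$ on $I\times\overline D$, and that the boundary is impermeable: $\mathbf v\cdot\mathbf n=0$ at every boundary point with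 a normal $\mathbf n$ (as a limit from inside $D$). Assume finally that $f$ is positive, smooth and decaying in the following sense: $f$ is continuous and $C^1$ in $(t,\mathbf X)$, with $\partial_tf$ and $\nabla_{\mathbf X}f$ continuous in all variables; $f$, $\partial_tf$ and $\nabla_{\mathbf X}f$ decay in $\boldsymbol\xi$ faster than every power of $|\boldsymbol\xi|$, and $|\ln f|$ grows at most polynomially in $|\boldsymbol\xi|$; the bounds are uniform for $t$ in compact subsets of $I$ and for $\mathbf X$ in bounded subsets of $D$ (for $\nabla_{\mathbf X}f$: in compact subsets of $D$). **Free energy and flux.** Let $T_w>0$ be the constant temperature of the heat bath, and set (summing over repeated indices) $$H=\langle f\ln f\rangle+H^{(c)},\quad H^{(c)}=\rho\int_0^{\mathcal R}\mathcal S(x)\,dx,\quad J^H_i=\langle\xi_if\ln f\rangle+J^{(k)}_i+J^{(c)}_i,$$ $$J^{(k)}_i=\frac{\sigma^3}{2m}\iiint\!\int_0^1\alpha_i\,g(\mathbf X^{\tau\sigma},\mathbf X^{(\tau-1)\sigma})\ln\frac{f(\mathbf X^{\tau\sigma},\boldsymbol\xi')}{f(\mathbf X^{\tau\sigma},\boldsymbol\xi)}f(\mathbf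 X^{\tau\sigma},\boldsymbol\xi)f(\mathbf X^{(\tau-1)\sigma},\boldsymbol\xi_*)V_\alpha\theta(V_\alpha)\,d\tau\,d\boldsymbol\xi_*d\boldsymbol\xi\,d\Omega(\boldsymbol\alpha),$$ $$J^{(c)}_i=H^{(c)}v_i-\frac{\sigma^3}{2m}\int_{\mathbb S^2}\int_0^1[v_j(\mathbf X^{\tau\sigma})-v_j(\mathbf X^{(\tau-1)\sigma})]\,\rho(\mathbf X^{\tau\sigma})\rho(\mathbf X^{(\tau-1)\sigma})\,\mathcal S(\mathcal R(\mathbf X^{\tau\sigma}))\,\chi_D(\mathbf X^{(\tau-1)\sigma})\chi_D(\mathbf X^{\tau\sigma})\,\alpha_i\alpha_j\,d\tau\,d\Omega(\boldsymbol\alpha).$$ Let $p_{ij}=\langle(\xi_i-v_i)(\xi_j-v_j)f\rangle+p^{(c)}_{ij}$ and $q_i=\frac12\langle(\xi_i-v_i)|\boldsymbol\xi-\mathbf v|^2f\rangle+q^{(c)}_i$ with the collisional parts $$p^{(c)}_{ij}=\frac{\sigma^2}{2m}\iiint\!\int_0^\sigma\alpha_i\alpha_j\,\Gamma\,d\lambda\,d\boldsymbol\xi_*d\boldsymbol\xi\,d\Omega(\boldsymbol\alpha),\qquad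 q^{(c)}_i=\frac{\sigma^2}{4m}\iiint\!\int_0^\sigma\alpha_i\,[(\boldsymbol\xi+\boldsymbol\xi_*-2\mathbf v(\mathbf X))\cdot\boldsymbol\alpha]\,\Gamma\,d\lambda\,d\boldsymbol\xi_*d\boldsymbol\xi\,d\Omega(\boldsymbol\alpha),$$ $$\Gamma=V_\alpha^2\,\theta(V_\alpha)\,g(\mathbf X^{\lambda},\mathbf X^{\lambda-\sigma})f(\mathbf X^{\lambda-\sigma},\boldsymbol\xi_*)f(\mathbf X^{\lambda},\boldsymbol\xi).$$ Finally let $$F=RT_wH+\rho\big(e+\tfrac12|\mathbf v|^2\big),\qquad J^F_i=RT_wJ^H_i+\rho v_i\big(e+\tfrac12|\mathbf v|^2\big)+p_{ij}v_j+q_i .$$ **Statement (local free-energy inequality).** $F$ is differentiable in $t$ on $I\times D$, and $$\frac{\partial F}{\partial t}+\frac{\partial J^F_i}{\partial X_i}\le0$$ holds (a) at every $(t,\mathbf X)\in I\times D$ at which $J^F(t,\cdot)$ is differentiable, and (b) for every $t\in I$ on the whole of $D$ in the sense of distributions: $\partial_tF(t,\cdot)$ and $J^F(t,\cdot)$ are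 locally integrable on $D$, and $$\int_D\partial_tF\,\varphi\,d\mathbf X\le\int_DJ^F_i\,\frac{\partial\varphi}{\partial X_i}\,d\mathbf X\qquad\text{for all }0\le\varphi\in C_c^\infty(D).$$ -/

import Mathlib

open MeasureTheory Set Filter Topology
open scoped ContDiff

namespace EESM

noncomputable section

/-- Physical space and velocity space, with the Euclidean norm. -/
abbrev E := EuclideanSpace ℝ (Fin 3)

/-- Unit vectors `α`. -/
abbrev S2 := Metric.sphere (0 : E) 1

/-- The solid-angle (surface) measure `dΩ(α)` on the unit sphere; its total mass is `4π`. -/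
def solidAngle : Measure S2 := (volume : Measure E).toSphere

/-- The partial derivative `∂h/∂X_i`. -/
def pderiv (i : Fin 3) (h : E → ℝ) (X : E) : ℝ :=
  fderiv ℝ h X (EuclideanSpace.single i 1)

/-- The Heaviside function, with `θ(0) = 1`. -/
def theta (x : ℝ) : ℝ := if 0 ≤ x then 1 else 0

/-- The data of a hard-sphere gas: molecular mass, molecular diameter, specific gas constant,
the function `S` that shapes the Enskog factor, and the spatial domain. -/
structure Gas where
  m : ℝ
  σ : ℝ
  R : ℝ
  S : ℝ → ℝ
  D : Set E

/-- `V_α = (ξ_* - ξ) · α`. -/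
def relV (α : S2) (ξ ξs : E) : ℝ := inner ℝ (ξs - ξ) (α : E)

/-- `ξ' = ξ + V_α α`. -/
def post (α : S2) (ξ ξs : E) : E := ξ + relV α ξ ξs • (α : E)

/-- `ξ_*' = ξ_* - V_α α`. -/
def postStar (α : S2) (ξ ξs : E) : E := ξs - relV α ξ ξs • (α : E)

/-! ### Macroscopic quantities

Everything below is defined at a frozen time, so `f X ξ` is the distribution function at that
time. -/

/-- The density `ρ = ⟨f⟩`. -/
def density (f : E → E → ℝ) (X : E) : ℝ := ∫ ξ, f X ξ

/-- The flow velocity `v = ρ⁻¹ ⟨ξ f⟩`. -/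
def flowVelocity (f : E → E → ℝ) (X : E) : E :=
  (density f X)⁻¹ • ∫ ξ, f X ξ • ξ

/-- The (kinetic) specific internal energy `e = (2ρ)⁻¹ ⟨|ξ - v|² f⟩`. -/
def internalEnergy (f : E → E → ℝ) (X : E) : ℝ :=
  (1 / (2 * density f X)) * ∫ ξ, ‖ξ - flowVelocity f X‖ ^ 2 * f X ξ

/-- Kinetic part of the stress tensor. -/
def stressK (f : E → E → ℝ) (i j : Fin 3) (X : E) : ℝ :=
  ∫ ξ, (ξ i - flowVelocity f X i) * (ξ j - flowVelocity f X j) * f X ξ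

/-- Kinetic part of the heat-flow vector. -/
def heatFlowK (f : E → E → ℝ) (i : Fin 3) (X : E) : ℝ :=
  (1 / 2) * ∫ ξ, (ξ i - flowVelocity f X i) * ‖ξ - flowVelocity f X‖ ^ 2 * f X ξ

namespace Gas

variable (G : Gas)

/-- The indicator function of the domain. -/
def chi (X : E) : ℝ := G.D.indicator (fun _ => (1 : ℝ)) X

/-- `𝓡(X) = m⁻¹ ∫_D ρ(Y) θ(σ - |Y - X|) dY`. -/
def calR (f : E → E → ℝ) (X : E) : ℝ :=
  (1 / G.m) * ∫ Y in G.D, density f Y * theta (G.σ - ‖Y - X‖)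

/-- The modified Enskog factor, cut off to the domain:
`g(X,Y) = (S(𝓡(X)) + S(𝓡(Y))) χ_D(X) χ_D(Y)`. -/
def g (f : E → E → ℝ) (X Y : E) : ℝ :=
  (G.S (G.calR f X) + G.S (G.calR f Y)) * G.chi X * G.chi Y

/-- The gain term `J^G(f)`. -/
def gain (f : E → E → ℝ) (X ξ : E) : ℝ :=
  G.σ ^ 2 / G.m * ∫ α : S2, (∫ ξs : E,
    g G f (X + G.σ • (α : E)) X
      * f (X + G.σ • (α : E)) (postStar α ξ ξs) * f X (post α ξ ξs)
      * relV α ξ ξs * theta (relV α ξ ξs)) ∂solidAngle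

/-- The loss term `J^L(f)`. -/
def loss (f : E → E → ℝ) (X ξ : E) : ℝ :=
  G.σ ^ 2 / G.m * ∫ α : S2, (∫ ξs : E,
    g G f (X - G.σ • (α : E)) X
      * f (X - G.σ • (α : E)) ξs * f X ξ
      * relV α ξ ξs * theta (relV α ξ ξs)) ∂solidAngle

/-- The collision term `J(f) = J^G(f) - J^L(f)`. -/
def collision (f : E → E → ℝ) (X ξ : E) : ℝ := G.gain f X ξ - G.loss f X ξ

/-- Collisional part of the stress tensor. -/
def stressC (f : E → E → ℝ) (i j : Fin 3) (X : E) : ℝ :=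
  G.σ ^ 2 / (2 * G.m) * ∫ α : S2, (∫ ξ : E, ∫ ξs : E, ∫ l in (0 : ℝ)..G.σ,
    (α : E) i * (α : E) j * relV α ξ ξs ^ 2 * theta (relV α ξ ξs)
      * g G f (X + l • (α : E)) (X + (l - G.σ) • (α : E))
      * f (X + (l - G.σ) • (α : E)) ξs * f (X + l • (α : E)) ξ) ∂solidAngle

/-- Collisional part of the heat-flow vector; `c = ξ - v(X)`, `c_* = ξ_* - v(X)`. -/
def heatFlowC (f : E → E → ℝ) (i : Fin 3) (X : E) : ℝ :=
  G.σ ^ 2 / (4 * G.m) * ∫ α : S2, (∫ ξ : E, ∫ ξs : E, ∫ l in (0 : ℝ)..G.σ,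
    (α : E) i * inner ℝ ((ξ - flowVelocity f X) + (ξs - flowVelocity f X)) (α : E)
      * relV α ξ ξs ^ 2 * theta (relV α ξ ξs)
      * g G f (X + l • (α : E)) (X + (l - G.σ) • (α : E))
      * f (X + (l - G.σ) • (α : E)) ξs * f (X + l • (α : E)) ξ) ∂solidAngle

/-- The stress tensor `p_ij`. -/
def stress (f : E → E → ℝ) (i j : Fin 3) (X : E) : ℝ :=
  stressK f i j X + G.stressC f i j X

/-- The heat-flow vector `q_i`. -/
def heatFlow (f : E → E → ℝ) (i : Fin 3) (X : E) : ℝ :=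
  heatFlowK f i X + G.heatFlowC f i X

/-! ### The local H function and its flux -/

/-- Collisional part `H^(c) = ρ ∫_0^𝓡 S(x) dx`. -/
def HC (f : E → E → ℝ) (X : E) : ℝ :=
  density f X * ∫ x in (0 : ℝ)..G.calR f X, G.S x

/-- `H = ⟨f ln f⟩ + H^(c)`. -/
def H (f : E → E → ℝ) (X : E) : ℝ :=
  (∫ ξ, f X ξ * Real.log (f X ξ)) + G.HC f X

/-- The flux `J^(k)`. -/
def fluxK (f : E → E → ℝ) (i : Fin 3) (X : E) : ℝ :=
  G.σ ^ 3 / (2 * G.m) * ∫ α : S2, (∫ ξ : E, ∫ ξs : E, ∫ τ in (0 : ℝ)..1,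
    (α : E) i
      * g G f (X + (τ * G.σ) • (α : E)) (X + ((τ - 1) * G.σ) • (α : E))
      * Real.log (f (X + (τ * G.σ) • (α : E)) (post α ξ ξs) / f (X + (τ * G.σ) • (α : E)) ξ)
      * f (X + (τ * G.σ) • (α : E)) ξ * f (X + ((τ - 1) * G.σ) • (α : E)) ξs
      * relV α ξ ξs * theta (relV α ξ ξs)) ∂solidAngle

/-- The flux `J^(c)`. -/
def fluxC (f : E → E → ℝ) (i : Fin 3) (X : E) : ℝ :=
  G.HC f X * flowVelocity f X i
    - G.σ ^ 3 / (2 * G.m) * ∫ α : S2, (∫ τ in (0 : ℝ)..1,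
        inner ℝ (flowVelocity f (X + (τ * G.σ) • (α : E))
            - flowVelocity f (X + ((τ - 1) * G.σ) • (α : E))) (α : E)
          * density f (X + (τ * G.σ) • (α : E)) * density f (X + ((τ - 1) * G.σ) • (α : E))
          * G.S (G.calR f (X + (τ * G.σ) • (α : E)))
          * G.chi (X + ((τ - 1) * G.σ) • (α : E)) * G.chi (X + (τ * G.σ) • (α : E))
          * (α : E) i) ∂solidAngle

/-- `J^H_i = ⟨ξ_i f ln f⟩ + J^(k)_i + J^(c)_i`. -/
def fluxH (f : E → E → ℝ) (i : Fin 3) (X : E) : ℝ :=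
  (∫ ξ : E, ξ i * (f X ξ * Real.log (f X ξ))) + G.fluxK f i X + G.fluxC f i X

/-! ### The local free energy and its flux -/

/-- `F = R T_w H + ρ (e + |v|²/2)`. -/
def freeEnergy (Tw : ℝ) (f : E → E → ℝ) (X : E) : ℝ :=
  G.R * Tw * G.H f X
    + density f X * (internalEnergy f X + ‖flowVelocity f X‖ ^ 2 / 2)

/-- `J^F_i = R T_w J^H_i + ρ v_i (e + |v|²/2) + p_ij v_j + q_i`. -/
def fluxF (Tw : ℝ) (f : E → E → ℝ) (i : Fin 3) (X : E) : ℝ :=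
  G.R * Tw * G.fluxH f i X
    + density f X * flowVelocity f X i
        * (internalEnergy f X + ‖flowVelocity f X‖ ^ 2 / 2)
    + ∑ j, G.stress f i j X * flowVelocity f X j
    + G.heatFlow f i X

/-- `f` satisfies the Enskog equation `∂f/∂t + ξ_i ∂f/∂X_i = J(f)` on `I × D × ℝ³`. -/
def IsSolution (I : Set ℝ) (f : ℝ → E → E → ℝ) : Prop :=
  ∀ t ∈ I, ∀ X ∈ G.D, ∀ ξ : E,
    deriv (fun s => f s X ξ) t + ∑ i, ξ i * pderiv i (fun Y => f t Y ξ) X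
      = G.collision (f t) X ξ

end Gas

/-- Classical smoothness and decay of a positive distribution function on `I × D × ℝ³`:
`f` is `C¹` in time and position, everything being continuous in all variables;
`f` and its first derivatives decay in `ξ` faster than any power, and `ln f` grows at most
polynomially in `ξ`. The bounds are locally uniform in `(t, X)`; those on `f`, `∂f/∂t` and `ln f`
hold up to the boundary of `D`, that on `∂f/∂X` on compact subsets of `D`. -/
structure IsRegular (D : Set E) (I : Set ℝ) (f : ℝ → E → E → ℝ) : Prop where
  pos : ∀ t ∈ I, ∀ X ∈ D, ∀ ξ, 0 < f t X ξ
  cont : ContinuousOn (fun p : ℝ × E × E => f p.1 p.2.1 p.2.2) (I ×ˢ D ×ˢ univ)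
  diff_t : ∀ t ∈ I, ∀ X ∈ D, ∀ ξ, DifferentiableAt ℝ (fun s => f s X ξ) t
  diff_X : ∀ t ∈ I, ∀ X ∈ D, ∀ ξ, DifferentiableAt ℝ (fun Y => f t Y ξ) X
  cont_dt : ContinuousOn
    (fun p : ℝ × E × E => deriv (fun s => f s p.2.1 p.2.2) p.1) (I ×ˢ D ×ˢ univ)
  cont_dX : ContinuousOn
    (fun p : ℝ × E × E => fderiv ℝ (fun Y => f p.1 Y p.2.2) p.2.1) (I ×ˢ D ×ˢ univ)
  decay : ∀ K ⊆ I, IsCompact K → ∀ (r : ℝ) (k : ℕ), ∃ C : ℝ,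
    ∀ t ∈ K, ∀ X ∈ D, ‖X‖ ≤ r → ∀ ξ, (1 + ‖ξ‖) ^ k * f t X ξ ≤ C
  decay_dt : ∀ K ⊆ I, IsCompact K → ∀ (r : ℝ) (k : ℕ), ∃ C : ℝ,
    ∀ t ∈ K, ∀ X ∈ D, ‖X‖ ≤ r → ∀ ξ, (1 + ‖ξ‖) ^ k * |deriv (fun s => f s X ξ) t| ≤ C
  decay_dX : ∀ K ⊆ I, IsCompact K → ∀ L ⊆ D, IsCompact L → ∀ k : ℕ, ∃ C : ℝ,
    ∀ t ∈ K, ∀ X ∈ L, ∀ ξ, (1 + ‖ξ‖) ^ k * ‖fderiv ℝ (fun Y => f t Y ξ) X‖ ≤ C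
  log_growth : ∀ K ⊆ I, IsCompact K → ∀ r : ℝ, ∃ (C : ℝ) (k : ℕ),
    ∀ t ∈ K, ∀ X ∈ D, ‖X‖ ≤ r → ∀ ξ, |Real.log (f t X ξ)| ≤ C * (1 + ‖ξ‖) ^ k

/-- `n` is the outer unit normal of `D` at the boundary point `x`, near which `D` is the
superlevel set `{ψ > 0}` of a `C¹` function `ψ` with nonvanishing gradient at `x`. -/
def IsOuterUnitNormal (D : Set E) (x n : E) : Prop :=
  x ∈ frontier D ∧ ∃ ψ : E → ℝ, ContDiffAt ℝ 1 ψ x ∧ gradient ψ x ≠ 0 ∧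
    (∀ᶠ y in 𝓝 x, y ∈ D ↔ 0 < ψ y) ∧ n = -(‖gradient ψ x‖⁻¹ • gradient ψ x)

/-- The boundary of `D` is `C¹` apart from a set of zero area (edges, corners). -/
def HasPiecewiseC1Boundary (D : Set E) : Prop :=
  Measure.hausdorffMeasure 2 {x ∈ frontier D | ¬ ∃ n, IsOuterUnitNormal D x n} = 0

/-- The boundary is impermeable: `v · n = 0` at every boundary point that has a normal `n`,
the boundary value being taken as the limit from inside `D`. -/
def IsImpermeable (D : Set E) (I : Set ℝ) (f : ℝ → E → E → ℝ) : Prop :=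
  ∀ t ∈ I, ∀ x n : E, IsOuterUnitNormal D x n →
    Tendsto (fun Y => inner ℝ (flowVelocity (f t) Y) n) (𝓝[D] x) (𝓝 0)

end

end EESM

/-! ### Measure on the sphere, velocity weights, collision kinematics -/

namespace EESM

noncomputable section

/-! Put `c = R T_w`. Multiplying the Enskog equation by `c (1 + ln f) + |ξ|²/2` (`feWeight`), which
is the derivative of `(c ln f + |ξ|²/2) f` with respect to `f`, and integrating over velocities
gives a balance law for the kinetic part of the free energy. Its source at `Y` is `σ²/m` times an
integral over directions `α` of a pair average: the change of the weight of the molecule at `Y` in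
collisions with a partner at `Z = Y - σα` (`weak_collision`). Adding the term attached to `(Z, -α)`
takes both partners of a collision into account: the energies cancel, and `ln x ≤ x - 1` bounds the
logarithms by `c (f' f_*' - f f_*)`. Since the collision map preserves the velocity measure, the
bound integrates to `c g(Y,Z) (ρ(Z) w(Y) - ρ(Y) w(Z))·α` with `w = ρv` (`pairInt_add_exchange_le`).
For two molecules at the same point this bracket would vanish; at distance `σ` it has no sign.

The collisional part `H^(c) = ρ Φ(𝓡)`, `Φ' = S`, is designed to remove it. The gradient of the ball
average `𝓡` is an integral over the sphere of radius `σ`, and so is its time derivative because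
`∂ρ/∂t = -div w`. The balance of `H^(c)` therefore has, besides the transport `Φ(𝓡) w`, the source
`-σ²/m ∫ S(𝓡(Y)) (ρ(Z) w(Y) - ρ(Y) w(Z))·α dΩ` (`weak_chain_rule`, `balance_HC`), and the two
summands of `g` are shared out between the partners in the same way (`exchangeC_add`). Hence the
total exchange `a` (`exchangeF`) satisfies `a(Y,α) + a(Z,-α) ≤ 0`.

Tested with `φ`, the source splits as `a φ(Y) = ½ a (φ(Y) - φ(Z)) + ½ a (φ(Y) + φ(Z))`. The first
half is a divergence: writing `φ(Y) - φ(Z)` as an integral of `∇φ` along the segment from `Z` to `Y`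
produces the line averages over `τ` that make up the collisional fluxes (`shiftFlux_weak`,
`collisional_flux_eq`, `fluxC_eq`). The second half is nonpositive after the exchange `(Y,α) ↦
(Z,-α)` (`integral_exchange_nonpos`).

Impermeability enters through the time derivative of `𝓡`: a ball around a point near the wall
crosses `∂D`, so `∫ ∂ₜρ k = ∫ w·∇k` is needed for test functions `k` that do not vanish on `∂D`.
This is `gauss_green`: at regular boundary points the error of a cut-off is controlled by `w·n → 0`,
and an exceptional set of zero area is removed by cut-offs whose gradients are arbitrarily small in
`L¹`.

Everything is done weakly, since `f` extended by zero jumps at `∂D` and the fluxes need not be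
differentiable. The pointwise inequality follows by blowing up test functions at a point of
differentiability (`pointwise_of_weak`). -/

instance : IsFiniteMeasure solidAngle := by unfold solidAngle; infer_instance

lemma measurable_neg_sphere : Measurable (fun α : S2 => -α) :=
  (continuous_neg : Continuous fun α : S2 => -α).measurable

-- The surface measure of a set of directions is a multiple of the volume of the cone over it, and
-- `X ↦ -X` maps cones to cones and preserves volume.
open scoped Pointwise in
lemma measurePreserving_neg_sphere : MeasurePreserving (fun α : S2 => -α) solidAngle solidAngle := by
  refine ⟨measurable_neg_sphere, ?_⟩
  ext s hs
  rw [Measure.map_apply measurable_neg_sphere hs, solidAngle,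
    Measure.toSphere_apply' _ (measurable_neg_sphere hs), Measure.toSphere_apply' _ hs]
  congr 1
  have : (Ioo (0 : ℝ) 1 • ((↑) '' ((fun α : S2 => -α) ⁻¹' s) : Set E))
      = (Neg.neg : E → E) ⁻¹' (Ioo (0 : ℝ) 1 • ((↑) '' s : Set E)) := by
    ext x
    simp only [Set.mem_smul, mem_image, mem_preimage]
    constructor
    · rintro ⟨r, hr, _, ⟨α, hα, rfl⟩, rfl⟩
      exact ⟨r, hr, _, ⟨-α, hα, rfl⟩, by simp⟩
    · rintro ⟨r, hr, _, ⟨α, hα, rfl⟩, h⟩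
      exact ⟨r, hr, _, ⟨-α, by simpa using hα, rfl⟩, by
        rw [← neg_eq_iff_eq_neg.mpr h.symm.symm]; simp⟩
  rw [this]
  exact (Measure.measurePreserving_neg (volume : Measure E)).measure_preimage_emb
    (MeasurableEquiv.neg E).measurableEmbedding _

/-- Integration in polar coordinates. -/
lemma integral_polar {F : E → ℝ} (hF : Integrable F) :
    ∫ Z, F Z = ∫ α : S2, (∫ r in Ioi (0 : ℝ), r ^ 2 * F (r • (α : E))) ∂solidAngle := by
  have hmp := Measure.measurePreserving_homeomorphUnitSphereProd (volume : Measure E)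
  have h3 : Module.finrank ℝ E - 1 = 2 := by simp
  rw [h3] at hmp
  have hme : MeasurableEmbedding (homeomorphUnitSphereProd E) :=
    (homeomorphUnitSphereProd E).measurableEmbedding
  have h0 : MeasurableSet ({0}ᶜ : Set E) := (measurableSet_singleton _).compl
  set Gf : S2 × Ioi (0 : ℝ) → ℝ := fun p => F ((p.2 : ℝ) • (p.1 : E)) with hG
  have hcomp : ∀ x : ({0}ᶜ : Set E), Gf (homeomorphUnitSphereProd E x) = F x := by
    intro x
    have hx : ‖(x : E)‖ ≠ 0 := norm_ne_zero_iff.2 x.2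
    simp [hG, homeomorphUnitSphereProd, smul_smul, hx]
  have hint : Integrable (fun x : ({0}ᶜ : Set E) => F x) (Measure.comap Subtype.val volume) := by
    exact ((MeasurableEmbedding.subtype_coe h0).integrableOn_range_iff_comap (f := F)).1
      hF.integrableOn
  have hGint : Integrable Gf (solidAngle.prod (Measure.volumeIoiPow 2)) := by
    refine (hmp.integrable_comp_emb hme).1 ?_
    exact hint.congr (Eventually.of_forall fun x => (hcomp x).symm)
  calc ∫ Z, F Z = ∫ Z in ({0}ᶜ : Set E), F Z := by
        rw [restrict_compl_singleton]
    _ = ∫ x : ({0}ᶜ : Set E), F x ∂(Measure.comap Subtype.val volume) := by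
        rw [integral_subtype_comap h0]
    _ = ∫ x, Gf (homeomorphUnitSphereProd E x) ∂(Measure.comap Subtype.val volume) := by
        simp_rw [hcomp]
    _ = ∫ p, Gf p ∂(solidAngle.prod (Measure.volumeIoiPow 2)) := by
        rw [hmp.integral_comp hme]; rfl
    _ = ∫ α : S2, (∫ r : Ioi (0 : ℝ), Gf (α, r) ∂(Measure.volumeIoiPow 2)) ∂solidAngle := by
        rw [integral_prod _ hGint]
    _ = _ := by
        congr 1 with α
        simp only [Measure.volumeIoiPow, ENNReal.ofReal]
        rw [integral_withDensity_eq_integral_smul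
          (by fun_prop), ← integral_subtype_comap measurableSet_Ioi]
        congr 1 with r
        have : (0 : ℝ) ≤ (r : ℝ) ^ 2 := by positivity
        simp [NNReal.smul_def, hG, Real.coe_toNNReal _ this]

/-- The velocity weight `1 + |ξ|`. -/
def wt (ξ : E) : ℝ := 1 + ‖ξ‖

lemma one_le_wt (ξ : E) : 1 ≤ wt ξ := by unfold wt; linarith [norm_nonneg ξ]
lemma wt_pos (ξ : E) : 0 < wt ξ := by linarith [one_le_wt ξ]
lemma norm_le_wt (ξ : E) : ‖ξ‖ ≤ wt ξ := by unfold wt; linarith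

lemma abs_coord_le (ξ : E) (i : Fin 3) : |ξ i| ≤ ‖ξ‖ := by
  exact PiLp.norm_apply_le ξ i

/-- The exponent 4 is the smallest integer exceeding the dimension 3; it is the weight used in every
domination argument over velocities. -/
lemma integrable_wt : Integrable (fun ξ : E => (wt ξ ^ 4)⁻¹) := by
  have : Integrable (fun x : E => (1 + ‖x‖) ^ (-(4 : ℝ))) := integrable_one_add_norm (by simp; norm_num)
  refine this.congr (Eventually.of_forall fun x => ?_)
  have : (0 : ℝ) ≤ 1 + ‖x‖ := by positivity
  simp only [wt, Real.rpow_neg this]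
  norm_cast

lemma integrable_of_wt {F : E → ℝ} (hF : AEStronglyMeasurable F) {C : ℝ}
    (h : ∀ ξ, wt ξ ^ 4 * |F ξ| ≤ C) : Integrable F := by
  refine (integrable_wt.const_mul C).mono' hF (Eventually.of_forall fun ξ => ?_)
  have := wt_pos ξ
  rw [Real.norm_eq_abs, ← div_eq_mul_inv, le_div_iff₀ (by positivity)]
  linarith [h ξ]

lemma integrable_wt_prod :
    Integrable (fun p : E × E => (wt p.1 ^ 4)⁻¹ * (wt p.2 ^ 4)⁻¹) (volume.prod volume) :=
  integrable_wt.mul_prod integrable_wt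

lemma le_of_wt_prod {F : E × E → ℝ} {C : ℝ} {p : E × E}
    (h : wt p.1 ^ 4 * wt p.2 ^ 4 * |F p| ≤ C) : ‖F p‖ ≤ C * ((wt p.1 ^ 4)⁻¹ * (wt p.2 ^ 4)⁻¹) := by
  have h1 := wt_pos p.1
  have h2 := wt_pos p.2
  rw [Real.norm_eq_abs, ← mul_inv, ← div_eq_mul_inv, le_div_iff₀ (by positivity)]
  linarith

lemma integrable_of_wt_prod {F : E × E → ℝ} (hF : AEStronglyMeasurable F (volume.prod volume)) {C : ℝ}
    (h : ∀ p, wt p.1 ^ 4 * wt p.2 ^ 4 * |F p| ≤ C) : Integrable F (volume.prod volume) :=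
  (integrable_wt_prod.const_mul C).mono' hF (Eventually.of_forall fun _ => le_of_wt_prod (h _))

/-- The positive part of the relative speed, `V_α θ(V_α)`. -/
def posV (α : S2) (ξ ξs : E) : ℝ := relV α ξ ξs * theta (relV α ξ ξs)

lemma posV_eq_max (α : S2) (ξ ξs : E) : posV α ξ ξs = max (relV α ξ ξs) 0 := by
  unfold posV theta; split_ifs with h
  · rw [max_eq_left h]; simp
  · rw [max_eq_right (le_of_not_ge h)]; simp

lemma posV_nonneg (α : S2) (ξ ξs : E) : 0 ≤ posV α ξ ξs := by
  rw [posV_eq_max]; exact le_max_right _ _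

lemma norm_sphere (α : S2) : ‖(α : E)‖ = 1 := by simp

/-- A product of weights, rather than a sum, is chosen so that powers of it split into one factor
for each velocity, to be absorbed by the decay of the corresponding `f`. -/
lemma abs_relV_le (α : S2) (ξ ξs : E) : |relV α ξ ξs| ≤ wt ξ * wt ξs := by
  unfold relV
  have h := abs_real_inner_le_norm (ξs - ξ) (α : E)
  rw [norm_sphere, mul_one] at h
  have h2 := norm_sub_le ξs ξ
  unfold wt
  nlinarith [norm_nonneg ξ, norm_nonneg ξs, mul_nonneg (norm_nonneg ξ) (norm_nonneg ξs)]

lemma posV_le (α : S2) (ξ ξs : E) : posV α ξ ξs ≤ wt ξ * wt ξs := by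
  rw [posV_eq_max]
  exact max_le ((le_abs_self _).trans (abs_relV_le α ξ ξs))
    (mul_nonneg (wt_pos _).le (wt_pos _).le)

lemma relV_neg (α : S2) (ξ ξs : E) : relV (-α) ξ ξs = -relV α ξ ξs := by
  simp [relV]

lemma relV_swap (α : S2) (ξ ξs : E) : relV α ξs ξ = -relV α ξ ξs := by
  rw [relV, relV, ← neg_sub, inner_neg_left]

lemma relV_neg_swap (α : S2) (ξ ξs : E) : relV (-α) ξs ξ = relV α ξ ξs := by
  rw [relV_neg, relV_swap, neg_neg]

lemma post_neg (α : S2) (ξ ξs : E) : post (-α) ξ ξs = post α ξ ξs := by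
  simp [post, relV_neg]

lemma postStar_neg (α : S2) (ξ ξs : E) : postStar (-α) ξ ξs = postStar α ξ ξs := by
  simp [postStar, relV_neg]

lemma post_swap (α : S2) (ξ ξs : E) : post α ξs ξ = postStar α ξ ξs := by
  rw [post, postStar, relV_swap α ξ ξs]; module

/-- At fixed `α` a collision exchanges the components of the two velocities along `α`, so the normal
relative velocity is reversed. The collision map is therefore an involution. -/
lemma relV_post (α : S2) (ξ ξs : E) :
    relV α (post α ξ ξs) (postStar α ξ ξs) = -relV α ξ ξs := by
  have h : inner ℝ (α : E) (α : E) = 1 := by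
    rw [real_inner_self_eq_norm_sq, norm_sphere]; norm_num
  have : postStar α ξ ξs - post α ξ ξs = (ξs - ξ) - (2 * relV α ξ ξs) • (α : E) := by
    simp only [post, postStar]; module
  rw [relV, this, inner_sub_left, inner_smul_left, h]
  simp [relV]; ring

lemma post_post (α : S2) (ξ ξs : E) : post α (post α ξ ξs) (postStar α ξ ξs) = ξ := by
  rw [post, relV_post, post]; module

lemma postStar_post (α : S2) (ξ ξs : E) : postStar α (post α ξ ξs) (postStar α ξ ξs) = ξs := by
  rw [postStar, relV_post, postStar]; module

/-- The energy gained by one molecule is lost by the other (`norm_sq_postStar`). Half of the gain is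
also the energy exchange that appears in the collisional heat flow. -/
lemma norm_sq_post (α : S2) (ξ ξs : E) :
    ‖post α ξ ξs‖ ^ 2 = ‖ξ‖ ^ 2 + relV α ξ ξs * inner ℝ (ξ + ξs) (α : E) := by
  rw [post, norm_add_sq_real, norm_smul, norm_sphere, inner_smul_right, inner_add_left]
  have : inner ℝ ξs (α : E) = relV α ξ ξs + inner ℝ ξ (α : E) := by
    simp [relV, inner_sub_left]
  rw [this]; simp; ring

lemma norm_sq_postStar (α : S2) (ξ ξs : E) :
    ‖postStar α ξ ξs‖ ^ 2 = ‖ξs‖ ^ 2 - relV α ξ ξs * inner ℝ (ξ + ξs) (α : E) := by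
  rw [← post_swap, norm_sq_post, relV_swap, add_comm ξs ξ]; ring

lemma wt_le_of_sq {a b c : E} (h : ‖a‖ ^ 2 ≤ ‖b‖ ^ 2 + ‖c‖ ^ 2) : wt a ≤ wt b * wt c := by
  have : ‖a‖ ≤ ‖b‖ + ‖c‖ := by
    apply le_of_sq_le_sq _ (by positivity)
    nlinarith [norm_nonneg b, norm_nonneg c, mul_nonneg (norm_nonneg b) (norm_nonneg c)]
  unfold wt
  nlinarith [mul_nonneg (norm_nonneg b) (norm_nonneg c)]

lemma wt_post_le (α : S2) (ξ ξs : E) : wt (post α ξ ξs) ≤ wt ξ * wt ξs := by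
  apply wt_le_of_sq
  have h1 := norm_sq_post α ξ ξs
  have h2 := norm_sq_postStar α ξ ξs
  nlinarith [sq_nonneg ‖postStar α ξ ξs‖]

@[fun_prop] lemma continuous_relV : Continuous fun p : S2 × E × E => relV p.1 p.2.1 p.2.2 := by
  unfold relV; fun_prop

@[fun_prop] lemma continuous_post : Continuous fun p : S2 × E × E => post p.1 p.2.1 p.2.2 := by
  unfold post
  have := continuous_relV
  fun_prop

@[fun_prop] lemma continuous_postStar : Continuous fun p : S2 × E × E => postStar p.1 p.2.1 p.2.2 := by
  unfold postStar
  have := continuous_relV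
  fun_prop

lemma continuous_posV : Continuous fun p : S2 × E × E => posV p.1 p.2.1 p.2.2 := by
  simp_rw [posV_eq_max]
  exact continuous_relV.max continuous_const

/-- The collision at fixed `α` as a linear map of the pair of velocities. -/
def collisionLin (α : S2) : (E × E) →ₗ[ℝ] (E × E) where
  toFun p := (post α p.1 p.2, postStar α p.1 p.2)
  map_add' p q := by
    have : relV α (p.1 + q.1) (p.2 + q.2) = relV α p.1 p.2 + relV α q.1 q.2 := by
      simp only [relV]; rw [← inner_add_left]; congr 1; abel
    ext1 <;> simp only [post, postStar, Prod.fst_add, Prod.snd_add, this] <;> module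
  map_smul' c p := by
    have : relV α (c • p.1) (c • p.2) = c * relV α p.1 p.2 := by
      simp only [relV]; rw [← smul_sub, inner_smul_left]; rfl
    ext1 <;> simp only [post, postStar, Prod.smul_fst, Prod.smul_snd, this, RingHom.id_apply] <;> module

/-- A linear involution has determinant `±1`. -/
lemma map_collisionLin (α : S2) :
    Measure.map (collisionLin α) (volume.prod volume) = (volume.prod volume : Measure (E × E)) := by
  have hinv : collisionLin α ∘ₗ collisionLin α = LinearMap.id := by
    ext1 <;> ext1 x <;>
    · simp only [LinearMap.coe_comp, Function.comp, LinearMap.id_coe, id]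
      exact Prod.ext (post_post α _ _) (postStar_post α _ _)
  have hdet : LinearMap.det (collisionLin α) * LinearMap.det (collisionLin α) = 1 := by
    rw [← LinearMap.det_comp, hinv, LinearMap.det_id]
  have habs : |(LinearMap.det (collisionLin α))⁻¹| = 1 := by
    rw [abs_inv]
    have : |LinearMap.det (collisionLin α)| * |LinearMap.det (collisionLin α)| = 1 := by
      rw [← abs_mul, hdet, abs_one]
    rw [inv_eq_one]
    nlinarith [abs_nonneg (LinearMap.det (collisionLin α))]
  rw [Measure.map_linearMap_addHaar_eq_smul_addHaar _ (fun h => by simp [h] at hdet), habs]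
  simp

/-- Collisions preserve the measure `dΩ dξ dξ_*`. -/
lemma measurePreserving_collision :
    MeasurePreserving (fun p : S2 × (E × E) =>
        (-p.1, (post p.1 p.2.1 p.2.2, postStar p.1 p.2.1 p.2.2)))
      (solidAngle.prod (volume.prod volume)) (solidAngle.prod (volume.prod volume)) := by
  refine measurePreserving_neg_sphere.skew_product
    (g := fun α (p : E × E) => (post α p.1 p.2, postStar α p.1 p.2)) ?_
    (Eventually.of_forall fun α => map_collisionLin α)
  exact (continuous_post.prodMk continuous_postStar).measurable

lemma collision_involutive : Function.Involutive (fun p : S2 × (E × E) =>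
        (-p.1, (post p.1 p.2.1 p.2.2, postStar p.1 p.2.1 p.2.2))) := by
  intro p
  simp [post_neg, postStar_neg, post_post, postStar_post]

lemma measurableEmbedding_collision : MeasurableEmbedding (fun p : S2 × (E × E) =>
        (-p.1, (post p.1 p.2.1 p.2.2, postStar p.1 p.2.1 p.2.2))) :=
  (MeasurableEquiv.ofInvolutive _ collision_involutive
    measurePreserving_collision.measurable).measurableEmbedding

/-- Collisions at fixed `α` preserve the measure `dξ dξ_*`. -/
lemma measurePreserving_collisionLin (α : S2) :
    MeasurePreserving (fun p : E × E => (post α p.1 p.2, postStar α p.1 p.2))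
      (volume.prod volume) (volume.prod volume) :=
  ⟨(continuous_post.prodMk continuous_postStar).measurable.comp measurable_prodMk_left,
    map_collisionLin α⟩

lemma collisionLin_involutive (α : S2) :
    Function.Involutive (fun p : E × E => (post α p.1 p.2, postStar α p.1 p.2)) := by
  intro p
  simp [post_post, postStar_post]

lemma measurableEmbedding_collisionLin (α : S2) :
    MeasurableEmbedding (fun p : E × E => (post α p.1 p.2, postStar α p.1 p.2)) :=
  (MeasurableEquiv.ofInvolutive _ (collisionLin_involutive α)
    (measurePreserving_collisionLin α).measurable).measurableEmbedding

/-- Exchange of the two partners of a collision preserves `dX dΩ`. -/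
lemma measurePreserving_exchange (σ : ℝ) :
    MeasurePreserving (fun p : S2 × E => (-p.1, p.2 - σ • (p.1 : E)))
      (solidAngle.prod volume) (solidAngle.prod volume) := by
  refine measurePreserving_neg_sphere.skew_product (g := fun α Y => Y - σ • (α : E)) ?_
    (Eventually.of_forall fun α => map_sub_right_eq_self volume _)
  have : Continuous (Function.uncurry fun (α : S2) (Y : E) => Y - σ • (α : E)) := by
    unfold Function.uncurry; fun_prop
  exact this.measurable

lemma measurableEmbedding_exchange (σ : ℝ) :
    MeasurableEmbedding (fun p : S2 × E => (-p.1, p.2 - σ • (p.1 : E))) :=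
  (MeasurableEquiv.ofInvolutive _ (fun p => by simp)
    (measurePreserving_exchange σ).measurable).measurableEmbedding

end

end EESM

namespace EESM

noncomputable section

/-! ### The Gauss–Green formula on domains with piecewise `C¹` boundary -/

lemma integrable_of_bdd_of_ball {F : E → ℝ} (hF : AEStronglyMeasurable F) {C r : ℝ}
    (hC : ∀ X, |F X| ≤ C) (hr : ∀ X, r < ‖X‖ → F X = 0) : Integrable F := by
  have hsub : Function.support F ⊆ Metric.closedBall 0 r := by
    intro X hX
    by_contra h
    exact hX (hr X (by simpa using h))
  rw [← integrableOn_iff_integrable_of_support_subset hsub]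
  exact Measure.integrableOn_of_bounded (M := C) (measure_closedBall_lt_top (x := (0 : E))).ne hF
    (Eventually.of_forall fun X => hC X)

lemma exists_radius {k : E → ℝ} (hk : HasCompactSupport k) :
    ∃ r : ℝ, 0 < r ∧ ∀ X ∈ tsupport k, ‖X‖ ≤ r := by
  obtain ⟨r, hr⟩ := hk.isCompact.isBounded.exists_norm_le
  exact ⟨max r 1, by positivity, fun X hX => (hr X hX).trans (le_max_left _ _)⟩

lemma exists_bound {F : Type*} [NormedAddCommGroup F] {k : E → F} (hk : HasCompactSupport k)
    (hc : Continuous k) : ∃ C : ℝ, 0 < C ∧ ∀ X, ‖k X‖ ≤ C := by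
  obtain ⟨C, hC⟩ := hk.exists_bound_of_continuous hc
  exact ⟨max C 1, by positivity, fun X => (hC X).trans (le_max_left _ _)⟩

/-- `w` and `d` are bounded on bounded sets, vanish off `D`, and `d = - div w` weakly in `D`. -/
structure WeakDiv (D : Set E) (w : E → E) (d : E → ℝ) : Prop where
  meas_w : Measurable w
  meas_d : Measurable d
  zero_w : ∀ X ∉ D, w X = 0
  zero_d : ∀ X ∉ D, d X = 0
  bdd : ∀ r : ℝ, ∃ C : ℝ, 0 ≤ C ∧ ∀ X, ‖X‖ ≤ r → ‖w X‖ ≤ C ∧ |d X| ≤ C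
  weak : ∀ φ : E → ℝ, ContDiff ℝ 1 φ → HasCompactSupport φ → tsupport φ ⊆ D →
    ∫ X, (d X * φ X - fderiv ℝ φ X (w X)) = 0

namespace WeakDiv

variable {D : Set E} {w : E → E} {d : E → ℝ}

lemma measurable_fderiv_apply (W : WeakDiv D w d) {φ : E → ℝ} (hφ : ContDiff ℝ 1 φ) :
    Measurable fun X => fderiv ℝ φ X (w X) := by
  have h : Measurable fun X => fderiv ℝ φ X := (hφ.continuous_fderiv one_ne_zero).measurable
  have hc : Continuous fun p : (E →L[ℝ] ℝ) × E => p.1 p.2 := by fun_prop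
  exact hc.measurable.comp (h.prodMk W.meas_w)

lemma bound_mul (W : WeakDiv D w d) {k : E → ℝ} (hc : Continuous k) (hk : HasCompactSupport k) :
    ∃ C, 0 ≤ C ∧ ∀ X, |d X * k X| ≤ C := by
  obtain ⟨r, -, hr⟩ := exists_radius hk
  obtain ⟨M, hM0, hM⟩ := exists_bound hk hc
  obtain ⟨C, hC0, hC⟩ := W.bdd r
  refine ⟨C * M, by positivity, fun X => ?_⟩
  by_cases hX : X ∈ tsupport k
  · rw [abs_mul]
    exact mul_le_mul (hC X (hr X hX)).2 (hM X) (abs_nonneg _) hC0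
  · rw [image_eq_zero_of_notMem_tsupport hX]; simp; positivity

lemma bound_fderiv (W : WeakDiv D w d) {φ : E → ℝ} (hφ : ContDiff ℝ 1 φ)
    (hk : HasCompactSupport φ) : ∃ C, 0 ≤ C ∧ ∀ X, |fderiv ℝ φ X (w X)| ≤ C := by
  obtain ⟨r, -, hr⟩ := exists_radius hk
  obtain ⟨M, hM0, hM⟩ := exists_bound (hk.fderiv (𝕜 := ℝ)) (hφ.continuous_fderiv one_ne_zero)
  obtain ⟨C, hC0, hC⟩ := W.bdd r
  refine ⟨M * C, by positivity, fun X => ?_⟩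
  by_cases hX : X ∈ tsupport φ
  · exact (ContinuousLinearMap.le_opNorm _ _).trans
      (mul_le_mul (hM X) (hC X (hr X hX)).1 (norm_nonneg _) hM0.le)
  · rw [fderiv_of_notMem_tsupport (𝕜 := ℝ) hX]; simp; positivity

lemma integrable_mul (W : WeakDiv D w d) {k : E → ℝ} (hc : Continuous k)
    (hk : HasCompactSupport k) : Integrable fun X => d X * k X := by
  obtain ⟨r, -, hr⟩ := exists_radius hk
  obtain ⟨C, -, hC⟩ := W.bound_mul hc hk
  refine integrable_of_bdd_of_ball (W.meas_d.mul hc.measurable).aestronglyMeasurable hC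
    (r := r) fun X hX => ?_
  rw [image_eq_zero_of_notMem_tsupport fun h => not_lt.2 (hr X h) hX, mul_zero]

lemma integrable_fderiv (W : WeakDiv D w d) {φ : E → ℝ} (hφ : ContDiff ℝ 1 φ)
    (hk : HasCompactSupport φ) : Integrable fun X => fderiv ℝ φ X (w X) := by
  obtain ⟨r, -, hr⟩ := exists_radius hk
  obtain ⟨C, -, hC⟩ := W.bound_fderiv hφ hk
  refine integrable_of_bdd_of_ball (W.measurable_fderiv_apply hφ).aestronglyMeasurable hC
    (r := r) fun X hX => ?_
  rw [fderiv_of_notMem_tsupport (𝕜 := ℝ) fun h => not_lt.2 (hr X h) hX]; rfl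

/-- The defect in the Gauss–Green formula. -/
def _root_.EESM.defect (w : E → E) (d : E → ℝ) (φ : E → ℝ) : ℝ :=
  ∫ X, (d X * φ X - fderiv ℝ φ X (w X))

lemma integrable_defect (W : WeakDiv D w d) {φ : E → ℝ} (hφ : ContDiff ℝ 1 φ)
    (hk : HasCompactSupport φ) : Integrable fun X => d X * φ X - fderiv ℝ φ X (w X) :=
  (W.integrable_mul hφ.continuous hk).sub (W.integrable_fderiv hφ hk)

lemma defect_add (W : WeakDiv D w d) {φ₁ φ₂ : E → ℝ} (h₁ : ContDiff ℝ 1 φ₁)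
    (k₁ : HasCompactSupport φ₁) (h₂ : ContDiff ℝ 1 φ₂) (k₂ : HasCompactSupport φ₂) :
    defect w d (fun X => φ₁ X + φ₂ X) = defect w d φ₁ + defect w d φ₂ := by
  unfold defect
  rw [← integral_add (W.integrable_defect h₁ k₁) (W.integrable_defect h₂ k₂)]
  congr 1 with X
  have e : fderiv ℝ (fun X => φ₁ X + φ₂ X) X = fderiv ℝ φ₁ X + fderiv ℝ φ₂ X :=
    fderiv_fun_add (h₁.differentiable one_ne_zero X) (h₂.differentiable one_ne_zero X)
  rw [e, _root_.add_apply]; ring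

/-- The Gauss–Green formula localizes. -/
lemma defect_eq_zero_of_cover (W : WeakDiv D w d) {O : Set E}
    (hO : ∀ x ∈ O, ∃ r > 0, ∀ φ : E → ℝ, ContDiff ℝ 1 φ → HasCompactSupport φ →
      tsupport φ ⊆ Metric.ball x r → defect w d φ = 0)
    {φ : E → ℝ} (hφ : ContDiff ℝ 1 φ) (hk : HasCompactSupport φ) (hs : tsupport φ ⊆ O) :
    defect w d φ = 0 := by
  choose! r hr0 hr using hO
  -- A bump equal to 1 on the ball of half the radius and supported strictly inside the full ball;
  -- off `O` the radius is a default value, hence the trivial branch.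
  let η : E → E → ℝ := fun x y =>
    if h : 0 < r x then (⟨r x / 2, r x * (3 / 4), by linarith, by linarith⟩ : ContDiffBump x) y else 0
  have hηC : ∀ x, ContDiff ℝ 1 (η x) := by
    intro x
    by_cases h : 0 < r x
    · simp only [η, dif_pos h]; exact ContDiffBump.contDiff _
    · simp only [η, dif_neg h]; exact contDiff_const
  have hη1 : ∀ x, ∀ y ∈ Metric.ball x (r x / 2), η x y = 1 := by
    intro x y hy
    have h : 0 < r x := by
      have := (dist_nonneg (x := y) (y := x)).trans_lt hy; linarith
    simp only [η, dif_pos h]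
    exact ContDiffBump.one_of_mem_closedBall _ (Metric.ball_subset_closedBall hy)
  have hηs : ∀ x, 0 < r x → tsupport (η x) ⊆ Metric.ball x (r x) := by
    intro x h
    simp only [η, dif_pos h]
    rw [ContDiffBump.tsupport_eq]
    exact Metric.closedBall_subset_ball (by show r x * (3 / 4) < r x; linarith)
  obtain ⟨t, htO, ht⟩ := hk.isCompact.elim_nhds_subcover (fun x => Metric.ball x (r x / 2))
    fun x hx => Metric.ball_mem_nhds _ (half_pos (hr0 x (hs hx)))
  -- Each factor `1 - η a` changes the test function by a piece supported in one good ball, which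
  -- has no defect. Once all factors are present the product vanishes on the support of `φ`, so no
  -- partition of unity is needed.
  have key : ∀ s : Finset E, s ⊆ t →
      defect w d φ = defect w d (fun y => φ y * ∏ x ∈ s, (1 - η x y)) := by
    intro s
    induction s using Finset.induction_on with
    | empty => intro _; simp
    | insert a s ha ih =>
      intro hst
      rw [ih ((Finset.subset_insert a s).trans hst)]
      have hat : 0 < r a := hr0 a (hs (htO a (hst (Finset.mem_insert_self a s))))
      have hPC : ContDiff ℝ 1 fun y => ∏ x ∈ s, (1 - η x y) :=
        contDiff_prod fun x _ => contDiff_const.sub (hηC x)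
      have h1 : ContDiff ℝ 1 fun y => φ y * (∏ x ∈ s, (1 - η x y)) * η a y :=
        (hφ.mul hPC).mul (hηC a)
      have h2 : ContDiff ℝ 1 fun y => φ y * ∏ x ∈ insert a s, (1 - η x y) :=
        hφ.mul (contDiff_prod fun x _ => contDiff_const.sub (hηC x))
      have k1 : HasCompactSupport fun y => φ y * (∏ x ∈ s, (1 - η x y)) * η a y := by
        simp_rw [mul_assoc]; exact hk.mul_right
      have k2 : HasCompactSupport fun y => φ y * ∏ x ∈ insert a s, (1 - η x y) := hk.mul_right
      have := W.defect_add h1 k1 h2 k2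
      rw [hr a (hs (htO a (hst (Finset.mem_insert_self a s)))) _ h1 k1
        ((tsupport_mul_subset_right).trans (hηs a hat)), zero_add] at this
      rw [← this]
      congr 1 with y
      rw [Finset.prod_insert ha]; ring
  rw [key t subset_rfl]
  have : (fun y => φ y * ∏ x ∈ t, (1 - η x y)) = fun _ => 0 := by
    ext y
    by_cases hy : y ∈ tsupport φ
    · obtain ⟨x, hx, hxy⟩ := mem_iUnion₂.1 (ht hy)
      rw [Finset.prod_eq_zero hx (by rw [hη1 x y hxy]; ring), mul_zero]
    · rw [image_eq_zero_of_notMem_tsupport hy, zero_mul]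
  rw [this]
  simp [defect]

end WeakDiv

/-! #### Near a regular boundary point -/

lemma exists_bound_deriv_smoothTransition :
    ∃ M : ℝ, 0 < M ∧ ∀ x, |deriv Real.smoothTransition x| ≤ M := by
  have hc : Continuous (deriv Real.smoothTransition) :=
    (Real.smoothTransition.contDiff (n := 1)).continuous_deriv le_rfl
  obtain ⟨C, hC⟩ := (isCompact_Icc (a := (-1 : ℝ)) (b := 2)).exists_bound_of_continuousOn
    hc.continuousOn
  refine ⟨max C 1, by positivity, fun x => ?_⟩
  by_cases hx : x ∈ Icc (-1 : ℝ) 2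
  · exact (hC x hx).trans (le_max_left _ _)
  · have : deriv Real.smoothTransition x = 0 := by
      rw [mem_Icc, not_and_or, not_le, not_le] at hx
      rcases hx with hx | hx
      · have : Real.smoothTransition =ᶠ[𝓝 x] fun _ => 0 := by
          filter_upwards [Iio_mem_nhds hx] with y hy
          exact Real.smoothTransition.zero_of_nonpos (by linarith [show y < -1 from hy])
        rw [this.deriv_eq]; simp
      · have : Real.smoothTransition =ᶠ[𝓝 x] fun _ => 1 := by
          filter_upwards [Ioi_mem_nhds hx] with y hy
          exact Real.smoothTransition.one_of_one_le (by linarith [show 2 < y from hy])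
        rw [this.deriv_eq]; simp
    rw [this, abs_zero]; positivity

lemma deriv_smoothTransition_eq_zero {x : ℝ} (hx : x < 0 ∨ 1 < x) :
    deriv Real.smoothTransition x = 0 := by
  rcases hx with hx | hx
  · have : Real.smoothTransition =ᶠ[𝓝 x] fun _ => 0 := by
      filter_upwards [Iio_mem_nhds hx] with y hy
      exact Real.smoothTransition.zero_of_nonpos (le_of_lt hy)
    rw [this.deriv_eq]; simp
  · have : Real.smoothTransition =ᶠ[𝓝 x] fun _ => 1 := by
      filter_upwards [Ioi_mem_nhds hx] with y hy
      exact Real.smoothTransition.one_of_one_le (le_of_lt hy)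
    rw [this.deriv_eq]; simp

/-- A slab between two level sets of a function that increases in a direction is thin. -/
lemma volume_slab_le {x₀ e : E} {r c : ℝ} {ψ : E → ℝ} (hc : 0 < c) (he : ‖e‖ = 1)
    (hψ : ∀ y ∈ Metric.ball x₀ r, DifferentiableAt ℝ ψ y)
    (hce : ∀ y ∈ Metric.ball x₀ r, c ≤ fderiv ℝ ψ y e) (δ : ℝ) :
    volume {y ∈ Metric.ball x₀ r | 0 < ψ y ∧ ψ y ≤ δ}
      ≤ volume (Metric.ball x₀ (r + 1)) * ENNReal.ofReal (δ / c) := by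
  set A := {y ∈ Metric.ball x₀ r | 0 < ψ y ∧ ψ y ≤ δ} with hA
  have hψc : ContinuousOn ψ (Metric.ball x₀ r) := fun y hy =>
    (hψ y hy).continuousAt.continuousWithinAt
  have hAm : MeasurableSet A := by
    have h1 : MeasurableSet (Metric.ball x₀ r ∩ ψ ⁻¹' Ioi 0) :=
      (hψc.isOpen_inter_preimage Metric.isOpen_ball isOpen_Ioi).measurableSet
    have h2 : MeasurableSet (Metric.ball x₀ r ∩ ψ ⁻¹' Ioi δ) :=
      (hψc.isOpen_inter_preimage Metric.isOpen_ball isOpen_Ioi).measurableSet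
    have : A = (Metric.ball x₀ r ∩ ψ ⁻¹' Ioi 0) \ (Metric.ball x₀ r ∩ ψ ⁻¹' Ioi δ) := by
      ext y; simp only [hA, mem_ofPred_eq, Set.mem_sdiff, mem_inter_iff, mem_preimage, mem_Ioi]
      constructor
      · rintro ⟨h, h0, h1⟩; exact ⟨⟨h, h0⟩, fun h' => not_lt.2 h1 h'.2⟩
      · rintro ⟨⟨h, h0⟩, h1⟩; exact ⟨h, h0, not_lt.1 fun h' => h1 ⟨h, h'⟩⟩
    rw [this]; exact h1.diff h2
  -- Along a line in direction `e` the function grows at rate at least `c`, so two points of the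
  -- slab on that line are at most `δ / c` apart; convexity of the ball keeps the segment inside.
  have hline : ∀ y : E, volume {s : ℝ | y + s • e ∈ A} ≤ ENNReal.ofReal (δ / c) := by
    intro y
    refine (Real.volume_le_diam _).trans (Metric.ediam_le fun s hs s' hs' => ?_)
    rw [edist_dist]
    apply ENNReal.ofReal_le_ofReal
    wlog hle : s ≤ s' generalizing s s'
    · rw [dist_comm]; exact this s' hs' s hs (le_of_not_ge hle)
    rw [Real.dist_eq, abs_sub_comm, abs_of_nonneg (by linarith), le_div_iff₀ hc]
    have hconv : ∀ u ∈ Icc s s', y + u • e ∈ Metric.ball x₀ r := by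
      intro u hu
      have := (convex_ball x₀ r).segment_subset hs.1 hs'.1
      apply this
      rcases eq_or_lt_of_le hle with h | h
      · have : u = s := le_antisymm (hu.2.trans h.ge) hu.1
        rw [this]; exact left_mem_segment ℝ _ _
      · rw [segment_eq_image']
        refine ⟨(u - s) / (s' - s), ⟨div_nonneg (by linarith [hu.1]) (by linarith), ?_⟩, ?_⟩
        · rw [div_le_one (by linarith)]; linarith [hu.2]
        · have h1 : y + s' • e - (y + s • e) = (s' - s) • e := by module
          simp only
          rw [h1, smul_smul, div_mul_cancel₀ _ (by linarith)]; module
    have hder : ∀ u ∈ Icc s s', HasDerivAt (fun u : ℝ => ψ (y + u • e))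
        (fderiv ℝ ψ (y + u • e) e) u := by
      intro u hu
      have h1 : HasDerivAt (fun u : ℝ => y + u • e) e u := by
        simpa using ((hasDerivAt_id u).smul_const e).const_add y
      exact (hψ _ (hconv u hu)).hasFDerivAt.comp_hasDerivAt u h1
    have hmvt := (convex_Icc s s').mul_sub_le_image_sub_of_le_deriv
      (f := fun u : ℝ => ψ (y + u • e)) (C := c)
      (fun u hu => (hder u hu).continuousAt.continuousWithinAt)
      (fun u hu => (hder u (interior_subset hu)).differentiableAt.differentiableWithinAt)
      (fun u hu => by rw [(hder u (interior_subset hu)).deriv]; exact hce _ (hconv u (interior_subset hu)))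
      s (left_mem_Icc.2 hle) s' (right_mem_Icc.2 hle) hle
    have h1 := hs.2.1
    have h2 := hs'.2.2
    linarith
  -- All translates of the slab have the same volume. Averaging over shifts `s ∈ [0,1]` and
  -- exchanging integrals reduces the volume to lengths along lines, with base points in the ball
  -- enlarged by 1.
  have htr : ∀ s : ℝ, ∫⁻ y, A.indicator (fun _ => (1 : ENNReal)) (y + s • e) = volume A := by
    intro s
    rw [lintegral_add_right_eq_self (fun y => A.indicator (fun _ => (1 : ENNReal)) y) (s • e),
      lintegral_indicator hAm]; simp
  calc volume A = ∫⁻ s in Icc (0 : ℝ) 1, (∫⁻ y, A.indicator (fun _ => (1 : ENNReal)) (y + s • e)) := by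
        simp_rw [htr]; simp
    _ = ∫⁻ y, ∫⁻ s in Icc (0 : ℝ) 1, A.indicator (fun _ => (1 : ENNReal)) (y + s • e) := by
        refine lintegral_lintegral_swap (f := fun (s : ℝ) (y : E) =>
          A.indicator (fun _ => (1 : ENNReal)) (y + s • e)) (Measurable.aemeasurable ?_)
        refine (measurable_const.indicator hAm).comp ?_
        fun_prop
    _ ≤ ∫⁻ y, (Metric.ball x₀ (r + 1)).indicator (fun _ => ENNReal.ofReal (δ / c)) y := by
        refine lintegral_mono fun y => ?_
        by_cases hy : y ∈ Metric.ball x₀ (r + 1)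
        · rw [indicator_of_mem hy]
          refine (setLIntegral_le_lintegral _ _).trans ?_
          have hm : MeasurableSet {s : ℝ | y + s • e ∈ A} :=
            (by fun_prop : Measurable fun s : ℝ => y + s • e) hAm
          have : (fun s : ℝ => A.indicator (fun _ => (1 : ENNReal)) (y + s • e))
              = {s : ℝ | y + s • e ∈ A}.indicator fun _ => 1 := by
            ext s; simp [indicator]
          rw [this, lintegral_indicator hm]
          simpa using hline y
        · rw [indicator_of_notMem hy, nonpos_iff_eq_zero]
          rw [setLIntegral_congr_fun (g := fun _ => 0) measurableSet_Icc]
          · simp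
          · intro s hs
            refine indicator_of_notMem (fun h => hy ?_) _
            have h1 : dist (y + s • e) x₀ < r := h.1
            rw [Metric.mem_ball]
            calc dist y x₀ ≤ dist y (y + s • e) + dist (y + s • e) x₀ := dist_triangle _ _ _
              _ < 1 + r := by
                refine add_lt_add_of_le_of_lt ?_ h1
                rw [dist_self_add_right, norm_smul, he, mul_one, Real.norm_eq_abs,
                  abs_of_nonneg hs.1]
                exact hs.2
              _ = r + 1 := add_comm _ _
    _ = _ := by rw [lintegral_indicator Metric.isOpen_ball.measurableSet]; simp [mul_comm]

end

end EESM

namespace EESM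

noncomputable section

namespace WeakDiv

variable {D : Set E} {w : E → E} {d : E → ℝ}

/-- If the normal component of `w` vanishes on the regular part of the boundary, the derivative of
a local defining function along `w` is small near the boundary. -/
lemma fderiv_small_near_boundary (W : WeakDiv D w d)
    (himp : ∀ x n, IsOuterUnitNormal D x n →
      Tendsto (fun Y => inner ℝ (w Y) n) (𝓝[D] x) (𝓝 0))
    {U K : Set E} (hU : IsOpen U) (hK : IsCompact K) (hKU : K ⊆ U) {ψ : E → ℝ}
    (hψ : ∀ y ∈ U, ContDiffAt ℝ 1 ψ y) (hgrad : ∀ y ∈ U, gradient ψ y ≠ 0)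
    (hiff : ∀ y ∈ U, y ∈ D ↔ 0 < ψ y) {δ : ℝ} (hδ : 0 < δ) :
    ∃ ε > 0, ∀ y ∈ K, 0 < ψ y → ψ y ≤ ε → |fderiv ℝ ψ y (w y)| ≤ δ := by
  -- Violating points with `ψ → 0` would accumulate at a point of `K` where `ψ = 0`. That point is a
  -- regular boundary point with `ψ` itself as defining function, so impermeability applies there.
  by_contra! hcon
  have hpos : ∀ n : ℕ, (0 : ℝ) < 1 / (n + 1) := fun n => by positivity
  choose y hyK hy0 hyn hyδ using fun n : ℕ => hcon (1 / (n + 1)) (hpos n)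
  obtain ⟨z, hzK, θ, hθ, hlim⟩ := hK.tendsto_subseq hyK
  have hzU := hKU hzK
  have hψz : ψ z = 0 := by
    have h1 : Tendsto (fun n => ψ (y (θ n))) atTop (𝓝 (ψ z)) :=
      ((hψ z hzU).continuousAt.tendsto).comp hlim
    have h2 : Tendsto (fun n => ψ (y (θ n))) atTop (𝓝 0) := by
      refine squeeze_zero (fun n => (hy0 _).le) (fun n => hyn _) ?_
      exact (tendsto_one_div_add_atTop_nhds_zero_nat (𝕜 := ℝ)).comp hθ.tendsto_atTop
    exact tendsto_nhds_unique h1 h2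
  have hyD : ∀ n, y n ∈ D := fun n => (hiff _ (hKU (hyK n))).2 (hy0 n)
  have hzD : z ∉ D := fun h => by have := (hiff z hzU).1 h; linarith
  have hlimD : Tendsto (fun n => y (θ n)) atTop (𝓝[D] z) :=
    tendsto_nhdsWithin_iff.2 ⟨hlim, Eventually.of_forall fun n => hyD _⟩
  have hfr : z ∈ frontier D :=
    ⟨mem_closure_of_tendsto hlim (Eventually.of_forall fun n => hyD _),
      fun h => hzD (interior_subset h)⟩
  have hnorm : IsOuterUnitNormal D z (-(‖gradient ψ z‖⁻¹ • gradient ψ z)) :=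
    ⟨hfr, ψ, hψ z hzU, hgrad z hzU,
      by filter_upwards [hU.mem_nhds hzU] with y hy using hiff y hy, rfl⟩
  have h1 := (himp z _ hnorm).comp hlimD
  have h2 : Tendsto (fun n => fderiv ℝ ψ z (w (y (θ n)))) atTop (𝓝 0) := by
    have h3 := h1.const_mul (-‖gradient ψ z‖)
    rw [mul_zero] at h3
    refine h3.congr fun n => ?_
    have hne : ‖gradient ψ z‖ ≠ 0 := norm_ne_zero_iff.2 (hgrad z hzU)
    have hg : fderiv ℝ ψ z (w (y (θ n))) = inner ℝ (w (y (θ n))) (gradient ψ z) := by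
      rw [real_inner_comm, gradient, InnerProductSpace.toDual_symm_apply]
    rw [hg, Function.comp, inner_neg_right, inner_smul_right]
    field_simp
  obtain ⟨r, hr⟩ := hK.isBounded.exists_norm_le
  obtain ⟨C, hC0, hC⟩ := W.bdd r
  -- The gradient at the moving point may be replaced by the one at the limit, because `∇ψ` is
  -- continuous and `w` is bounded on the compact set.
  have h3 : Tendsto (fun n => (fderiv ℝ ψ (y (θ n)) - fderiv ℝ ψ z) (w (y (θ n)))) atTop (𝓝 0) := by
    have hcont : ContinuousAt (fderiv ℝ ψ) z :=
      ((hψ z hzU).fderiv_right (m := 0) (by norm_num)).continuousAt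
    have h4 : Tendsto (fun n => ‖fderiv ℝ ψ (y (θ n)) - fderiv ℝ ψ z‖ * C) atTop (𝓝 0) := by
      have := ((hcont.tendsto.comp hlim).sub_const (fderiv ℝ ψ z)).norm.mul_const C
      simpa using this
    refine squeeze_zero_norm (fun n => ?_) h4
    exact (ContinuousLinearMap.le_opNorm _ _).trans
      (mul_le_mul_of_nonneg_left (hC _ (hr _ (hyK _))).1 (norm_nonneg _))
  have h4 : Tendsto (fun n => |fderiv ℝ ψ (y (θ n)) (w (y (θ n)))|) atTop (𝓝 0) := by
    have := (h3.add h2).abs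
    simp only [add_zero, abs_zero] at this
    refine this.congr fun n => ?_
    rw [_root_.sub_apply]; ring_nf
  have := ge_of_tendsto h4 (Eventually.of_forall fun n => (hyδ (θ n)).le)
  linarith

/-- The Gauss–Green formula near a regular boundary point. -/
lemma defect_eq_zero_near_regular (W : WeakDiv D w d)
    (himp : ∀ x n, IsOuterUnitNormal D x n →
      Tendsto (fun Y => inner ℝ (w Y) n) (𝓝[D] x) (𝓝 0))
    {x₀ n₀ : E} (hn : IsOuterUnitNormal D x₀ n₀) :
    ∃ r > 0, ∀ φ : E → ℝ, ContDiff ℝ 1 φ → HasCompactSupport φ →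
      tsupport φ ⊆ Metric.ball x₀ r → defect w d φ = 0 := by
  obtain ⟨-, ψ, hψ0, hg0, hiff0, -⟩ := hn
  have hgn : 0 < ‖gradient ψ x₀‖ := norm_pos_iff.2 hg0
  set e : E := ‖gradient ψ x₀‖⁻¹ • gradient ψ x₀ with he
  have hgrad : ∀ y v, fderiv ℝ ψ y v = inner ℝ (gradient ψ y) v := fun y v => by
    rw [gradient, InnerProductSpace.toDual_symm_apply]
  have hen : ‖e‖ = 1 := by rw [he, norm_smul, norm_inv, norm_norm, inv_mul_cancel₀ hgn.ne']
  have hfe : fderiv ℝ ψ x₀ e = ‖gradient ψ x₀‖ := by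
    rw [hgrad, he, inner_smul_right, real_inner_self_eq_norm_sq]; field_simp
  -- Half of the normal derivative at `x₀` remains a lower bound nearby, which is what the slab
  -- estimate requires.
  set c := ‖gradient ψ x₀‖ / 2 with hc
  have hc0 : 0 < c := by positivity
  have hev1 : ∀ᶠ y in 𝓝 x₀, ContDiffAt ℝ 1 ψ y := hψ0.eventually (by simp)
  have hcont : ContinuousAt (fderiv ℝ ψ) x₀ :=
    (hψ0.fderiv_right (m := 0) (by norm_num)).continuousAt
  have hev2 : ∀ᶠ y in 𝓝 x₀, c < fderiv ℝ ψ y e := by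
    have : ContinuousAt (fun y => fderiv ℝ ψ y e) x₀ := hcont.clm_apply continuousAt_const
    exact this.eventually (lt_mem_nhds (by show c < fderiv ℝ ψ x₀ e; rw [hfe]; linarith))
  obtain ⟨r, hr0, hr⟩ := Metric.eventually_nhds_iff_ball.1 (hev1.and (hev2.and hiff0))
  refine ⟨r, hr0, fun φ hφ hk hs => ?_⟩
  set U := Metric.ball x₀ r with hU
  have hUo : IsOpen U := Metric.isOpen_ball
  have hgne : ∀ y ∈ U, gradient ψ y ≠ 0 := by
    intro y hy h
    have := (hr y hy).2.1
    rw [hgrad, h, inner_zero_left] at this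
    linarith
  have hiff : ∀ y ∈ U, y ∈ D ↔ 0 < ψ y := fun y hy => (hr y hy).2.2
  have hψd : ∀ y ∈ U, DifferentiableAt ℝ ψ y := fun y hy => (hr y hy).1.differentiableAt one_ne_zero
  have hψK : ContinuousOn ψ (tsupport φ) := fun y hy =>
    (hr y (hs hy)).1.continuousAt.continuousWithinAt
  let st := Real.smoothTransition
  have hstC : ContDiff ℝ 1 st := Real.smoothTransition.contDiff (n := 1)
  obtain ⟨M, hM0, hM⟩ := exists_bound_deriv_smoothTransition
  obtain ⟨Mφ, hMφ0, hMφ⟩ := exists_bound hk hφ.continuous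
  -- cut-off test functions
  let T : ℕ → E → ℝ := fun n y => φ y * st (n * ψ y - 1)
  have hTC : ∀ n, ContDiff ℝ 1 (T n) := by
    intro n
    rw [contDiff_iff_contDiffAt]
    intro y
    by_cases hy : y ∈ tsupport φ
    · refine hφ.contDiffAt.mul (hstC.contDiffAt.comp y ?_)
      exact (contDiffAt_const.mul (hr y (hs hy)).1).sub contDiffAt_const
    · have : T n =ᶠ[𝓝 y] fun _ => 0 := by
        filter_upwards [(isClosed_tsupport φ).isOpen_compl.mem_nhds hy] with z hz
        simp [T, image_eq_zero_of_notMem_tsupport hz]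
      exact contDiffAt_const.congr_of_eventuallyEq this
  have hTk : ∀ n, HasCompactSupport (T n) := fun n => hk.mul_right
  -- The cut-off vanishes where `ψ < 1/n`, so the support stays in `{ψ ≥ 1/n}`, a closed part of
  -- `D`, and interior test functions suffice.
  have hTs : ∀ n : ℕ, 0 < n → tsupport (T n) ⊆ D := by
    intro n hn
    have hn' : (0 : ℝ) < n := by exact_mod_cast hn
    have hcl : IsClosed (tsupport φ ∩ ψ ⁻¹' Ici (1 / n : ℝ)) :=
      hψK.preimage_isClosed_of_isClosed (isClosed_tsupport φ) isClosed_Ici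
    have hsub : tsupport (T n) ⊆ tsupport φ ∩ ψ ⁻¹' Ici (1 / n : ℝ) := by
      refine closure_minimal (fun y hy => ?_) hcl
      refine ⟨subset_tsupport _ (left_ne_zero_of_mul hy), ?_⟩
      by_contra h
      have h : ψ y < 1 / n := not_le.1 h
      rw [lt_div_iff₀ hn'] at h
      exact right_ne_zero_of_mul hy (Real.smoothTransition.zero_of_nonpos (by linarith))
    intro y hy
    have h := hsub hy
    exact (hiff y (hs h.1)).2 ((by positivity : (0 : ℝ) < 1 / n).trans_le h.2)
  let g : E → ℝ := fun y => d y * φ y - fderiv ℝ φ y (w y)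
  let k : ℕ → E → ℝ := fun n y => φ y * (n * deriv st (n * ψ y - 1)) * fderiv ℝ ψ y (w y)
  have hfd : ∀ n y, d y * T n y - fderiv ℝ (T n) y (w y) = st (n * ψ y - 1) * g y - k n y := by
    intro n y
    by_cases hy : y ∈ tsupport φ
    · have h1 : HasFDerivAt (fun y => (n : ℝ) * ψ y - 1) ((n : ℝ) • fderiv ℝ ψ y) y :=
        ((hψd y (hs hy)).hasFDerivAt.const_mul (n : ℝ)).sub_const 1
      have h2 : HasFDerivAt (fun y => st (n * ψ y - 1))
          (deriv st (n * ψ y - 1) • ((n : ℝ) • fderiv ℝ ψ y)) y :=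
        ((hstC.differentiable one_ne_zero _).hasDerivAt).comp_hasFDerivAt y h1
      have h3 := ((hφ.differentiable one_ne_zero y).hasFDerivAt.mul h2).fderiv
      have h4 : fderiv ℝ (T n) y = _ := h3
      rw [h4]
      simp only [T, g, k, _root_.add_apply, _root_.smul_apply, smul_eq_mul]
      ring
    · have h0 : fderiv ℝ φ y = 0 := fderiv_of_notMem_tsupport (𝕜 := ℝ) hy
      have h1 : fderiv ℝ (T n) y = 0 := fderiv_of_notMem_tsupport (𝕜 := ℝ)
        fun h => hy (tsupport_mul_subset_left h)
      simp [T, g, k, h0, h1, image_eq_zero_of_notMem_tsupport hy]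
  have hgint : Integrable g := W.integrable_defect hφ hk
  have hg0 : ∀ y, (y ∉ tsupport φ ∨ ψ y ≤ 0) → g y = 0 := by
    intro y hy
    by_cases h : y ∈ tsupport φ
    · have hyD : y ∉ D := fun h' => by
        have := (hiff y (hs h)).1 h'
        rcases hy with hy | hy
        · exact hy h
        · linarith
      simp [g, W.zero_d y hyD, W.zero_w y hyD]
    · have h0 : fderiv ℝ φ y = 0 := fderiv_of_notMem_tsupport (𝕜 := ℝ) h
      simp [g, h0, image_eq_zero_of_notMem_tsupport h]
  have hstg : ∀ n : ℕ, ∀ y, ‖st (n * ψ y - 1) * g y‖ ≤ ‖g y‖ := by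
    intro n y
    rw [norm_mul, Real.norm_eq_abs, abs_of_nonneg (Real.smoothTransition.nonneg _)]
    exact mul_le_of_le_one_left (norm_nonneg _) (Real.smoothTransition.le_one _)
  have hstm : ∀ n : ℕ, AEStronglyMeasurable (fun y => st (n * ψ y - 1) * g y) := by
    intro n
    -- measurable on the support of `φ`, zero elsewhere
    have h1 : AEStronglyMeasurable (fun y => st (n * ψ y - 1)) (volume.restrict (tsupport φ)) := by
      refine ContinuousOn.aestronglyMeasurable ?_ (isClosed_tsupport φ).measurableSet
      exact hstC.continuous.comp_continuousOn ((continuousOn_const.mul hψK).sub continuousOn_const)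
    refine (aestronglyMeasurable_indicator_iff (isClosed_tsupport φ).measurableSet).2
      (h1.mul hgint.aestronglyMeasurable.restrict) |>.congr (Eventually.of_forall fun y => ?_)
    by_cases hy : y ∈ tsupport φ
    · rw [indicator_of_mem hy]; rfl
    · rw [indicator_of_notMem hy]; simp only [hg0 y (Or.inl hy), mul_zero]
  have hlim1 : Tendsto (fun n : ℕ => ∫ y, st (n * ψ y - 1) * g y) atTop (𝓝 (∫ y, g y)) := by
    refine tendsto_integral_of_dominated_convergence (fun y => ‖g y‖) hstm hgint.norm
      (fun n => Eventually.of_forall (hstg n)) (Eventually.of_forall fun y => ?_)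
    by_cases hy : y ∉ tsupport φ ∨ ψ y ≤ 0
    · simp [hg0 y hy]
    · push Not at hy
      obtain ⟨N, hN⟩ := exists_nat_ge (2 / ψ y)
      refine tendsto_const_nhds.congr' ?_
      filter_upwards [eventually_ge_atTop N] with n hn
      have : (1 : ℝ) ≤ n * ψ y - 1 := by
        have h1 : 2 / ψ y ≤ n := hN.trans (by exact_mod_cast hn)
        rw [div_le_iff₀ hy.2] at h1; linarith
      show g y = Real.smoothTransition _ * _
      rw [Real.smoothTransition.one_of_one_le this, one_mul]
  have hkint : ∀ n : ℕ, 0 < n → ∫ y, st (n * ψ y - 1) * g y = ∫ y, k n y := by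
    intro n hn
    have h0 := W.weak (T n) (hTC n) (hTk n) (hTs n hn)
    simp_rw [hfd] at h0
    have h1 : Integrable fun y => st (n * ψ y - 1) * g y :=
      hgint.norm.mono' (hstm n) (Eventually.of_forall (hstg n))
    have h2 : Integrable (k n) := by
      have h3 := W.integrable_defect (hTC n) (hTk n)
      simp_rw [hfd] at h3
      refine (h1.sub h3).congr (Eventually.of_forall fun y => ?_)
      simp
    rw [integral_sub h1 h2] at h0
    linarith
  -- The term from differentiating the cut-off is of size `n` times the normal component `∇ψ·w`, on
  -- a slab of volume `O(1/n)`. The factors `n` cancel and the normal component tends to zero.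
  have hlim2 : Tendsto (fun n : ℕ => ∫ y, k n y) atTop (𝓝 0) := by
    rw [Metric.tendsto_atTop]
    intro ε hε
    set V := (volume (Metric.ball x₀ (r + 1))).toReal with hV
    have hVtop : volume (Metric.ball x₀ (r + 1)) ≠ ⊤ := measure_ball_lt_top.ne
    have hV0 : 0 ≤ V := ENNReal.toReal_nonneg
    -- The constant left after `n` cancels; the added 1 keeps it positive and makes the final
    -- inequality strict.
    set B := Mφ * M * (V * (2 / c)) + 1 with hB
    have hB0 : 0 < B := by positivity
    obtain ⟨ε', hε', hsm⟩ := W.fderiv_small_near_boundary himp hUo hk.isCompact hs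
      (fun y hy => (hr y hy).1) hgne hiff (δ := ε / (2 * B)) (by positivity)
    obtain ⟨N, hN⟩ := exists_nat_ge (2 / ε')
    refine ⟨max N 1, fun n hn => ?_⟩
    have hn0 : (0 : ℝ) < n := by exact_mod_cast (le_trans (le_max_right _ _) hn)
    have hnε : 2 / (n : ℝ) ≤ ε' := by
      have : (N : ℝ) ≤ n := by exact_mod_cast le_trans (le_max_left _ _) hn
      rw [div_le_iff₀ hε'] at hN
      rw [div_le_iff₀ hn0]; nlinarith
    set A := {y ∈ U | 0 < ψ y ∧ ψ y ≤ 2 / n} with hA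
    have hAvol := volume_slab_le hc0 hen hψd (fun y hy => ((hr y hy).2.1).le) (2 / n)
    have hAtop : volume A ≠ ⊤ := ne_top_of_le_ne_top
      (ENNReal.mul_ne_top hVtop ENNReal.ofReal_ne_top) hAvol
    have hAV : (volume A).toReal ≤ V * (2 / n / c) := by
      have := ENNReal.toReal_mono (ENNReal.mul_ne_top hVtop ENNReal.ofReal_ne_top) hAvol
      rwa [ENNReal.toReal_mul, ENNReal.toReal_ofReal (by positivity)] at this
    have hk0 : ∀ y ∉ A, k n y = 0 := by
      intro y hy
      by_cases h : y ∈ tsupport φ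
      · have : deriv st (n * ψ y - 1) = 0 := by
          by_contra h'
          refine hy ⟨hs h, ?_⟩
          have h2 : ¬ ((n * ψ y - 1 : ℝ) < 0 ∨ 1 < (n * ψ y - 1 : ℝ)) :=
            fun h3 => h' (deriv_smoothTransition_eq_zero h3)
          push Not at h2
          constructor
          · by_contra h3
            nlinarith [h2.1]
          · rw [le_div_iff₀ hn0]; linarith [h2.2]
        simp [k, this]
      · simp [k, image_eq_zero_of_notMem_tsupport h]
    have hkb : ∀ y ∈ A, ‖k n y‖ ≤ Mφ * (n * M) * (ε / (2 * B)) := by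
      intro y hy
      by_cases h : y ∈ tsupport φ
      · simp only [k, norm_mul, Real.norm_eq_abs, Nat.abs_cast]
        have h1 := hsm y h hy.2.1 (hy.2.2.trans hnε)
        have h2 := hMφ y
        rw [Real.norm_eq_abs] at h2
        have h3 := hM (n * ψ y - 1)
        gcongr
      · simp only [k, image_eq_zero_of_notMem_tsupport h, zero_mul, norm_zero]
        positivity
    rw [dist_zero_right, ← setIntegral_eq_integral_of_forall_compl_eq_zero hk0]
    have := norm_setIntegral_le_of_norm_le_const (μ := volume) (lt_top_iff_ne_top.2 hAtop) hkb
    refine this.trans_lt ?_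
    rw [measureReal_def]
    calc Mφ * (n * M) * (ε / (2 * B)) * (volume A).toReal
        ≤ Mφ * (n * M) * (ε / (2 * B)) * (V * (2 / n / c)) := by gcongr
      _ = ε * ((Mφ * M * (V * (2 / c))) / (2 * B)) := by field_simp
      _ < ε * 1 := by
        gcongr
        rw [div_lt_one (by positivity)]
        have : 0 ≤ Mφ * M * (V * (2 / c)) := by positivity
        linarith
      _ = ε := mul_one ε
  refine tendsto_nhds_unique hlim1 (hlim2.congr' ?_)
  filter_upwards [eventually_gt_atTop 0] with n hn using (hkint n hn).symm

end WeakDiv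

end

end EESM

/-! ### Sets of zero area and the global Gauss–Green formula -/

namespace EESM

noncomputable section

/-- A compact set of zero area is covered by finitely many balls with small total area. -/
lemma exists_finite_ball_cover {S : Set E} (hS : IsCompact S)
    (h0 : Measure.hausdorffMeasure 2 S = 0) {ε : ℝ} (hε : 0 < ε) :
    ∃ (t : Finset ℕ) (x : ℕ → E) (r : ℕ → ℝ), (∀ i ∈ t, 0 < r i ∧ r i ≤ 1) ∧
      (S ⊆ ⋃ i ∈ t, Metric.ball (x i) (r i)) ∧ ∑ i ∈ t, r i ^ 2 ≤ ε := by
  rw [Measure.hausdorffMeasure_apply] at h0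
  -- Covers at scale `1/2` leave room to enlarge the sets and still keep all radii at most 1.
  have hhalf : (0 : ENNReal) < ENNReal.ofReal (1 / 2) := by simp
  have h1 := le_of_le_of_eq (le_iSup₂ (f := fun (r : ENNReal) (_ : 0 < r) =>
    ⨅ (t : ℕ → Set E), ⨅ (_ : S ⊆ ⋃ n, t n), ⨅ (_ : ∀ n, Metric.ediam (t n) ≤ r),
      ∑' n, ⨆ (_ : (t n).Nonempty), Metric.ediam (t n) ^ (2 : ℝ)) (ENNReal.ofReal (1 / 2)) hhalf) h0
  have h2 := h1.trans_lt (ENNReal.ofReal_pos.2 (show (0 : ℝ) < ε / 4 by positivity))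
  simp only [iInf_lt_iff] at h2
  obtain ⟨T, hST, hTd, hsum⟩ := h2
  -- A positive summable sequence thickens each set to an open ball, including sets of zero
  -- diameter. With `δ ≤ 1/2` one has `(d + δ)² ≤ 2d² + 2δ² ≤ 2d² + δ`, so the total stays below
  -- `ε`.
  obtain ⟨η, hη0, ⟨c, hηs, hηc⟩⟩ := NNReal.exists_pos_sum_of_countable
    (ε := (⟨ε / 4, by positivity⟩ : NNReal)) (by
      intro h; have := congrArg NNReal.toReal h
      have h' : ε / 4 = 0 := this
      linarith) ℕ
  let dd : ℕ → ℝ := fun n => (Metric.ediam (T n)).toReal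
  have hTtop : ∀ n, Metric.ediam (T n) ≠ ⊤ := fun n =>
    ne_top_of_le_ne_top ENNReal.ofReal_ne_top (hTd n)
  have hdd0 : ∀ n, 0 ≤ dd n := fun n => ENNReal.toReal_nonneg
  have hdd : ∀ n, dd n ≤ 1 / 2 := fun n => by
    have := ENNReal.toReal_mono ENNReal.ofReal_ne_top (hTd n)
    rwa [ENNReal.toReal_ofReal (by norm_num)] at this
  let δ : ℕ → ℝ := fun n => min (1 / 2) (η n)
  have hδ0 : ∀ n, 0 < δ n := fun n => lt_min (by norm_num) (by exact_mod_cast hη0 n)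
  have hδ1 : ∀ n, δ n ≤ 1 / 2 := fun n => min_le_left _ _
  have hδη : ∀ n, δ n ≤ η n := fun n => min_le_right _ _
  choose! x hx using fun n => (fun h : (T n).Nonempty => h : (T n).Nonempty → ∃ x, x ∈ T n)
  let r : ℕ → ℝ := fun n => dd n + δ n
  have hcov : S ⊆ ⋃ n, Metric.ball (x n) (r n) := by
    intro y hy
    obtain ⟨n, hn⟩ := mem_iUnion.1 (hST hy)
    refine mem_iUnion.2 ⟨n, ?_⟩
    have h3 : edist y (x n) ≤ Metric.ediam (T n) :=
      Metric.edist_le_ediam_of_mem hn (hx n ⟨y, hn⟩)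
    have h4 : dist y (x n) ≤ dd n := by
      rw [dist_edist]; exact ENNReal.toReal_mono (hTtop n) h3
    rw [Metric.mem_ball]; linarith [hδ0 n, show r n = dd n + δ n from rfl]
  obtain ⟨t, ht⟩ := hS.elim_finite_subcover _ (fun n => Metric.isOpen_ball) hcov
  refine ⟨t, x, r, fun i _ => ⟨by linarith [hdd0 i, hδ0 i, show r i = dd i + δ i from rfl], ?_⟩, ht, ?_⟩
  · linarith [hdd i, hδ1 i, show r i = dd i + δ i from rfl]
  · have hA : ∑ i ∈ t, dd i ^ 2 ≤ ε / 4 := by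
      have h3 : ∀ i, ENNReal.ofReal (dd i ^ 2) ≤ ⨆ (_ : (T i).Nonempty), Metric.ediam (T i) ^ (2 : ℝ) := by
        intro i
        rcases (T i).eq_empty_or_nonempty with h | h
        · simp [dd, h]
        · rw [iSup_pos h, ENNReal.ofReal_pow (hdd0 i), ENNReal.ofReal_toReal (hTtop i)]
          norm_cast
      have h4 : ENNReal.ofReal (∑ i ∈ t, dd i ^ 2) ≤ ENNReal.ofReal (ε / 4) := by
        rw [ENNReal.ofReal_sum_of_nonneg fun i _ => sq_nonneg _]
        exact (Finset.sum_le_sum fun i _ => h3 i).trans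
          ((ENNReal.sum_le_tsum t).trans hsum.le)
      exact (ENNReal.ofReal_le_ofReal_iff (by positivity)).1 h4
    have hB : ∑ i ∈ t, (η i : ℝ) ≤ ε / 4 := by
      have h3 : ∑ i ∈ t, η i ≤ c := sum_le_hasSum t (fun i _ => zero_le) hηs
      have h4 : (∑ i ∈ t, η i) ≤ (⟨ε / 4, by positivity⟩ : NNReal) := h3.trans hηc.le
      have h5 : ((∑ i ∈ t, η i : NNReal) : ℝ) ≤ ε / 4 := by exact_mod_cast h4
      simpa using h5
    calc ∑ i ∈ t, r i ^ 2 ≤ ∑ i ∈ t, (2 * dd i ^ 2 + η i) := by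
          refine Finset.sum_le_sum fun i _ => ?_
          have : r i = dd i + δ i := rfl
          rw [this]
          nlinarith [sq_nonneg (dd i - δ i), hδ0 i, hδ1 i, hδη i]
      _ = 2 * ∑ i ∈ t, dd i ^ 2 + ∑ i ∈ t, (η i : ℝ) := by
          rw [Finset.sum_add_distrib, Finset.mul_sum]
      _ ≤ ε := by linarith

/-- A cut-off function that vanishes near a small ball, at a cost of order `r²`. -/
lemma exists_ball_cutoff : ∃ C : ℝ, 0 < C ∧ ∀ (x : E) (r : ℝ), 0 < r → r ≤ 1 →
    ∃ η : E → ℝ, ContDiff ℝ 1 η ∧ HasCompactSupport η ∧ (∀ y, 0 ≤ η y ∧ η y ≤ 1) ∧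
      (∀ y ∈ Metric.ball x r, η y = 1) ∧
      (∫ y, η y) + (∫ y, ‖fderiv ℝ η y‖) ≤ C * r ^ 2 := by
  let b : ContDiffBump (0 : E) := ⟨1, 2, by norm_num, by norm_num⟩
  have hbC : ContDiff ℝ 1 b := b.contDiff
  refine ⟨(∫ y, b y) + (∫ y, ‖fderiv ℝ b y‖) + 1, ?_, fun x r hr hr1 => ?_⟩
  · have h1 : 0 ≤ ∫ y, b y := integral_nonneg fun y => b.nonneg
    have h2 : 0 ≤ ∫ y, ‖fderiv ℝ b y‖ := integral_nonneg fun y => norm_nonneg _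
    linarith
  refine ⟨fun y => b (r⁻¹ • (y - x)), ?_, ?_, fun y => ⟨b.nonneg, b.le_one⟩, fun y hy => ?_, ?_⟩
  · exact hbC.comp ((contDiff_id.sub contDiff_const).const_smul r⁻¹)
  · have hh : HasCompactSupport fun y => b (r⁻¹ • y) := b.hasCompactSupport.comp_smul (inv_ne_zero hr.ne')
    exact hh.comp_homeomorph (Homeomorph.subRight x)
  · refine b.one_of_mem_closedBall ?_
    rw [mem_closedBall_zero_iff, norm_smul, norm_inv, Real.norm_eq_abs, abs_of_pos hr]
    rw [Metric.mem_ball, dist_eq_norm] at hy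
    show r⁻¹ * ‖y - x‖ ≤ 1
    rw [inv_mul_le_iff₀ hr]; linarith
  -- Rescaling contributes `r³` from the volume and `r⁻¹` from the gradient; since `r ≤ 1`, both
  -- integrals are bounded by a multiple of `r²`.
  · have hI : ∀ F : E → ℝ, ∫ y, F (r⁻¹ • (y - x)) = r ^ 3 * ∫ y, F y := by
      intro F
      rw [integral_sub_right_eq_self (fun y => F (r⁻¹ • y)) x, Measure.integral_comp_inv_smul]
      simp [abs_of_pos hr]
    have hf : ∀ y, ‖fderiv ℝ (fun y => b (r⁻¹ • (y - x))) y‖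
        = r⁻¹ * ‖fderiv ℝ b (r⁻¹ • (y - x))‖ := by
      intro y
      have h1 : HasFDerivAt (fun y : E => r⁻¹ • (y - x)) (r⁻¹ • ContinuousLinearMap.id ℝ E) y :=
        ((hasFDerivAt_id y).sub_const x).const_smul r⁻¹
      have h2 := ((hbC.differentiable one_ne_zero (r⁻¹ • (y - x))).hasFDerivAt.comp y h1).fderiv
      have h3 : fderiv ℝ (fun y => b (r⁻¹ • (y - x))) y = _ := h2
      rw [h3, ContinuousLinearMap.comp_smul, ContinuousLinearMap.comp_id, norm_smul, norm_inv,
        Real.norm_eq_abs, abs_of_pos hr]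
    simp_rw [hf]
    rw [integral_const_mul, hI, hI (fun y => ‖fderiv ℝ b y‖)]
    have h1 : 0 ≤ ∫ y, b y := integral_nonneg fun y => b.nonneg
    have h2 : 0 ≤ ∫ y, ‖fderiv ℝ b y‖ := integral_nonneg fun y => norm_nonneg _
    have h3 : r⁻¹ * (r ^ 3 * ∫ y, ‖fderiv ℝ b y‖) = r ^ 2 * ∫ y, ‖fderiv ℝ b y‖ := by field_simp
    rw [h3]
    have h4 : r ^ 3 ≤ r ^ 2 := pow_le_pow_of_le_one hr.le hr1 (by norm_num)
    nlinarith [sq_nonneg r]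

/-- A compact set of zero area has zero capacity in the sense needed for the Gauss–Green formula. -/
lemma exists_cutoff_of_null {S : Set E} (hS : IsCompact S)
    (h0 : Measure.hausdorffMeasure 2 S = 0) {ε : ℝ} (hε : 0 < ε) :
    ∃ P : E → ℝ, ContDiff ℝ 1 P ∧ HasCompactSupport (fun y => 1 - P y) ∧
      (∀ y, 0 ≤ P y ∧ P y ≤ 1) ∧ (∃ O, IsOpen O ∧ S ⊆ O ∧ ∀ y ∈ O, P y = 0) ∧
      (∫ y, (1 - P y)) + (∫ y, ‖fderiv ℝ P y‖) ≤ ε := by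
  obtain ⟨C, hC0, hC⟩ := exists_ball_cutoff
  obtain ⟨t, x, r, hr, hcov, hsum⟩ := exists_finite_ball_cover hS h0 (show 0 < ε / C by positivity)
  -- Products of the functions `1 - η` are used: both `∫ (1 - P)` and `∫ |∇P|` are subadditive under
  -- such products because every factor lies in `[0,1]`.
  have key : ∀ s : Finset ℕ, s ⊆ t → ∃ P : E → ℝ, ContDiff ℝ 1 P ∧
      HasCompactSupport (fun y => 1 - P y) ∧ (∀ y, 0 ≤ P y ∧ P y ≤ 1) ∧
      (∀ i ∈ s, ∀ y ∈ Metric.ball (x i) (r i), P y = 0) ∧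
      (∫ y, (1 - P y)) + (∫ y, ‖fderiv ℝ P y‖) ≤ C * ∑ i ∈ s, r i ^ 2 := by
    intro s
    induction s using Finset.induction_on with
    | empty =>
      intro _
      exact ⟨fun _ => 1, contDiff_const, by simp; exact HasCompactSupport.zero, by simp, by simp,
        by simp⟩
    | insert a s ha ih =>
      intro hst
      obtain ⟨P, hPC, hPk, hP01, hP0, hPs⟩ := ih ((Finset.subset_insert a s).trans hst)
      obtain ⟨η, hηC, hηk, hη01, hη1, hηs⟩ := hC (x a) (r a)
        (hr a (hst (Finset.mem_insert_self a s))).1 (hr a (hst (Finset.mem_insert_self a s))).2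
      have hQC : ContDiff ℝ 1 fun y => P y * (1 - η y) := hPC.mul (contDiff_const.sub hηC)
      have hQk : HasCompactSupport fun y => 1 - P y * (1 - η y) := by
        have : (fun y => 1 - P y * (1 - η y)) = (fun y => 1 - P y) + fun y => P y * η y := by
          ext y; simp; ring
        rw [this]; exact hPk.add hηk.mul_left
      have hfQ : ∀ y, fderiv ℝ (fun y => P y * (1 - η y)) y
          = -(P y • fderiv ℝ η y) + (1 - η y) • fderiv ℝ P y := by
        intro y
        have h1 := (hPC.differentiable one_ne_zero y).hasFDerivAt
        have h2 := (hηC.differentiable one_ne_zero y).hasFDerivAt.const_sub 1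
        rw [← smul_neg]
        exact (h1.mul h2).fderiv
      have hPkf : HasCompactSupport (fderiv ℝ P) := by
        have := hPk.fderiv (𝕜 := ℝ)
        have h : (fderiv ℝ fun y => 1 - P y) = fun y => -fderiv ℝ P y := by
          ext1 y; exact fderiv_const_sub 1
        rw [h] at this
        exact (by ext1 y; simp : fderiv ℝ P = -fun y => -fderiv ℝ P y) ▸ this.neg
      have hPi : Integrable fun y => ‖fderiv ℝ P y‖ :=
        ((hPC.continuous_fderiv one_ne_zero).norm).integrable_of_hasCompactSupport hPkf.norm
      have hηi : Integrable fun y => ‖fderiv ℝ η y‖ :=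
        ((hηC.continuous_fderiv one_ne_zero).norm).integrable_of_hasCompactSupport
          (hηk.fderiv (𝕜 := ℝ)).norm
      have h1Pi : Integrable fun y => 1 - P y :=
        (continuous_const.sub hPC.continuous).integrable_of_hasCompactSupport hPk
      have hηi0 : Integrable η := hηC.continuous.integrable_of_hasCompactSupport hηk
      refine ⟨fun y => P y * (1 - η y), hQC, hQk, fun y => ⟨?_, ?_⟩, fun i hi y hy => ?_, ?_⟩
      · exact mul_nonneg (hP01 y).1 (by linarith [(hη01 y).2])
      · exact mul_le_one₀ (hP01 y).2 (by linarith [(hη01 y).2]) (by linarith [(hη01 y).1])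
      · rcases Finset.mem_insert.1 hi with rfl | hi
        · simp [hη1 y hy]
        · simp [hP0 i hi y hy]
      · have hb1 : ∫ y, (1 - P y * (1 - η y)) ≤ (∫ y, (1 - P y)) + ∫ y, η y := by
          rw [← integral_add h1Pi hηi0]
          refine integral_mono ((continuous_const.sub hQC.continuous).integrable_of_hasCompactSupport
            hQk) (h1Pi.add hηi0) fun y => ?_
          nlinarith [hP01 y, hη01 y, mul_le_of_le_one_left (hη01 y).1 (hP01 y).2]
        have hb2 : ∫ y, ‖fderiv ℝ (fun y => P y * (1 - η y)) y‖
            ≤ (∫ y, ‖fderiv ℝ P y‖) + ∫ y, ‖fderiv ℝ η y‖ := by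
          rw [← integral_add hPi hηi]
          refine integral_mono_of_nonneg (Eventually.of_forall fun y => norm_nonneg _)
            (hPi.add hηi) (Eventually.of_forall fun y => ?_)
          simp only [hfQ]
          refine (norm_add_le _ _).trans ?_
          rw [norm_neg, norm_smul, norm_smul, Real.norm_eq_abs, Real.norm_eq_abs,
            abs_of_nonneg (hP01 y).1, abs_of_nonneg (by linarith [(hη01 y).2] : (0 : ℝ) ≤ 1 - η y),
            add_comm]
          exact add_le_add
            (mul_le_of_le_one_left (norm_nonneg _) (by linarith [(hη01 y).1]))
            (mul_le_of_le_one_left (norm_nonneg _) (hP01 y).2)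
        rw [Finset.sum_insert ha, mul_add]
        linarith
  obtain ⟨P, hPC, hPk, hP01, hP0, hPs⟩ := key t subset_rfl
  refine ⟨P, hPC, hPk, hP01, ⟨⋃ i ∈ t, Metric.ball (x i) (r i),
    isOpen_biUnion fun i _ => Metric.isOpen_ball, hcov, fun y hy => ?_⟩, hPs.trans ?_⟩
  · obtain ⟨i, hi, hy⟩ := mem_iUnion₂.1 hy
    exact hP0 i hi y hy
  · calc C * ∑ i ∈ t, r i ^ 2 ≤ C * (ε / C) := by gcongr
      _ = ε := by field_simp

namespace WeakDiv

variable {D : Set E} {w : E → E} {d : E → ℝ}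

/-- Regularity is open along the boundary: a defining function at one point serves at all nearby
boundary points, its gradient being continuous. Closedness gives compactness of the exceptional set
within a support, hence a finite cover by balls. -/
lemma isClosed_irregular (D : Set E) : IsClosed {x ∈ frontier D | ¬ ∃ n, IsOuterUnitNormal D x n} := by
  have : {x ∈ frontier D | ¬ ∃ n, IsOuterUnitNormal D x n}
      = frontier D ∩ {x | ∀ᶠ z in 𝓝 x, ∃ ψ : E → ℝ, ContDiffAt ℝ 1 ψ z ∧ gradient ψ z ≠ 0 ∧
        (∀ᶠ y in 𝓝 z, y ∈ D ↔ 0 < ψ y)}ᶜ := by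
    ext x
    refine and_congr_right fun hx => not_congr ⟨?_, ?_⟩
    · rintro ⟨n, -, ψ, h1, h2, h3, -⟩
      have hc : ContinuousAt (gradient ψ) x := by
        have h4 : ContinuousAt (fderiv ℝ ψ) x :=
          (h1.fderiv_right (m := 0) (by norm_num)).continuousAt
        exact (InnerProductSpace.toDual ℝ E).symm.continuous.continuousAt.comp h4
      filter_upwards [h1.eventually (by simp), hc.eventually_ne h2, h3.eventually_nhds]
        with z hz1 hz2 hz3 using ⟨ψ, hz1, hz2, hz3⟩
    · intro h
      obtain ⟨ψ, h1, h2, h3⟩ := h.self_of_nhds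
      exact ⟨_, hx, ψ, h1, h2, h3, rfl⟩
  rw [this]
  exact isClosed_frontier.inter (isOpen_setOfPred_eventually_nhds).isClosed_compl

/-- The Gauss–Green formula for a bounded field with bounded weak divergence whose normal component
vanishes on the boundary. -/
theorem gauss_green (W : WeakDiv D w d) (hD : IsOpen D) (hbdry : HasPiecewiseC1Boundary D)
    (himp : ∀ x n, IsOuterUnitNormal D x n →
      Tendsto (fun Y => inner ℝ (w Y) n) (𝓝[D] x) (𝓝 0))
    {φ : E → ℝ} (hφ : ContDiff ℝ 1 φ) (hk : HasCompactSupport φ) :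
    ∫ X, d X * φ X = ∫ X, fderiv ℝ φ X (w X) := by
  set N := {x ∈ frontier D | ¬ ∃ n, IsOuterUnitNormal D x n} with hN
  have hNc : IsClosed N := isClosed_irregular D
  -- away from the exceptional set
  have haway : ∀ φ : E → ℝ, ContDiff ℝ 1 φ → HasCompactSupport φ → tsupport φ ⊆ Nᶜ →
      defect w d φ = 0 := by
    intro φ hφ hk hs
    refine W.defect_eq_zero_of_cover (O := Nᶜ) (fun x hx => ?_) hφ hk hs
    by_cases hxD : x ∈ D
    · obtain ⟨r, hr, hrD⟩ := Metric.isOpen_iff.1 hD x hxD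
      exact ⟨r, hr, fun φ h1 h2 h3 => W.weak φ h1 h2 (h3.trans hrD)⟩
    · by_cases hxc : x ∈ closure D
      · have hfr : x ∈ frontier D := ⟨hxc, fun h => hxD (interior_subset h)⟩
        have : ∃ n, IsOuterUnitNormal D x n := by
          by_contra h; exact hx ⟨hfr, h⟩
        obtain ⟨n, hn⟩ := this
        exact W.defect_eq_zero_near_regular himp hn
      · obtain ⟨r, hr, hrD⟩ := Metric.isOpen_iff.1 isClosed_closure.isOpen_compl x hxc
        refine ⟨r, hr, fun φ h1 h2 h3 => ?_⟩
        unfold defect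
        refine integral_eq_zero_of_ae (Eventually.of_forall fun y => ?_)
        by_cases hy : y ∈ D
        · have hyt : y ∉ tsupport φ := fun h => hrD (h3 h) (subset_closure hy)
          simp [image_eq_zero_of_notMem_tsupport hyt, fderiv_of_notMem_tsupport (𝕜 := ℝ) hyt]
        · simp [W.zero_d y hy, W.zero_w y hy]
  have hzero : defect w d φ = 0 := by
    obtain ⟨rr, -, hrr⟩ := exists_radius hk
    obtain ⟨C, hC0, hC⟩ := W.bdd rr
    obtain ⟨M₁, hM₁0, hM₁⟩ := exists_bound hk hφ.continuous
    obtain ⟨C₁, hC₁0, hC₁⟩ := W.bound_mul hφ.continuous hk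
    obtain ⟨C₂, hC₂0, hC₂⟩ := W.bound_fderiv hφ hk
    set B := C₁ + C₂ + M₁ * C with hB
    have hB0 : 0 ≤ B := by positivity
    have hSc : IsCompact (tsupport φ ∩ N) := hk.isCompact.inter_right hNc
    have hS0 : Measure.hausdorffMeasure 2 (tsupport φ ∩ N) = 0 :=
      measure_mono_null inter_subset_right hbdry
    refine abs_eq_zero.1 (le_antisymm (le_of_forall_pos_le_add fun ε hε => ?_) (abs_nonneg _))
    obtain ⟨P, hPC, hPk, hP01, ⟨O, hO, hSO, hPO⟩, hPs⟩ :=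
      exists_cutoff_of_null hSc hS0 (show 0 < ε / (B + 1) by positivity)
    have hφP : ContDiff ℝ 1 fun y => φ y * P y := hφ.mul hPC
    have hkP : HasCompactSupport fun y => φ y * P y := hk.mul_right
    have hz := haway _ hφP hkP (by
      intro y hy hyN
      have hyφ : y ∈ tsupport φ := tsupport_mul_subset_left hy
      refine (notMem_tsupport_iff_eventuallyEq.2 ?_) hy
      filter_upwards [hO.mem_nhds (hSO ⟨hyφ, hyN⟩)] with z hz
      simp [hPO z hz])
    have hPkf : HasCompactSupport (fderiv ℝ P) := by
      have := hPk.fderiv (𝕜 := ℝ)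
      have h : (fderiv ℝ fun y => 1 - P y) = fun y => -fderiv ℝ P y := by
        ext1 y; exact fderiv_const_sub 1
      rw [h] at this
      exact (by ext1 y; simp : fderiv ℝ P = -fun y => -fderiv ℝ P y) ▸ this.neg
    have hPi : Integrable fun y => ‖fderiv ℝ P y‖ :=
      ((hPC.continuous_fderiv one_ne_zero).norm).integrable_of_hasCompactSupport hPkf.norm
    have h1Pi : Integrable fun y => 1 - P y :=
      (continuous_const.sub hPC.continuous).integrable_of_hasCompactSupport hPk
    have hdiff : defect w d φ = ∫ y, ((d y * φ y - fderiv ℝ φ y (w y))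
        - (d y * (φ y * P y) - fderiv ℝ (fun y => φ y * P y) y (w y))) := by
      rw [integral_sub (W.integrable_defect hφ hk) (W.integrable_defect hφP hkP)]
      show _ = defect w d φ - defect w d _
      rw [hz, sub_zero]
    rw [hdiff, zero_add, ← Real.norm_eq_abs]
    -- Replacing `φ` by `φ P` costs `(1 - P)(dφ - ∇φ·w) + φ ∇P·w`. Boundedness of `d` and `w` on the
    -- support reduces this to the two small integrals of the cut-off.
    have hpt : ∀ y, ‖(d y * φ y - fderiv ℝ φ y (w y))
        - (d y * (φ y * P y) - fderiv ℝ (fun y => φ y * P y) y (w y))‖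
        ≤ B * ((1 - P y) + ‖fderiv ℝ P y‖) := by
      intro y
      have hf : fderiv ℝ (fun y => φ y * P y) y = φ y • fderiv ℝ P y + P y • fderiv ℝ φ y :=
        ((hφ.differentiable one_ne_zero y).hasFDerivAt.mul
          (hPC.differentiable one_ne_zero y).hasFDerivAt).fderiv
      rw [hf]
      simp only [_root_.add_apply, _root_.smul_apply, smul_eq_mul]
      have e : d y * φ y - fderiv ℝ φ y (w y) - (d y * (φ y * P y)
          - (φ y * fderiv ℝ P y (w y) + P y * fderiv ℝ φ y (w y)))
          = (1 - P y) * (d y * φ y) - (1 - P y) * fderiv ℝ φ y (w y) + φ y * fderiv ℝ P y (w y) := by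
        ring
      rw [e, Real.norm_eq_abs]
      have hp : 0 ≤ 1 - P y := by linarith [(hP01 y).2]
      have b1 : |(1 - P y) * (d y * φ y)| ≤ (1 - P y) * C₁ := by
        rw [abs_mul, abs_of_nonneg hp]; exact mul_le_mul_of_nonneg_left (hC₁ y) hp
      have b2 : |(1 - P y) * fderiv ℝ φ y (w y)| ≤ (1 - P y) * C₂ := by
        rw [abs_mul, abs_of_nonneg hp]; exact mul_le_mul_of_nonneg_left (hC₂ y) hp
      have b3 : |φ y * fderiv ℝ P y (w y)| ≤ M₁ * C * ‖fderiv ℝ P y‖ := by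
        by_cases hy : y ∈ tsupport φ
        · rw [abs_mul]
          have h1 := hM₁ y
          have h2 := ((fderiv ℝ P y).le_opNorm (w y)).trans
            (mul_le_mul_of_nonneg_left (hC y (hrr y hy)).1 (norm_nonneg _))
          calc |φ y| * |fderiv ℝ P y (w y)| ≤ M₁ * (‖fderiv ℝ P y‖ * C) :=
                mul_le_mul h1 h2 (abs_nonneg _) hM₁0.le
            _ = _ := by ring
        · rw [image_eq_zero_of_notMem_tsupport hy, zero_mul, abs_zero]; positivity
      have b4 := abs_add_le ((1 - P y) * (d y * φ y) - (1 - P y) * fderiv ℝ φ y (w y))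
        (φ y * fderiv ℝ P y (w y))
      have b5 := abs_sub ((1 - P y) * (d y * φ y)) ((1 - P y) * fderiv ℝ φ y (w y))
      have b6 : 0 ≤ M₁ * C * (1 - P y) := by positivity
      have b7 : 0 ≤ (C₁ + C₂) * ‖fderiv ℝ P y‖ := by positivity
      rw [hB]; nlinarith
    refine (norm_integral_le_of_norm_le ((h1Pi.add hPi).const_mul B)
      (Eventually.of_forall hpt)).trans ?_
    have : ∫ y, B * ((1 - P y) + ‖fderiv ℝ P y‖) = B * ((∫ y, (1 - P y)) + ∫ y, ‖fderiv ℝ P y‖) := by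
      rw [integral_const_mul, integral_add h1Pi hPi]
    calc _ = B * ((∫ y, (1 - P y)) + ∫ y, ‖fderiv ℝ P y‖) := this
      _ ≤ B * (ε / (B + 1)) := by gcongr
      _ ≤ ε := by
        rw [mul_div_assoc', div_le_iff₀ (by positivity)]; nlinarith
  have h := hzero
  unfold defect at h
  rw [integral_sub (W.integrable_mul hφ.continuous hk) (W.integrable_fderiv hφ hk)] at h
  linarith

end WeakDiv

end

end EESM

namespace EESM

noncomputable section

/-! ### Pair integrals over the velocities of two colliding molecules -/

/-- A distribution function at a frozen time, positive in `D`, extended by zero. -/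
structure Kinetic (D : Set E) (f : E → E → ℝ) : Prop where
  meas : Measurable fun p : E × E => f p.1 p.2
  pos : ∀ X ∈ D, ∀ ξ, 0 < f X ξ
  zero_off : ∀ X ∉ D, ∀ ξ, f X ξ = 0
  decay : ∀ (r : ℝ) (k : ℕ), ∃ C : ℝ, 0 ≤ C ∧ ∀ X, ‖X‖ ≤ r → ∀ ξ, wt ξ ^ k * f X ξ ≤ C

/-- A collision kernel on `D`. -/
structure IsKernel (D : Set E) (γ : E → E → ℝ) : Prop where
  meas : Measurable fun p : E × E => γ p.1 p.2
  symm : ∀ X Y, γ X Y = γ Y X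
  nonneg : ∀ X Y, 0 ≤ γ X Y
  zero_off : ∀ X Y, X ∉ D → γ X Y = 0
  bdd : ∀ r : ℝ, ∃ C : ℝ, 0 ≤ C ∧ ∀ X Y, ‖X‖ ≤ r → ‖Y‖ ≤ r → γ X Y ≤ C

/-- Measurability and locally uniform polynomial growth of a function of a pair of velocities. -/
structure PairGrowth (Q : E → S2 → E × E → ℝ) : Prop where
  meas : Measurable fun q : (E × S2) × (E × E) => Q q.1.1 q.1.2 q.2
  growth : ∀ r : ℝ, ∃ (C : ℝ) (k : ℕ), 0 ≤ C ∧ ∀ Y α p, ‖Y‖ ≤ r →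
    |Q Y α p| ≤ C * (wt p.1 * wt p.2) ^ k

/-- Measurability and locally uniform polynomial growth of a function of a velocity. -/
structure VelGrowth (ψ : E → E → ℝ) : Prop where
  meas : Measurable fun p : E × E => ψ p.1 p.2
  growth : ∀ r : ℝ, ∃ (C : ℝ) (k : ℕ), 0 ≤ C ∧ ∀ X ξ, ‖X‖ ≤ r → |ψ X ξ| ≤ C * wt ξ ^ k

/-- Measurability and local boundedness of a function of position and direction. -/
structure LocBdd (a : E → S2 → ℝ) : Prop where
  meas : Measurable fun p : E × S2 => a p.1 p.2
  bdd : ∀ r : ℝ, ∃ C : ℝ, 0 ≤ C ∧ ∀ Y α, ‖Y‖ ≤ r → |a Y α| ≤ C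

lemma Measurable.comp_pair {β γ δ ε : Type*} [MeasurableSpace β] [MeasurableSpace γ]
    [MeasurableSpace δ] [MeasurableSpace ε] {f : β → γ → δ}
    (hf : Measurable fun p : β × γ => f p.1 p.2) {g : ε → β} {h : ε → γ} (hg : Measurable g)
    (hh : Measurable h) : Measurable fun x => f (g x) (h x) :=
  hf.comp (hg.prodMk hh)

lemma Kinetic.nonneg {D : Set E} {f : E → E → ℝ} (hf : Kinetic D f) (X ξ : E) : 0 ≤ f X ξ := by
  by_cases h : X ∈ D
  · exact (hf.pos X h ξ).le
  · exact (hf.zero_off X h ξ).ge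

/-- The integrand of a pair integral. -/
def pairFun (σ : ℝ) (γ f : E → E → ℝ) (Q : E → S2 → E × E → ℝ) (Y : E) (α : S2) (p : E × E) : ℝ :=
  γ Y (Y - σ • (α : E)) * Q Y α p * f Y p.1 * f (Y - σ • (α : E)) p.2 * posV α p.1 p.2

/-- Average of `Q` over the collisions at `Y` with a partner at `Y - σ α`. -/
def pairInt (σ : ℝ) (γ f : E → E → ℝ) (Q : E → S2 → E × E → ℝ) (Y : E) (α : S2) : ℝ :=
  ∫ p : E × E, pairFun σ γ f Q Y α p

section pair

variable {D : Set E} {σ : ℝ} {γ f : E → E → ℝ} {Q : E → S2 → E × E → ℝ}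

lemma norm_smul_sphere (s : ℝ) (α : S2) : ‖s • (α : E)‖ = |s| := by
  rw [norm_smul, norm_sphere, mul_one, Real.norm_eq_abs]

lemma norm_sub_le_of {Y : E} {r : ℝ} (h : ‖Y‖ ≤ r) (σ : ℝ) (α : S2) :
    ‖Y - σ • (α : E)‖ ≤ r + |σ| :=
  (norm_sub_le _ _).trans (by rw [norm_smul_sphere]; linarith)

lemma norm_add_le_of {Y : E} {r : ℝ} (h : ‖Y‖ ≤ r) (σ : ℝ) (α : S2) :
    ‖Y + σ • (α : E)‖ ≤ r + |σ| :=
  (norm_add_le _ _).trans (by rw [norm_smul_sphere]; linarith)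

lemma Kinetic.pair_bound (hf : Kinetic D f) (r : ℝ) (k : ℕ) :
    ∃ C, 0 ≤ C ∧ ∀ X Y, ‖X‖ ≤ r → ‖Y‖ ≤ r → ∀ p : E × E,
      wt p.1 ^ 4 * wt p.2 ^ 4 * ((wt p.1 * wt p.2) ^ k * (f X p.1 * f Y p.2)) ≤ C := by
  obtain ⟨C, hC0, hC⟩ := hf.decay r (k + 4)
  refine ⟨C * C, by positivity, fun X Y hX hY p => ?_⟩
  have h1 := hC X hX p.1
  have h2 := hC Y hY p.2
  have h3 : 0 ≤ wt p.2 ^ (k + 4) * f Y p.2 :=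
    mul_nonneg (pow_nonneg (wt_pos _).le _) (hf.nonneg _ _)
  calc _ = (wt p.1 ^ (k + 4) * f X p.1) * (wt p.2 ^ (k + 4) * f Y p.2) := by ring
    _ ≤ C * C := mul_le_mul h1 h2 h3 hC0

/-- The growth of `Q` and one power from the relative speed are absorbed by the rapid decay of both
distribution functions, with four powers to spare in each velocity. The bound is uniform in `Y` and
`α` because the partner stays within distance `|σ|`. -/
lemma PairGrowth.bound (hQ : PairGrowth Q) (hγ : IsKernel D γ) (hf : Kinetic D f) (σ r : ℝ) :
    ∃ C, 0 ≤ C ∧ ∀ Y α p, ‖Y‖ ≤ r →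
      wt p.1 ^ 4 * wt p.2 ^ 4 * |pairFun σ γ f Q Y α p| ≤ C := by
  obtain ⟨C₁, k, hC₁0, hC₁⟩ := hQ.growth r
  obtain ⟨C₂, hC₂0, hC₂⟩ := hγ.bdd (r + |σ|)
  obtain ⟨C₃, hC₃0, hC₃⟩ := hf.pair_bound (r + |σ|) (k + 1)
  refine ⟨C₂ * C₁ * C₃, by positivity, fun Y α p hY => ?_⟩
  have hY' : ‖Y‖ ≤ r + |σ| := by linarith [abs_nonneg σ]
  have h1 := hC₁ Y α p hY
  have h2 := hC₂ Y (Y - σ • (α : E)) hY' (norm_sub_le_of hY σ α)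
  have h3 := hC₃ Y (Y - σ • (α : E)) hY' (norm_sub_le_of hY σ α) p
  have h4 := posV_le α p.1 p.2
  have hw1 := wt_pos p.1
  have hw2 := wt_pos p.2
  have hf1 := hf.nonneg Y p.1
  have hf2 := hf.nonneg (Y - σ • (α : E)) p.2
  rw [pairFun, abs_mul, abs_mul, abs_mul, abs_mul, abs_of_nonneg (hγ.nonneg _ _),
    abs_of_nonneg hf1, abs_of_nonneg hf2, abs_of_nonneg (posV_nonneg _ _ _)]
  calc wt p.1 ^ 4 * wt p.2 ^ 4 * (γ Y (Y - σ • (α : E)) * |Q Y α p| * f Y p.1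
        * f (Y - σ • (α : E)) p.2 * posV α p.1 p.2)
      ≤ wt p.1 ^ 4 * wt p.2 ^ 4 * (C₂ * (C₁ * (wt p.1 * wt p.2) ^ k) * f Y p.1
        * f (Y - σ • (α : E)) p.2 * (wt p.1 * wt p.2)) := by
        have := posV_nonneg α p.1 p.2
        gcongr
    _ = C₂ * C₁ * (wt p.1 ^ 4 * wt p.2 ^ 4 * ((wt p.1 * wt p.2) ^ (k + 1) * (f Y p.1
        * f (Y - σ • (α : E)) p.2))) := by ring
    _ ≤ C₂ * C₁ * C₃ := by gcongr

lemma PairGrowth.measurable_pairFun (hQ : PairGrowth Q) (hγ : IsKernel D γ) (hf : Kinetic D f)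
    (σ : ℝ) : Measurable fun q : (E × S2) × (E × E) => pairFun σ γ f Q q.1.1 q.1.2 q.2 := by
  have hX : Measurable fun q : (E × S2) × (E × E) => q.1.1 := measurable_fst.fst
  have hα : Measurable fun q : (E × S2) × (E × E) => q.1.2 := measurable_fst.snd
  have h1 : Measurable fun q : (E × S2) × (E × E) => q.2.1 := measurable_snd.fst
  have h2 : Measurable fun q : (E × S2) × (E × E) => q.2.2 := measurable_snd.snd
  have hY : Measurable fun q : (E × S2) × (E × E) => q.1.1 - σ • (q.1.2 : E) :=
    hX.sub (measurable_subtype_coe.comp hα |>.const_smul σ)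
  have m1 := Measurable.comp_pair hγ.meas hX hY
  have m2 := Measurable.comp_pair hf.meas hX h1
  have m3 := Measurable.comp_pair hf.meas hY h2
  have m4 := continuous_posV.measurable.comp (hα.prodMk (h1.prodMk h2))
  exact (((m1.mul hQ.meas).mul m2).mul m3).mul m4

lemma PairGrowth.integrable (hQ : PairGrowth Q) (hγ : IsKernel D γ) (hf : Kinetic D f) (σ : ℝ)
    (Y : E) (α : S2) : Integrable (pairFun σ γ f Q Y α) (volume.prod volume) := by
  obtain ⟨C, -, hC⟩ := hQ.bound hγ hf σ ‖Y‖
  have hm : Measurable (pairFun σ γ f Q Y α) :=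
    (hQ.measurable_pairFun hγ hf σ).comp (measurable_prodMk_left (x := (Y, α)))
  exact integrable_of_wt_prod hm.aestronglyMeasurable (fun p => hC Y α p le_rfl)

lemma PairGrowth.locBdd (hQ : PairGrowth Q) (hγ : IsKernel D γ) (hf : Kinetic D f) (σ : ℝ) :
    LocBdd (pairInt σ γ f Q) := by
  constructor
  · exact ((hQ.measurable_pairFun hγ hf σ).stronglyMeasurable.integral_prod_right'
      (ν := (volume : Measure (E × E)))).measurable
  · intro r
    obtain ⟨C, hC0, hC⟩ := hQ.bound hγ hf σ r
    refine ⟨∫ p : E × E, C * ((wt p.1 ^ 4)⁻¹ * (wt p.2 ^ 4)⁻¹), ?_, fun Y α hY => ?_⟩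
    · refine integral_nonneg fun p => ?_
      have := wt_pos p.1
      have := wt_pos p.2
      positivity
    · rw [← Real.norm_eq_abs]
      exact norm_integral_le_of_norm_le (integrable_wt_prod.const_mul C)
        (Eventually.of_forall fun p => le_of_wt_prod (hC Y α p hY))

/-- Integrability of a pair integrand over further parameters. -/
lemma PairGrowth.integrable_param {B : Type*} [MeasurableSpace B] {ν : Measure B}
    [IsFiniteMeasure ν] (hQ : PairGrowth Q) (hγ : IsKernel D γ) (hf : Kinetic D f) (σ : ℝ)
    {y : B → E} {a : B → S2} (hy : Measurable y) (ha : Measurable a) {r : ℝ}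
    (hr : ∀ᵐ b ∂ν, ‖y b‖ ≤ r) :
    Integrable (fun q : B × (E × E) => pairFun σ γ f Q (y q.1) (a q.1) q.2)
      (ν.prod (volume.prod volume)) := by
  obtain ⟨C, hC0, hC⟩ := hQ.bound hγ hf σ r
  have hm : Measurable fun q : B × (E × E) => pairFun σ γ f Q (y q.1) (a q.1) q.2 :=
    (hQ.measurable_pairFun hγ hf σ).comp
      (((hy.comp measurable_fst).prodMk (ha.comp measurable_fst)).prodMk measurable_snd)
  have hb : Integrable (fun q : B × (E × E) => (1 : ℝ) * (C * ((wt q.2.1 ^ 4)⁻¹ * (wt q.2.2 ^ 4)⁻¹)))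
      (ν.prod (volume.prod volume)) :=
    Integrable.mul_prod (f := fun _ : B => (1 : ℝ)) (integrable_const 1)
      (integrable_wt_prod.const_mul C)
  refine hb.mono' hm.aestronglyMeasurable ?_
  filter_upwards [(Measure.quasiMeasurePreserving_fst
    (μ := ν) (ν := (volume.prod volume : Measure (E × E)))).ae hr] with q hq
  rw [one_mul]
  exact le_of_wt_prod (F := fun p => pairFun σ γ f Q (y q.1) (a q.1) p) (p := q.2)
    (hC _ _ _ hq)

lemma PairGrowth.add {Q' : E → S2 → E × E → ℝ} (hQ : PairGrowth Q) (hQ' : PairGrowth Q') :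
    PairGrowth fun Y α p => Q Y α p + Q' Y α p := by
  refine ⟨hQ.meas.add hQ'.meas, fun r => ?_⟩
  obtain ⟨C, k, hC0, hC⟩ := hQ.growth r
  obtain ⟨C', k', hC0', hC'⟩ := hQ'.growth r
  refine ⟨C + C', k + k', by positivity, fun Y α p hY => ?_⟩
  have h1 : 1 ≤ wt p.1 * wt p.2 := one_le_mul_of_one_le_of_one_le (one_le_wt _) (one_le_wt _)
  have h2 : (wt p.1 * wt p.2) ^ k ≤ (wt p.1 * wt p.2) ^ (k + k') := pow_le_pow_right₀ h1 (by omega)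
  have h3 : (wt p.1 * wt p.2) ^ k' ≤ (wt p.1 * wt p.2) ^ (k + k') := pow_le_pow_right₀ h1 (by omega)
  calc |Q Y α p + Q' Y α p| ≤ |Q Y α p| + |Q' Y α p| := abs_add_le _ _
    _ ≤ C * (wt p.1 * wt p.2) ^ k + C' * (wt p.1 * wt p.2) ^ k' := add_le_add (hC Y α p hY) (hC' Y α p hY)
    _ ≤ C * (wt p.1 * wt p.2) ^ (k + k') + C' * (wt p.1 * wt p.2) ^ (k + k') := by gcongr
    _ = _ := by ring

lemma PairGrowth.neg (hQ : PairGrowth Q) : PairGrowth fun Y α p => -Q Y α p :=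
  ⟨hQ.meas.neg, fun r => by simpa only [abs_neg] using hQ.growth r⟩

lemma VelGrowth.pre {ψ : E → E → ℝ} (hψ : VelGrowth ψ) : PairGrowth fun Y _ p => ψ Y p.1 := by
  refine ⟨Measurable.comp_pair hψ.meas (by fun_prop) (by fun_prop), fun r => ?_⟩
  obtain ⟨C, k, hC0, hC⟩ := hψ.growth r
  refine ⟨C, k, hC0, fun Y α p hY => (hC Y p.1 hY).trans ?_⟩
  have := wt_pos p.1
  gcongr
  exact le_mul_of_one_le_right this.le (one_le_wt _)

lemma VelGrowth.post {ψ : E → E → ℝ} (hψ : VelGrowth ψ) :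
    PairGrowth fun Y α p => ψ Y (post α p.1 p.2) := by
  refine ⟨Measurable.comp_pair hψ.meas (by fun_prop) ?_, fun r => ?_⟩
  · exact continuous_post.measurable.comp
      (by fun_prop : Measurable fun q : (E × S2) × (E × E) => (q.1.2, (q.2.1, q.2.2)))
  obtain ⟨C, k, hC0, hC⟩ := hψ.growth r
  refine ⟨C, k, hC0, fun Y α p hY => (hC Y _ hY).trans ?_⟩
  have := wt_pos (EESM.post α p.1 p.2)
  gcongr
  exact wt_post_le _ _ _

/-- The change of `ψ` in a collision. -/
def gainLoss (ψ : E → E → ℝ) (Y : E) (α : S2) (p : E × E) : ℝ := ψ Y (post α p.1 p.2) - ψ Y p.1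

lemma VelGrowth.gainLoss {ψ : E → E → ℝ} (hψ : VelGrowth ψ) : PairGrowth (gainLoss ψ) := by
  have h : (EESM.gainLoss ψ) = fun Y α p => ψ Y (EESM.post α p.1 p.2) + -ψ Y p.1 := by
    ext; rw [EESM.gainLoss, sub_eq_add_neg]
  rw [h]
  exact hψ.post.add hψ.pre.neg

/-- Reordering of the integrations in the collision integral. -/
lemma integral_reorder {F : S2 × (E × E) → ℝ}
    (hF : Integrable F (solidAngle.prod (volume.prod volume))) :
    Integrable (fun ξ => ∫ α, (∫ ξs, F (α, (ξ, ξs))) ∂solidAngle) ∧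
      ∫ ξ, (∫ α, (∫ ξs, F (α, (ξ, ξs))) ∂solidAngle) = ∫ q, F q ∂(solidAngle.prod (volume.prod volume)) := by
  have hmp := measurePreserving_prodAssoc solidAngle (volume : Measure E) (volume : Measure E)
  have hF' : Integrable (fun q : (S2 × E) × E => F (q.1.1, (q.1.2, q.2)))
      ((solidAngle.prod volume).prod volume) :=
    (hmp.integrable_comp_emb MeasurableEquiv.prodAssoc.measurableEmbedding).2 hF
  have h1 := hF'.integral_prod_left
  have hsw := h1.swap
  refine ⟨hsw.integral_prod_left, ?_⟩
  have e1 : ∫ q, F q ∂(solidAngle.prod (volume.prod volume))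
      = ∫ q : (S2 × E) × E, F (q.1.1, (q.1.2, q.2)) ∂((solidAngle.prod volume).prod volume) :=
    (hmp.integral_comp MeasurableEquiv.prodAssoc.measurableEmbedding F).symm
  rw [e1, integral_prod _ hF', integral_prod_symm _ h1]

end pair

end

end EESM

/-! ### Weak form of the collision term and entropy production of a pair -/

namespace EESM

noncomputable section

section pair

variable {D : Set E} {σ : ℝ} {γ f ψ : E → E → ℝ} {Q : E → S2 → E × E → ℝ}

/-- After a collision the molecules separate along `α`, that is, they approach along `-α`. Direct
and inverse collisions therefore occur with the same rate. -/
lemma posV_neg_post (α : S2) (ξ ξs : E) :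
    posV (-α) (post α ξ ξs) (postStar α ξ ξs) = posV α ξ ξs := by
  rw [posV_eq_max, posV_eq_max, relV_neg, relV_post, neg_neg]

lemma posV_neg_swap (α : S2) (ξ ξs : E) : posV (-α) ξs ξ = posV α ξ ξs := by
  rw [posV_eq_max, posV_eq_max, relV_neg_swap]

/-- The Heaviside functions cancel in this difference. What remains is linear in the velocities, so
the pair integral factorizes into densities and momenta. -/
lemma posV_neg_sub (α : S2) (ξ ξs : E) : posV (-α) ξ ξs - posV α ξ ξs = -relV α ξ ξs := by
  rw [posV_eq_max, posV_eq_max, relV_neg]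
  rcases le_total 0 (relV α ξ ξs) with h | h
  · rw [max_eq_right (by linarith), max_eq_left h]; ring
  · rw [max_eq_left (by linarith), max_eq_right h]; ring

/-- The weak form of the collision term. -/
lemma weak_collision (hψ : VelGrowth ψ) (hγ : IsKernel D γ) (hf : Kinetic D f) (σ : ℝ) (X : E) :
    Integrable (fun ξ => ψ X ξ *
        ((∫ α : S2, (∫ ξs : E, γ (X + σ • (α : E)) X
            * f (X + σ • (α : E)) (postStar α ξ ξs) * f X (post α ξ ξs)
            * relV α ξ ξs * theta (relV α ξ ξs)) ∂solidAngle)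
        - ∫ α : S2, (∫ ξs : E, γ (X - σ • (α : E)) X
            * f (X - σ • (α : E)) ξs * f X ξ * relV α ξ ξs * theta (relV α ξ ξs)) ∂solidAngle)) ∧
      ∫ ξ, ψ X ξ *
        ((∫ α : S2, (∫ ξs : E, γ (X + σ • (α : E)) X
            * f (X + σ • (α : E)) (postStar α ξ ξs) * f X (post α ξ ξs)
            * relV α ξ ξs * theta (relV α ξ ξs)) ∂solidAngle)
        - ∫ α : S2, (∫ ξs : E, γ (X - σ • (α : E)) X
            * f (X - σ • (α : E)) ξs * f X ξ * relV α ξ ξs * theta (relV α ξ ξs)) ∂solidAngle)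
        = ∫ α, pairInt σ γ f (gainLoss ψ) X α ∂solidAngle := by
  have hM := hψ.post.integrable_param (ν := solidAngle) hγ hf σ (y := fun _ => X) (a := id)
    measurable_const measurable_id (Eventually.of_forall fun _ => le_rfl)
  have hL := hψ.pre.integrable_param (ν := solidAngle) hγ hf σ (y := fun _ => X) (a := id)
    measurable_const measurable_id (Eventually.of_forall fun _ => le_rfl)
  -- The change of variables `(α, ξ, ξ_*) ↦ (-α, ξ', ξ_*')` turns the gain integral into a loss-type
  -- integral in which `ψ` is evaluated after the collision.
  have hG := (measurePreserving_collision.integrable_comp_emb measurableEmbedding_collision).2 hM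
  have hGI := measurePreserving_collision.integral_comp measurableEmbedding_collision
    (fun q : S2 × (E × E) => pairFun σ γ f (fun Y α p => ψ Y (post α p.1 p.2)) X (id q.1) q.2)
  obtain ⟨iG, eG⟩ := integral_reorder hG
  obtain ⟨iL, eL⟩ := integral_reorder hL
  have pG : ∀ (ξ : E) (α : S2) (ξs : E),
      pairFun σ γ f (fun Y α p => ψ Y (post α p.1 p.2)) X (-α) (post α ξ ξs, postStar α ξ ξs)
        = ψ X ξ * (γ (X + σ • (α : E)) X * f (X + σ • (α : E)) (postStar α ξ ξs)
          * f X (post α ξ ξs) * relV α ξ ξs * theta (relV α ξ ξs)) := by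
    intro ξ α ξs
    have e1 : X - σ • ((-α : S2) : E) = X + σ • (α : E) := by simp
    simp only [pairFun, e1, post_neg, post_post, posV_neg_post]
    rw [hγ.symm X, posV]; ring
  have pL : ∀ (ξ : E) (α : S2) (ξs : E), pairFun σ γ f (fun Y _ p => ψ Y p.1) X α (ξ, ξs)
        = ψ X ξ * (γ (X - σ • (α : E)) X * f (X - σ • (α : E)) ξs
          * f X ξ * relV α ξ ξs * theta (relV α ξ ξs)) := by
    intro ξ α ξs
    simp only [pairFun]
    rw [hγ.symm X, posV]; ring
  simp only [Function.comp_def, pG, id, integral_const_mul] at iG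
  simp only [pL, id, integral_const_mul] at iL
  replace eG := eG.trans hGI
  conv_lhs at eG => simp only [Function.comp_def, pG, id, integral_const_mul]
  conv_lhs at eL => simp only [pL, id, integral_const_mul]
  simp only [mul_sub]
  refine ⟨iG.sub iL, ?_⟩
  rw [integral_sub iG iL, eL, eG]
  rw [← integral_sub hM hL, integral_prod (fun q : S2 × (E × E) =>
    pairFun σ γ f (fun Y α p => ψ Y (post α p.1 p.2)) X (id q.1) q.2
      - pairFun σ γ f (fun Y _ p => ψ Y p.1) X (id q.1) q.2) (hM.sub hL)]
  congr 1 with α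
  refine integral_congr_ae (Eventually.of_forall fun p => ?_)
  simp only [pairFun, gainLoss, id]
  ring

/-- The momentum density `⟨ξ f⟩`. -/
def momentum (f : E → E → ℝ) (X : E) : E := ∫ ξ, f X ξ • ξ

lemma Kinetic.measurable_right (hf : Kinetic D f) (X : E) : Measurable (f X) :=
  hf.meas.comp measurable_prodMk_left

lemma Kinetic.integrable_mul (hf : Kinetic D f) (X : E) {h : E → ℝ} (hh : Measurable h) {C : ℝ}
    {k : ℕ} (hb : ∀ ξ, |h ξ| ≤ C * wt ξ ^ k) : Integrable fun ξ => h ξ * f X ξ := by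
  obtain ⟨C', hC'0, hC'⟩ := hf.decay ‖X‖ (k + 4)
  have hC0 : 0 ≤ C := by
    have := (abs_nonneg _).trans (hb 0)
    simpa [wt] using this
  refine integrable_of_wt (C := C * C') (hh.mul (hf.measurable_right X)).aestronglyMeasurable
    fun ξ => ?_
  rw [abs_mul, abs_of_nonneg (hf.nonneg X ξ)]
  calc wt ξ ^ 4 * (|h ξ| * f X ξ) ≤ wt ξ ^ 4 * (C * wt ξ ^ k * f X ξ) := by
        have := hf.nonneg X ξ
        have := wt_pos ξ
        gcongr
        exact hb ξ
    _ = C * (wt ξ ^ (k + 4) * f X ξ) := by ring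
    _ ≤ C * C' := by gcongr; exact hC' X le_rfl ξ

lemma Kinetic.integrable (hf : Kinetic D f) (X : E) : Integrable (f X) := by
  simpa using hf.integrable_mul X (h := fun _ => 1) measurable_const (C := 1) (k := 0) (by simp)

lemma Kinetic.integrable_smul (hf : Kinetic D f) (X : E) : Integrable fun ξ => f X ξ • ξ := by
  have h := hf.integrable_mul X (h := fun ξ => ‖ξ‖) measurable_norm (C := 1) (k := 1)
    (fun ξ => by rw [abs_norm, one_mul, pow_one]; exact norm_le_wt ξ)
  refine h.mono' ((hf.measurable_right X).smul measurable_id).aestronglyMeasurable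
    (Eventually.of_forall fun ξ => ?_)
  rw [norm_smul, Real.norm_eq_abs, abs_of_nonneg (hf.nonneg X ξ), mul_comm]

lemma Kinetic.integral_inner (hf : Kinetic D f) (X a : E) :
    ∫ ξ, f X ξ * inner ℝ ξ a = inner ℝ (momentum f X) a := by
  rw [real_inner_comm, momentum, ← _root_.integral_inner (hf.integrable_smul X)]
  congr 1 with ξ
  rw [inner_smul_right, real_inner_comm]

/-- The free-energy weight `c (1 + ln f) + |ξ|²/2`. -/
def feWeight (c : ℝ) (f : E → E → ℝ) (X ξ : E) : ℝ := c * (1 + Real.log (f X ξ)) + ‖ξ‖ ^ 2 / 2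

/-- This is `ln x ≤ x - 1` for `x = a'b'/(ab)`. The surplus `a'b' - ab` is kept: for partners at
different points it does not integrate to zero. -/
lemma mul_log_sub_le {a b a' b' : ℝ} (ha : 0 < a) (hb : 0 < b) (ha' : 0 < a') (hb' : 0 < b') :
    (Real.log a' + Real.log b' - Real.log a - Real.log b) * (a * b) ≤ a' * b' - a * b := by
  have h1 : Real.log a' + Real.log b' - Real.log a - Real.log b = Real.log (a' * b' / (a * b)) := by
    rw [Real.log_div (by positivity) (by positivity), Real.log_mul ha'.ne' hb'.ne',
      Real.log_mul ha.ne' hb.ne']; ring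
  rw [h1]
  have h2 := Real.log_le_sub_one_of_pos (show 0 < a' * b' / (a * b) by positivity)
  calc _ ≤ (a' * b' / (a * b) - 1) * (a * b) := by gcongr
    _ = _ := by field_simp

lemma Kinetic.integrable_pair_posV (hf : Kinetic D f) (X Y : E) (α : S2) :
    Integrable (fun p : E × E => f X p.1 * f Y p.2 * posV α p.1 p.2) (volume.prod volume) := by
  obtain ⟨C, -, hC⟩ := hf.pair_bound (max ‖X‖ ‖Y‖) 1
  have hm : Measurable fun p : E × E => posV α p.1 p.2 :=
    by
    have h : Measurable fun p : E × E => ((α, p) : S2 × E × E) := measurable_prodMk_left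
    have h' := continuous_posV.measurable.comp h
    exact h'
  have h1 : Measurable fun p : E × E => f X p.1 := (hf.measurable_right X).comp measurable_fst
  have h2 : Measurable fun p : E × E => f Y p.2 := (hf.measurable_right Y).comp measurable_snd
  refine integrable_of_wt_prod (C := C) ((h1.mul h2).mul hm).aestronglyMeasurable fun p => ?_
  refine le_trans ?_ (hC X Y (le_max_left _ _) (le_max_right _ _) p)
  have := hf.nonneg X p.1
  have := hf.nonneg Y p.2
  have h := posV_nonneg α p.1 p.2
  have := wt_pos p.1
  have := wt_pos p.2
  rw [abs_of_nonneg (by positivity), pow_one, mul_comm (wt p.1 * wt p.2)]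
  gcongr
  exact posV_le _ _ _

/-- Local entropy production of a pair of collision sites. -/
lemma pairInt_add_exchange_le (hγ : IsKernel D γ) (hf : Kinetic D f) {c : ℝ} (hc : 0 ≤ c)
    (hψ : VelGrowth (feWeight c f)) (σ : ℝ) (Y : E) (α : S2) :
    pairInt σ γ f (gainLoss (feWeight c f)) Y α
        + pairInt σ γ f (gainLoss (feWeight c f)) (Y - σ • (α : E)) (-α)
      ≤ c * (γ Y (Y - σ • (α : E)) * inner ℝ (density f (Y - σ • (α : E)) • momentum f Y
          - density f Y • momentum f (Y - σ • (α : E))) (α : E)) := by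
  set Z := Y - σ • (α : E) with hZ
  by_cases hD : Y ∈ D ∧ Z ∈ D
  -- If one site lies outside `D`, the kernel vanishes and both sides are zero; the logarithmic
  -- inequality is needed only when both sites lie in `D`.
  swap
  · have h0 : γ Y Z = 0 := by
      by_cases hY : Y ∈ D
      · rw [hγ.symm]; exact hγ.zero_off _ _ fun h => hD ⟨hY, h⟩
      · exact hγ.zero_off _ _ hY
    have h1 : pairInt σ γ f (gainLoss (feWeight c f)) Y α = 0 := by
      simp [pairInt, pairFun, ← hZ, h0]
    have h2 : pairInt σ γ f (gainLoss (feWeight c f)) Z (-α) = 0 := by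
      have e1 : Z - σ • ((-α : S2) : E) = Y := by simp [hZ]
      have h3 : ∀ p, pairFun σ γ f (gainLoss (feWeight c f)) Z (-α) p = 0 := fun p => by
        rw [pairFun, e1, hγ.symm Z Y, h0]; ring
      simp only [pairInt, h3, integral_zero]
    rw [h1, h2, h0]; simp
  obtain ⟨hY, hZD⟩ := hD
  have hi1 := hψ.gainLoss.integrable hγ hf σ Y α
  have hi2 := (hψ.gainLoss.integrable hγ hf σ Z (-α)).swap
  have hA := hf.integrable_pair_posV Y Z α
  have hB := hf.integrable_pair_posV Y Z (-α)
  have hC := ((measurePreserving_collisionLin α).integrable_comp_emb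
    (measurableEmbedding_collisionLin α)).2 hB
  have hCI := (measurePreserving_collisionLin α).integral_comp (measurableEmbedding_collisionLin α)
    (fun p : E × E => f Y p.1 * f Z p.2 * posV (-α) p.1 p.2)
  have e1 : Z - σ • ((-α : S2) : E) = Y := by simp [hZ]
  -- The event `(Z, -α)` with swapped velocities is the same collision seen by the partner, at the
  -- same rate. The energy gains cancel and only the four logarithms remain.
  have hle : ∀ p : E × E, pairFun σ γ f (gainLoss (feWeight c f)) Y α p
      + pairFun σ γ f (gainLoss (feWeight c f)) Z (-α) p.swap
      ≤ c * γ Y Z * (f Y (post α p.1 p.2) * f Z (postStar α p.1 p.2)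
          * posV (-α) (post α p.1 p.2) (postStar α p.1 p.2) - f Y p.1 * f Z p.2 * posV α p.1 p.2) := by
    intro p
    have h := mul_log_sub_le (hf.pos Y hY p.1) (hf.pos Z hZD p.2) (hf.pos Y hY (post α p.1 p.2))
      (hf.pos Z hZD (postStar α p.1 p.2))
    have n1 := norm_sq_post α p.1 p.2
    have n2 := norm_sq_postStar α p.1 p.2
    have s1 : post (-α) p.2 p.1 = postStar α p.1 p.2 := by rw [post_neg, post_swap]
    have s2 := posV_neg_swap α p.1 p.2
    have s3 := posV_neg_post α p.1 p.2
    simp only [pairFun, ← hZ, e1, Prod.fst_swap, Prod.snd_swap, gainLoss, feWeight, s1, s2, s3]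
    rw [hγ.symm Z Y, n1, n2]
    have hg : 0 ≤ c * γ Y Z * posV α p.1 p.2 :=
      mul_nonneg (mul_nonneg hc (hγ.nonneg _ _)) (posV_nonneg _ _ _)
    have := mul_le_mul_of_nonneg_left h hg
    linarith
  have hCI' : ∫ p : E × E, f Y (post α p.1 p.2) * f Z (postStar α p.1 p.2)
      * posV (-α) (post α p.1 p.2) (postStar α p.1 p.2) ∂(volume.prod volume)
      = ∫ p : E × E, f Y p.1 * f Z p.2 * posV (-α) p.1 p.2 ∂(volume.prod volume) := hCI
  have hsw : pairInt σ γ f (gainLoss (feWeight c f)) Z (-α)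
      = ∫ p : E × E, pairFun σ γ f (gainLoss (feWeight c f)) Z (-α) p.swap ∂(volume.prod volume) :=
    (integral_prod_swap (fun p => pairFun σ γ f (gainLoss (feWeight c f)) Z (-α) p)).symm
  -- After the change of variables the bound is the integral of `f(Y,ξ) f(Z,ξ_*) V_α` up to sign; as
  -- `V_α` is a difference of two one-velocity terms, it is a combination of products of moments.
  have hfac : ∫ p : E × E, f Y p.1 * f Z p.2 * relV α p.1 p.2 ∂(volume.prod volume)
      = inner ℝ (density f Y • momentum f Z - density f Z • momentum f Y) (α : E) := by
    have j : ∀ X, Integrable fun ξ => f X ξ * inner ℝ ξ (α : E) := by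
      intro X
      have := hf.integrable_mul X (h := fun ξ => inner ℝ ξ (α : E)) (by fun_prop) (C := 1) (k := 1)
        (fun ξ => by
          rw [one_mul, pow_one]
          refine (abs_real_inner_le_norm _ _).trans ?_
          rw [norm_sphere, mul_one]; exact norm_le_wt ξ)
      simpa only [mul_comm] using this
    have h1 := (hf.integrable Y).mul_prod (j Z)
    have h2 := (j Y).mul_prod (hf.integrable Z)
    have h3 : ∀ p : E × E, f Y p.1 * f Z p.2 * relV α p.1 p.2
        = f Y p.1 * (f Z p.2 * inner ℝ p.2 (α : E)) - f Y p.1 * inner ℝ p.1 (α : E) * f Z p.2 := by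
      intro p; rw [relV, inner_sub_left]; ring
    simp_rw [h3]
    rw [integral_sub h1 h2, integral_prod_mul (f Y) (fun ξ => f Z ξ * inner ℝ ξ (α : E)),
      integral_prod_mul (fun ξ => f Y ξ * inner ℝ ξ (α : E)) (f Z), hf.integral_inner,
      hf.integral_inner, inner_sub_left, inner_smul_left, inner_smul_left]
    simp [density]; ring
  rw [hsw]
  calc pairInt σ γ f (gainLoss (feWeight c f)) Y α
        + ∫ p : E × E, pairFun σ γ f (gainLoss (feWeight c f)) Z (-α) p.swap ∂(volume.prod volume)
      = ∫ p : E × E, (pairFun σ γ f (gainLoss (feWeight c f)) Y α p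
        + pairFun σ γ f (gainLoss (feWeight c f)) Z (-α) p.swap) ∂(volume.prod volume) :=
        (integral_add hi1 hi2).symm
    _ ≤ ∫ p : E × E, c * γ Y Z * (f Y (post α p.1 p.2) * f Z (postStar α p.1 p.2)
          * posV (-α) (post α p.1 p.2) (postStar α p.1 p.2)
          - f Y p.1 * f Z p.2 * posV α p.1 p.2) ∂(volume.prod volume) :=
        integral_mono (hi1.add hi2) ((hC.sub hA).const_mul _) hle
    _ = c * γ Y Z * ∫ p : E × E, -(f Y p.1 * f Z p.2 * relV α p.1 p.2) ∂(volume.prod volume) := by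
        rw [integral_const_mul]
        congr 1
        have h5 := integral_sub hC hA
        simp only [Function.comp_def] at h5
        rw [h5, hCI', ← integral_sub hB hA]
        congr 1 with p
        rw [← mul_sub, posV_neg_sub]; ring
    _ = _ := by
        rw [integral_neg, hfac, ← inner_neg_left, neg_sub]; ring

end pair

end

end EESM

namespace EESM

noncomputable section

/-! ### Fluxes obtained by averaging along the line of centres -/

/-- The measure `dΩ(α) dτ`, `0 < τ ≤ 1`. -/
def lineMeasure : Measure (S2 × ℝ) := solidAngle.prod (volume.restrict (Ioc 0 1))

instance : IsFiniteMeasure lineMeasure := by unfold lineMeasure; infer_instance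

lemma ae_lineMeasure : ∀ᵐ b ∂lineMeasure, b.2 ∈ Ioc (0 : ℝ) 1 :=
  (Measure.quasiMeasurePreserving_snd (μ := solidAngle)
    (ν := volume.restrict (Ioc (0 : ℝ) 1))).ae (ae_restrict_mem measurableSet_Ioc)

/-- The `i`-th component of the flux generated by `a`. -/
def shiftFlux (σ : ℝ) (a : E → S2 → ℝ) (i : Fin 3) (X : E) : ℝ :=
  ∫ α : S2, (∫ τ in (0 : ℝ)..1, (α : E) i * a (X + (τ * σ) • (α : E)) α) ∂solidAngle

lemma integrable_prod_of_bdd {B : Type*} [MeasurableSpace B] {ν : Measure B} [IsFiniteMeasure ν]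
    {F : E × B → ℝ} (hm : Measurable F) {C r : ℝ} (hC : ∀ᵐ b ∂ν, ∀ X, |F (X, b)| ≤ C)
    (hr : ∀ᵐ b ∂ν, ∀ X, r < ‖X‖ → F (X, b) = 0) : Integrable F (volume.prod ν) := by
  have hb : Integrable (fun q : E × B =>
      (Metric.closedBall (0 : E) r).indicator (fun _ => C) q.1 * (1 : ℝ)) (volume.prod ν) := by
    refine Integrable.mul_prod (f := fun X => (Metric.closedBall (0 : E) r).indicator (fun _ => C) X)
      (g := fun _ : B => (1 : ℝ)) ?_ (integrable_const 1)
    exact (integrable_indicator_iff Metric.isClosed_closedBall.measurableSet).2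
      (integrableOn_const (measure_closedBall_lt_top (x := (0 : E))).ne)
  refine hb.mono' hm.aestronglyMeasurable ?_
  filter_upwards [(Measure.quasiMeasurePreserving_snd (μ := (volume : Measure E)) (ν := ν)).ae hC,
    (Measure.quasiMeasurePreserving_snd (μ := (volume : Measure E)) (ν := ν)).ae hr] with q h1 h2
  rw [mul_one]
  by_cases hq : q.1 ∈ Metric.closedBall (0 : E) r
  · rw [indicator_of_mem hq]; exact h1 q.1
  · rw [indicator_of_notMem hq]
    have : F q = 0 := h2 q.1 (by simpa using hq)
    rw [this, norm_zero]

lemma norm_line_le {X : E} {r : ℝ} (h : ‖X‖ ≤ r) (σ : ℝ) {b : S2 × ℝ} (hb : b.2 ∈ Ioc (0 : ℝ) 1) :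
    ‖X + (b.2 * σ) • (b.1 : E)‖ ≤ r + |σ| := by
  refine (norm_add_le_of h _ _).trans ?_
  rw [abs_mul, abs_of_pos hb.1]
  have := mul_le_of_le_one_left (abs_nonneg σ) hb.2
  linarith

lemma abs_coord_sphere_le (α : S2) (i : Fin 3) : |(α : E) i| ≤ 1 := by
  have := abs_coord_le (α : E) i
  rwa [norm_sphere] at this

lemma measurable_coord_sphere (i : Fin 3) : Measurable fun α : S2 => (α : E) i := by
  fun_prop

lemma LocBdd.measurable_line {a : E → S2 → ℝ} (ha : LocBdd a) (σ : ℝ) :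
    Measurable fun q : E × (S2 × ℝ) => a (q.1 + (q.2.2 * σ) • (q.2.1 : E)) q.2.1 := by
  have h1 : Measurable fun q : E × (S2 × ℝ) => q.1 + (q.2.2 * σ) • (q.2.1 : E) := by fun_prop
  exact Measurable.comp_pair ha.meas h1 (by fun_prop)

lemma LocBdd.integrable_line {a : E → S2 → ℝ} (ha : LocBdd a) (σ : ℝ) (i : Fin 3) (X : E) :
    Integrable (fun b : S2 × ℝ => (b.1 : E) i * a (X + (b.2 * σ) • (b.1 : E)) b.1) lineMeasure := by
  obtain ⟨C, hC0, hC⟩ := ha.bdd (‖X‖ + |σ|)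
  have hm : Measurable fun b : S2 × ℝ => (b.1 : E) i * a (X + (b.2 * σ) • (b.1 : E)) b.1 :=
    ((measurable_coord_sphere i).comp measurable_fst).mul
      ((ha.measurable_line σ).comp measurable_prodMk_left)
  refine (integrable_const C).mono' hm.aestronglyMeasurable ?_
  filter_upwards [ae_lineMeasure] with b hb
  rw [norm_mul]
  calc _ ≤ 1 * C := mul_le_mul (abs_coord_sphere_le _ _) (hC _ _ (norm_line_le le_rfl σ hb))
        (abs_nonneg _) zero_le_one
    _ = C := one_mul C

lemma shiftFlux_eq {a : E → S2 → ℝ} (ha : LocBdd a) (σ : ℝ) (i : Fin 3) (X : E) :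
    shiftFlux σ a i X = ∫ b, (b.1 : E) i * a (X + (b.2 * σ) • (b.1 : E)) b.1 ∂lineMeasure := by
  rw [lineMeasure, integral_prod _ (ha.integrable_line σ i X), shiftFlux]
  simp_rw [intervalIntegral.integral_of_le zero_le_one]

lemma shiftFlux_add {a a' : E → S2 → ℝ} (ha : LocBdd a) (ha' : LocBdd a') (σ : ℝ) (i : Fin 3)
    (X : E) : shiftFlux σ (fun Y α => a Y α + a' Y α) i X = shiftFlux σ a i X + shiftFlux σ a' i X := by
  have hs : LocBdd fun Y α => a Y α + a' Y α := by
    refine ⟨ha.meas.add ha'.meas, fun r => ?_⟩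
    obtain ⟨C, hC0, hC⟩ := ha.bdd r
    obtain ⟨C', hC'0, hC'⟩ := ha'.bdd r
    exact ⟨C + C', by positivity, fun Y α hY =>
      (abs_add_le _ _).trans (add_le_add (hC Y α hY) (hC' Y α hY))⟩
  rw [shiftFlux_eq hs, shiftFlux_eq ha, shiftFlux_eq ha',
    ← integral_add (ha.integrable_line σ i X) (ha'.integrable_line σ i X)]
  simp_rw [mul_add]

lemma shiftFlux_const_mul (c σ : ℝ) (a : E → S2 → ℝ) (i : Fin 3) (X : E) :
    shiftFlux σ (fun Y α => c * a Y α) i X = c * shiftFlux σ a i X := by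
  unfold shiftFlux
  simp_rw [mul_left_comm _ c, intervalIntegral.integral_const_mul, integral_const_mul]

lemma LocBdd.measurable_shiftFlux {a : E → S2 → ℝ} (ha : LocBdd a) (σ : ℝ) (i : Fin 3) :
    Measurable (shiftFlux σ a i) := by
  have : shiftFlux σ a i = fun X =>
      ∫ b, (b.1 : E) i * a (X + (b.2 * σ) • (b.1 : E)) b.1 ∂lineMeasure := by
    ext X; exact shiftFlux_eq ha σ i X
  rw [this]
  have hm : Measurable fun q : E × (S2 × ℝ) =>
      (q.2.1 : E) i * a (q.1 + (q.2.2 * σ) • (q.2.1 : E)) q.2.1 :=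
    ((measurable_coord_sphere i).comp (measurable_fst.comp measurable_snd)).mul
      (ha.measurable_line σ)
  exact (hm.stronglyMeasurable.integral_prod_right' (ν := lineMeasure)).measurable

lemma LocBdd.shiftFlux_bdd {a : E → S2 → ℝ} (ha : LocBdd a) (σ : ℝ) (i : Fin 3) (r : ℝ) :
    ∃ C : ℝ, 0 ≤ C ∧ ∀ X, ‖X‖ ≤ r → |shiftFlux σ a i X| ≤ C := by
  obtain ⟨C, hC0, hC⟩ := ha.bdd (r + |σ|)
  refine ⟨∫ _ : S2 × ℝ, C ∂lineMeasure, integral_nonneg fun _ => hC0, fun X hX => ?_⟩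
  rw [shiftFlux_eq ha, ← Real.norm_eq_abs]
  refine norm_integral_le_of_norm_le (integrable_const C) ?_
  filter_upwards [ae_lineMeasure] with b hb
  rw [norm_mul]
  calc _ ≤ 1 * C := mul_le_mul (abs_coord_sphere_le _ _) (hC _ _ (norm_line_le hX σ hb))
        (abs_nonneg _) zero_le_one
    _ = C := one_mul C

lemma clm_apply_eq_sum (L : E →L[ℝ] ℝ) (v : E) :
    L v = ∑ i, v i * L (EuclideanSpace.single i 1) := by
  conv_lhs => rw [← (EuclideanSpace.basisFun (Fin 3) ℝ).sum_repr v]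
  simp [map_sum]

lemma LocBdd.integrable_mul {a : E → S2 → ℝ} (ha : LocBdd a) {φ : E → ℝ} (hc : Continuous φ)
    (hk : HasCompactSupport φ) (s : ℝ) :
    Integrable (fun q : S2 × E => a q.2 q.1 * φ (q.2 - s • (q.1 : E))) (solidAngle.prod volume) := by
  obtain ⟨r, -, hr⟩ := exists_radius hk
  obtain ⟨M, hM0, hM⟩ := exists_bound hk hc
  obtain ⟨C, hC0, hC⟩ := ha.bdd (r + |s|)
  have hm : Measurable fun q : E × S2 => a q.1 q.2 * φ (q.1 - s • (q.2 : E)) :=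
    ha.meas.mul (hc.measurable.comp (by fun_prop))
  have hz : ∀ (X : E) (α : S2), r + |s| < ‖X‖ → φ (X - s • (α : E)) = 0 := by
    intro X α h
    refine image_eq_zero_of_notMem_tsupport fun h' => ?_
    have h1 := norm_add_le_of (hr _ h') s α
    rw [sub_add_cancel] at h1
    linarith
  have hI : Integrable (fun q : E × S2 => a q.1 q.2 * φ (q.1 - s • (q.2 : E)))
      (volume.prod solidAngle) := by
    refine integrable_prod_of_bdd hm (C := C * M) (r := r + |s|) (Eventually.of_forall fun α X => ?_)
      (Eventually.of_forall fun α X h => by simp only [hz X α h, mul_zero])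
    by_cases h : ‖X‖ ≤ r + |s|
    · rw [abs_mul]; exact mul_le_mul (hC X α h) (hM _) (abs_nonneg _) hC0
    · simp only [hz X α (not_le.1 h), mul_zero, abs_zero]; positivity
  exact hI.swap

/-- The flux generated by `a`, tested against a gradient. -/
lemma shiftFlux_weak {a : E → S2 → ℝ} (ha : LocBdd a) (σ : ℝ) {φ : E → ℝ} (hφ : ContDiff ℝ 1 φ)
    (hk : HasCompactSupport φ) :
    σ * ∫ X, ∑ i, shiftFlux σ a i X * pderiv i φ X
      = ∫ q : S2 × E, a q.2 q.1 * (φ q.2 - φ (q.2 - σ • (q.1 : E))) ∂(solidAngle.prod volume) := by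
  obtain ⟨r, -, hr⟩ := exists_radius hk
  have hfc : Continuous (fderiv ℝ φ) := hφ.continuous_fderiv one_ne_zero
  obtain ⟨M, hM0, hM⟩ := exists_bound (hk.fderiv (𝕜 := ℝ)) hfc
  obtain ⟨C, hC0, hC⟩ := ha.bdd (r + |σ|)
  have hMα : ∀ X (α : S2), |fderiv ℝ φ X (α : E)| ≤ M := fun X α => by
    have := (fderiv ℝ φ X).le_opNorm (α : E)
    rw [norm_sphere, mul_one] at this
    exact this.trans (hM X)
  have hz : ∀ X, r < ‖X‖ → fderiv ℝ φ X = 0 := fun X h =>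
    fderiv_of_notMem_tsupport (𝕜 := ℝ) fun h' => not_lt.2 (hr X h') h
  have hcl : Continuous fun p : E × E => fderiv ℝ φ p.1 p.2 := by fun_prop
  -- the sum over components
  have e1 : ∀ X, ∑ i, shiftFlux σ a i X * pderiv i φ X
      = ∫ b, a (X + (b.2 * σ) • (b.1 : E)) b.1 * fderiv ℝ φ X (b.1 : E) ∂lineMeasure := by
    intro X
    simp_rw [shiftFlux_eq ha, ← integral_mul_const]
    rw [← integral_finsetSum _ fun i _ => (ha.integrable_line σ i X).mul_const _]
    congr 1 with b
    rw [clm_apply_eq_sum (fderiv ℝ φ X) (b.1 : E), Finset.mul_sum]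
    refine Finset.sum_congr rfl fun i _ => ?_
    rw [pderiv]; ring
  have hF : Integrable (fun q : E × (S2 × ℝ) =>
      a (q.1 + (q.2.2 * σ) • (q.2.1 : E)) q.2.1 * fderiv ℝ φ q.1 (q.2.1 : E))
      (volume.prod lineMeasure) := by
    refine integrable_prod_of_bdd (C := C * M) (r := r) ((ha.measurable_line σ).mul
      (hcl.measurable.comp (g := fun p : E × E => fderiv ℝ φ p.1 p.2)
        (by fun_prop : Measurable fun q : E × (S2 × ℝ) => (q.1, (q.2.1 : E))))) ?_ ?_
    · filter_upwards [ae_lineMeasure] with b hb X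
      by_cases h : ‖X‖ ≤ r
      · rw [abs_mul]
        exact mul_le_mul (hC _ _ (norm_line_le h σ hb)) (hMα _ _) (abs_nonneg _) hC0
      · simp only [hz X (not_le.1 h), _root_.zero_apply, mul_zero, abs_zero]; positivity
    · filter_upwards with b X h
      simp only [hz X h, _root_.zero_apply, mul_zero]
  have hF' : Integrable (fun q : E × (S2 × ℝ) =>
      a q.1 q.2.1 * fderiv ℝ φ (q.1 - (q.2.2 * σ) • (q.2.1 : E)) (q.2.1 : E))
      (volume.prod lineMeasure) := by
    have hz' : ∀ (b : S2 × ℝ), b.2 ∈ Ioc (0 : ℝ) 1 → ∀ X, r + |σ| < ‖X‖ →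
        fderiv ℝ φ (X - (b.2 * σ) • (b.1 : E)) = 0 := by
      intro b hb X h
      refine hz _ (not_le.1 fun h' => ?_)
      have := norm_line_le h' σ hb
      rw [sub_add_cancel] at this
      linarith
    refine integrable_prod_of_bdd (C := C * M) (r := r + |σ|) ((Measurable.comp_pair ha.meas
      (by fun_prop) (by fun_prop)).mul (hcl.measurable.comp
        (g := fun p : E × E => fderiv ℝ φ p.1 p.2)
        (by fun_prop : Measurable fun q : E × (S2 × ℝ) =>
          (q.1 - (q.2.2 * σ) • (q.2.1 : E), (q.2.1 : E))))) ?_ ?_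
    · filter_upwards [ae_lineMeasure] with b hb X
      by_cases h : ‖X‖ ≤ r + |σ|
      · rw [abs_mul]
        exact mul_le_mul (hC _ _ h) (hMα _ _) (abs_nonneg _) hC0
      · simp only [hz' b hb X (not_le.1 h), _root_.zero_apply, mul_zero, abs_zero]; positivity
    · filter_upwards [ae_lineMeasure] with b hb X h
      simp only [hz' b hb X h, _root_.zero_apply, mul_zero]
  -- For each `α` and `τ` a translation moves the shift along the line of centres from `a` to the
  -- test function.
  have e2 : ∫ X, ∑ i, shiftFlux σ a i X * pderiv i φ X
      = ∫ Y, ∫ b, a Y b.1 * fderiv ℝ φ (Y - (b.2 * σ) • (b.1 : E)) (b.1 : E) ∂lineMeasure := by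
    simp_rw [e1]
    have s1 := integral_integral_swap (f := fun (X : E) (b : S2 × ℝ) =>
      a (X + (b.2 * σ) • (b.1 : E)) b.1 * fderiv ℝ φ X (b.1 : E)) hF
    have s2 := integral_integral_swap (f := fun (Y : E) (b : S2 × ℝ) =>
      a Y b.1 * fderiv ℝ φ (Y - (b.2 * σ) • (b.1 : E)) (b.1 : E)) hF'
    refine s1.trans (Eq.trans ?_ s2.symm)
    congr 1 with b
    rw [← integral_sub_right_eq_self (fun X => a (X + (b.2 * σ) • (b.1 : E)) b.1
      * fderiv ℝ φ X (b.1 : E)) ((b.2 * σ) • (b.1 : E))]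
    simp_rw [sub_add_cancel]
  -- Averaging the directional derivative over the segment from `Y - σα` to `Y` leaves the
  -- difference of the end values. This is why the collisional fluxes contain an integral over `τ`.
  have hFTC : ∀ (Y : E) (α : S2), σ * ∫ τ in (0 : ℝ)..1, fderiv ℝ φ (Y - (τ * σ) • (α : E)) (α : E)
      = φ Y - φ (Y - σ • (α : E)) := by
    intro Y α
    have hd : ∀ τ : ℝ, HasDerivAt (fun τ : ℝ => -φ (Y - (τ * σ) • (α : E)))
        (σ * fderiv ℝ φ (Y - (τ * σ) • (α : E)) (α : E)) τ := by
      intro τ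
      have h1 : HasDerivAt (fun τ : ℝ => Y - (τ * σ) • (α : E)) (-(σ • (α : E))) τ := by
        have := (((hasDerivAt_id τ).mul_const σ).smul_const (α : E)).const_sub Y
        simpa using this
      have h2 := ((hφ.differentiable one_ne_zero _).hasFDerivAt.comp_hasDerivAt τ h1).neg
      refine h2.congr_deriv ?_
      rw [map_neg, map_smul, neg_neg, smul_eq_mul]
    rw [← intervalIntegral.integral_const_mul, intervalIntegral.integral_eq_sub_of_hasDerivAt
      (fun τ _ => hd τ)]
    · simp; ring
    · refine Continuous.intervalIntegrable ?_ _ _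
      refine continuous_const.mul (hcl.comp (f := fun τ : ℝ => (Y - (τ * σ) • (α : E), (α : E))) ?_)
      fun_prop
  have e3 : ∀ᵐ Y : E, σ * ∫ b, a Y b.1 * fderiv ℝ φ (Y - (b.2 * σ) • (b.1 : E)) (b.1 : E) ∂lineMeasure
      = ∫ α : S2, a Y α * (φ Y - φ (Y - σ • (α : E))) ∂solidAngle := by
    filter_upwards [hF'.prod_right_ae] with Y hY
    rw [lineMeasure] at hY ⊢
    rw [integral_prod _ hY, ← integral_const_mul]
    congr 1 with α
    simp only
    rw [integral_const_mul, ← hFTC, intervalIntegral.integral_of_le zero_le_one]; ring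
  have hI : Integrable (fun q : S2 × E => a q.2 q.1 * (φ q.2 - φ (q.2 - σ • (q.1 : E))))
      (solidAngle.prod volume) := by
    have h0 := ha.integrable_mul hφ.continuous hk 0
    have h1 := ha.integrable_mul hφ.continuous hk σ
    refine (h0.sub h1).congr (Eventually.of_forall fun q => ?_)
    simp [mul_sub]
  rw [e2, ← integral_const_mul, integral_congr_ae e3, integral_prod_symm _ hI]

/-- Reordering of the integrations in a collisional flux. -/
lemma integral_line_reorder {h : (S2 × ℝ) × (E × E) → ℝ}
    (hh : Integrable h (lineMeasure.prod (volume.prod volume))) :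
    ∫ α : S2, (∫ ξ : E, ∫ ξs : E, ∫ τ in (0 : ℝ)..1, h ((α, τ), (ξ, ξs))) ∂solidAngle
      = ∫ b, (∫ p : E × E, h (b, p)) ∂lineMeasure := by
  have h1 := hh.integral_prod_left
  unfold lineMeasure at h1 hh ⊢
  have hmp := measurePreserving_prodAssoc solidAngle (volume.restrict (Ioc (0 : ℝ) 1))
    (volume.prod volume : Measure (E × E))
  have h2 := (hmp.symm.integrable_comp_emb MeasurableEquiv.prodAssoc.symm.measurableEmbedding).2 hh
  refine Eq.trans ?_ (integral_prod _ h1).symm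
  refine integral_congr_ae ?_
  filter_upwards [h2.prod_right_ae] with α hα
  have hα' : Integrable (fun q : ℝ × (E × E) => h ((α, q.1), q.2))
      ((volume.restrict (Ioc (0 : ℝ) 1)).prod (volume.prod volume)) := hα
  have e1 := integral_integral_swap (f := fun (τ : ℝ) (p : E × E) => h ((α, τ), p)) hα'
  refine Eq.trans ?_ e1.symm
  have h3 := hα'.swap.integral_prod_left
  have e2 := integral_prod _ h3
  refine Eq.trans ?_ e2.symm
  simp_rw [intervalIntegral.integral_of_le zero_le_one]
  rfl

lemma PairGrowth.flux_eq {D : Set E} {γ f : E → E → ℝ} {Q : E → S2 → E × E → ℝ} (hQ : PairGrowth Q)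
    (hγ : IsKernel D γ) (hf : Kinetic D f) (σ : ℝ) (i : Fin 3) (X : E) :
    ∫ α : S2, (∫ ξ : E, ∫ ξs : E, ∫ τ in (0 : ℝ)..1,
      (α : E) i * pairFun σ γ f Q (X + (τ * σ) • (α : E)) α (ξ, ξs)) ∂solidAngle
      = shiftFlux σ (pairInt σ γ f Q) i X := by
  have hy : Measurable fun b : S2 × ℝ => X + (b.2 * σ) • (b.1 : E) := by fun_prop
  have h1 := hQ.integrable_param (ν := lineMeasure) hγ hf σ hy measurable_fst (r := ‖X‖ + |σ|)
    (by filter_upwards [ae_lineMeasure] with b hb using norm_line_le le_rfl σ hb)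
  have h2 : Integrable (fun q : (S2 × ℝ) × (E × E) => (q.1.1 : E) i
      * pairFun σ γ f Q (X + (q.1.2 * σ) • (q.1.1 : E)) q.1.1 q.2)
      (lineMeasure.prod (volume.prod volume)) := by
    refine h1.bdd_mul (c := 1) ?_ (Eventually.of_forall fun q => abs_coord_sphere_le _ _)
    exact ((measurable_coord_sphere i).comp measurable_fst.fst).aestronglyMeasurable
  have h3 := integral_line_reorder h2
  refine h3.trans ?_
  rw [shiftFlux_eq (hQ.locBdd hγ hf σ)]
  simp_rw [integral_const_mul]
  rfl

end

end EESM

namespace EESM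

noncomputable section

/-! ### Smooth approximation of the indicator function of a ball -/

/-- Measurability and local boundedness. -/
structure LocBddFun (q : E → ℝ) : Prop where
  meas : Measurable q
  bdd : ∀ r : ℝ, ∃ C : ℝ, 0 ≤ C ∧ ∀ X, ‖X‖ ≤ r → |q X| ≤ C

/-- A smooth approximation from below of the indicator function of the ball of radius `σ`. -/
def cutoff (σ : ℝ) (n : ℕ) (Z : E) : ℝ := Real.smoothTransition (n * (σ ^ 2 - ‖Z‖ ^ 2))

/-- The radial density of `cutoff`. -/
def shell (σ : ℝ) (n : ℕ) (r : ℝ) : ℝ :=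
  2 * n * r * deriv Real.smoothTransition (n * (σ ^ 2 - r ^ 2))

section oneDim

variable {σ : ℝ}

lemma shell_nonneg (σ : ℝ) (n : ℕ) {r : ℝ} (hr : 0 < r) : 0 ≤ shell σ n r := by
  have : 0 ≤ deriv Real.smoothTransition (n * (σ ^ 2 - r ^ 2)) :=
    Real.smoothTransition.monotone.deriv_nonneg
  unfold shell; positivity

/-- The derivative of the transition vanishes unless `0 ≤ n(σ² - r²) ≤ 1`. Since `σ² - r² ≥ σ(σ -
r)` for `0 < r ≤ σ`, this confines `r` to a layer of width `1/(nσ)` inside the sphere. -/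
lemma shell_eq_zero (hσ : 0 < σ) {n : ℕ} {r : ℝ} (hr : 0 < r) (hn : 0 < n)
    (h : σ < r ∨ r < σ - 1 / (n * σ)) : shell σ n r = 0 := by
  have hn' : (0 : ℝ) < n := by exact_mod_cast hn
  unfold shell
  rw [deriv_smoothTransition_eq_zero, mul_zero]
  rcases h with h | h
  · left
    have : σ ^ 2 - r ^ 2 < 0 := by nlinarith
    exact mul_neg_of_pos_of_neg hn' this
  · right
    have h2 : 1 / (n * σ) < σ - r := by linarith
    rw [div_lt_iff₀ (by positivity)] at h2
    nlinarith [mul_pos hn' hr, mul_pos hn' hσ]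

lemma hasDerivAt_shell (σ : ℝ) (n : ℕ) (r : ℝ) :
    HasDerivAt (fun r => -Real.smoothTransition (n * (σ ^ 2 - r ^ 2))) (shell σ n r) r := by
  have h1 : HasDerivAt (fun r : ℝ => (n : ℝ) * (σ ^ 2 - r ^ 2)) (n * (-(2 * r))) r := by
    have := ((hasDerivAt_pow 2 r).const_sub (σ ^ 2)).const_mul (n : ℝ)
    simpa using this
  have h2 := ((Real.smoothTransition.contDiff (n := 1)).differentiable (by norm_num)
    (n * (σ ^ 2 - r ^ 2))).hasDerivAt
  refine ((h2.comp r h1).neg).congr_deriv ?_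
  unfold shell; ring

lemma tendsto_shell (σ : ℝ) (n : ℕ) :
    Tendsto (fun r => -Real.smoothTransition (n * (σ ^ 2 - r ^ 2))) atTop (𝓝 0) := by
  refine tendsto_const_nhds.congr' ?_
  filter_upwards [eventually_ge_atTop |σ|] with r hr
  rw [Real.smoothTransition.zero_of_nonpos, neg_zero]
  have : σ ^ 2 ≤ r ^ 2 := sq_le_sq' (by linarith [neg_abs_le σ]) ((le_abs_self σ).trans hr)
  exact mul_nonpos_of_nonneg_of_nonpos (Nat.cast_nonneg n) (by linarith)

lemma integrableOn_shell (σ : ℝ) (n : ℕ) : IntegrableOn (shell σ n) (Ioi 0) :=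
  integrableOn_Ioi_deriv_of_nonneg (hasDerivAt_shell σ n 0).continuousAt.continuousWithinAt
    (fun r _ => hasDerivAt_shell σ n r) (fun _ hr => shell_nonneg σ n hr) (tendsto_shell σ n)

lemma integral_shell (σ : ℝ) (n : ℕ) :
    ∫ r in Ioi (0 : ℝ), shell σ n r = Real.smoothTransition (n * σ ^ 2) := by
  rw [integral_Ioi_of_hasDerivAt_of_nonneg' (fun r _ => hasDerivAt_shell σ n r)
    (fun _ hr => shell_nonneg σ n hr) (tendsto_shell σ n)]
  simp

/-- The radial density is nonnegative with mass at most 1 and lives in a thin layer, so a bound on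
`G` in that layer is enough. -/
lemma integral_shell_mul_le (hσ : 0 < σ) {n : ℕ} (hn : 0 < n) {G : ℝ → ℝ} {B : ℝ} (hB : 0 ≤ B)
    (hG : ∀ r, 0 < r → r ≤ σ → σ - 1 / (n * σ) ≤ r → |G r| ≤ B) :
    |∫ r in Ioi (0 : ℝ), shell σ n r * G r| ≤ B := by
  have h1 : ∀ᵐ r ∂volume.restrict (Ioi (0 : ℝ)), ‖shell σ n r * G r‖ ≤ shell σ n r * B := by
    filter_upwards [ae_restrict_mem measurableSet_Ioi] with r hr
    rw [norm_mul, Real.norm_eq_abs, abs_of_nonneg (shell_nonneg σ n hr)]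
    by_cases h : σ < r ∨ r < σ - 1 / (n * σ)
    · rw [shell_eq_zero hσ hr hn h]; simp
    · push Not at h
      exact mul_le_mul_of_nonneg_left (hG r hr h.1 h.2) (shell_nonneg σ n hr)
  have h2 := norm_integral_le_of_norm_le ((integrableOn_shell σ n).mul_const B) h1
  rw [integral_mul_const, integral_shell σ n] at h2
  exact h2.trans (mul_le_of_le_one_left hB (Real.smoothTransition.le_one _))

lemma integrableOn_shell_mul (hσ : 0 < σ) {n : ℕ} (hn : 0 < n) {G : ℝ → ℝ} {B : ℝ}
    (hm : Measurable G) (hG : ∀ r, 0 < r → r ≤ σ → |G r| ≤ B) :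
    IntegrableOn (fun r => shell σ n r * G r) (Ioi 0) := by
  refine ((integrableOn_shell σ n).mul_const B).mono' ?_ ?_
  · exact (integrableOn_shell σ n).aestronglyMeasurable.mul hm.aestronglyMeasurable
  filter_upwards [ae_restrict_mem measurableSet_Ioi] with r hr
  rw [norm_mul, Real.norm_eq_abs, abs_of_nonneg (shell_nonneg σ n hr)]
  by_cases h : σ < r
  · rw [shell_eq_zero hσ hr hn (Or.inl h)]; simp
  · exact mul_le_mul_of_nonneg_left (hG r hr (not_lt.1 h)) (shell_nonneg σ n hr)

/-- The radial densities concentrate at `r = σ`. -/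
lemma tendsto_integral_shell (hσ : 0 < σ) {G : ℕ → ℝ → ℝ} {g B : ℝ} (hm : ∀ n, Measurable (G n))
    (hB : ∀ n r, 0 < r → r ≤ σ → |G n r| ≤ B)
    (hG : Tendsto (fun p : ℕ × ℝ => G p.1 p.2) (atTop ×ˢ 𝓝 σ) (𝓝 g)) :
    Tendsto (fun n => ∫ r in Ioi (0 : ℝ), shell σ n r * G n r) atTop (𝓝 g) := by
  rw [Metric.tendsto_atTop]
  intro ε hε
  have h1 := hG.eventually (Metric.ball_mem_nhds g (half_pos hε))
  rw [eventually_prod_iff] at h1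
  obtain ⟨P, hP, P', hP', hPP⟩ := h1
  obtain ⟨δ, hδ, hδP⟩ := Metric.eventually_nhds_iff_ball.1 hP'
  obtain ⟨N₁, hN₁⟩ := eventually_atTop.1 hP
  -- `N₂` makes the layer thinner than `δ`; `N₃` ensures `nσ² ≥ 1`, from which point on the mass
  -- `smoothTransition (nσ²)` is exactly 1.
  obtain ⟨N₂, hN₂⟩ := exists_nat_gt (1 / (δ * σ))
  obtain ⟨N₃, hN₃⟩ := exists_nat_ge (1 / σ ^ 2)
  refine ⟨max (max N₁ N₂) (max N₃ 1), fun n hn => ?_⟩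
  have hn1 : N₁ ≤ n := (le_max_left _ _).trans ((le_max_left _ _).trans hn)
  have hn2 : (N₂ : ℝ) ≤ n := by exact_mod_cast (le_max_right _ _).trans ((le_max_left _ _).trans hn)
  have hn3 : (N₃ : ℝ) ≤ n := by exact_mod_cast (le_max_left _ _).trans ((le_max_right _ _).trans hn)
  have hn0 : 0 < n := (le_max_right _ _).trans ((le_max_right _ _).trans hn)
  have hn' : (0 : ℝ) < n := by exact_mod_cast hn0
  have hone : ∫ r in Ioi (0 : ℝ), shell σ n r = 1 := by
    rw [integral_shell σ n, Real.smoothTransition.one_of_one_le]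
    have := hN₃.trans hn3
    rwa [div_le_iff₀ (by positivity)] at this
  have hsub : ∫ r in Ioi (0 : ℝ), shell σ n r * (G n r - g)
      = (∫ r in Ioi (0 : ℝ), shell σ n r * G n r) - g := by
    simp_rw [mul_sub]
    rw [integral_sub (integrableOn_shell_mul hσ hn0 (hm n) (hB n))
      ((integrableOn_shell σ n).mul_const g), integral_mul_const, hone, one_mul]
  rw [Real.dist_eq, ← hsub]
  refine (integral_shell_mul_le hσ hn0 (half_pos hε).le fun r hr0 hrσ hr => ?_).trans_lt
    (half_lt_self hε)
  have hball : r ∈ Metric.ball σ δ := by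
    rw [Metric.mem_ball, Real.dist_eq, abs_sub_comm, abs_of_nonneg (by linarith)]
    have h2 : 1 / (n * σ) < δ := by
      have h3 := hN₂.trans_le hn2
      rw [div_lt_iff₀ (by positivity)] at h3 ⊢
      linarith
    linarith
  have := hPP (hN₁ n hn1) (hδP r hball)
  exact (le_of_lt this : dist (G n r) g ≤ ε / 2)

end oneDim

section cutoff

variable {σ : ℝ}

lemma contDiff_cutoff (σ : ℝ) (n : ℕ) : ContDiff ℝ 1 (cutoff σ n) := by
  unfold cutoff
  refine (Real.smoothTransition.contDiff (n := 1)).comp ?_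
  exact contDiff_const.mul (contDiff_const.sub (contDiff_norm_sq ℝ))

lemma cutoff_nonneg (σ : ℝ) (n : ℕ) (Z : E) : 0 ≤ cutoff σ n Z := Real.smoothTransition.nonneg _

lemma cutoff_eq_zero (hσ : 0 < σ) (n : ℕ) {Z : E} (h : σ ≤ ‖Z‖) : cutoff σ n Z = 0 := by
  refine Real.smoothTransition.zero_of_nonpos ?_
  have : σ ^ 2 ≤ ‖Z‖ ^ 2 := by gcongr
  exact mul_nonpos_of_nonneg_of_nonpos (Nat.cast_nonneg n) (by linarith)

lemma cutoff_le_theta (hσ : 0 < σ) (n : ℕ) (Z : E) : cutoff σ n Z ≤ theta (σ - ‖Z‖) := by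
  unfold theta
  split_ifs with h
  · exact Real.smoothTransition.le_one _
  · rw [cutoff_eq_zero hσ n (by linarith)]

lemma theta_nonneg (x : ℝ) : 0 ≤ theta x := by unfold theta; split_ifs <;> norm_num
lemma theta_le_one (x : ℝ) : theta x ≤ 1 := by unfold theta; split_ifs <;> norm_num
lemma measurable_theta : Measurable theta :=
  Measurable.ite measurableSet_Ici measurable_const measurable_const

lemma hasCompactSupport_cutoff (hσ : 0 < σ) (n : ℕ) : HasCompactSupport (cutoff σ n) := by
  refine HasCompactSupport.of_support_subset_isCompact (isCompact_closedBall (0 : E) σ) ?_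
  intro Z hZ
  by_contra h
  exact hZ (cutoff_eq_zero hσ n (by simpa using (not_le.1 (by simpa using h)).le))

lemma cutoff_neg (σ : ℝ) (n : ℕ) (Z : E) : cutoff σ n (-Z) = cutoff σ n Z := by simp [cutoff]

/-- The cut-off is radial, so its gradient points along `-α` with magnitude `shell`. In polar
coordinates the gradient thus becomes an approximate surface measure on the sphere of radius `σ`. -/
lemma pderiv_cutoff (σ : ℝ) (n : ℕ) (i : Fin 3) (r : ℝ) (α : S2) :
    pderiv i (cutoff σ n) (r • (α : E)) = -((α : E) i * shell σ n r) := by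
  have h1 : HasFDerivAt (fun Z : E => (n : ℝ) * (σ ^ 2 - ‖Z‖ ^ 2))
      ((n : ℝ) • -((2 : ℕ) • (innerSL ℝ (r • (α : E)) : E →L[ℝ] ℝ))) (r • (α : E)) :=
    ((hasStrictFDerivAt_norm_sq (r • (α : E))).hasFDerivAt.const_sub (σ ^ 2)).const_mul (n : ℝ)
  have h2 := ((Real.smoothTransition.contDiff (n := 1)).differentiable (by norm_num)
    (n * (σ ^ 2 - ‖r • (α : E)‖ ^ 2))).hasDerivAt
  have h3 := (HasDerivAt.comp_hasFDerivAt (r • (α : E)) h2 h1).fderiv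
  have h4 : fderiv ℝ (cutoff σ n) (r • (α : E)) = _ := h3
  have h5 : ‖r • (α : E)‖ ^ 2 = r ^ 2 := by rw [norm_smul_sphere, sq_abs]
  rw [pderiv, h4, h5, shell]
  simp [EuclideanSpace.inner_single_right]
  ring

/-- Pointwise convergence of the approximations off the sphere, jointly in the centre. -/
lemma tendsto_cutoff {Z : E} (hσ : 0 < σ) (hZ : ‖Z‖ ≠ σ) :
    Tendsto (fun p : ℕ × E => cutoff σ p.1 p.2) (atTop ×ˢ 𝓝 Z) (𝓝 (theta (σ - ‖Z‖))) := by
  rcases lt_or_gt_of_ne hZ with h | h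
  · have h1 : theta (σ - ‖Z‖) = 1 := by unfold theta; rw [if_pos (by linarith)]
    rw [h1]
    refine tendsto_const_nhds.congr' ?_
    obtain ⟨s, hs1, hs2⟩ := exists_between h
    obtain ⟨N, hN⟩ := exists_nat_ge (1 / (σ ^ 2 - s ^ 2))
    have hs0 : 0 ≤ s := (norm_nonneg Z).trans hs1.le
    have hpos : 0 < σ ^ 2 - s ^ 2 := by nlinarith
    have e1 : ∀ᶠ n : ℕ in atTop, N ≤ n := eventually_ge_atTop N
    have e2 : ∀ᶠ W : E in 𝓝 Z, ‖W‖ < s := continuous_norm.continuousAt.eventually (gt_mem_nhds hs1)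
    filter_upwards [e1.prod_mk e2] with p hp
    rw [cutoff, Real.smoothTransition.one_of_one_le]
    have h2 : (N : ℝ) ≤ p.1 := by exact_mod_cast hp.1
    rw [div_le_iff₀ hpos] at hN
    have h3 : ‖p.2‖ ^ 2 ≤ s ^ 2 := by have := hp.2.le; gcongr
    calc (1 : ℝ) ≤ N * (σ ^ 2 - s ^ 2) := hN
      _ ≤ p.1 * (σ ^ 2 - ‖p.2‖ ^ 2) := by gcongr
  · have h1 : theta (σ - ‖Z‖) = 0 := by unfold theta; rw [if_neg (by linarith)]
    rw [h1]
    refine tendsto_const_nhds.congr' ?_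
    have e2 : ∀ᶠ W : E in 𝓝 Z, σ < ‖W‖ := continuous_norm.continuousAt.eventually (lt_mem_nhds h)
    filter_upwards [(Eventually.of_forall fun _ => trivial : ∀ᶠ _ : ℕ in atTop, True).prod_mk e2]
      with p hp
    rw [cutoff_eq_zero hσ _ hp.2.le]

lemma tendsto_theta {Z : E} (hZ : ‖Z‖ ≠ σ) :
    Tendsto (fun W : E => theta (σ - ‖W‖)) (𝓝 Z) (𝓝 (theta (σ - ‖Z‖))) := by
  rcases lt_or_gt_of_ne hZ with h | h
  · refine tendsto_const_nhds.congr' ?_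
    filter_upwards [continuous_norm.continuousAt.eventually (gt_mem_nhds h)] with W hW
    simp only [theta]; rw [if_pos (by linarith), if_pos (by linarith)]
  · refine tendsto_const_nhds.congr' ?_
    filter_upwards [continuous_norm.continuousAt.eventually (lt_mem_nhds h)] with W hW
    simp only [theta]; rw [if_neg (by linarith), if_neg (by linarith)]

lemma ae_norm_sub_ne (σ : ℝ) (X : E) : ∀ᵐ Y : E, ‖Y - X‖ ≠ σ := by
  have := Measure.addHaar_sphere (volume : Measure E) X σ
  rw [← compl_mem_ae_iff] at this
  filter_upwards [this] with Y hY h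
  exact hY (by simpa [dist_eq_norm] using h)

/-- Integral of `q` over the ball of radius `σ` around `X`. -/
def ballInt (σ : ℝ) (q : E → ℝ) (X : E) : ℝ := ∫ Y, q Y * theta (σ - ‖Y - X‖)

/-- Smooth approximation of `ballInt`. -/
def ballMoll (σ : ℝ) (q : E → ℝ) (n : ℕ) (X : E) : ℝ := ∫ Y, q Y * cutoff σ n (Y - X)

lemma integrable_indicator_closedBall (C r : ℝ) :
    Integrable ((Metric.closedBall (0 : E) r).indicator fun _ => C) :=
  (integrable_indicator_iff Metric.isClosed_closedBall.measurableSet).2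
    (integrableOn_const (measure_closedBall_lt_top (x := (0 : E))).ne)

lemma abs_mul_le_indicator {q : E → ℝ} {C r s : ℝ}
    (hC : ∀ X, ‖X‖ ≤ r + s → |q X| ≤ C) {X Y : E} (hX : ‖X‖ ≤ r) {t : ℝ} (ht0 : 0 ≤ t) (ht1 : t ≤ 1)
    (ht : s < ‖Y - X‖ → t = 0) :
    ‖q Y * t‖ ≤ (Metric.closedBall (0 : E) (r + s)).indicator (fun _ => C) Y := by
  by_cases hY : ‖Y‖ ≤ r + s
  · rw [indicator_of_mem (by simpa using hY), norm_mul, Real.norm_eq_abs, Real.norm_eq_abs,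
      abs_of_nonneg ht0]
    exact (mul_le_of_le_one_right (abs_nonneg _) ht1).trans (hC Y hY)
  · rw [indicator_of_notMem (by simpa using hY), ht, mul_zero, norm_zero]
    have := norm_sub_norm_le Y X
    push Not at hY
    linarith

lemma LocBddFun.integrable_theta {q : E → ℝ} (hq : LocBddFun q) (σ : ℝ) (X : E) :
    Integrable fun Y => q Y * theta (σ - ‖Y - X‖) := by
  obtain ⟨C, hC0, hC⟩ := hq.bdd (‖X‖ + σ)
  refine (integrable_indicator_closedBall C (‖X‖ + σ)).mono'
    (hq.meas.mul (measurable_theta.comp (by fun_prop))).aestronglyMeasurable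
    (Eventually.of_forall fun Y => abs_mul_le_indicator hC le_rfl (theta_nonneg _)
      (theta_le_one _) fun h => ?_)
  unfold theta; rw [if_neg (by linarith)]

lemma LocBddFun.integrable_cutoff {q : E → ℝ} (hq : LocBddFun q) (hσ : 0 < σ) (n : ℕ) (X : E) :
    Integrable fun Y => q Y * cutoff σ n (Y - X) := by
  obtain ⟨C, hC0, hC⟩ := hq.bdd (‖X‖ + σ)
  refine (integrable_indicator_closedBall C (‖X‖ + σ)).mono'
    (hq.meas.mul ((contDiff_cutoff σ n).continuous.measurable.comp (by fun_prop))).aestronglyMeasurable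
    (Eventually.of_forall fun Y => abs_mul_le_indicator hC le_rfl (cutoff_nonneg _ _ _)
      (Real.smoothTransition.le_one _) fun h => cutoff_eq_zero hσ n h.le)

/-- The limit is taken jointly in the index and the centre because later the radius tends to `σ`
while the smoothing index tends to infinity. Dominated convergence applies: the exceptional sphere
has zero volume. -/
lemma LocBddFun.tendsto_ballMoll {q : E → ℝ} (hq : LocBddFun q) (hσ : 0 < σ) (X : E) :
    Tendsto (fun p : ℕ × E => ballMoll σ q p.1 p.2) (atTop ×ˢ 𝓝 X) (𝓝 (ballInt σ q X)) := by
  obtain ⟨C, hC0, hC⟩ := hq.bdd (‖X‖ + 1 + σ)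
  have hev : ∀ᶠ p : ℕ × E in atTop ×ˢ 𝓝 X, ‖p.2‖ ≤ ‖X‖ + 1 := by
    have : ∀ᶠ W : E in 𝓝 X, ‖W‖ < ‖X‖ + 1 :=
      continuous_norm.continuousAt.eventually (gt_mem_nhds (by linarith))
    filter_upwards [(Eventually.of_forall fun _ => trivial : ∀ᶠ _ : ℕ in atTop, True).prod_mk this]
      with p hp using hp.2.le
  refine tendsto_integral_filter_of_dominated_convergence _ ?_ ?_
    (integrable_indicator_closedBall C (‖X‖ + 1 + σ)) ?_
  · exact Eventually.of_forall fun p => (hq.integrable_cutoff hσ p.1 p.2).aestronglyMeasurable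
  · filter_upwards [hev] with p hp
    exact Eventually.of_forall fun Y => abs_mul_le_indicator hC hp (cutoff_nonneg _ _ _)
      (Real.smoothTransition.le_one _) fun h => cutoff_eq_zero hσ _ h.le
  · filter_upwards [ae_norm_sub_ne σ X] with Y hY
    refine Tendsto.const_mul _ ?_
    have h1 : Tendsto (fun p : ℕ × E => (p.1, Y - p.2)) (atTop ×ˢ 𝓝 X) (atTop ×ˢ 𝓝 (Y - X)) :=
      tendsto_fst.prodMk ((tendsto_const_nhds.sub tendsto_id).comp tendsto_snd)
    exact (tendsto_cutoff hσ hY).comp h1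

/-- The sharp ball average is continuous even for discontinuous `q`, since the jump set of the
kernel is a null set. -/
lemma LocBddFun.continuous_ballInt {q : E → ℝ} (hq : LocBddFun q) (σ : ℝ) :
    Continuous (ballInt σ q) := by
  rw [continuous_iff_continuousAt]
  intro X
  obtain ⟨C, hC0, hC⟩ := hq.bdd (‖X‖ + 1 + σ)
  refine tendsto_integral_filter_of_dominated_convergence _ ?_ ?_
    (integrable_indicator_closedBall C (‖X‖ + 1 + σ)) ?_
  · exact Eventually.of_forall fun p => (hq.integrable_theta σ p).aestronglyMeasurable
  · filter_upwards [continuous_norm.continuousAt.eventually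
      (gt_mem_nhds (show ‖X‖ < ‖X‖ + 1 by linarith))] with W hW
    refine Eventually.of_forall fun Y => abs_mul_le_indicator hC (le_of_lt hW) (theta_nonneg _)
      (theta_le_one _) fun h => ?_
    unfold theta; rw [if_neg (by linarith)]
  · filter_upwards [ae_norm_sub_ne σ X] with Y hY
    refine Tendsto.const_mul _ ?_
    exact (tendsto_theta hY).comp (tendsto_const_nhds.sub tendsto_id)

lemma LocBddFun.ballMoll_le {q : E → ℝ} (hq : LocBddFun q) (hσ : 0 < σ) (hq0 : ∀ X, 0 ≤ q X) (n : ℕ)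
    (X : E) : 0 ≤ ballMoll σ q n X ∧ ballMoll σ q n X ≤ ballInt σ q X :=
  ⟨integral_nonneg fun Y => mul_nonneg (hq0 Y) (cutoff_nonneg _ _ _),
    integral_mono (hq.integrable_cutoff hσ n X) (hq.integrable_theta σ X) fun Y =>
      mul_le_mul_of_nonneg_left (cutoff_le_theta hσ n _) (hq0 Y)⟩

lemma LocBddFun.locallyIntegrable {q : E → ℝ} (hq : LocBddFun q) : LocallyIntegrable q := by
  intro X
  obtain ⟨C, hC0, hC⟩ := hq.bdd (‖X‖ + 1)
  refine ⟨Metric.ball X 1, Metric.ball_mem_nhds _ one_pos, ?_⟩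
  refine Measure.integrableOn_of_bounded (M := C) measure_ball_lt_top.ne
    hq.meas.aestronglyMeasurable ?_
  filter_upwards [ae_restrict_mem Metric.isOpen_ball.measurableSet] with Y hY
  refine hC Y ?_
  rw [Metric.mem_ball, dist_eq_norm] at hY
  have := norm_sub_norm_le Y X
  linarith

lemma LocBddFun.ballMoll_eq_convolution (q : E → ℝ) (σ : ℝ) (n : ℕ) :
    ballMoll σ q n = convolution q (cutoff σ n) (ContinuousLinearMap.mul ℝ ℝ) volume := by
  ext X
  simp only [ballMoll, convolution, ContinuousLinearMap.mul_apply']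
  congr 1 with Y
  rw [← cutoff_neg, neg_sub]

lemma LocBddFun.contDiff_ballMoll {q : E → ℝ} (hq : LocBddFun q) (hσ : 0 < σ) (n : ℕ) :
    ContDiff ℝ 1 (ballMoll σ q n) := by
  rw [ballMoll_eq_convolution]
  exact (hasCompactSupport_cutoff hσ n).contDiff_convolution_right (n := 1) _ hq.locallyIntegrable
    (contDiff_cutoff σ n)

lemma fderiv_cutoff_neg (σ : ℝ) (n : ℕ) (Z v : E) :
    fderiv ℝ (cutoff σ n) (-Z) v = -fderiv ℝ (cutoff σ n) Z v := by
  have hd := ((contDiff_cutoff σ n).differentiable one_ne_zero (-Z)).hasFDerivAt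
  have h1 := hd.comp Z (hasFDerivAt_id Z).neg
  have h2 : cutoff σ n ∘ (Neg.neg : E → E) = cutoff σ n := by ext Z; exact cutoff_neg σ n Z
  rw [h2] at h1
  rw [h1.fderiv]; simp

/-- The derivative falls on the smooth kernel, so `q` needs no regularity; the gradient of the even
kernel is odd, whence the sign. -/
lemma LocBddFun.fderiv_ballMoll {q : E → ℝ} (hq : LocBddFun q) (hσ : 0 < σ) (n : ℕ) (X v : E) :
    fderiv ℝ (ballMoll σ q n) X v = -∫ Z, q (X + Z) * fderiv ℝ (cutoff σ n) Z v := by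
  have h := (hasCompactSupport_cutoff hσ n).hasFDerivAt_convolution_right
    (ContinuousLinearMap.mul ℝ ℝ) hq.locallyIntegrable (contDiff_cutoff σ n) X
  have hcont : Continuous (fderiv ℝ (cutoff σ n)) :=
    (contDiff_cutoff σ n).continuous_fderiv one_ne_zero
  have hex := ((hasCompactSupport_cutoff hσ n).fderiv (𝕜 := ℝ)).convolutionExists_right
    ((ContinuousLinearMap.mul ℝ ℝ).precompR E) hq.locallyIntegrable hcont X
  rw [ballMoll_eq_convolution, h.fderiv, convolution, ← ContinuousLinearMap.apply_apply v (∫ _, _),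
    ← ContinuousLinearMap.integral_comp_comm _ hex, ← integral_neg,
    ← integral_add_left_eq_self _ X]
  congr 1 with Z
  have h1 : X - (X + Z) = -Z := by abel
  have h2 := fderiv_cutoff_neg σ n Z v
  simp only [ContinuousLinearMap.apply_apply, ContinuousLinearMap.precompR_apply, h1]
  show q (X + Z) * fderiv ℝ (cutoff σ n) (-Z) v = _
  rw [h2]; ring

end cutoff

end

end EESM

/-! ### Surface integrals as limits of gradients of smoothed balls -/

namespace EESM

noncomputable section

section limit

variable {σ : ℝ} {q : E → ℝ}

lemma continuous_pderiv_cutoff (σ : ℝ) (n : ℕ) (i : Fin 3) : Continuous (pderiv i (cutoff σ n)) := by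
  unfold pderiv
  exact ((contDiff_cutoff σ n).continuous_fderiv one_ne_zero).clm_apply continuous_const

lemma pderiv_cutoff_eq_zero (hσ : 0 < σ) (n : ℕ) (i : Fin 3) {Z : E} (h : σ < ‖Z‖) :
    pderiv i (cutoff σ n) Z = 0 := by
  have : cutoff σ n =ᶠ[𝓝 Z] fun _ => 0 := by
    filter_upwards [continuous_norm.continuousAt.eventually (lt_mem_nhds h)] with W hW
    exact cutoff_eq_zero hσ n hW.le
  rw [pderiv, this.fderiv_eq]; simp

lemma integrable_pderiv_cutoff (hσ : 0 < σ) (n : ℕ) (i : Fin 3) :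
    Integrable (pderiv i (cutoff σ n)) := by
  refine (continuous_pderiv_cutoff σ n i).integrable_of_hasCompactSupport ?_
  refine HasCompactSupport.of_support_subset_isCompact (isCompact_closedBall (0 : E) σ) ?_
  intro Z hZ
  by_contra h
  exact hZ (pderiv_cutoff_eq_zero hσ n i (by simpa using h))

lemma LocBddFun.shift_pderiv_le (hq : LocBddFun q) (hσ : 0 < σ) (i : Fin 3) (r : ℝ) :
    ∃ C, 0 ≤ C ∧ ∀ n X, ‖X‖ ≤ r → ∀ Z,
      ‖q (X + Z) * pderiv i (cutoff σ n) Z‖ ≤ C * ‖pderiv i (cutoff σ n) Z‖ := by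
  obtain ⟨C, hC0, hC⟩ := hq.bdd (r + σ)
  refine ⟨C, hC0, fun n X hX Z => ?_⟩
  rw [norm_mul]
  by_cases hZ : ‖Z‖ ≤ σ
  · exact mul_le_mul_of_nonneg_right
      (hC _ ((norm_add_le _ _).trans (add_le_add hX hZ))) (norm_nonneg _)
  · rw [pderiv_cutoff_eq_zero hσ n i (not_le.1 hZ)]; simp

lemma LocBddFun.integrable_shift_pderiv (hq : LocBddFun q) (hσ : 0 < σ) (n : ℕ) (i : Fin 3) (X : E) :
    Integrable fun Z => q (X + Z) * pderiv i (cutoff σ n) Z := by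
  obtain ⟨C, hC0, hC⟩ := hq.shift_pderiv_le hσ i ‖X‖
  refine ((integrable_pderiv_cutoff hσ n i).norm.const_mul C).mono' ?_
    (Eventually.of_forall (hC n X le_rfl))
  exact ((hq.meas.comp (measurable_const_add X)).mul
    (continuous_pderiv_cutoff σ n i).measurable).aestronglyMeasurable

lemma integrable_shift_prod (hq : LocBddFun q) (hσ : 0 < σ) (n : ℕ) (i : Fin 3) {u : E → ℝ}
    (hu : Measurable u) {r C : ℝ} (hr : ∀ X, r < ‖X‖ → u X = 0) (hC : ∀ X, |u X| ≤ C) :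
    Integrable (fun p : E × E => u p.1 * (q (p.1 + p.2) * pderiv i (cutoff σ n) p.2))
      (volume.prod volume) := by
  obtain ⟨B, hB0, hB⟩ := hq.shift_pderiv_le hσ i r
  have hb := (integrable_indicator_closedBall C r).mul_prod
    ((integrable_pderiv_cutoff hσ n i).norm.const_mul B)
  have h1 : Measurable fun p : E × E => u p.1 := hu.comp measurable_fst
  have h2 : Measurable fun p : E × E => q (p.1 + p.2) :=
    hq.meas.comp (measurable_fst.add measurable_snd)
  have h3 : Measurable fun p : E × E => pderiv i (cutoff σ n) p.2 :=
    (continuous_pderiv_cutoff σ n i).measurable.comp measurable_snd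
  refine hb.mono' (h1.mul (h2.mul h3)).aestronglyMeasurable (Eventually.of_forall fun p => ?_)
  by_cases hp : ‖p.1‖ ≤ r
  · rw [indicator_of_mem (by simpa using hp), norm_mul]
    exact mul_le_mul (hC p.1) (hB n p.1 hp p.2) (norm_nonneg _) ((abs_nonneg _).trans (hC p.1))
  · rw [indicator_of_notMem (by simpa using hp), hr _ (not_le.1 hp)]; simp

/-- Differentiating the smoothed ball in the limit produces the surface integral. -/
lemma tendsto_shell_average (hq : LocBddFun q) (hσ : 0 < σ) (i : Fin 3) {u : ℕ → E → ℝ}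
    {v : E → ℝ} (hu : ∀ n, Measurable (u n)) {r C : ℝ} (hr : ∀ n X, r < ‖X‖ → u n X = 0)
    (hC : ∀ n X, |u n X| ≤ C)
    (hv : ∀ X, Tendsto (fun p : ℕ × E => u p.1 p.2) (atTop ×ˢ 𝓝 X) (𝓝 (v X))) :
    Tendsto (fun n => ∫ X, u n X * ∫ Z, q (X + Z) * pderiv i (cutoff σ n) Z) atTop
      (𝓝 (-(σ ^ 2 * ∫ α : S2, (α : E) i * (∫ X, v X * q (X + σ • (α : E))) ∂solidAngle))) := by
  have hC0 : 0 ≤ C := (abs_nonneg _).trans (hC 0 0)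
  -- The correlation of `u n` and `q` at displacement `Z`. Integrating over the position before the
  -- displacement makes it converge locally uniformly enough to be evaluated on the concentrating
  -- layer, although `q` may be discontinuous.
  let M : ℕ → E → ℝ := fun n Z => ∫ Y, u n (Y - Z) * q Y
  have hbd : ∀ s : ℝ, ∃ B, 0 ≤ B ∧ ∀ n Z, ‖Z‖ ≤ s → ∀ Y, ‖u n (Y - Z) * q Y‖
      ≤ (Metric.closedBall (0 : E) (r + s)).indicator (fun _ => B) Y := by
    intro s
    obtain ⟨B, hB0, hB⟩ := hq.bdd (r + s)
    refine ⟨C * B, by positivity, fun n Z hZ Y => ?_⟩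
    by_cases hY : ‖Y‖ ≤ r + s
    · rw [indicator_of_mem (by simpa using hY), norm_mul]
      exact mul_le_mul (hC n _) (hB Y hY) (norm_nonneg _) hC0
    · rw [indicator_of_notMem (by simpa using hY), hr, zero_mul, norm_zero]
      have := norm_sub_norm_le Y Z
      push Not at hY
      linarith
  have hmeas : ∀ n, Measurable fun p : E × E => u n (p.2 - p.1) * q p.2 := fun n =>
    ((hu n).comp (measurable_snd.sub measurable_fst)).mul (hq.meas.comp measurable_snd)
  have hMm : ∀ n, Measurable (M n) := fun n =>
    ((hmeas n).stronglyMeasurable.integral_prod_right' (ν := (volume : Measure E))).measurable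
  have hMb : ∀ s : ℝ, ∃ B, 0 ≤ B ∧ ∀ n Z, ‖Z‖ ≤ s → |M n Z| ≤ B := by
    intro s
    obtain ⟨B, hB0, hB⟩ := hbd s
    refine ⟨∫ Y, (Metric.closedBall (0:E) (r+s)).indicator (fun _ => B) Y, integral_nonneg fun Y => indicator_nonneg (fun _ _ => hB0) Y, fun n Z hZ => ?_⟩
    exact norm_integral_le_of_norm_le (integrable_indicator_closedBall B (r + s))
      (Eventually.of_forall (hB n Z hZ))
  have hMl : ∀ Z, Tendsto (fun p : ℕ × E => M p.1 p.2) (atTop ×ˢ 𝓝 Z)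
      (𝓝 (∫ Y, v (Y - Z) * q Y)) := by
    intro Z
    obtain ⟨B, hB0, hB⟩ := hbd (‖Z‖ + 1)
    refine tendsto_integral_filter_of_dominated_convergence _
      (Eventually.of_forall fun p =>
        ((hmeas p.1).comp measurable_prodMk_left).aestronglyMeasurable) ?_
      (integrable_indicator_closedBall B (r + (‖Z‖ + 1))) (Eventually.of_forall fun Y => ?_)
    · have : ∀ᶠ W : E in 𝓝 Z, ‖W‖ < ‖Z‖ + 1 :=
        continuous_norm.continuousAt.eventually (gt_mem_nhds (by linarith))
      filter_upwards [(Eventually.of_forall fun _ => trivial : ∀ᶠ _ : ℕ in atTop, True).prod_mk this]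
        with p hp using Eventually.of_forall (hB p.1 p.2 hp.2.le)
    · refine Tendsto.mul_const _ ?_
      have h1 : Tendsto (fun p : ℕ × E => (p.1, Y - p.2)) (atTop ×ˢ 𝓝 Z) (atTop ×ˢ 𝓝 (Y - Z)) :=
        tendsto_fst.prodMk ((tendsto_const_nhds.sub tendsto_id).comp tendsto_snd)
      exact (hv (Y - Z)).comp h1
  -- Exchanging the integrals and passing to polar coordinates in the displacement leaves a
  -- one-dimensional integral against the radial density; the Jacobian `s²` becomes the area factor
  -- `σ²` in the limit.
  have e1 : ∀ n, ∫ X, u n X * ∫ Z, q (X + Z) * pderiv i (cutoff σ n) Z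
      = ∫ α : S2, -((α : E) i * ∫ s in Ioi (0 : ℝ), shell σ n s * (s ^ 2 * M n (s • (α : E))))
        ∂solidAngle := by
    intro n
    have hF := integrable_shift_prod hq hσ n i (hu n) (hr n) (hC n)
    have s1 := integral_integral_swap
      (f := fun X Z : E => u n X * (q (X + Z) * pderiv i (cutoff σ n) Z)) hF
    simp_rw [integral_const_mul] at s1
    have hsh : ∀ Z, ∫ X, u n X * (q (X + Z) * pderiv i (cutoff σ n) Z)
        = M n Z * pderiv i (cutoff σ n) Z := by
      intro Z
      simp_rw [← mul_assoc]
      rw [integral_mul_const, ← integral_sub_right_eq_self (fun X => u n X * q (X + Z)) Z]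
      simp_rw [sub_add_cancel]
      rfl
    have hI : Integrable fun Z => M n Z * pderiv i (cutoff σ n) Z := by
      have := hF.integral_prod_right
      simp only [hsh] at this
      exact this
    rw [s1]
    simp_rw [hsh]
    rw [integral_polar hI]
    congr 1 with α
    rw [← integral_const_mul, ← integral_neg]
    congr 1 with s
    rw [pderiv_cutoff]; ring
  have e2 : -(σ ^ 2 * ∫ α : S2, (α : E) i * (∫ X, v X * q (X + σ • (α : E))) ∂solidAngle)
      = ∫ α : S2, -((α : E) i * (σ ^ 2 * ∫ Y, v (Y - σ • (α : E)) * q Y)) ∂solidAngle := by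
    rw [← integral_const_mul, ← integral_neg]
    congr 1 with α
    rw [← integral_sub_right_eq_self (fun X => v X * q (X + σ • (α : E))) (σ • (α : E))]
    simp_rw [sub_add_cancel]; ring
  rw [e2]
  simp_rw [e1]
  obtain ⟨B, hB0, hB⟩ := hMb σ
  have hGB : ∀ (α : S2) (n : ℕ) (s : ℝ), 0 < s → s ≤ σ → |s ^ 2 * M n (s • (α : E))| ≤ σ ^ 2 * B := by
    intro α n s hs0 hs
    rw [abs_mul, abs_of_nonneg (sq_nonneg s)]
    have h1 : ‖s • (α : E)‖ ≤ σ := by rw [norm_smul_sphere, abs_of_pos hs0]; exact hs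
    have := hB n _ h1
    gcongr
  refine tendsto_integral_filter_of_dominated_convergence (fun _ => σ ^ 2 * B)
    (Eventually.of_forall fun n => ?_) ?_ (integrable_const _) (Eventually.of_forall fun α => ?_)
  · have hm : Measurable fun p : S2 × ℝ => shell σ n p.2 * (p.2 ^ 2 * M n (p.2 • (p.1 : E))) := by
      have h1 : Measurable (shell σ n) := by
        have : Continuous (deriv Real.smoothTransition) :=
          (Real.smoothTransition.contDiff (n := 1)).continuous_deriv le_rfl
        unfold shell; fun_prop
      have h2 : Measurable fun p : S2 × ℝ => p.2 • (p.1 : E) := by fun_prop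
      exact (h1.comp measurable_snd).mul ((measurable_snd.pow_const 2).mul ((hMm n).comp h2))
    have h3 := (hm.stronglyMeasurable.integral_prod_right'
      (ν := volume.restrict (Ioi (0 : ℝ)))).measurable
    exact ((measurable_coord_sphere i).mul h3).neg.aestronglyMeasurable
  · filter_upwards [eventually_gt_atTop 0] with n hn
    refine Eventually.of_forall fun α => ?_
    rw [norm_neg, norm_mul]
    calc _ ≤ 1 * (σ ^ 2 * B) := mul_le_mul (abs_coord_sphere_le α i)
          (integral_shell_mul_le hσ hn (by positivity) fun s h0 h1 _ => hGB α n s h0 h1)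
          (abs_nonneg _) zero_le_one
      _ = _ := one_mul _
  · refine ((tendsto_integral_shell hσ (G := fun n s => s ^ 2 * M n (s • (α : E)))
      (B := σ ^ 2 * B) (fun n => ?_) (hGB α) ?_).const_mul _).neg
    · have h2 : Measurable fun s : ℝ => s • (α : E) := by fun_prop
      exact (measurable_id.pow_const 2).mul ((hMm n).comp h2)
    · have h1 : Tendsto (fun p : ℕ × ℝ => (p.1, p.2 • (α : E))) (atTop ×ˢ 𝓝 σ)
          (atTop ×ˢ 𝓝 (σ • (α : E))) :=
        tendsto_fst.prodMk ((Continuous.tendsto (by fun_prop : Continuous fun s : ℝ => s • (α : E)) σ).comp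
          tendsto_snd)
      have h2 : Tendsto (fun p : ℕ × ℝ => p.2 ^ 2) (atTop ×ˢ 𝓝 σ) (𝓝 (σ ^ 2)) :=
        ((continuous_pow 2).tendsto σ).comp tendsto_snd
      exact h2.mul ((hMl (σ • (α : E))).comp h1)

end limit

end

end EESM

namespace EESM

noncomputable section

/-! ### The weak chain rule for a function of the local average of the density -/

lemma tendsto_integral_of_bdd {u : ℕ → E → ℝ} {v : E → ℝ} (hu : ∀ n, Measurable (u n)) {r C : ℝ}
    (hr : ∀ n X, r < ‖X‖ → u n X = 0) (hC : ∀ n X, |u n X| ≤ C)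
    (hv : ∀ X, Tendsto (fun n => u n X) atTop (𝓝 (v X))) :
    Tendsto (fun n => ∫ X, u n X) atTop (𝓝 (∫ X, v X)) := by
  refine tendsto_integral_of_dominated_convergence _ (fun n => (hu n).aestronglyMeasurable)
    (integrable_indicator_closedBall C r) (fun n => Eventually.of_forall fun X => ?_)
    (Eventually.of_forall hv)
  by_cases hX : ‖X‖ ≤ r
  · rw [indicator_of_mem (by simpa using hX)]; exact hC n X
  · rw [indicator_of_notMem (by simpa using hX), hr n X (not_le.1 hX), norm_zero]

lemma LocBddFun.abs {q : E → ℝ} (hq : LocBddFun q) : LocBddFun fun X => |q X| :=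
  ⟨hq.meas.abs, fun r => by simpa using hq.bdd r⟩

lemma LocBddFun.ballMoll_bdd {q : E → ℝ} (hq : LocBddFun q) {σ : ℝ} (hσ : 0 < σ) (r : ℝ) :
    ∃ C, 0 ≤ C ∧ ∀ n X, ‖X‖ ≤ r → |ballMoll σ q n X| ≤ C := by
  obtain ⟨C, hC⟩ := (isCompact_closedBall (0 : E) r).exists_bound_of_continuousOn
    (hq.abs.continuous_ballInt σ).continuousOn
  refine ⟨|C|, abs_nonneg C, fun n X hX => ?_⟩
  calc |ballMoll σ q n X| ≤ ∫ Y, |q Y * cutoff σ n (Y - X)| :=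
        norm_integral_le_integral_norm fun Y => q Y * cutoff σ n (Y - X)
    _ = ballMoll σ (fun X => |q X|) n X := by
      unfold ballMoll; congr 1 with Y
      rw [abs_mul, abs_of_nonneg (cutoff_nonneg σ n _)]
    _ ≤ ballInt σ (fun X => |q X|) X := (hq.abs.ballMoll_le hσ (fun X => abs_nonneg _) n X).2
    _ ≤ ‖ballInt σ (fun X => |q X|) X‖ := le_abs_self _
    _ ≤ C := hC X (by simpa using hX)
    _ ≤ |C| := le_abs_self C

lemma integral_neg_sphere (F : S2 → ℝ) : ∫ α, F (-α) ∂solidAngle = ∫ α, F α ∂solidAngle :=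
  measurePreserving_neg_sphere.integral_comp (Homeomorph.neg S2).measurableEmbedding F

lemma inner_coord (v w : E) : inner ℝ v w = ∑ i, v i * w i := by
  rw [PiLp.inner_apply]
  exact Finset.sum_congr rfl fun i _ => by simp [mul_comm]

section chain

variable {σ κ : ℝ} {ρ : E → ℝ} {S : ℝ → ℝ}

lemma LocBddFun.comp_ballMoll_bdd (hρ : LocBddFun ρ) (hσ : 0 < σ) (hS : Continuous S) (κ r : ℝ) :
    ∃ C, 0 ≤ C ∧ ∀ n X, ‖X‖ ≤ r → |S (κ * ballMoll σ ρ n X)| ≤ C := by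
  obtain ⟨C, hC0, hC⟩ := hρ.ballMoll_bdd hσ r
  obtain ⟨B, hB⟩ := (isCompact_Icc (a := -(|κ| * C)) (b := |κ| * C)).exists_bound_of_continuousOn
    hS.continuousOn
  refine ⟨|B|, abs_nonneg B, fun n X hX => (hB _ ?_).trans (le_abs_self B)⟩
  rw [mem_Icc, ← abs_le, abs_mul]
  exact mul_le_mul_of_nonneg_left (hC n X hX) (abs_nonneg κ)

lemma LocBddFun.tendsto_comp_ballMoll (hρ : LocBddFun ρ) (hσ : 0 < σ) (hS : Continuous S) (κ : ℝ)
    (X : E) : Tendsto (fun p : ℕ × E => S (κ * ballMoll σ ρ p.1 p.2)) (atTop ×ˢ 𝓝 X)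
      (𝓝 (S (κ * ballInt σ ρ X))) :=
  (hS.tendsto _).comp ((hρ.tendsto_ballMoll hσ X).const_mul κ)

lemma LocBddFun.tendsto_comp_ballMoll_mul (hρ : LocBddFun ρ) (hσ : 0 < σ) (hS : Continuous S)
    (κ : ℝ) {h : ℕ → E → ℝ} {l : E → ℝ} (hh : ∀ n, Measurable (h n)) {r C : ℝ}
    (hr : ∀ n X, r < ‖X‖ → h n X = 0) (hC : ∀ n X, |h n X| ≤ C)
    (hl : ∀ X, Tendsto (fun n => h n X) atTop (𝓝 (l X))) :
    Tendsto (fun n => ∫ X, S (κ * ballMoll σ ρ n X) * h n X) atTop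
      (𝓝 (∫ X, S (κ * ballInt σ ρ X) * l X)) := by
  obtain ⟨B, hB0, hB⟩ := hρ.comp_ballMoll_bdd hσ hS κ r
  refine tendsto_integral_of_bdd (r := r) (C := B * C) (fun n => ?_) (fun n X hX => ?_)
    (fun n X => ?_) fun X => ?_
  · have h1 := hS.measurable.comp ((hρ.contDiff_ballMoll hσ n).continuous.measurable.const_mul κ)
    exact h1.mul (hh n)
  · rw [hr n X hX, mul_zero]
  · by_cases hX : ‖X‖ ≤ r
    · rw [abs_mul]; exact mul_le_mul (hB n X hX) (hC n X) (abs_nonneg _) hB0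
    · rw [hr n X (not_le.1 hX), mul_zero, abs_zero]
      exact mul_nonneg hB0 ((abs_nonneg _).trans (hC 0 0))
  · refine Tendsto.mul ?_ (hl X)
    have h1 : Tendsto (fun n : ℕ => (n, X)) atTop (atTop ×ˢ 𝓝 X) :=
      tendsto_id.prodMk tendsto_const_nhds
    have h2 := (hρ.tendsto_comp_ballMoll hσ hS κ X).comp h1
    exact h2

lemma LocBddFun.tendsto_comp_shell (hρ : LocBddFun ρ) (hσ : 0 < σ) (hS : Continuous S) (κ : ℝ)
    {q c : E → ℝ} (hq : LocBddFun q) (hc : Continuous c) (hk : HasCompactSupport c) (i : Fin 3) :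
    Tendsto (fun n => ∫ X, (S (κ * ballMoll σ ρ n X) * c X)
        * ∫ Z, q (X + Z) * pderiv i (cutoff σ n) Z) atTop
      (𝓝 (-(σ ^ 2 * ∫ α : S2, (α : E) i
        * (∫ X, (S (κ * ballInt σ ρ X) * c X) * q (X + σ • (α : E))) ∂solidAngle))) := by
  obtain ⟨r, -, hr⟩ := exists_radius hk
  have hr' : ∀ X, r < ‖X‖ → c X = 0 := fun X hX =>
    image_eq_zero_of_notMem_tsupport fun h => (hX.trans_le (hr X h)).false
  obtain ⟨C, hC0, hC⟩ := exists_bound hk hc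
  obtain ⟨B, hB0, hB⟩ := hρ.comp_ballMoll_bdd hσ hS κ r
  refine tendsto_shell_average hq hσ i (r := r) (C := B * C) (fun n => ?_) (fun n X hX => ?_)
    (fun n X => ?_) fun X => ?_
  · have h1 := hS.measurable.comp ((hρ.contDiff_ballMoll hσ n).continuous.measurable.const_mul κ)
    exact h1.mul hc.measurable
  · rw [hr' X hX, mul_zero]
  · by_cases hX : ‖X‖ ≤ r
    · rw [abs_mul]; exact mul_le_mul (hB n X hX) (hC X) (abs_nonneg _) hB0
    · rw [hr' X (not_le.1 hX), mul_zero, abs_zero]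
      exact mul_nonneg hB0 hC0.le
  · exact (hρ.tendsto_comp_ballMoll hσ hS κ X).mul ((hc.tendsto X).comp tendsto_snd)

lemma LocBddFun.continuous_shell_integral (hρ : LocBddFun ρ) (hσ : 0 < σ) (n : ℕ) (i : Fin 3) :
    Continuous fun X => ∫ Z, ρ (X + Z) * pderiv i (cutoff σ n) Z := by
  have h : Continuous fun X => -(fderiv ℝ (ballMoll σ ρ n) X (EuclideanSpace.single i 1)) :=
    (((hρ.contDiff_ballMoll hσ n).continuous_fderiv one_ne_zero).clm_apply continuous_const).neg
  refine h.congr fun X => ?_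
  rw [hρ.fderiv_ballMoll hσ, neg_neg]; rfl

lemma LocBddFun.mul {p q : E → ℝ} (hp : LocBddFun p) (hq : LocBddFun q) :
    LocBddFun fun X => p X * q X := by
  refine ⟨hp.meas.mul hq.meas, fun r => ?_⟩
  obtain ⟨B, hB0, hB⟩ := hp.bdd r
  obtain ⟨C, hC0, hC⟩ := hq.bdd r
  exact ⟨B * C, by positivity, fun X hX => by
    rw [abs_mul]; exact mul_le_mul (hB X hX) (hC X hX) (abs_nonneg _) hB0⟩

lemma LocBddFun.of_continuous {q : E → ℝ} (hq : Continuous q) : LocBddFun q := by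
  refine ⟨hq.measurable, fun r => ?_⟩
  obtain ⟨C, hC⟩ := (isCompact_closedBall (0 : E) r).exists_bound_of_continuousOn hq.continuousOn
  exact ⟨|C|, abs_nonneg C, fun X hX => (hC X (by simpa using hX)).trans (le_abs_self C)⟩

lemma LocBddFun.locBdd_mul_shift {p q : E → ℝ} (hp : LocBddFun p) (hq : LocBddFun q) (σ : ℝ)
    (i : Fin 3) : LocBdd fun X α => (α : E) i * (p X * q (X - σ • (α : E))) := by
  constructor
  · have h1 : Measurable fun x : E × S2 => x.1 - σ • (x.2 : E) := by fun_prop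
    exact ((measurable_coord_sphere i).comp measurable_snd).mul
      ((hp.meas.comp measurable_fst).mul (hq.meas.comp h1))
  · intro r
    obtain ⟨B, hB0, hB⟩ := hp.bdd r
    obtain ⟨C, hC0, hC⟩ := hq.bdd (r + |σ|)
    refine ⟨1 * (B * C), by positivity, fun X α hX => ?_⟩
    rw [abs_mul, abs_mul (p X)]
    exact mul_le_mul (abs_coord_sphere_le α i) (mul_le_mul (hB X hX)
      (hC _ (norm_sub_le_of hX σ α)) (abs_nonneg _) hB0) (by positivity) zero_le_one

/-- Under `α ↦ -α` the shift `X - σα` becomes `X + σα` and the odd factor `α_i` changes sign. This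
reconciles the orientation of the surface integrals with that of the pair averages. -/
lemma LocBddFun.integral_shift_sphere {p q φ : E → ℝ} (hp : LocBddFun p) (hq : LocBddFun q) (σ : ℝ)
    (hφ : Continuous φ) (hk : HasCompactSupport φ) (i : Fin 3) :
    Integrable (fun x : S2 × E => (x.1 : E) i * (p x.2 * q (x.2 - σ • (x.1 : E))) * φ x.2)
        (solidAngle.prod volume) ∧
      ∫ x : S2 × E, (x.1 : E) i * (p x.2 * q (x.2 - σ • (x.1 : E))) * φ x.2
          ∂(solidAngle.prod volume)
        = -∫ α : S2, (α : E) i * (∫ X, p X * φ X * q (X + σ • (α : E))) ∂solidAngle := by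
  have hI := (hp.locBdd_mul_shift hq σ i).integrable_mul hφ hk 0
  simp only [zero_smul, sub_zero] at hI
  refine ⟨hI, ?_⟩
  rw [integral_prod _ hI, ← integral_neg_sphere, ← integral_neg]
  congr 1 with α
  rw [← integral_const_mul, ← integral_neg]
  congr 1 with X
  simp only [coe_neg_sphere, PiLp.neg_apply, smul_neg, sub_neg_eq_add]
  ring

/-- The normal derivative of the smoothed ball average, expressed by coordinates. -/
lemma LocBddFun.fderiv_ballMoll_eq_sum (hρ : LocBddFun ρ) (hσ : 0 < σ) (n : ℕ) (X v : E) :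
    fderiv ℝ (ballMoll σ ρ n) X v
      = -∑ i, v i * ∫ Z, ρ (X + Z) * pderiv i (cutoff σ n) Z := by
  rw [hρ.fderiv_ballMoll hσ]
  simp_rw [clm_apply_eq_sum _ v, Finset.mul_sum]
  rw [integral_finsetSum _ fun i _ => ?_]
  · congr 1
    refine Finset.sum_congr rfl fun i _ => ?_
    rw [← integral_const_mul]
    congr 1 with Z
    unfold pderiv; ring
  · have := (hρ.integrable_shift_pderiv hσ n i X).const_mul (v i)
    refine this.congr (Eventually.of_forall fun Z => ?_)
    simp only [pderiv]; ring

variable {D : Set E} {w : E → E} {d : E → ℝ}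

lemma WeakDiv.locBddFun_coord (W : WeakDiv D w d) (i : Fin 3) : LocBddFun fun X => w X i := by
  refine ⟨?_, fun r => ?_⟩
  · have : Measurable fun v : E => v i := by fun_prop
    exact this.comp W.meas_w
  · obtain ⟨C, hC0, hC⟩ := W.bdd r
    exact ⟨C, hC0, fun X hX => (abs_coord_le _ i).trans (hC X hX).1⟩

lemma WeakDiv.locBddFun_div (W : WeakDiv D w d) : LocBddFun d :=
  ⟨W.meas_d, fun r => let ⟨C, hC0, hC⟩ := W.bdd r; ⟨C, hC0, fun X hX => (hC X hX).2⟩⟩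

/-- Here the impermeable wall matters: the smoothed ball around `X` may cross `∂D`, so it is not an
interior test function and the global Gauss–Green formula `hGG` is required. -/
lemma WeakDiv.ballMoll_eq_sum (W : WeakDiv D w d) (hσ : 0 < σ)
    (hGG : ∀ k : E → ℝ, ContDiff ℝ 1 k → HasCompactSupport k →
      ∫ X, d X * k X = ∫ X, fderiv ℝ k X (w X)) (n : ℕ) (X : E) :
    ballMoll σ d n X = ∑ i, ∫ Z, w (X + Z) i * pderiv i (cutoff σ n) Z := by
  have h1 := hGG (fun Y => cutoff σ n (Y - X)) ((contDiff_cutoff σ n).comp (by fun_prop))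
    ((hasCompactSupport_cutoff hσ n).comp_homeomorph (Homeomorph.subRight X))
  rw [← integral_finsetSum _ fun i _ => (W.locBddFun_coord i).integrable_shift_pderiv hσ n i X]
  unfold ballMoll
  rw [h1, ← integral_add_left_eq_self _ X]
  congr 1 with Z
  rw [fderiv_comp_sub, add_sub_cancel_left, clm_apply_eq_sum]
  rfl

variable {φ : E → ℝ}

lemma continuous_mul_of_tsupport {φ u : E → ℝ} (hφ : Continuous φ) (hs : tsupport φ ⊆ D)
    (hD : IsOpen D) (hu : ContinuousOn u D) : Continuous fun X => φ X * u X := by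
  refine (hφ.continuousOn.mul hu).continuous_of_tsupport_subset hD ?_
  exact (tsupport_mul_subset_left).trans hs

lemma continuous_mul_coord (hφ : Continuous φ) (hs : tsupport φ ⊆ D) (hD : IsOpen D)
    (hw : ContinuousOn w D) (i : Fin 3) : Continuous fun X => φ X * w X i := by
  have h : Continuous fun v : E => v i := by fun_prop
  exact continuous_mul_of_tsupport hφ hs hD (h.comp_continuousOn hw)

/-- This is the weak equation `d = -div w` tested with `φ Φ(κ ballMoll)`, `Φ' = S`. Smoothing the
ball makes this a `C¹` function, and `φ` confines its support to `D`. -/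
lemma WeakDiv.weak_comp_ballMoll (W : WeakDiv D w d) (hρ : LocBddFun ρ) (hσ : 0 < σ)
    (hS : Continuous S) (κ : ℝ) (hφ : ContDiff ℝ 1 φ) (hk : HasCompactSupport φ)
    (hs : tsupport φ ⊆ D) (hD : IsOpen D) (hw : ContinuousOn w D) (n : ℕ) :
    (∫ X, (∫ y in (0 : ℝ)..κ * ballMoll σ ρ n X, S y) * (d X * φ X))
      - (∫ X, (∫ y in (0 : ℝ)..κ * ballMoll σ ρ n X, S y) * fderiv ℝ φ X (w X))
      + κ * ∑ i, ∫ X, (S (κ * ballMoll σ ρ n X) * (φ X * w X i))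
        * ∫ Z, ρ (X + Z) * pderiv i (cutoff σ n) Z = 0 := by
  let Φ : ℝ → ℝ := fun x => ∫ y in (0 : ℝ)..x, S y
  have hΦ : ∀ x, HasDerivAt Φ (S x) x := fun x => (hS.integral_hasStrictDerivAt 0 x).hasDerivAt
  have hΦ1 : ContDiff ℝ 1 Φ := by
    refine contDiff_one_iff_deriv.2 ⟨fun x => (hΦ x).differentiableAt, ?_⟩
    rw [funext fun x => (hΦ x).deriv]; exact hS
  have hM := hρ.contDiff_ballMoll hσ n
  have hR : ContDiff ℝ 1 fun X => κ * ballMoll σ ρ n X := contDiff_const.mul hM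
  have hk1 : ContDiff ℝ 1 fun X => φ X * Φ (κ * ballMoll σ ρ n X) := hφ.mul (hΦ1.comp hR)
  have hweak := W.weak _ hk1 hk.mul_right ((tsupport_mul_subset_left).trans hs)
  have hfd : ∀ X v, fderiv ℝ (fun X => φ X * Φ (κ * ballMoll σ ρ n X)) X v
      = Φ (κ * ballMoll σ ρ n X) * fderiv ℝ φ X v
        - κ * ∑ i, (S (κ * ballMoll σ ρ n X) * (φ X * v i))
          * ∫ Z, ρ (X + Z) * pderiv i (cutoff σ n) Z := by
    intro X v
    have h1 : HasFDerivAt (fun X => κ * ballMoll σ ρ n X) (κ • fderiv ℝ (ballMoll σ ρ n) X) X :=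
      ((hM.differentiable one_ne_zero X).hasFDerivAt).const_mul κ
    have h2 : HasFDerivAt (fun X => φ X * Φ (κ * ballMoll σ ρ n X)) _ X :=
      (hφ.differentiable one_ne_zero X).hasFDerivAt.mul ((hΦ _).comp_hasFDerivAt X h1)
    have h3 := hρ.fderiv_ballMoll_eq_sum hσ n X v
    rw [h2.fderiv]
    simp only [_root_.add_apply, _root_.smul_apply, smul_eq_mul, h3]
    have h4 : ∑ i, (S (κ * ballMoll σ ρ n X) * (φ X * v i))
          * ∫ Z, ρ (X + Z) * pderiv i (cutoff σ n) Z = S (κ * ballMoll σ ρ n X) * φ X *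
          ∑ i, v i * ∫ Z, ρ (X + Z) * pderiv i (cutoff σ n) Z := by
      rw [Finset.mul_sum]
      exact Finset.sum_congr rfl fun i _ => by ring
    rw [h4]; ring
  have hC : ∀ i, Integrable fun X => (S (κ * ballMoll σ ρ n X) * (φ X * w X i))
        * ∫ Z, ρ (X + Z) * pderiv i (cutoff σ n) Z := by
    intro i
    have h1 : Continuous fun X => φ X * w X i :=
      continuous_mul_coord hφ.continuous hs hD hw i
    have h2 := hρ.continuous_shell_integral hσ n i
    exact (((hS.comp hR.continuous).mul h1).mul h2).integrable_of_hasCompactSupport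
      (hk.mul_right.mul_left.mul_right)
  have hA : Integrable fun X => Φ (κ * ballMoll σ ρ n X) * (d X * φ X) :=
    (W.integrable_mul hk1.continuous hk.mul_right).congr (Eventually.of_forall fun X => by ring)
  have hC' : Integrable fun X => κ * ∑ i, (S (κ * ballMoll σ ρ n X) * (φ X * w X i))
        * ∫ Z, ρ (X + Z) * pderiv i (cutoff σ n) Z :=
    (integrable_finsetSum _ fun i _ => hC i).const_mul κ
  have hB : Integrable fun X => Φ (κ * ballMoll σ ρ n X) * fderiv ℝ φ X (w X) := by
    refine ((hA.add hC').sub (W.integrable_defect hk1 hk.mul_right)).congr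
      (Eventually.of_forall fun X => ?_)
    simp only [Pi.add_apply, Pi.sub_apply]
    rw [hfd]; ring
  simp_rw [hfd] at hweak
  have hAB : Integrable fun X => Φ (κ * ballMoll σ ρ n X) * (d X * φ X)
      - Φ (κ * ballMoll σ ρ n X) * fderiv ℝ φ X (w X) := hA.sub hB
  rw [← integral_finsetSum _ fun i _ => hC i, ← integral_const_mul, ← integral_sub hA hB,
    ← integral_add hAB hC', ← hweak]
  congr 1 with X
  ring

/-- The weak form of the chain rule `∂ₜ(Φ(R) ρ)`, where `R` is the average of `ρ` over balls and
`∂ₜρ = d = -div w`; the variation of `R` is turned into a surface integral. -/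
lemma WeakDiv.weak_chain_rule (W : WeakDiv D w d) (hρ : LocBddFun ρ) (hσ : 0 < σ)
    (hGG : ∀ k : E → ℝ, ContDiff ℝ 1 k → HasCompactSupport k →
      ∫ X, d X * k X = ∫ X, fderiv ℝ k X (w X))
    (hS : Continuous S) (κ : ℝ) (hφ : ContDiff ℝ 1 φ) (hk : HasCompactSupport φ)
    (hs : tsupport φ ⊆ D) (hD : IsOpen D) (hw : ContinuousOn w D) (hρc : ContinuousOn ρ D) :
    (∫ X, (∫ y in (0 : ℝ)..κ * ballInt σ ρ X, S y) * (d X * φ X))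
      - (∫ X, (∫ y in (0 : ℝ)..κ * ballInt σ ρ X, S y) * fderiv ℝ φ X (w X))
      + (∫ X, S (κ * ballInt σ ρ X) * (φ X * ρ X * (κ * ballInt σ d X)))
      = -(κ * σ ^ 2 * ∫ q : S2 × E, (S (κ * ballInt σ ρ q.2)
          * inner ℝ (ρ (q.2 - σ • (q.1 : E)) • w q.2 - ρ q.2 • w (q.2 - σ • (q.1 : E))) (q.1 : E))
          * φ q.2 ∂(solidAngle.prod volume)) := by
  obtain ⟨r, -, hr⟩ := exists_radius hk
  have hr' : ∀ X, r < ‖X‖ → X ∉ tsupport φ := fun X hX h => (hX.trans_le (hr X h)).false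
  have hd := W.locBddFun_div
  have hcw := continuous_mul_coord hφ.continuous hs hD hw
  have hcρ : Continuous fun X => φ X * ρ X := continuous_mul_of_tsupport hφ.continuous hs hD hρc
  have hΦc : Continuous fun x => ∫ y in (0 : ℝ)..x, S y :=
    intervalIntegral.continuous_primitive (fun a b => hS.intervalIntegrable a b) 0
  -- limits of the two identities
  have l1 : Tendsto (fun n => ∫ X, (∫ y in (0 : ℝ)..κ * ballMoll σ ρ n X, S y) * (d X * φ X)) atTop
      (𝓝 (∫ X, (∫ y in (0 : ℝ)..κ * ballInt σ ρ X, S y) * (d X * φ X))) := by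
    obtain ⟨C, -, hC⟩ := W.bound_mul hφ.continuous hk
    exact hρ.tendsto_comp_ballMoll_mul hσ hΦc κ (h := fun _ X => d X * φ X)
      (fun _ => W.meas_d.mul hφ.continuous.measurable) (r := r) (C := C)
      (fun _ X hX => by rw [image_eq_zero_of_notMem_tsupport (hr' X hX), mul_zero])
      (fun _ => hC) fun X => tendsto_const_nhds
  have l2 : Tendsto (fun n => ∫ X, (∫ y in (0 : ℝ)..κ * ballMoll σ ρ n X, S y)
      * fderiv ℝ φ X (w X)) atTop
      (𝓝 (∫ X, (∫ y in (0 : ℝ)..κ * ballInt σ ρ X, S y) * fderiv ℝ φ X (w X))) := by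
    obtain ⟨C, -, hC⟩ := W.bound_fderiv hφ hk
    exact hρ.tendsto_comp_ballMoll_mul hσ hΦc κ (h := fun _ X => fderiv ℝ φ X (w X))
      (fun _ => W.measurable_fderiv_apply hφ) (r := r) (C := C)
      (fun _ X hX => by rw [fderiv_of_notMem_tsupport (𝕜 := ℝ) (hr' X hX)]; rfl)
      (fun _ => hC) fun X => tendsto_const_nhds
  have l3 : ∀ i, _ := fun i =>
    hρ.tendsto_comp_shell hσ hS κ (c := fun X => φ X * w X i) hρ (hcw i) hk.mul_right i
  have l4 : ∀ i, _ := fun i =>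
    hρ.tendsto_comp_shell hσ hS κ (c := fun X => φ X * ρ X) (W.locBddFun_coord i) hcρ hk.mul_right i
  have l5 : Tendsto (fun n => ∫ X, S (κ * ballMoll σ ρ n X)
      * (φ X * ρ X * (κ * ballMoll σ d n X))) atTop
      (𝓝 (∫ X, S (κ * ballInt σ ρ X) * (φ X * ρ X * (κ * ballInt σ d X)))) := by
    obtain ⟨C, hC0, hC⟩ := exists_bound hk.mul_right hcρ
    obtain ⟨B, hB0, hB⟩ := hd.ballMoll_bdd hσ r
    refine hρ.tendsto_comp_ballMoll_mul hσ hS κ (r := r) (C := C * (|κ| * B)) (fun n => ?_)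
      (fun n X hX => ?_) (fun n X => ?_) fun X => ?_
    · exact hcρ.measurable.mul ((hd.contDiff_ballMoll hσ n).continuous.measurable.const_mul κ)
    · rw [image_eq_zero_of_notMem_tsupport (hr' X hX), zero_mul, zero_mul]
    · by_cases hX : ‖X‖ ≤ r
      · rw [abs_mul, abs_mul κ]
        exact mul_le_mul (hC X) (mul_le_mul_of_nonneg_left (hB n X hX) (abs_nonneg κ))
          (by positivity) hC0.le
      · rw [image_eq_zero_of_notMem_tsupport (hr' X (not_le.1 hX)), zero_mul, zero_mul, abs_zero]
        positivity
    · have h1 : Tendsto (fun n : ℕ => (n, X)) atTop (atTop ×ˢ 𝓝 X) :=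
        tendsto_id.prodMk tendsto_const_nhds
      have h2 := (hd.tendsto_ballMoll hσ X).comp h1
      exact (h2.const_mul κ).const_mul _
  -- The first limit contains the surface integral coming from the gradient of the ball average of
  -- `ρ`; `e2` gives the one coming from its rate of change, through `ballMoll_eq_sum`.
  have e1 := tendsto_nhds_unique ((l1.sub l2).add
    ((tendsto_finsetSum Finset.univ fun i _ => l3 i).const_mul κ))
    (tendsto_const_nhds.congr fun n =>
      (W.weak_comp_ballMoll hρ hσ hS κ hφ hk hs hD hw n).symm)
  have e2 := tendsto_nhds_unique l5 (((tendsto_finsetSum Finset.univ fun i _ => l4 i).const_mul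
    κ).congr fun n => ?_)
  · rw [e2]
    -- The two surface integrals differ by an interchange of `ρ` and `w`, so together they form the
    -- antisymmetric bracket.
    have e3 : ∫ q : S2 × E, (S (κ * ballInt σ ρ q.2)
          * inner ℝ (ρ (q.2 - σ • (q.1 : E)) • w q.2 - ρ q.2 • w (q.2 - σ • (q.1 : E))) (q.1 : E))
          * φ q.2 ∂(solidAngle.prod volume)
        = ∑ i, ((∫ α : S2, (α : E) i * (∫ X, (S (κ * ballInt σ ρ X) * (φ X * ρ X))
            * w (X + σ • (α : E)) i) ∂solidAngle)
          - ∫ α : S2, (α : E) i * (∫ X, (S (κ * ballInt σ ρ X) * (φ X * w X i))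
            * ρ (X + σ • (α : E))) ∂solidAngle) := by
      have hSR : LocBddFun fun X => S (κ * ballInt σ ρ X) :=
        LocBddFun.of_continuous (hS.comp ((hρ.continuous_ballInt σ).const_mul κ))
      have t1 := fun i => (hSR.mul hρ).integral_shift_sphere (W.locBddFun_coord i) σ
        hφ.continuous hk i
      have t2 := fun i => (hSR.mul (W.locBddFun_coord i)).integral_shift_sphere hρ σ
        hφ.continuous hk i
      have i1 : ∀ i, ∫ α : S2, (α : E) i * (∫ X, (S (κ * ballInt σ ρ X) * (φ X * ρ X))
          * w (X + σ • (α : E)) i) ∂solidAngle = _ := fun i => Eq.trans (by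
            congr 1 with α; congr 2 with X; ring) (neg_eq_iff_eq_neg.2 (t1 i).2).symm
      have i2 : ∀ i, ∫ α : S2, (α : E) i * (∫ X, (S (κ * ballInt σ ρ X) * (φ X * w X i))
          * ρ (X + σ • (α : E))) ∂solidAngle = _ := fun i => Eq.trans (by
            congr 1 with α; congr 2 with X; ring) (neg_eq_iff_eq_neg.2 (t2 i).2).symm
      simp_rw [i1, i2]
      rw [Finset.sum_congr rfl fun i _ => (neg_sub_neg _ _).trans
        (integral_sub (t2 i).1 (t1 i).1).symm,
        ← integral_finsetSum (f := fun i (q : S2 × E) =>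
          (q.1 : E) i * (S (κ * ballInt σ ρ q.2) * w q.2 i * ρ (q.2 - σ • (q.1 : E))) * φ q.2
          - (q.1 : E) i * (S (κ * ballInt σ ρ q.2) * ρ q.2 * w (q.2 - σ • (q.1 : E)) i) * φ q.2)
          _ fun i _ => (t2 i).1.sub (t1 i).1]
      congr 1 with q
      rw [inner_coord, Finset.mul_sum, Finset.sum_mul]
      refine Finset.sum_congr rfl fun i _ => ?_
      simp only [PiLp.sub_apply, PiLp.smul_apply, smul_eq_mul]
      ring
    rw [e3]
    simp only [Finset.sum_sub_distrib, Finset.sum_neg_distrib, ← Finset.mul_sum] at e1 ⊢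
    linear_combination e1
  · have hc := fun i => (W.locBddFun_coord i).continuous_shell_integral hσ n i
    have hSR : Continuous fun X => S (κ * ballMoll σ ρ n X) :=
      hS.comp ((hρ.contDiff_ballMoll hσ n).continuous.const_mul κ)
    have hI : ∀ i, Integrable fun X => S (κ * ballMoll σ ρ n X) * (φ X * ρ X)
        * ∫ Z, w (X + Z) i * pderiv i (cutoff σ n) Z := fun i =>
      ((hSR.mul hcρ).mul (hc i)).integrable_of_hasCompactSupport
        (hk.mul_right.mul_left.mul_right)
    rw [← integral_finsetSum _ fun i _ => hI i, ← integral_const_mul]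
    congr 1 with X
    rw [W.ballMoll_eq_sum hσ hGG, ← Finset.mul_sum]
    ring

end chain

end

end EESM

namespace EESM

noncomputable section

/-! ### Functions of position and velocity on a domain -/

/-- Continuity on `D × ℝ³` and rapid decay in the velocity, uniformly on bounded subsets of `D`. -/
structure RapidOn (D : Set E) (F : E → E → ℝ) : Prop where
  cont : ContinuousOn (fun p : E × E => F p.1 p.2) (D ×ˢ univ)
  decay : ∀ (r : ℝ) (k : ℕ), ∃ C : ℝ, 0 ≤ C ∧ ∀ X ∈ D, ‖X‖ ≤ r → ∀ ξ, wt ξ ^ k * |F X ξ| ≤ C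

/-- Continuity on `D × ℝ³` and polynomial growth in the velocity, uniformly on bounded subsets
of `D`. -/
structure PolyOn (D : Set E) (ψ : E → E → ℝ) : Prop where
  cont : ContinuousOn (fun p : E × E => ψ p.1 p.2) (D ×ˢ univ)
  growth : ∀ r : ℝ, ∃ (C : ℝ) (k : ℕ), 0 ≤ C ∧ ∀ X ∈ D, ‖X‖ ≤ r → ∀ ξ, |ψ X ξ| ≤ C * wt ξ ^ k

/-- Extension by zero off `D`. -/
def ext (D : Set E) (F : E → E → ℝ) (X ξ : E) : ℝ := D.indicator (fun Y => F Y ξ) X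

section ext

variable {D D' : Set E} {F F' ψ ψ' : E → E → ℝ}

lemma ext_of_mem {X : E} (hX : X ∈ D) (F : E → E → ℝ) (ξ : E) : ext D F X ξ = F X ξ :=
  indicator_of_mem hX _

lemma ext_of_notMem {X : E} (hX : X ∉ D) (F : E → E → ℝ) (ξ : E) : ext D F X ξ = 0 :=
  indicator_of_notMem hX _

lemma measurable_ext (hD : IsOpen D)
    (hF : ContinuousOn (fun p : E × E => F p.1 p.2) (D ×ˢ univ)) :
    Measurable fun p : E × E => ext D F p.1 p.2 := by
  classical
  have h := hF.measurable_piecewise (g := fun _ => (0 : ℝ)) continuousOn_const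
    (hD.measurableSet.prod MeasurableSet.univ)
  convert h using 1
  ext p
  by_cases hp : p.1 ∈ D
  · rw [ext_of_mem hp, piecewise_eq_of_mem _ _ _ (by simpa using hp)]
  · rw [ext_of_notMem hp, piecewise_eq_of_notMem _ _ _ (by simpa using hp)]

lemma measurable_indicator_of_continuousOn (hD : IsOpen D) {q : E → ℝ} (hq : ContinuousOn q D) :
    Measurable (D.indicator q) := by
  classical
  rw [← piecewise_eq_indicator]
  exact hq.measurable_piecewise (g := fun _ => (0 : ℝ)) continuousOn_const hD.measurableSet

lemma PolyOn.mono (h : PolyOn D ψ) (hD : D' ⊆ D) : PolyOn D' ψ :=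
  ⟨h.cont.mono (prod_mono_left hD), fun r => by
    obtain ⟨C, k, h0, hC⟩ := h.growth r
    exact ⟨C, k, h0, fun X hX => hC X (hD hX)⟩⟩

lemma PolyOn.of_velocity (D : Set E) {u : E → ℝ} (hu : Continuous u) {C : ℝ} {k : ℕ} (hC0 : 0 ≤ C)
    (hC : ∀ ξ, |u ξ| ≤ C * wt ξ ^ k) : PolyOn D fun _ ξ => u ξ :=
  ⟨(hu.comp continuous_snd).continuousOn, fun _ => ⟨C, k, hC0, fun _ _ _ ξ => hC ξ⟩⟩

lemma polyOn_const (D : Set E) (c : ℝ) : PolyOn D fun _ _ => c :=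
  PolyOn.of_velocity D continuous_const (C := |c|) (k := 0) (abs_nonneg c) (by simp)

lemma polyOn_coord (D : Set E) (i : Fin 3) : PolyOn D fun _ ξ => ξ i :=
  PolyOn.of_velocity D (by fun_prop) (C := 1) (k := 1) zero_le_one fun ξ => by
    rw [one_mul, pow_one]; exact (abs_coord_le ξ i).trans (norm_le_wt ξ)

lemma polyOn_norm_sq (D : Set E) : PolyOn D fun _ ξ => ‖ξ‖ ^ 2 / 2 :=
  PolyOn.of_velocity D (by fun_prop) (C := 1) (k := 2) zero_le_one fun ξ => by
    rw [one_mul, abs_of_nonneg (by positivity)]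
    have := pow_le_pow_left₀ (norm_nonneg ξ) (norm_le_wt ξ) 2
    nlinarith [sq_nonneg ‖ξ‖]

lemma PolyOn.add (h : PolyOn D ψ) (h' : PolyOn D ψ') : PolyOn D fun X ξ => ψ X ξ + ψ' X ξ := by
  refine ⟨h.cont.add h'.cont, fun r => ?_⟩
  obtain ⟨C, k, hC0, hC⟩ := h.growth r
  obtain ⟨C', k', hC0', hC'⟩ := h'.growth r
  refine ⟨C + C', k + k', by positivity, fun X hX hr ξ => (abs_add_le _ _).trans ?_⟩
  have h1 : wt ξ ^ k ≤ wt ξ ^ (k + k') := pow_le_pow_right₀ (one_le_wt ξ) (by omega)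
  have h2 : wt ξ ^ k' ≤ wt ξ ^ (k + k') := pow_le_pow_right₀ (one_le_wt ξ) (by omega)
  rw [add_mul]
  exact add_le_add ((hC X hX hr ξ).trans (mul_le_mul_of_nonneg_left h1 hC0))
    ((hC' X hX hr ξ).trans (mul_le_mul_of_nonneg_left h2 hC0'))

lemma PolyOn.mul (h : PolyOn D ψ) (h' : PolyOn D ψ') : PolyOn D fun X ξ => ψ X ξ * ψ' X ξ := by
  refine ⟨h.cont.mul h'.cont, fun r => ?_⟩
  obtain ⟨C, k, hC0, hC⟩ := h.growth r
  obtain ⟨C', k', hC0', hC'⟩ := h'.growth r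
  refine ⟨C * C', k + k', by positivity, fun X hX hr ξ => ?_⟩
  rw [abs_mul, pow_add, mul_mul_mul_comm]
  exact mul_le_mul (hC X hX hr ξ) (hC' X hX hr ξ) (abs_nonneg _)
    (mul_nonneg hC0 (pow_pos (wt_pos ξ) k).le)

lemma PolyOn.mul_rapidOn (h : PolyOn D ψ) (hF : RapidOn D F) : RapidOn D fun X ξ => ψ X ξ * F X ξ := by
  refine ⟨h.cont.mul hF.cont, fun r k => ?_⟩
  obtain ⟨C, l, hC0, hC⟩ := h.growth r
  obtain ⟨C', hC0', hC'⟩ := hF.decay r (k + l)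
  refine ⟨C * C', by positivity, fun X hX hr ξ => ?_⟩
  have hw := wt_pos ξ
  calc wt ξ ^ k * |ψ X ξ * F X ξ| = |ψ X ξ| * (wt ξ ^ k * |F X ξ|) := by rw [abs_mul]; ring
    _ ≤ C * wt ξ ^ l * (wt ξ ^ k * |F X ξ|) :=
      mul_le_mul_of_nonneg_right (hC X hX hr ξ) (by positivity)
    _ = C * (wt ξ ^ (k + l) * |F X ξ|) := by rw [pow_add]; ring
    _ ≤ C * C' := mul_le_mul_of_nonneg_left (hC' X hX hr ξ) hC0

lemma PolyOn.velGrowth (hD : IsOpen D) (h : PolyOn D ψ) : VelGrowth (ext D ψ) := by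
  refine ⟨measurable_ext hD h.cont, fun r => ?_⟩
  obtain ⟨C, k, hC0, hC⟩ := h.growth r
  refine ⟨C, k, hC0, fun X ξ hr => ?_⟩
  by_cases hX : X ∈ D
  · rw [ext_of_mem hX]; exact hC X hX hr ξ
  · rw [ext_of_notMem hX, abs_zero]; have := wt_pos ξ; positivity

lemma continuous_velocity {X : E} (hX : X ∈ D)
    (h : ContinuousOn (fun p : E × E => F p.1 p.2) (D ×ˢ univ)) : Continuous (F X) := by
  have h1 : Continuous fun ξ : E => (X, ξ) := by fun_prop
  exact continuousOn_univ.1 (h.comp h1.continuousOn fun ξ _ => ⟨hX, mem_univ ξ⟩)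

lemma RapidOn.integrable (h : RapidOn D F) {X : E} (hX : X ∈ D) : Integrable (F X) := by
  obtain ⟨C, -, hC⟩ := h.decay ‖X‖ 4
  exact integrable_of_wt (continuous_velocity hX h.cont).aestronglyMeasurable
    (hC X hX le_rfl)

lemma norm_le_of_wt {x C : ℝ} {ξ : E} (h : wt ξ ^ 4 * |x| ≤ C) : ‖x‖ ≤ C * (wt ξ ^ 4)⁻¹ := by
  have := wt_pos ξ
  rw [Real.norm_eq_abs, ← div_eq_mul_inv, le_div_iff₀ (by positivity), mul_comm]
  exact h

lemma RapidOn.continuousOn_integral (h : RapidOn D F) : ContinuousOn (fun X => ∫ ξ, F X ξ) D := by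
  intro X hX
  obtain ⟨C, -, hC⟩ := h.decay (‖X‖ + 1) 4
  refine continuousWithinAt_of_dominated (bound := fun ξ => C * (wt ξ ^ 4)⁻¹) ?_ ?_
    (integrable_wt.const_mul C) (Eventually.of_forall fun ξ => ?_)
  · filter_upwards [self_mem_nhdsWithin] with Y hY
    exact (h.integrable hY).aestronglyMeasurable
  · filter_upwards [self_mem_nhdsWithin, mem_nhdsWithin_of_mem_nhds
      (continuous_norm.continuousAt.eventually (gt_mem_nhds (by linarith : ‖X‖ < ‖X‖ + 1)))]
      with Y hY hYr
    exact Eventually.of_forall fun ξ => norm_le_of_wt (hC Y hY (le_of_lt hYr) ξ)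
  · have h1 : Continuous fun Y : E => (Y, ξ) := by fun_prop
    exact (h.cont.comp h1.continuousOn fun Y hY => ⟨hY, mem_univ ξ⟩) X hX

lemma RapidOn.locBddFun_integral (hD : IsOpen D) (h : RapidOn D F) :
    LocBddFun (D.indicator fun X => ∫ ξ, F X ξ) := by
  refine ⟨measurable_indicator_of_continuousOn hD h.continuousOn_integral, fun r => ?_⟩
  obtain ⟨C, hC0, hC⟩ := h.decay r 4
  refine ⟨∫ ξ, C * (wt ξ ^ 4)⁻¹,
    integral_nonneg fun ξ => by have := wt_pos ξ; positivity, fun X hX => ?_⟩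
  by_cases hXD : X ∈ D
  · rw [indicator_of_mem hXD]
    exact norm_integral_le_of_norm_le (integrable_wt.const_mul C)
      (Eventually.of_forall fun ξ => norm_le_of_wt (hC X hXD hX ξ))
  · rw [indicator_of_notMem hXD, abs_zero]
    exact integral_nonneg fun ξ => by have := wt_pos ξ; positivity

lemma RapidOn.integrable_test (hD : IsOpen D) (h : RapidOn D F) {φ : E → ℝ} (hφ : Continuous φ)
    (hk : HasCompactSupport φ) (hs : tsupport φ ⊆ D) :
    Integrable (fun p : E × E => φ p.1 * F p.1 p.2) (volume.prod volume) := by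
  obtain ⟨r, -, hr⟩ := exists_radius hk
  obtain ⟨M, hM0, hM⟩ := exists_bound hk hφ
  obtain ⟨C, hC0, hC⟩ := h.decay r 4
  have he : (fun p : E × E => φ p.1 * F p.1 p.2) = fun p => φ p.1 * ext D F p.1 p.2 := by
    ext p
    by_cases hp : p.1 ∈ tsupport φ
    · rw [ext_of_mem (hs hp)]
    · rw [image_eq_zero_of_notMem_tsupport hp, zero_mul, zero_mul]
  have hb := (integrable_indicator_closedBall M r).mul_prod (integrable_wt.const_mul C)
  refine hb.mono' ?_ (Eventually.of_forall fun p => ?_)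
  · rw [he]
    exact ((hφ.measurable.comp measurable_fst).mul (measurable_ext hD h.cont)).aestronglyMeasurable
  · by_cases hp : p.1 ∈ tsupport φ
    · rw [indicator_of_mem (by simpa using hr _ hp), norm_mul]
      exact mul_le_mul (hM _) (norm_le_of_wt (hC _ (hs hp) (hr _ hp) _)) (norm_nonneg _) hM0.le
    · rw [image_eq_zero_of_notMem_tsupport hp, zero_mul, norm_zero]
      have := wt_pos p.2
      exact mul_nonneg (indicator_nonneg (fun _ _ => hM0.le) _) (by positivity)

lemma RapidOn.kinetic (hD : IsOpen D) (h : RapidOn D F) (hpos : ∀ X ∈ D, ∀ ξ, 0 < F X ξ) :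
    Kinetic D (ext D F) where
  meas := measurable_ext hD h.cont
  pos X hX ξ := by rw [ext_of_mem hX]; exact hpos X hX ξ
  zero_off X hX ξ := ext_of_notMem hX F ξ
  decay r k := by
    obtain ⟨C, hC0, hC⟩ := h.decay r k
    refine ⟨C, hC0, fun X hr ξ => ?_⟩
    by_cases hX : X ∈ D
    · rw [ext_of_mem hX, ← abs_of_pos (hpos X hX ξ)]; exact hC X hX hr ξ
    · rw [ext_of_notMem hX, mul_zero]; exact hC0

lemma density_ext (D : Set E) (F : E → E → ℝ) : density (ext D F) = D.indicator (density F) := by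
  ext X
  by_cases hX : X ∈ D
  · rw [indicator_of_mem hX]; unfold density; simp_rw [ext_of_mem hX]
  · rw [indicator_of_notMem hX]; unfold density; simp_rw [ext_of_notMem hX]; simp

lemma momentum_ext (D : Set E) (F : E → E → ℝ) : momentum (ext D F) = D.indicator (momentum F) := by
  ext1 X
  by_cases hX : X ∈ D
  · rw [indicator_of_mem hX]; unfold momentum; simp_rw [ext_of_mem hX]
  · rw [indicator_of_notMem hX]; unfold momentum; simp_rw [ext_of_notMem hX]; simp

lemma RapidOn.integrable_smul (h : RapidOn D F) {X : E} (hX : X ∈ D) :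
    Integrable fun ξ => F X ξ • ξ := by
  have h1 := (PolyOn.of_velocity D continuous_norm (C := 1) (k := 1) zero_le_one
    (fun ξ => by rw [abs_norm, one_mul, pow_one]; exact norm_le_wt ξ)).mul_rapidOn h
  refine (h1.integrable hX).norm.mono'
    ((continuous_velocity hX h.cont).smul continuous_id).aestronglyMeasurable
    (Eventually.of_forall fun ξ => ?_)
  rw [norm_smul, norm_mul, norm_norm, mul_comm]

lemma RapidOn.momentum_coord (h : RapidOn D F) {X : E} (hX : X ∈ D) (i : Fin 3) :
    momentum F X i = ∫ ξ, ξ i * F X ξ := by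
  have h1 := ContinuousLinearMap.integral_comp_comm (EuclideanSpace.proj (𝕜 := ℝ) i : E →L[ℝ] ℝ)
    (h.integrable_smul hX)
  rw [momentum]
  refine (Eq.trans ?_ h1).symm
  congr 1 with ξ
  simp [mul_comm]

end ext

end

end EESM

namespace EESM

noncomputable section

/-! ### The solution at a frozen time -/

/-- A positive distribution function `h` and its time derivative `dh` at an instant, solving the
Enskog equation. -/
structure Snapshot (G : Gas) (h dh : E → E → ℝ) : Prop where
  isOpen : IsOpen G.D
  pos : ∀ X ∈ G.D, ∀ ξ, 0 < h X ξ
  rapid : RapidOn G.D h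
  rapid_dt : RapidOn G.D dh
  poly_log : PolyOn G.D fun X ξ => Real.log (h X ξ)
  diff : ∀ X ∈ G.D, ∀ ξ, DifferentiableAt ℝ (fun Y => h Y ξ) X
  rapid_dX : ∀ D' : Set E, IsCompact (closure D') → closure D' ⊆ G.D →
    RapidOn D' fun X ξ => fderiv ℝ (fun Y => h Y ξ) X ξ
  eqn : ∀ X ∈ G.D, ∀ ξ, dh X ξ + fderiv ℝ (fun Y => h Y ξ) X ξ = G.collision h X ξ
  kernel : IsKernel G.D (G.g h)

namespace Snapshot

variable {G : Gas} {h dh β ψ : E → E → ℝ} {φ : E → ℝ}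

lemma kinetic (P : Snapshot G h dh) : Kinetic G.D (ext G.D h) := P.rapid.kinetic P.isOpen P.pos

lemma integral_fderiv_mul (hβ : RapidOn G.D β) (hs : tsupport φ ⊆ G.D) (X : E) :
    ∫ ξ, fderiv ℝ φ X ξ * β X ξ = ∑ i, (∫ ξ, ξ i * β X ξ) * pderiv i φ X := by
  by_cases hX : X ∈ tsupport φ
  · simp_rw [← integral_mul_const]
    rw [← integral_finsetSum _ fun i _ =>
      (((polyOn_coord G.D i).mul_rapidOn hβ).integrable (hs hX)).mul_const _]
    congr 1 with ξ
    rw [clm_apply_eq_sum, Finset.sum_mul]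
    exact Finset.sum_congr rfl fun i _ => by unfold pderiv; ring
  · have h0 : fderiv ℝ φ X = 0 := fderiv_of_notMem_tsupport (𝕜 := ℝ) hX
    simp [pderiv, h0]

/-- Integration by parts in the transport term. -/
lemma transport (P : Snapshot G h dh) (hβ : RapidOn G.D β) (hψ : PolyOn G.D ψ)
    (hd : ∀ X ∈ G.D, ∀ ξ,
      HasFDerivAt (fun Y => β Y ξ) (ψ X ξ • fderiv ℝ (fun Y => h Y ξ) X) X)
    (hφ : ContDiff ℝ 1 φ) (hk : HasCompactSupport φ) (hs : tsupport φ ⊆ G.D) :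
    ∫ X, φ X * ∫ ξ, ψ X ξ * fderiv ℝ (fun Y => h Y ξ) X ξ
      = -∫ X, ∑ i, (∫ ξ, ξ i * β X ξ) * pderiv i φ X := by
  -- The decay of the spatial gradient is uniform only on compact subsets of `D`, so the domain is
  -- shrunk to a relatively compact neighbourhood of the support.
  obtain ⟨D', hD', hsD, hcD, hcc⟩ := exists_open_between_and_isCompact_closure hk.isCompact P.isOpen hs
  have hF := (hψ.mono (subset_closure.trans hcD)).mul_rapidOn (P.rapid_dX D' hcc hcD)
  have h1 := hF.integrable_test hD' hφ.continuous hk hsD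
  have h2 : Integrable (fun p : E × E => fderiv ℝ φ p.1 p.2 * β p.1 p.2) (volume.prod volume) := by
    have h3 : ∀ i : Fin 3, Integrable
        (fun p : E × E => pderiv i φ p.1 * (p.2 i * β p.1 p.2)) (volume.prod volume) := by
      intro i
      have hc : Continuous (pderiv i φ) :=
        (hφ.continuous_fderiv one_ne_zero).clm_apply continuous_const
      have hk' : HasCompactSupport (pderiv i φ) := hk.fderiv_apply (𝕜 := ℝ) _
      exact ((polyOn_coord G.D i).mul_rapidOn hβ).integrable_test P.isOpen hc hk'
        ((tsupport_fderiv_apply_subset ℝ _).trans hs)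
    refine (integrable_finsetSum Finset.univ fun i _ => h3 i).congr (Eventually.of_forall fun p => ?_)
    simp only
    rw [clm_apply_eq_sum, Finset.sum_mul]
    exact Finset.sum_congr rfl fun i _ => by unfold pderiv; ring
  have h3 := hβ.integrable_test P.isOpen hφ.continuous hk hs
  simp_rw [← integral_fderiv_mul hβ hs, ← integral_const_mul]
  -- With the velocity integral outermost, `ξ` is a fixed direction and the transport term is a
  -- directional derivative in `X`, which is integrated by parts.
  rw [integral_integral_swap (f := fun X ξ : E => φ X * (ψ X ξ * fderiv ℝ (fun Y => h Y ξ) X ξ)) h1,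
    integral_integral_swap (f := fun X ξ : E => fderiv ℝ φ X ξ * β X ξ) h2, ← integral_neg]
  refine integral_congr_ae ?_
  filter_upwards [h1.prod_left_ae, h2.prod_left_ae, h3.prod_left_ae] with ξ i1 i2 i3
  have he : ∀ X, φ X * (ψ X ξ * fderiv ℝ (fun Y => h Y ξ) X ξ)
      = φ X * fderiv ℝ (fun Y => β Y ξ) X ξ := by
    intro X
    by_cases hX : X ∈ tsupport φ
    · rw [(hd X (hs hX) ξ).fderiv]; simp
    · rw [image_eq_zero_of_notMem_tsupport hX, zero_mul, zero_mul]
  simp only [he] at i1 ⊢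
  exact integral_mul_fderiv_eq_neg_fderiv_mul_of_integrable i2 i1 i3
    (fun X _ => hφ.differentiable one_ne_zero X)
    (fun X hX => (hd X (hs hX) ξ).differentiableAt)

/-- Nothing is assumed about `h` outside `D`. The kernel vanishes there, so `h` may be replaced by
its zero extension and the weak form for measurable `f` applies. -/
lemma weak_collision_eq (P : Snapshot G h dh) {Ψ : E → E → ℝ} (hΨ : VelGrowth Ψ) {X : E}
    (hX : X ∈ G.D) :
    Integrable (fun ξ => Ψ X ξ * G.collision h X ξ) ∧ ∫ ξ, Ψ X ξ * G.collision h X ξ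
      = G.σ ^ 2 / G.m
        * ∫ α : S2, pairInt G.σ (G.g h) (ext G.D h) (gainLoss Ψ) X α ∂solidAngle := by
  obtain ⟨h1, h2⟩ := weak_collision hΨ P.kernel P.kinetic G.σ X
  have hg : ∀ (Y : E) (ξ : E), G.g h Y X * ext G.D h Y ξ = G.g h Y X * h Y ξ := by
    intro Y ξ
    by_cases hY : Y ∈ G.D
    · rw [ext_of_mem hY]
    · rw [P.kernel.zero_off Y X hY, zero_mul, zero_mul]
  simp only [hg, ext_of_mem hX] at h1 h2
  have he : ∀ ξ, Ψ X ξ * G.collision h X ξ = G.σ ^ 2 / G.m * (Ψ X ξ *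
      ((∫ α : S2, (∫ ξs : E, G.g h (X + G.σ • (α : E)) X
            * h (X + G.σ • (α : E)) (postStar α ξ ξs) * h X (post α ξ ξs)
            * relV α ξ ξs * theta (relV α ξ ξs)) ∂solidAngle)
        - ∫ α : S2, (∫ ξs : E, G.g h (X - G.σ • (α : E)) X
            * h (X - G.σ • (α : E)) ξs * h X ξ
            * relV α ξ ξs * theta (relV α ξ ξs)) ∂solidAngle)) := by
    intro ξ
    unfold Gas.collision Gas.gain Gas.loss
    ring
  simp_rw [he]
  exact ⟨h1.const_mul _, by rw [integral_const_mul, h2]⟩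

/-- The general moment balance behind both conservation of mass and the kinetic free energy: the
relation `∇β = ψ ∇h` in `hd` turns the weighted transport term into the divergence of the flux `ξ
β`. -/
lemma balance (P : Snapshot G h dh) (hβ : RapidOn G.D β) (hψ : PolyOn G.D ψ) {Ψ : E → E → ℝ}
    (hΨ : VelGrowth Ψ) (hΨψ : ∀ X ∈ G.D, ∀ ξ, Ψ X ξ = ψ X ξ)
    (hd : ∀ X ∈ G.D, ∀ ξ,
      HasFDerivAt (fun Y => β Y ξ) (ψ X ξ • fderiv ℝ (fun Y => h Y ξ) X) X)
    (hφ : ContDiff ℝ 1 φ) (hk : HasCompactSupport φ) (hs : tsupport φ ⊆ G.D) :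
    ∫ X, φ X * ∫ ξ, ψ X ξ * dh X ξ
      = (∫ X, ∑ i, (∫ ξ, ξ i * β X ξ) * pderiv i φ X)
        + G.σ ^ 2 / G.m * ∫ q : S2 × E, pairInt G.σ (G.g h) (ext G.D h) (gainLoss Ψ) q.2 q.1
            * φ q.2 ∂(solidAngle.prod volume) := by
  have ht := P.transport hβ hψ hd hφ hk hs
  have hL := (hΨ.gainLoss.locBdd P.kernel P.kinetic G.σ).integrable_mul hφ.continuous hk 0
  simp only [zero_smul, sub_zero] at hL
  have e1 : ∀ X, φ X * ∫ ξ, ψ X ξ * fderiv ℝ (fun Y => h Y ξ) X ξ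
      = G.σ ^ 2 / G.m * (∫ α : S2, pairInt G.σ (G.g h) (ext G.D h) (gainLoss Ψ) X α
          * φ X ∂solidAngle) - φ X * ∫ ξ, ψ X ξ * dh X ξ := by
    intro X
    by_cases hX : X ∈ tsupport φ
    · have hX := hs hX
      obtain ⟨h1, h2⟩ := P.weak_collision_eq hΨ hX
      have h3 : ∀ ξ, ψ X ξ * fderiv ℝ (fun Y => h Y ξ) X ξ
          = Ψ X ξ * G.collision h X ξ - ψ X ξ * dh X ξ := by
        intro ξ; rw [← P.eqn X hX ξ, hΨψ X hX ξ]; ring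
      simp_rw [h3]
      rw [integral_sub h1 ((hψ.mul_rapidOn P.rapid_dt).integrable hX), h2, integral_mul_const]
      ring
    · rw [image_eq_zero_of_notMem_tsupport hX]; simp
  have i1 : Integrable fun X => φ X * ∫ ξ, ψ X ξ * dh X ξ := by
    have := ((hψ.mul_rapidOn P.rapid_dt).integrable_test P.isOpen hφ.continuous hk hs).integral_prod_left
    simp only [integral_const_mul] at this
    exact this
  simp_rw [e1] at ht
  rw [integral_sub (hL.integral_prod_right.const_mul _) i1, integral_const_mul,
    ← integral_prod_symm _ hL] at ht
  linarith

end Snapshot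

end

end EESM

namespace EESM

noncomputable section

/-! ### Macroscopic fields of a frozen solution -/

section fields

variable {G : Gas} {h : E → E → ℝ}

lemma RapidOn.locBddFun_density (hD : IsOpen G.D) (hh : RapidOn G.D h) :
    LocBddFun (density (ext G.D h)) := by
  rw [density_ext]; exact hh.locBddFun_integral hD

lemma density_ext_nonneg {D : Set E} (hpos : ∀ X ∈ D, ∀ ξ, 0 < h X ξ) (X : E) :
    0 ≤ density (ext D h) X := by
  refine integral_nonneg fun ξ => ?_
  by_cases hX : X ∈ D
  · rw [ext_of_mem hX]; exact (hpos X hX ξ).le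
  · rw [ext_of_notMem hX]; exact le_rfl

lemma calR_eq (hD : IsOpen G.D) (X : E) :
    G.calR h X = 1 / G.m * ballInt G.σ (density (ext G.D h)) X := by
  unfold Gas.calR ballInt
  rw [← integral_indicator hD.measurableSet]
  congr 2 with Y
  rw [density_ext]
  by_cases hY : Y ∈ G.D
  · rw [indicator_of_mem hY, indicator_of_mem hY]
  · rw [indicator_of_notMem hY, indicator_of_notMem hY, zero_mul]

lemma continuous_calR (hD : IsOpen G.D) (hh : RapidOn G.D h) : Continuous (G.calR h) := by
  rw [funext (calR_eq hD)]
  exact ((hh.locBddFun_density hD).continuous_ballInt G.σ).const_mul _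

lemma calR_nonneg (hm : 0 < G.m) (hD : IsOpen G.D) (hpos : ∀ X ∈ G.D, ∀ ξ, 0 < h X ξ) (X : E) :
    0 ≤ G.calR h X := by
  rw [calR_eq hD]
  exact mul_nonneg (by positivity)
    (integral_nonneg fun Y => mul_nonneg (density_ext_nonneg hpos Y) (theta_nonneg _))

/-- The Enskog factor at a point, cut off to the domain. -/
def enskogFactor (G : Gas) (h : E → E → ℝ) : E → ℝ := G.D.indicator fun X => G.S (G.calR h X)

/-- The factor is a sum with one term attached to each molecule; the exchange of `H^(c)` at a point
uses only the term belonging to that point. -/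
lemma g_eq_enskogFactor (X Y : E) :
    G.g h X Y = enskogFactor G h X * G.chi Y + enskogFactor G h Y * G.chi X := by
  unfold Gas.g enskogFactor Gas.chi
  by_cases hX : X ∈ G.D <;> by_cases hY : Y ∈ G.D <;> simp [hX, hY]

variable {xmax : EReal}

lemma continuousOn_enskog (hm : 0 < G.m) (hD : IsOpen G.D) (hh : RapidOn G.D h)
    (hpos : ∀ X ∈ G.D, ∀ ξ, 0 < h X ξ)
    (hSc : ContinuousOn G.S {x : ℝ | 0 ≤ x ∧ (x : EReal) < xmax})
    (hdom : ∀ X ∈ closure G.D, (G.calR h X : EReal) < xmax) :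
    ContinuousOn (fun X => G.S (G.calR h X)) (closure G.D) :=
  hSc.comp (continuous_calR hD hh).continuousOn fun X hX =>
    ⟨calR_nonneg hm hD hpos X, hdom X hX⟩

/-- The requirement `𝓡 < xmax` on the closure is used here: on a bounded part of the closure, which
is compact, `S(𝓡)` is continuous and hence bounded up to the wall. -/
lemma locBddFun_enskogFactor (hm : 0 < G.m) (hD : IsOpen G.D) (hh : RapidOn G.D h)
    (hpos : ∀ X ∈ G.D, ∀ ξ, 0 < h X ξ)
    (hSc : ContinuousOn G.S {x : ℝ | 0 ≤ x ∧ (x : EReal) < xmax})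
    (hdom : ∀ X ∈ closure G.D, (G.calR h X : EReal) < xmax) :
    LocBddFun (enskogFactor G h) := by
  have hc := continuousOn_enskog hm hD hh hpos hSc hdom
  refine ⟨measurable_indicator_of_continuousOn hD (hc.mono subset_closure), fun r => ?_⟩
  obtain ⟨C, hC⟩ := ((isCompact_closedBall (0 : E) r).inter_left isClosed_closure).exists_bound_of_continuousOn
    (hc.mono inter_subset_left)
  refine ⟨|C|, abs_nonneg C, fun X hX => ?_⟩
  by_cases hXD : X ∈ G.D
  · rw [enskogFactor, indicator_of_mem hXD]
    exact (hC X ⟨subset_closure hXD, by simpa using hX⟩).trans (le_abs_self C)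
  · rw [enskogFactor, indicator_of_notMem hXD, abs_zero]; exact abs_nonneg C

lemma isKernel_g (hm : 0 < G.m) (hD : IsOpen G.D) (hh : RapidOn G.D h)
    (hpos : ∀ X ∈ G.D, ∀ ξ, 0 < h X ξ)
    (hSc : ContinuousOn G.S {x : ℝ | 0 ≤ x ∧ (x : EReal) < xmax})
    (hSn : ∀ x : ℝ, 0 ≤ x → (x : EReal) < xmax → 0 ≤ G.S x)
    (hdom : ∀ X ∈ closure G.D, (G.calR h X : EReal) < xmax) : IsKernel G.D (G.g h) := by
  have hs := locBddFun_enskogFactor hm hD hh hpos hSc hdom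
  have hs0 : ∀ X, 0 ≤ enskogFactor G h X := fun X => indicator_nonneg (fun X hX =>
    hSn _ (calR_nonneg hm hD hpos X) (hdom X (subset_closure hX))) X
  have hχ0 : ∀ X, 0 ≤ G.chi X := fun X => indicator_nonneg (fun _ _ => zero_le_one) X
  have hχ1 : ∀ X, G.chi X ≤ 1 := fun X => by
    unfold Gas.chi; exact indicator_apply_le' (fun _ => le_rfl) fun _ => zero_le_one
  have hχm : Measurable G.chi := measurable_const.indicator hD.measurableSet
  refine ⟨?_, fun X Y => ?_, fun X Y => ?_, fun X Y hX => ?_, fun r => ?_⟩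
  · simp_rw [g_eq_enskogFactor]
    have h1 := hs.meas
    fun_prop
  · rw [g_eq_enskogFactor, g_eq_enskogFactor, add_comm]
  · rw [g_eq_enskogFactor]
    exact add_nonneg (mul_nonneg (hs0 X) (hχ0 Y)) (mul_nonneg (hs0 Y) (hχ0 X))
  · simp [Gas.g, Gas.chi, hX]
  · obtain ⟨C, hC0, hC⟩ := hs.bdd r
    refine ⟨C + C, by positivity, fun X Y hX hY => ?_⟩
    rw [g_eq_enskogFactor]
    have h1 := (le_abs_self _).trans (hC X hX)
    have h2 := (le_abs_self _).trans (hC Y hY)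
    exact add_le_add ((mul_le_of_le_one_right (hs0 X) (hχ1 Y)).trans h1)
      ((mul_le_of_le_one_right (hs0 Y) (hχ1 X)).trans h2)

end fields

/-- The chain rule is stated for a factor continuous on all of `ℝ`, whereas `S` is controlled only
on `[0, xmax)`. On the compact support `R` attains a maximum below `xmax`, and `S` is extended by
its end values beyond that range. -/
lemma exists_continuous_extension {S : ℝ → ℝ} {R φ : E → ℝ} {D : Set E} {xmax : EReal}
    (hSc : ContinuousOn S {x : ℝ | 0 ≤ x ∧ (x : EReal) < xmax}) (hR : Continuous R)
    (hR0 : ∀ X, 0 ≤ R X) (hdom : ∀ X ∈ D, (R X : EReal) < xmax) (hk : HasCompactSupport φ)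
    (hs : tsupport φ ⊆ D) :
    ∃ T : ℝ → ℝ, Continuous T ∧ ∀ X ∈ tsupport φ, ∀ y ∈ Icc 0 (R X), T y = S y := by
  rcases (tsupport φ).eq_empty_or_nonempty with h0 | h0
  · exact ⟨fun _ => 0, continuous_const, fun X hX => by simp [h0] at hX⟩
  obtain ⟨X₀, hX₀, hmax⟩ := hk.isCompact.exists_isMaxOn h0 hR.continuousOn
  have hc : ContinuousOn S (Icc 0 (R X₀)) := hSc.mono fun y hy =>
    ⟨hy.1, lt_of_le_of_lt (EReal.coe_le_coe_iff.2 hy.2) (hdom X₀ (hs hX₀))⟩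
  refine ⟨IccExtend (hR0 X₀) ((Icc 0 (R X₀)).domRestrict S),
    (continuousOn_iff_continuous_domRestrict.1 hc).Icc_extend', ?_⟩
  intro X hX y hy
  have hy' : y ∈ Icc 0 (R X₀) := ⟨hy.1, hy.2.trans (hmax hX)⟩
  rw [IccExtend_of_mem _ _ hy']; rfl

namespace Snapshot

variable {G : Gas} {h dh : E → E → ℝ} {φ : E → ℝ}

lemma polyOn_feWeight (P : Snapshot G h dh) (c : ℝ) : PolyOn G.D (feWeight c h) :=
  ((polyOn_const G.D c).mul ((polyOn_const G.D 1).add P.poly_log)).add (polyOn_norm_sq G.D)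

lemma velGrowth_feWeight (P : Snapshot G h dh) (c : ℝ) : VelGrowth (feWeight c (ext G.D h)) := by
  have h0 := P.poly_log.velGrowth P.isOpen
  have he : feWeight c (ext G.D h) = fun X ξ =>
      c * (1 + ext G.D (fun X ξ => Real.log (h X ξ)) X ξ) + ‖ξ‖ ^ 2 / 2 := by
    ext X ξ
    unfold feWeight
    by_cases hX : X ∈ G.D
    · rw [ext_of_mem hX, ext_of_mem hX]
    -- The default value `log 0 = 0` makes the logarithm of the zero extension equal to the zero
    -- extension of the logarithm.
    · rw [ext_of_notMem hX, ext_of_notMem hX, Real.log_zero]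
  rw [he]
  refine ⟨?_, fun r => ?_⟩
  · have := h0.meas
    fun_prop
  · obtain ⟨C, k, hC0, hC⟩ := h0.growth r
    refine ⟨|c| * (1 + C) + 1, k + 2, by positivity, fun X ξ hX => ?_⟩
    have h1 := one_le_wt ξ
    have h2 : 1 ≤ wt ξ ^ (k + 2) := one_le_pow₀ h1
    have h3 : wt ξ ^ k ≤ wt ξ ^ (k + 2) := pow_le_pow_right₀ h1 (by omega)
    have h4 : ‖ξ‖ ^ 2 / 2 ≤ wt ξ ^ (k + 2) := by
      have := pow_le_pow_left₀ (norm_nonneg ξ) (norm_le_wt ξ) 2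
      have h5 : wt ξ ^ 2 ≤ wt ξ ^ (k + 2) := pow_le_pow_right₀ h1 (by omega)
      nlinarith [sq_nonneg ‖ξ‖]
    refine (abs_add_le _ _).trans ?_
    rw [abs_mul, abs_of_nonneg (by positivity : 0 ≤ ‖ξ‖ ^ 2 / 2), add_mul, one_mul]
    refine add_le_add ?_ h4
    rw [mul_assoc]
    refine mul_le_mul_of_nonneg_left ((abs_add_le _ _).trans ?_) (abs_nonneg c)
    rw [abs_one, add_mul, one_mul]
    exact add_le_add h2 ((hC X ξ hX).trans (mul_le_mul_of_nonneg_left h3 hC0))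

/-- The free energy per unit volume of phase space, without its collisional part. -/
def _root_.EESM.feDensity (c : ℝ) (h : E → E → ℝ) (X ξ : E) : ℝ :=
  (c * Real.log (h X ξ) + ‖ξ‖ ^ 2 / 2) * h X ξ

lemma rapidOn_feDensity (P : Snapshot G h dh) (c : ℝ) : RapidOn G.D (feDensity c h) :=
  (((polyOn_const G.D c).mul P.poly_log).add (polyOn_norm_sq G.D)).mul_rapidOn P.rapid

/-- The derivative of `x ↦ (c ln x + a) x` is `c (1 + ln x) + a`; this is the origin of the weight
and allows the transport term to be written as a divergence. -/
lemma hasFDerivAt_feDensity (P : Snapshot G h dh) (c : ℝ) {X : E} (hX : X ∈ G.D) (ξ : E) :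
    HasFDerivAt (fun Y => feDensity c h Y ξ)
      (feWeight c h X ξ • fderiv ℝ (fun Y => h Y ξ) X) X := by
  have h1 := (P.diff X hX ξ).hasFDerivAt
  have h0 := (P.pos X hX ξ).ne'
  have h2 := (((h1.log h0).const_mul c).add_const (‖ξ‖ ^ 2 / 2)).mul h1
  refine h2.congr_fderiv ?_
  ext v
  simp only [_root_.add_apply, _root_.smul_apply, smul_eq_mul, feWeight]
  field_simp
  ring

lemma balance_feWeight (P : Snapshot G h dh) (c : ℝ) (hφ : ContDiff ℝ 1 φ)
    (hk : HasCompactSupport φ) (hs : tsupport φ ⊆ G.D) :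
    ∫ X, φ X * ∫ ξ, feWeight c h X ξ * dh X ξ
      = (∫ X, ∑ i, (∫ ξ, ξ i * feDensity c h X ξ) * pderiv i φ X)
        + G.σ ^ 2 / G.m * ∫ q : S2 × E, pairInt G.σ (G.g h) (ext G.D h)
            (gainLoss (feWeight c (ext G.D h))) q.2 q.1 * φ q.2 ∂(solidAngle.prod volume) :=
  P.balance (P.rapidOn_feDensity c) (P.polyOn_feWeight c) (P.velGrowth_feWeight c)
    (fun X hX ξ => by unfold feWeight; rw [ext_of_mem hX])
    (fun X hX ξ => P.hasFDerivAt_feDensity c hX ξ) hφ hk hs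

lemma continuousOn_density (P : Snapshot G h dh) : ContinuousOn (density (ext G.D h)) G.D := by
  rw [density_ext]
  exact P.rapid.continuousOn_integral.congr fun X hX => indicator_of_mem hX _

lemma momentum_ext_coord (P : Snapshot G h dh) (X : E) (i : Fin 3) :
    momentum (ext G.D h) X i = G.D.indicator (fun X => ∫ ξ, ξ i * h X ξ) X := by
  rw [momentum_ext]
  by_cases hX : X ∈ G.D
  · rw [indicator_of_mem hX, indicator_of_mem hX, P.rapid.momentum_coord hX]
  · rw [indicator_of_notMem hX, indicator_of_notMem hX]; rfl

lemma continuousOn_momentum (P : Snapshot G h dh) : ContinuousOn (momentum (ext G.D h)) G.D := by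
  refine (PiLp.continuous_toLp 2 _).comp_continuousOn (f := fun X i => momentum (ext G.D h) X i) ?_
  refine continuousOn_pi.2 fun i => ?_
  refine ((polyOn_coord G.D i).mul_rapidOn P.rapid).continuousOn_integral.congr fun X hX => ?_
  rw [P.momentum_ext_coord, indicator_of_mem hX]

lemma density_pos (P : Snapshot G h dh) {X : E} (hX : X ∈ G.D) : 0 < density h X := by
  have h0 := P.pos X hX
  refine (integral_pos_iff_support_of_nonneg (fun ξ => (h0 ξ).le) (P.rapid.integrable hX)).2 ?_
  have : Function.support (h X) = univ := eq_univ_of_forall fun ξ => (h0 ξ).ne'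
  rw [this]
  exact NeZero.pos _

/-- Conservation of mass in the weak form. -/
lemma weakDiv (P : Snapshot G h dh) :
    WeakDiv G.D (momentum (ext G.D h)) (G.D.indicator (density dh)) := by
  have hd := P.rapid_dt.locBddFun_integral P.isOpen
  have hw := fun i => ((polyOn_coord G.D i).mul_rapidOn P.rapid).locBddFun_integral P.isOpen
  have hmw : Measurable (momentum (ext G.D h)) := by
    refine (PiLp.continuous_toLp 2 _).measurable.comp
      (f := fun X i => momentum (ext G.D h) X i) (measurable_pi_lambda _ fun i => ?_)
    simp_rw [P.momentum_ext_coord]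
    exact (hw i).meas
  refine ⟨hmw, hd.meas, fun X hX => ?_, fun X hX => indicator_of_notMem hX _, fun r => ?_,
    fun φ hφ hk hs => ?_⟩
  · rw [momentum_ext, indicator_of_notMem hX]
  · obtain ⟨C, hC0, hC⟩ := hd.bdd r
    choose B hB0 hB using fun i => (hw i).bdd r
    refine ⟨C + ∑ i, B i, add_nonneg hC0 (Finset.sum_nonneg fun i _ => hB0 i), fun X hX => ⟨?_, ?_⟩⟩
    · have h1 : ‖momentum (ext G.D h) X‖ ≤ ∑ i, |momentum (ext G.D h) X i| := by
        rw [EuclideanSpace.norm_eq]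
        refine Real.sqrt_le_iff.2 ⟨Finset.sum_nonneg fun i _ => abs_nonneg _, ?_⟩
        exact Finset.sum_sq_le_sq_sum_of_nonneg fun i _ => abs_nonneg _
      refine h1.trans ?_
      have h2 : ∑ i, |momentum (ext G.D h) X i| ≤ ∑ i, B i := Finset.sum_le_sum fun i _ => by
        rw [P.momentum_ext_coord]; exact hB i X hX
      linarith
    · have := hC X hX
      have h2 := Finset.sum_nonneg fun i (_ : i ∈ Finset.univ) => hB0 i
      change |G.D.indicator (density dh) X| ≤ C at this
      linarith
  · have h1 : VelGrowth fun _ _ : E => (1 : ℝ) :=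
      ⟨measurable_const, fun r => ⟨1, 0, zero_le_one, fun X ξ _ => by simp⟩⟩
    have hb := P.balance P.rapid (polyOn_const G.D 1) h1 (fun X _ ξ => rfl)
      (fun X hX ξ => by rw [one_smul]; exact (P.diff X hX ξ).hasFDerivAt) hφ hk hs
    -- A constant weight is unchanged in a collision, so mass has no collisional source.
    have h2 : ∀ q : S2 × E, pairInt G.σ (G.g h) (ext G.D h) (gainLoss fun _ _ => 1) q.2 q.1 = 0 := by
      intro q; simp [pairInt, pairFun, gainLoss]
    simp only [one_mul, h2, zero_mul, integral_zero, mul_zero, add_zero] at hb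
    have i1 := (P.rapid_dt.integrable_test P.isOpen hφ.continuous hk hs).integral_prod_left
    simp only [integral_const_mul] at i1
    have e1 : ∀ X, fderiv ℝ φ X (momentum (ext G.D h) X)
        = ∑ i, (∫ ξ, ξ i * h X ξ) * pderiv i φ X := by
      intro X
      by_cases hX : X ∈ tsupport φ
      · rw [clm_apply_eq_sum]
        refine Finset.sum_congr rfl fun i _ => ?_
        rw [P.momentum_ext_coord, indicator_of_mem (hs hX)]; rfl
      · have h0 : fderiv ℝ φ X = 0 := fderiv_of_notMem_tsupport (𝕜 := ℝ) hX
        simp [pderiv, h0]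
    have i2 : Integrable fun X => fderiv ℝ φ X (momentum (ext G.D h) X) := by
      have hI : ∀ i, Integrable fun X => pderiv i φ X * momentum (ext G.D h) X i := fun i =>
        (continuous_mul_coord ((hφ.continuous_fderiv one_ne_zero).clm_apply continuous_const)
          ((tsupport_fderiv_apply_subset ℝ _).trans hs) P.isOpen P.continuousOn_momentum
          i).integrable_of_hasCompactSupport (hk.fderiv_apply (𝕜 := ℝ) _).mul_right
      refine (integrable_finsetSum Finset.univ fun i _ => hI i).congr
        (Eventually.of_forall fun X => ?_)
      simp only
      rw [clm_apply_eq_sum]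
      exact Finset.sum_congr rfl fun i _ => by unfold pderiv; ring
    have e2 : ∀ X, G.D.indicator (density dh) X * φ X = φ X * ∫ ξ, dh X ξ := by
      intro X
      by_cases hX : X ∈ tsupport φ
      · rw [indicator_of_mem (hs hX), mul_comm]; rfl
      · rw [image_eq_zero_of_notMem_tsupport hX, mul_zero, zero_mul]
    simp_rw [e2]
    rw [integral_sub i1 i2, hb]
    simp_rw [e1, sub_self]

/-- The normal component of the momentum vanishes at an impermeable boundary. -/
lemma tendsto_momentum_normal (P : Snapshot G h dh) {x n : E}
    (hv : Tendsto (fun Y => inner ℝ (flowVelocity h Y) n) (𝓝[G.D] x) (𝓝 0)) :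
    Tendsto (fun Y => inner ℝ (momentum (ext G.D h) Y) n) (𝓝[G.D] x) (𝓝 0) := by
  obtain ⟨C, hC0, hC⟩ := (P.rapid.locBddFun_density P.isOpen).bdd (‖x‖ + 1)
  have hv' := (hv.norm).const_mul C
  rw [norm_zero, mul_zero] at hv'
  refine squeeze_zero_norm' ?_ hv'
  filter_upwards [self_mem_nhdsWithin, mem_nhdsWithin_of_mem_nhds
    (continuous_norm.continuousAt.eventually (gt_mem_nhds (by linarith : ‖x‖ < ‖x‖ + 1)))]
    with Y hY hYr
  have h1 := hC Y (le_of_lt hYr)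
  rw [density_ext, indicator_of_mem hY] at h1
  have h2 : momentum (ext G.D h) Y = density h Y • flowVelocity h Y := by
    have h3 : density h Y ≠ 0 := (P.density_pos hY).ne'
    rw [momentum_ext, indicator_of_mem hY, flowVelocity, smul_inv_smul₀ h3]; rfl
  rw [h2, inner_smul_left, norm_mul]
  exact mul_le_mul_of_nonneg_right (by simpa using h1) (norm_nonneg _)

/-- The exchange of free energy between the centers of colliding molecules. -/
def _root_.EESM.exchangeC (G : Gas) (h : E → E → ℝ) (Y : E) (α : S2) : ℝ :=
  enskogFactor G h Y * inner ℝ (density (ext G.D h) (Y - G.σ • (α : E)) • momentum (ext G.D h) Y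
    - density (ext G.D h) Y • momentum (ext G.D h) (Y - G.σ • (α : E))) (α : E)

/-- The time derivative of the local average of the density. -/
def _root_.EESM.dtCalR (G : Gas) (dh : E → E → ℝ) (X : E) : ℝ :=
  1 / G.m * ballInt G.σ (G.D.indicator (density dh)) X

/-- With `Φ' = S` the product rule for `ρ Φ(𝓡)` yields the two terms on the left. `weak_chain_rule`
converts the variations of `𝓡` in space and time into surface integrals; `gauss_green` justifies
this across the wall. -/
lemma balance_HC (P : Snapshot G h dh) (hm : 0 < G.m) (hσ : 0 < G.σ) {xmax : EReal}
    (hSc : ContinuousOn G.S {x : ℝ | 0 ≤ x ∧ (x : EReal) < xmax})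
    (hdom : ∀ X ∈ G.D, (G.calR h X : EReal) < xmax)
    (hbdry : HasPiecewiseC1Boundary G.D)
    (himp : ∀ x n : E, IsOuterUnitNormal G.D x n →
      Tendsto (fun Y => inner ℝ (flowVelocity h Y) n) (𝓝[G.D] x) (𝓝 0))
    (hφ : ContDiff ℝ 1 φ) (hk : HasCompactSupport φ) (hs : tsupport φ ⊆ G.D) :
    (∫ X, φ X * (density dh X * ∫ y in (0 : ℝ)..G.calR h X, G.S y))
        + (∫ X, φ X * (density h X * G.S (G.calR h X) * dtCalR G dh X))
      = (∫ X, (∫ y in (0 : ℝ)..G.calR h X, G.S y) * fderiv ℝ φ X (momentum (ext G.D h) X))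
        - G.σ ^ 2 / G.m * ∫ q : S2 × E, exchangeC G h q.2 q.1 * φ q.2
            ∂(solidAngle.prod volume) := by
  have hR0 := calR_nonneg hm P.isOpen P.pos
  obtain ⟨T, hT, hTS⟩ := exists_continuous_extension hSc (continuous_calR P.isOpen P.rapid) hR0 hdom hk hs
  -- The chain rule is applied with the extension `T`, which agrees with `S` at all values relevant
  -- on the support of `φ`; the identities below restore `S`.
  have hch := P.weakDiv.weak_chain_rule (P.rapid.locBddFun_density P.isOpen) hσ
    (fun k h1 h2 => P.weakDiv.gauss_green P.isOpen hbdry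
      (fun x n hn => P.tendsto_momentum_normal (himp x n hn)) h1 h2)
    hT (1 / G.m) hφ hk hs P.isOpen P.continuousOn_momentum P.continuousOn_density
  simp_rw [← calR_eq P.isOpen] at hch
  have e0 : ∀ X ∈ tsupport φ, T (G.calR h X) = G.S (G.calR h X) := fun X hX =>
    hTS X hX _ ⟨hR0 X, le_rfl⟩
  have e1 : ∀ X ∈ tsupport φ, ∫ y in (0 : ℝ)..G.calR h X, T y = ∫ y in (0 : ℝ)..G.calR h X, G.S y :=
    fun X hX => intervalIntegral.integral_congr fun y hy =>
      hTS X hX y (by rwa [uIcc_of_le (hR0 X)] at hy)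
  have z : ∀ {X}, X ∉ tsupport φ → φ X = 0 := fun hX => image_eq_zero_of_notMem_tsupport hX
  have f1 : ∀ X, (∫ y in (0 : ℝ)..G.calR h X, T y) * (G.D.indicator (density dh) X * φ X)
      = φ X * (density dh X * ∫ y in (0 : ℝ)..G.calR h X, G.S y) := by
    intro X
    by_cases hX : X ∈ tsupport φ
    · rw [e1 X hX, indicator_of_mem (hs hX)]; ring
    · rw [z hX]; ring
  have f2 : ∀ X, (∫ y in (0 : ℝ)..G.calR h X, T y) * fderiv ℝ φ X (momentum (ext G.D h) X)
      = (∫ y in (0 : ℝ)..G.calR h X, G.S y) * fderiv ℝ φ X (momentum (ext G.D h) X) := by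
    intro X
    by_cases hX : X ∈ tsupport φ
    · rw [e1 X hX]
    · rw [fderiv_of_notMem_tsupport (𝕜 := ℝ) hX]; simp
  have f3 : ∀ X, T (G.calR h X) * (φ X * density (ext G.D h) X
        * (1 / G.m * ballInt G.σ (G.D.indicator (density dh)) X))
      = φ X * (density h X * G.S (G.calR h X) * dtCalR G dh X) := by
    intro X
    by_cases hX : X ∈ tsupport φ
    · rw [e0 X hX, density_ext, indicator_of_mem (hs hX)]; unfold dtCalR; ring
    · rw [z hX]; ring
  have f4 : ∀ q : S2 × E, T (G.calR h q.2) * inner ℝ (density (ext G.D h) (q.2 - G.σ • (q.1 : E))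
          • momentum (ext G.D h) q.2 - density (ext G.D h) q.2
          • momentum (ext G.D h) (q.2 - G.σ • (q.1 : E))) (q.1 : E) * φ q.2
      = exchangeC G h q.2 q.1 * φ q.2 := by
    intro q
    by_cases hX : q.2 ∈ tsupport φ
    · unfold exchangeC enskogFactor
      rw [e0 _ hX, indicator_of_mem (hs hX)]
    · rw [z hX]; ring
  simp_rw [f1, f2, f3, f4] at hch
  have : G.σ ^ 2 / G.m = 1 / G.m * G.σ ^ 2 := by ring
  rw [this]
  linarith

end Snapshot

end

end EESM

namespace EESM

noncomputable section

/-! ### The flux as an average of exchanges along the line of centers -/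

section linear

variable {D : Set E} {σ : ℝ} {γ f : E → E → ℝ} {Q Q' : E → S2 → E × E → ℝ}

lemma pairInt_const_mul (c σ : ℝ) (γ f : E → E → ℝ) (Q : E → S2 → E × E → ℝ) :
    pairInt σ γ f (fun Y α p => c * Q Y α p) = fun Y α => c * pairInt σ γ f Q Y α := by
  ext Y α
  unfold pairInt
  rw [← integral_const_mul]
  congr 1 with p
  unfold pairFun; ring

lemma pairInt_add (hQ : PairGrowth Q) (hQ' : PairGrowth Q') (hγ : IsKernel D γ) (hf : Kinetic D f)
    (σ : ℝ) : pairInt σ γ f (fun Y α p => Q Y α p + Q' Y α p)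
      = fun Y α => pairInt σ γ f Q Y α + pairInt σ γ f Q' Y α := by
  ext Y α
  unfold pairInt
  refine Eq.trans ?_ (integral_add (hQ.integrable hγ hf σ Y α) (hQ'.integrable hγ hf σ Y α))
  congr 1 with p
  unfold pairFun; ring

lemma shiftFlux_pairInt_const_mul (c σ : ℝ) (γ f : E → E → ℝ) (Q : E → S2 → E × E → ℝ) (i : Fin 3)
    (X : E) : c * shiftFlux σ (pairInt σ γ f Q) i X
      = shiftFlux σ (pairInt σ γ f fun Y α p => c * Q Y α p) i X := by
  rw [pairInt_const_mul, shiftFlux_const_mul]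

lemma shiftFlux_pairInt_add (hQ : PairGrowth Q) (hQ' : PairGrowth Q') (hγ : IsKernel D γ)
    (hf : Kinetic D f) (σ : ℝ) (i : Fin 3) (X : E) :
    shiftFlux σ (pairInt σ γ f Q) i X + shiftFlux σ (pairInt σ γ f Q') i X
      = shiftFlux σ (pairInt σ γ f fun Y α p => Q Y α p + Q' Y α p) i X := by
  rw [pairInt_add hQ hQ' hγ hf, ← shiftFlux_add (hQ.locBdd hγ hf σ) (hQ'.locBdd hγ hf σ)]

lemma PairGrowth.const_mul (hQ : PairGrowth Q) (c : ℝ) : PairGrowth fun Y α p => c * Q Y α p := by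
  refine ⟨hQ.meas.const_mul c, fun r => ?_⟩
  obtain ⟨C, k, hC0, hC⟩ := hQ.growth r
  refine ⟨|c| * C, k, by positivity, fun Y α p hY => ?_⟩
  rw [abs_mul, mul_assoc]
  exact mul_le_mul_of_nonneg_left (hC Y α p hY) (abs_nonneg c)

lemma pairGrowth_momentum (j : Fin 3) :
    PairGrowth fun _ α p => (α : E) j * relV α p.1 p.2 := by
  refine ⟨?_, fun r => ⟨1, 1, zero_le_one, fun Y α p _ => ?_⟩⟩
  · have h : Continuous fun q : (E × S2) × (E × E) => ((q.1.2 : S2), q.2.1, q.2.2) := by fun_prop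
    have h1 := continuous_relV.comp h
    have h2 : Continuous fun q : (E × S2) × (E × E) => (q.1.2 : E) j := by fun_prop
    exact (h2.mul h1).measurable
  · rw [abs_mul, pow_one]
    exact mul_le_mul (abs_coord_sphere_le α j) (abs_relV_le α _ _) (abs_nonneg _) zero_le_one

lemma pairGrowth_energy (v : E) :
    PairGrowth fun _ α p => 1 / 2 * (inner ℝ ((p.1 - v) + (p.2 - v)) (α : E) * relV α p.1 p.2) := by
  refine PairGrowth.const_mul ⟨?_, fun r => ⟨1 + 2 * ‖v‖, 2, by positivity, fun Y α p _ => ?_⟩⟩ (1 / 2)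
  · have h : Continuous fun q : (E × S2) × (E × E) => ((q.1.2 : S2), q.2.1, q.2.2) := by fun_prop
    have h1 := continuous_relV.comp h
    have h2 : Continuous fun q : (E × S2) × (E × E) =>
        (inner ℝ ((q.2.1 - v) + (q.2.2 - v)) (q.1.2 : E) : ℝ) := by fun_prop
    exact (h2.mul h1).measurable
  · have h1 := abs_real_inner_le_norm ((p.1 - v) + (p.2 - v)) (α : E)
    rw [norm_sphere, mul_one] at h1
    have h2 : ‖(p.1 - v) + (p.2 - v)‖ ≤ (1 + 2 * ‖v‖) * (wt p.1 * wt p.2) := by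
      have h3 := norm_add_le (p.1 - v) (p.2 - v)
      have h4 := norm_sub_le p.1 v
      have h5 := norm_sub_le p.2 v
      have h6 := mul_nonneg (norm_nonneg p.1) (norm_nonneg p.2)
      have h7 : 0 ≤ ‖v‖ * (‖p.1‖ + ‖p.2‖ + ‖p.1‖ * ‖p.2‖) := by positivity
      unfold wt
      nlinarith
    rw [abs_mul, pow_two, ← mul_assoc]
    exact mul_le_mul (h1.trans h2) (abs_relV_le α _ _) (abs_nonneg _)
      ((norm_nonneg _).trans h2)

end linear

namespace Snapshot

variable {G : Gas} {h dh : E → E → ℝ}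

lemma g_mul_ext (P : Snapshot G h dh) (Y Z ξ ξs : E) :
    G.g h Y Z * ext G.D h Y ξ * ext G.D h Z ξs = G.g h Y Z * h Y ξ * h Z ξs := by
  by_cases hY : Y ∈ G.D
  · by_cases hZ : Z ∈ G.D
    · rw [ext_of_mem hY, ext_of_mem hZ]
    · rw [P.kernel.symm, P.kernel.zero_off Z Y hZ]; ring
  · rw [P.kernel.zero_off Y Z hY]; ring

lemma flux_eq (P : Snapshot G h dh) {Q : E → S2 → E × E → ℝ} (hQ : PairGrowth Q) (i : Fin 3)
    (X : E) : ∫ α : S2, (∫ ξ : E, ∫ ξs : E, ∫ τ in (0 : ℝ)..1,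
        (α : E) i * (G.g h (X + (τ * G.σ) • (α : E)) (X + (τ * G.σ) • (α : E) - G.σ • (α : E))
          * Q (X + (τ * G.σ) • (α : E)) α (ξ, ξs) * h (X + (τ * G.σ) • (α : E)) ξ
          * h (X + (τ * G.σ) • (α : E) - G.σ • (α : E)) ξs * posV α ξ ξs)) ∂solidAngle
      = shiftFlux G.σ (pairInt G.σ (G.g h) (ext G.D h) Q) i X := by
  rw [← hQ.flux_eq P.kernel P.kinetic]
  unfold pairFun
  congr 1 with α; congr 1 with ξ; congr 1 with ξs
  refine intervalIntegral.integral_congr fun τ _ => ?_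
  have := P.g_mul_ext (X + (τ * G.σ) • (α : E)) (X + (τ * G.σ) • (α : E) - G.σ • (α : E)) ξ ξs
  linear_combination -((α : E) i * Q (X + (τ * G.σ) • (α : E)) α (ξ, ξs) * posV α ξ ξs) * this

lemma add_sub_smul (X : E) (α : S2) (τ σ : ℝ) :
    X + ((τ - 1) * σ) • (α : E) = X + (τ * σ) • (α : E) - σ • (α : E) := by
  module

lemma add_sub_smul' (X : E) (α : S2) (l σ : ℝ) :
    X + (l - σ) • (α : E) = X + l • (α : E) - σ • (α : E) := by
  module

/-- The substitution `λ = τσ` supplies a factor `σ`, and `V_α² θ(V_α)` is the momentum transfer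
`V_α` times the collision rate. The stress is thus the line average of exchanged momentum. -/
lemma stressC_eq (P : Snapshot G h dh) (i j : Fin 3) (X : E) :
    G.stressC h i j X = G.σ ^ 3 / (2 * G.m) * shiftFlux G.σ (pairInt G.σ (G.g h) (ext G.D h)
      fun _ α p => (α : E) j * relV α p.1 p.2) i X := by
  rw [← P.flux_eq (pairGrowth_momentum j)]
  have e : G.σ ^ 3 / (2 * G.m) = G.σ ^ 2 / (2 * G.m) * G.σ := by ring
  rw [Gas.stressC, e, mul_assoc]
  congr 1
  rw [← integral_const_mul]
  congr 1 with α
  rw [← integral_const_mul]; congr 1 with ξ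
  rw [← integral_const_mul]; congr 1 with ξs
  have h1 := intervalIntegral.mul_integral_comp_mul_right (a := 0) (b := 1) (f := fun l =>
    (α : E) i * (α : E) j * relV α ξ ξs ^ 2 * theta (relV α ξ ξs)
      * Gas.g G h (X + l • (α : E)) (X + (l - G.σ) • (α : E))
      * h (X + (l - G.σ) • (α : E)) ξs * h (X + l • (α : E)) ξ) G.σ
  rw [zero_mul, one_mul] at h1
  rw [← h1]
  congr 1
  refine intervalIntegral.integral_congr fun τ _ => ?_
  simp only [add_sub_smul', posV]
  ring

lemma heatFlowC_eq (P : Snapshot G h dh) (i : Fin 3) (X : E) :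
    G.heatFlowC h i X = G.σ ^ 3 / (2 * G.m) * shiftFlux G.σ (pairInt G.σ (G.g h) (ext G.D h)
      fun _ α p => 1 / 2 * (inner ℝ ((p.1 - flowVelocity h X) + (p.2 - flowVelocity h X)) (α : E)
        * relV α p.1 p.2)) i X := by
  rw [← P.flux_eq (pairGrowth_energy (flowVelocity h X))]
  -- One `σ` comes from the substitution; the factor 2 compensates the `1/2` placed in the energy
  -- exchange.
  have e : G.σ ^ 3 / (2 * G.m) = G.σ ^ 2 / (4 * G.m) * (2 * G.σ) := by ring
  rw [Gas.heatFlowC, e, mul_assoc]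
  congr 1
  rw [← integral_const_mul]
  congr 1 with α
  rw [← integral_const_mul]; congr 1 with ξ
  rw [← integral_const_mul]; congr 1 with ξs
  have h1 := intervalIntegral.mul_integral_comp_mul_right (a := 0) (b := 1) (f := fun l =>
    (α : E) i * inner ℝ ((ξ - flowVelocity h X) + (ξs - flowVelocity h X)) (α : E)
      * relV α ξ ξs ^ 2 * theta (relV α ξ ξs)
      * Gas.g G h (X + l • (α : E)) (X + (l - G.σ) • (α : E))
      * h (X + (l - G.σ) • (α : E)) ξs * h (X + l • (α : E)) ξ) G.σ
  rw [zero_mul, one_mul] at h1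
  rw [← h1, mul_assoc 2, mul_left_comm 2]
  congr 1
  rw [← intervalIntegral.integral_const_mul (2 : ℝ)]
  refine intervalIntegral.integral_congr fun τ _ => ?_
  simp only [add_sub_smul', posV]
  ring

lemma fluxK_eq (P : Snapshot G h dh) (i : Fin 3) (X : E) :
    G.fluxK h i X = G.σ ^ 3 / (2 * G.m) * shiftFlux G.σ (pairInt G.σ (G.g h) (ext G.D h)
      (gainLoss (ext G.D fun X ξ => Real.log (h X ξ)))) i X := by
  rw [← P.flux_eq (P.poly_log.velGrowth P.isOpen).gainLoss, Gas.fluxK]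
  congr 2 with α; congr 1 with ξ; congr 1 with ξs
  refine intervalIntegral.integral_congr fun τ _ => ?_
  simp only [add_sub_smul, posV, gainLoss]
  by_cases hY : X + (τ * G.σ) • (α : E) ∈ G.D
  · rw [ext_of_mem hY, ext_of_mem hY, Real.log_div (P.pos _ hY _).ne' (P.pos _ hY _).ne']
    ring
  · rw [P.kernel.zero_off _ _ hY]; ring

/-- The collisional parts of the flux combine into the exchange of the free-energy weight. -/
lemma collisional_flux_eq (P : Snapshot G h dh) (c : ℝ) (i : Fin 3) (X : E) :
    c * G.fluxK h i X + ∑ j, G.stressC h i j X * flowVelocity h X j + G.heatFlowC h i X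
      = G.σ ^ 3 / (2 * G.m) * shiftFlux G.σ (pairInt G.σ (G.g h) (ext G.D h)
          (gainLoss (feWeight c (ext G.D h)))) i X := by
  set v := flowVelocity h X with hv
  have hK := (P.poly_log.velGrowth P.isOpen).gainLoss
  have hM := fun j => (pairGrowth_momentum j).const_mul (v j)
  -- The work `p^(c)_ij v_j` adds `(v·α) V_α`, which cancels the `-2v` in the heat-flow integrand.
  -- What remains is `½ (ξ + ξ_*)·α V_α`, the energy gained in the collision; with the logarithm it
  -- forms the change of the weight.
  have key : (fun Y α p => ((c * gainLoss (ext G.D fun X ξ => Real.log (h X ξ)) Y α p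
        + v 0 * ((α : E) 0 * relV α p.1 p.2)) + v 1 * ((α : E) 1 * relV α p.1 p.2)
        + v 2 * ((α : E) 2 * relV α p.1 p.2))
        + 1 / 2 * (inner ℝ ((p.1 - v) + (p.2 - v)) (α : E) * relV α p.1 p.2))
      = gainLoss (feWeight c (ext G.D h)) := by
    ext Y α p
    have hl : ∀ ξ, Real.log (ext G.D h Y ξ) = ext G.D (fun X ξ => Real.log (h X ξ)) Y ξ := by
      intro ξ
      by_cases hY : Y ∈ G.D
      · rw [ext_of_mem hY, ext_of_mem hY]
      · rw [ext_of_notMem hY, ext_of_notMem hY, Real.log_zero]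
    have h1 : inner ℝ ((p.1 - v) + (p.2 - v)) (α : E)
        = inner ℝ (p.1 + p.2) (α : E) - 2 * (v 0 * (α : E) 0 + v 1 * (α : E) 1 + v 2 * (α : E) 2) := by
      have h2 : inner ℝ v (α : E) = v 0 * (α : E) 0 + v 1 * (α : E) 1 + v 2 * (α : E) 2 := by
        rw [inner_coord, Fin.sum_univ_three]
      rw [← h2]
      simp only [inner_add_left, inner_sub_left]
      ring
    unfold gainLoss feWeight
    rw [norm_sq_post, hl, hl, h1]
    ring
  rw [← key, ← shiftFlux_pairInt_add ((((hK.const_mul c).add (hM 0)).add (hM 1)).add (hM 2))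
    (pairGrowth_energy v) P.kernel P.kinetic,
    ← shiftFlux_pairInt_add (((hK.const_mul c).add (hM 0)).add (hM 1)) (hM 2) P.kernel P.kinetic,
    ← shiftFlux_pairInt_add ((hK.const_mul c).add (hM 0)) (hM 1) P.kernel P.kinetic,
    ← shiftFlux_pairInt_add (hK.const_mul c) (hM 0) P.kernel P.kinetic,
    ← shiftFlux_pairInt_const_mul, ← shiftFlux_pairInt_const_mul, ← shiftFlux_pairInt_const_mul,
    ← shiftFlux_pairInt_const_mul, Fin.sum_univ_three, P.fluxK_eq, P.stressC_eq, P.stressC_eq,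
    P.stressC_eq, P.heatFlowC_eq]
  ring

lemma momentum_eq (P : Snapshot G h dh) {X : E} (hX : X ∈ G.D) :
    momentum (ext G.D h) X = density h X • flowVelocity h X := by
  have h3 : density h X ≠ 0 := (P.density_pos hX).ne'
  rw [momentum_ext, indicator_of_mem hX, flowVelocity, smul_inv_smul₀ h3]; rfl

/-- Multiplying the velocity difference by both densities gives the bracket of densities and
momenta; the indicators are supplied by the zero extensions. -/
lemma fluxC_eq (P : Snapshot G h dh) (i : Fin 3) {X : E} (hX : X ∈ G.D) :
    G.fluxC h i X = (∫ y in (0 : ℝ)..G.calR h X, G.S y) * momentum (ext G.D h) X i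
      - G.σ ^ 3 / (2 * G.m) * shiftFlux G.σ (exchangeC G h) i X := by
  unfold Gas.fluxC Gas.HC shiftFlux
  rw [P.momentum_eq hX, PiLp.smul_apply, smul_eq_mul]
  congr 1
  · ring
  congr 2 with α
  refine intervalIntegral.integral_congr fun τ _ => ?_
  simp only [add_sub_smul, exchangeC, enskogFactor, Gas.chi]
  set Y := X + (τ * G.σ) • (α : E)
  by_cases hY : Y ∈ G.D
  · by_cases hZ : Y - G.σ • (α : E) ∈ G.D
    · rw [indicator_of_mem hY, indicator_of_mem hZ, indicator_of_mem hY, P.momentum_eq hY,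
        P.momentum_eq hZ, density_ext, indicator_of_mem hY, indicator_of_mem hZ]
      simp only [inner_sub_left, inner_smul_left, RCLike.conj_to_real]
      ring
    · rw [indicator_of_notMem hZ, momentum_ext, density_ext, indicator_of_notMem hZ,
        indicator_of_notMem hZ]
      simp
  · simp [indicator_of_notMem hY]

end Snapshot

end

end EESM

namespace EESM

noncomputable section

/-! ### The weak free-energy inequality at a frozen time -/

lemma LocBdd.add {a a' : E → S2 → ℝ} (ha : LocBdd a) (ha' : LocBdd a') :
    LocBdd fun Y α => a Y α + a' Y α := by
  refine ⟨ha.meas.add ha'.meas, fun r => ?_⟩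
  obtain ⟨C, hC0, hC⟩ := ha.bdd r
  obtain ⟨C', hC'0, hC'⟩ := ha'.bdd r
  exact ⟨C + C', by positivity, fun Y α hY =>
    (abs_add_le _ _).trans (add_le_add (hC Y α hY) (hC' Y α hY))⟩

lemma LocBdd.const_mul {a : E → S2 → ℝ} (ha : LocBdd a) (c : ℝ) : LocBdd fun Y α => c * a Y α := by
  refine ⟨ha.meas.const_mul c, fun r => ?_⟩
  obtain ⟨C, hC0, hC⟩ := ha.bdd r
  refine ⟨|c| * C, by positivity, fun Y α hY => ?_⟩
  rw [abs_mul]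
  exact mul_le_mul_of_nonneg_left (hC Y α hY) (abs_nonneg c)

lemma LocBddFun.integrable_test {q φ : E → ℝ} (hq : LocBddFun q) (hφ : Continuous φ)
    (hk : HasCompactSupport φ) : Integrable fun X => q X * φ X :=
  hq.locallyIntegrable.integrable_smul_right_of_hasCompactSupport hφ hk

lemma LocBdd.locBddFun_shiftFlux {a : E → S2 → ℝ} (ha : LocBdd a) (σ : ℝ) (i : Fin 3) :
    LocBddFun (shiftFlux σ a i) :=
  ⟨ha.measurable_shiftFlux σ i, ha.shiftFlux_bdd σ i⟩

/-- A quantity that does not increase in an exchange of the two molecules dissipates. -/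
lemma LocBdd.integral_exchange_nonpos {a : E → S2 → ℝ} (ha : LocBdd a) {σ : ℝ}
    (hex : ∀ Y α, a Y α + a (Y - σ • (α : E)) (-α) ≤ 0) {φ : E → ℝ} (hφ : Continuous φ)
    (hk : HasCompactSupport φ) (h0 : ∀ X, 0 ≤ φ X) :
    (∫ q : S2 × E, a q.2 q.1 * φ q.2 ∂(solidAngle.prod volume))
      + ∫ q : S2 × E, a q.2 q.1 * φ (q.2 - σ • (q.1 : E)) ∂(solidAngle.prod volume) ≤ 0 := by
  have i1 := ha.integrable_mul hφ hk 0
  simp only [zero_smul, sub_zero] at i1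
  have i2 := ha.integrable_mul hφ hk σ
  -- Exchanging the partners moves the test function back from `Y - σα` to `Y`, so that both
  -- integrals carry the same weight `φ(Y)` and the pairwise sum appears.
  have e := (measurePreserving_exchange σ).integral_comp (measurableEmbedding_exchange σ)
    (fun q : S2 × E => a q.2 q.1 * φ (q.2 - σ • (q.1 : E)))
  have i3 := ((measurePreserving_exchange σ).integrable_comp_emb (measurableEmbedding_exchange σ)).2 i2
  rw [← e]
  have i3' : Integrable (fun q : S2 × E => a (q.2 - σ • (q.1 : E)) (-q.1)
      * φ (q.2 - σ • (q.1 : E) - σ • ((-q.1 : S2) : E))) (solidAngle.prod volume) := i3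
  rw [← integral_add i1 i3']
  refine integral_nonpos fun q => ?_
  have : q.2 - σ • (q.1 : E) - σ • ((-q.1 : S2) : E) = q.2 := by
    rw [coe_neg_sphere]; module
  simp only [this, ← add_mul]
  exact mul_nonpos_of_nonpos_of_nonneg (hex _ _) (h0 _)

lemma locallyIntegrableOn_congr {D : Set E} (hD : IsOpen D) {p q : E → ℝ} (h : EqOn p q D)
    (hq : LocallyIntegrableOn q D) : LocallyIntegrableOn p D := by
  rw [locallyIntegrableOn_iff hD.isLocallyClosed] at hq ⊢
  intro K hK hc
  exact (integrableOn_congr_fun (h.mono hK) hc.measurableSet).2 (hq K hK hc)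

namespace Snapshot

variable {G : Gas} {h dh : E → E → ℝ} {φ : E → ℝ}

section moments

lemma integral_centered (P : Snapshot G h dh) {X : E} (hX : X ∈ G.D) (i : Fin 3) :
    ∫ ξ, (ξ i - flowVelocity h X i) * h X ξ = 0 := by
  have h1 := ((polyOn_coord G.D i).mul_rapidOn P.rapid).integrable hX
  have h2 := P.rapid.integrable hX
  have h3 := (P.density_pos hX).ne'
  simp_rw [sub_mul]
  rw [integral_sub h1 (h2.const_mul _), integral_const_mul, ← P.rapid.momentum_coord hX]
  change momentum h X i - ((density h X)⁻¹ • momentum h X) i * density h X = 0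
  rw [PiLp.smul_apply, smul_eq_mul]
  field_simp
  ring

lemma norm_sq_eq_centered (ξ v : E) :
    ‖ξ‖ ^ 2 = ‖ξ - v‖ ^ 2 + 2 * ∑ j, v j * (ξ j - v j) + ‖v‖ ^ 2 := by
  have h1 : ∑ j, v j * (ξ j - v j) = inner ℝ v (ξ - v) := by rw [inner_coord]; rfl
  have h2 := norm_add_sq_real (ξ - v) v
  rw [sub_add_cancel, real_inner_comm] at h2
  rw [h1, h2]

lemma polyOn_centered (D : Set E) (v : E) (i : Fin 3) : PolyOn D fun _ ξ => ξ i - v i := by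
  simpa only [sub_eq_add_neg] using (polyOn_coord D i).add (polyOn_const D (-v i))

lemma polyOn_centered_sq (D : Set E) (v : E) : PolyOn D fun _ ξ => ‖ξ - v‖ ^ 2 := by
  refine PolyOn.of_velocity D (by fun_prop) (C := (1 + ‖v‖) ^ 2) (k := 2) (by positivity) fun ξ => ?_
  rw [abs_of_nonneg (by positivity), ← mul_pow]
  refine pow_le_pow_left₀ (norm_nonneg _) ((norm_sub_le ξ v).trans ?_) 2
  have := mul_nonneg (norm_nonneg v) (norm_nonneg ξ)
  unfold wt; linarith

/-- Expanding the square about the mean velocity leaves no cross term, because the centred first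
moment vanishes. -/
lemma energy_eq (P : Snapshot G h dh) {X : E} (hX : X ∈ G.D) :
    ∫ ξ, ‖ξ‖ ^ 2 / 2 * h X ξ
      = density h X * (internalEnergy h X + ‖flowVelocity h X‖ ^ 2 / 2) := by
  set v := flowVelocity h X with hv
  have i1 := ((polyOn_centered_sq G.D v).mul_rapidOn P.rapid).integrable hX
  have i2 := fun j => ((polyOn_centered G.D v j).mul_rapidOn P.rapid).integrable hX
  have e1 : ∀ ξ, ‖ξ‖ ^ 2 / 2 * h X ξ = (1 / 2 * (‖ξ - v‖ ^ 2 * h X ξ)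
      + ∑ j, v j * ((ξ j - v j) * h X ξ)) + ‖v‖ ^ 2 / 2 * h X ξ := by
    intro ξ
    rw [norm_sq_eq_centered ξ v]
    simp only [← mul_assoc, ← Finset.sum_mul]
    ring
  simp_rw [e1]
  have i3 : Integrable fun ξ => ∑ j, v j * ((ξ j - v j) * h X ξ) :=
    integrable_finsetSum _ fun j _ => (i2 j).const_mul _
  rw [integral_add ((i1.const_mul _).fun_add i3) ((P.rapid.integrable hX).const_mul _),
    integral_add (i1.const_mul _) i3, integral_finsetSum _ fun j _ => (i2 j).const_mul _]
  simp_rw [integral_const_mul]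
  have h0 := fun j => P.integral_centered hX j
  rw [← hv] at h0
  simp_rw [h0]
  have h3 := (P.density_pos hX).ne'
  unfold internalEnergy
  rw [← hv]
  change 1 / 2 * _ + _ + ‖v‖ ^ 2 / 2 * density h X = _
  simp only [mul_zero, Finset.sum_const_zero]
  field_simp
  ring

/-- Splitting `ξ_i` into its mean and its fluctuation separates convection of the total energy, the
work of the kinetic stress and the kinetic heat flow. -/
lemma energy_flux_eq (P : Snapshot G h dh) {X : E} (hX : X ∈ G.D) (i : Fin 3) :
    ∫ ξ, ξ i * (‖ξ‖ ^ 2 / 2 * h X ξ)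
      = density h X * flowVelocity h X i
          * (internalEnergy h X + ‖flowVelocity h X‖ ^ 2 / 2)
        + ∑ j, stressK h i j X * flowVelocity h X j + heatFlowK h i X := by
  set v := flowVelocity h X with hv
  have ci := polyOn_centered G.D v i
  have i1 := ((ci.mul (polyOn_centered_sq G.D v)).mul_rapidOn P.rapid).integrable hX
  have i2 := fun j => ((ci.mul (polyOn_centered G.D v j)).mul_rapidOn P.rapid).integrable hX
  have i3 := (ci.mul_rapidOn P.rapid).integrable hX
  have i4 := ((polyOn_norm_sq G.D).mul_rapidOn P.rapid).integrable hX
  have e1 : ∀ ξ, ξ i * (‖ξ‖ ^ 2 / 2 * h X ξ)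
      = ((1 / 2 * ((ξ i - v i) * ‖ξ - v‖ ^ 2 * h X ξ)
        + ∑ j, v j * ((ξ i - v i) * (ξ j - v j) * h X ξ))
        + ‖v‖ ^ 2 / 2 * ((ξ i - v i) * h X ξ)) + v i * (‖ξ‖ ^ 2 / 2 * h X ξ) := by
    intro ξ
    have h1 : ∑ j, v j * ((ξ i - v i) * (ξ j - v j) * h X ξ)
        = (ξ i - v i) * h X ξ * ∑ j, v j * (ξ j - v j) := by
      rw [Finset.mul_sum]; exact Finset.sum_congr rfl fun j _ => by ring
    rw [h1, norm_sq_eq_centered ξ v]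
    ring
  simp_rw [e1]
  have i5 : Integrable fun ξ => ∑ j, v j * ((ξ i - v i) * (ξ j - v j) * h X ξ) :=
    integrable_finsetSum _ fun j _ => (i2 j).const_mul _
  rw [integral_add (((i1.const_mul _).fun_add i5).fun_add (i3.const_mul _)) (i4.const_mul _),
    integral_add ((i1.const_mul _).fun_add i5) (i3.const_mul _), integral_add (i1.const_mul _) i5,
    integral_finsetSum _ fun j _ => (i2 j).const_mul _]
  simp_rw [integral_const_mul]
  rw [P.integral_centered hX i, P.energy_eq hX]
  unfold stressK heatFlowK
  simp_rw [← hv, mul_comm (v _) (∫ _, _)]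
  ring

end moments

lemma freeEnergy_eq (P : Snapshot G h dh) (Tw : ℝ) {X : E} (hX : X ∈ G.D) :
    G.freeEnergy Tw h X = (∫ ξ, feDensity (G.R * Tw) h X ξ)
      + G.R * Tw * (density h X * ∫ y in (0 : ℝ)..G.calR h X, G.S y) := by
  have i1 := (P.poly_log.mul_rapidOn P.rapid).integrable hX
  have i2 := ((polyOn_norm_sq G.D).mul_rapidOn P.rapid).integrable hX
  unfold Gas.freeEnergy Gas.H Gas.HC feDensity
  rw [← P.energy_eq hX]
  simp_rw [add_mul, mul_assoc (G.R * Tw)]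
  rw [integral_add (i1.const_mul _) i2, integral_const_mul]
  simp_rw [mul_comm (h X _)]
  ring

lemma fluxF_eq (P : Snapshot G h dh) (Tw : ℝ) (i : Fin 3) {X : E} (hX : X ∈ G.D) :
    G.fluxF Tw h i X = (∫ ξ, ξ i * feDensity (G.R * Tw) h X ξ)
      + G.R * Tw * ((∫ y in (0 : ℝ)..G.calR h X, G.S y) * momentum (ext G.D h) X i)
      + G.σ ^ 3 / (2 * G.m) * (shiftFlux G.σ (pairInt G.σ (G.g h) (ext G.D h)
          (gainLoss (feWeight (G.R * Tw) (ext G.D h)))) i X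
        - G.R * Tw * shiftFlux G.σ (exchangeC G h) i X) := by
  have i1 := ((polyOn_coord G.D i).mul_rapidOn (P.poly_log.mul_rapidOn P.rapid)).integrable hX
  have i2 := ((polyOn_coord G.D i).mul_rapidOn
    ((polyOn_norm_sq G.D).mul_rapidOn P.rapid)).integrable hX
  have e1 : ∫ ξ, ξ i * feDensity (G.R * Tw) h X ξ
      = G.R * Tw * (∫ ξ, ξ i * (h X ξ * Real.log (h X ξ))) + ∫ ξ, ξ i * (‖ξ‖ ^ 2 / 2 * h X ξ) := by
    simp_rw [mul_comm (h X _)]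
    rw [← integral_const_mul, ← integral_add (i1.const_mul _) i2]
    congr 1 with ξ
    unfold feDensity; ring
  have e2 := P.collisional_flux_eq (G.R * Tw) i X
  unfold Gas.fluxF Gas.fluxH Gas.stress Gas.heatFlow
  rw [e1, P.energy_flux_eq hX, P.fluxC_eq i hX]
  simp_rw [add_mul, Finset.sum_add_distrib]
  linear_combination e2

/-- The time derivative of the local free energy. -/
def _root_.EESM.dtFreeEnergy (c : ℝ) (G : Gas) (h dh : E → E → ℝ) (X : E) : ℝ :=
  (∫ ξ, feWeight c h X ξ * dh X ξ)
    + c * (density dh X * (∫ y in (0 : ℝ)..G.calR h X, G.S y)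
      + density h X * G.S (G.calR h X) * dtCalR G dh X)

end Snapshot

end

end EESM

/-! ### Total exchange and assembly of the weak inequality -/

namespace EESM

noncomputable section

namespace Snapshot

variable {G : Gas} {h dh : E → E → ℝ} {φ : E → ℝ}

lemma locBddFun_momentum (P : Snapshot G h dh) (i : Fin 3) :
    LocBddFun fun X => momentum (ext G.D h) X i :=
  P.weakDiv.locBddFun_coord i

lemma locBdd_exchangeC (P : Snapshot G h dh) (hs : LocBddFun (enskogFactor G h)) :
    LocBdd (exchangeC G h) := by
  have hρ := P.rapid.locBddFun_density P.isOpen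
  have h1 := fun i => (((hs.mul (P.locBddFun_momentum i)).locBdd_mul_shift hρ G.σ i).add
    (((hs.mul hρ).locBdd_mul_shift (P.locBddFun_momentum i) G.σ i).const_mul (-1)))
  have h2 := ((h1 0).add (h1 1)).add (h1 2)
  refine (congrArg LocBdd (funext fun Y => funext fun α => ?_)).mp h2
  unfold exchangeC
  rw [inner_coord, Fin.sum_univ_three]
  simp only [PiLp.sub_apply, PiLp.smul_apply, smul_eq_mul]
  ring

/-- The two exchanges in a collision. -/
lemma exchangeC_add (G : Gas) (h : E → E → ℝ) (Y : E) (α : S2) :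
    exchangeC G h Y α + exchangeC G h (Y - G.σ • (α : E)) (-α)
      = G.g h Y (Y - G.σ • (α : E)) * inner ℝ (density (ext G.D h) (Y - G.σ • (α : E))
          • momentum (ext G.D h) Y - density (ext G.D h) Y
          • momentum (ext G.D h) (Y - G.σ • (α : E))) (α : E) := by
  unfold exchangeC
  rw [g_eq_enskogFactor]
  have h1 : Y - G.σ • (α : E) - G.σ • ((-α : S2) : E) = Y := by rw [coe_neg_sphere]; module
  rw [h1, coe_neg_sphere, inner_neg_right]
  set Z := Y - G.σ • (α : E)
  have h2 : inner ℝ (density (ext G.D h) Y • momentum (ext G.D h) Z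
      - density (ext G.D h) Z • momentum (ext G.D h) Y) (α : E)
      = -inner ℝ (density (ext G.D h) Z • momentum (ext G.D h) Y
      - density (ext G.D h) Y • momentum (ext G.D h) Z) (α : E) := by
    rw [← inner_neg_left, neg_sub]
  rw [h2]
  by_cases hY : Y ∈ G.D
  · by_cases hZ : Z ∈ G.D
    · simp only [Gas.chi, indicator_of_mem hY, indicator_of_mem hZ]; ring
    · simp [density_ext, momentum_ext, indicator_of_notMem hZ]
  · simp [density_ext, momentum_ext, indicator_of_notMem hY]

/-- The total exchange of free energy between the centers of colliding molecules. -/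
def _root_.EESM.exchangeF (c : ℝ) (G : Gas) (h : E → E → ℝ) (Y : E) (α : S2) : ℝ :=
  pairInt G.σ (G.g h) (ext G.D h) (gainLoss (feWeight c (ext G.D h))) Y α
    + -c * exchangeC G h Y α

lemma locBdd_pairInt (P : Snapshot G h dh) (c : ℝ) :
    LocBdd (pairInt G.σ (G.g h) (ext G.D h) (gainLoss (feWeight c (ext G.D h)))) :=
  (P.velGrowth_feWeight c).gainLoss.locBdd P.kernel P.kinetic G.σ

lemma locBdd_exchangeF (P : Snapshot G h dh) (hs : LocBddFun (enskogFactor G h)) (c : ℝ) :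
    LocBdd (exchangeF c G h) :=
  (P.locBdd_pairInt c).add ((P.locBdd_exchangeC hs).const_mul (-c))

/-- The decisive cancellation: the positive bound left over by the logarithmic inequality is exactly
`c` times the symmetrized exchange of `H^(c)`. -/
lemma exchangeF_add_nonpos (P : Snapshot G h dh) {c : ℝ} (hc : 0 ≤ c) (Y : E) (α : S2) :
    exchangeF c G h Y α + exchangeF c G h (Y - G.σ • (α : E)) (-α) ≤ 0 := by
  have h1 := pairInt_add_exchange_le P.kernel P.kinetic hc (P.velGrowth_feWeight c) G.σ Y α
  rw [← exchangeC_add] at h1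
  unfold exchangeF
  linarith

lemma fluxF_eq_shiftFlux (P : Snapshot G h dh) (hs : LocBddFun (enskogFactor G h)) (Tw : ℝ)
    (i : Fin 3) {X : E} (hX : X ∈ G.D) :
    G.fluxF Tw h i X = (∫ ξ, ξ i * feDensity (G.R * Tw) h X ξ)
      + G.R * Tw * ((∫ y in (0 : ℝ)..G.calR h X, G.S y) * momentum (ext G.D h) X i)
      + G.σ ^ 3 / (2 * G.m) * shiftFlux G.σ (exchangeF (G.R * Tw) G h) i X := by
  rw [P.fluxF_eq Tw i hX]
  unfold exchangeF
  rw [shiftFlux_add (P.locBdd_pairInt _) ((P.locBdd_exchangeC hs).const_mul _), shiftFlux_const_mul]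
  ring

lemma continuousOn_integral_enskog {xmax : EReal} (P : Snapshot G h dh) (hm : 0 < G.m)
    (hSc : ContinuousOn G.S {x : ℝ | 0 ≤ x ∧ (x : EReal) < xmax})
    (hdom : ∀ X ∈ G.D, (G.calR h X : EReal) < xmax) :
    ContinuousOn (fun X => ∫ y in (0 : ℝ)..G.calR h X, G.S y) G.D := by
  have hR := continuous_calR P.isOpen P.rapid
  have hR0 := calR_nonneg hm P.isOpen P.pos
  intro X hX
  -- Some room below `xmax` is needed, so that nearby values of `𝓡` stay in a compact interval on
  -- which `S` is continuous.
  obtain ⟨b, hb1, hb2⟩ := EReal.lt_iff_exists_real_btwn.1 (hdom X hX)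
  have hb1' : G.calR h X < b := EReal.coe_lt_coe_iff.1 hb1
  have hc : ContinuousOn G.S (Icc 0 b) := hSc.mono fun y hy =>
    ⟨hy.1, lt_of_le_of_lt (EReal.coe_le_coe_iff.2 hy.2) hb2⟩
  have h1 : ContinuousOn (fun x => ∫ y in (0 : ℝ)..x, G.S y) (Icc 0 b) :=
    intervalIntegral.continuousOn_primitive_interval
      (by rw [uIcc_of_le ((hR0 X).trans hb1'.le)]; exact hc.integrableOn_Icc) |>.mono
      (by rw [uIcc_of_le ((hR0 X).trans hb1'.le)])
  have h2 := (h1 (G.calR h X) ⟨hR0 X, hb1'.le⟩)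
  refine (h2.tendsto.comp (tendsto_nhdsWithin_iff.2 ⟨hR.continuousWithinAt, ?_⟩) : )
  filter_upwards [mem_nhdsWithin_of_mem_nhds (hR.continuousAt.eventually (gt_mem_nhds hb1'))]
    with Y hY using ⟨hR0 Y, hY.le⟩

lemma continuous_dtCalR (P : Snapshot G h dh) : Continuous (dtCalR G dh) :=
  ((P.rapid_dt.locBddFun_integral P.isOpen).continuous_ballInt G.σ).const_mul _

section inequality

variable {xmax : EReal}

lemma continuousOn_dtFreeEnergy (P : Snapshot G h dh) (hm : 0 < G.m)
    (hSc : ContinuousOn G.S {x : ℝ | 0 ≤ x ∧ (x : EReal) < xmax})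
    (hdom : ∀ X ∈ closure G.D, (G.calR h X : EReal) < xmax) (c : ℝ) :
    ContinuousOn (dtFreeEnergy c G h dh) G.D := by
  have h1 := ((P.polyOn_feWeight c).mul_rapidOn P.rapid_dt).continuousOn_integral
  have h2 := P.continuousOn_integral_enskog hm hSc fun X hX => hdom X (subset_closure hX)
  have h3 := (continuousOn_enskog hm P.isOpen P.rapid P.pos hSc hdom).mono subset_closure
  have h4 : ContinuousOn (density dh) G.D := P.rapid_dt.continuousOn_integral
  have h5 : ContinuousOn (density h) G.D := P.rapid.continuousOn_integral
  exact h1.add (continuousOn_const.mul ((h4.mul h2).add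
    ((h5.mul h3).mul P.continuous_dtCalR.continuousOn)))

lemma locallyIntegrableOn_fluxF (P : Snapshot G h dh) (hm : 0 < G.m)
    (hSc : ContinuousOn G.S {x : ℝ | 0 ≤ x ∧ (x : EReal) < xmax})
    (hdom : ∀ X ∈ closure G.D, (G.calR h X : EReal) < xmax) (Tw : ℝ) (i : Fin 3) :
    LocallyIntegrableOn (fun X => G.fluxF Tw h i X) G.D := by
  have hs := locBddFun_enskogFactor hm P.isOpen P.rapid P.pos hSc hdom
  refine locallyIntegrableOn_congr P.isOpen (fun X hX => P.fluxF_eq_shiftFlux hs Tw i hX) ?_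
  have h1 := ((polyOn_coord G.D i).mul_rapidOn (P.rapidOn_feDensity (G.R * Tw))).continuousOn_integral
  have h2 := P.continuousOn_integral_enskog hm hSc fun X hX => hdom X (subset_closure hX)
  have hc : Continuous fun v : E => v i := by fun_prop
  have h3 := hc.comp_continuousOn P.continuousOn_momentum
  have h4 := ((P.locBdd_exchangeF hs (G.R * Tw)).locBddFun_shiftFlux G.σ i).locallyIntegrable
  exact ((h1.add (continuousOn_const.mul (h2.mul h3))).locallyIntegrableOn
    P.isOpen.measurableSet).add ((h4.smul (G.σ ^ 3 / (2 * G.m))).locallyIntegrableOn _)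

/-- The weak form of the local free-energy inequality. -/
theorem weak_inequality (P : Snapshot G h dh) (hm : 0 < G.m) (hσ : 0 < G.σ)
    (hSc : ContinuousOn G.S {x : ℝ | 0 ≤ x ∧ (x : EReal) < xmax})
    (hdom : ∀ X ∈ closure G.D, (G.calR h X : EReal) < xmax)
    (hbdry : HasPiecewiseC1Boundary G.D)
    (himp : ∀ x n : E, IsOuterUnitNormal G.D x n →
      Tendsto (fun Y => inner ℝ (flowVelocity h Y) n) (𝓝[G.D] x) (𝓝 0))
    {Tw : ℝ} (hc : 0 ≤ G.R * Tw)
    (hφ : ContDiff ℝ 1 φ) (hk : HasCompactSupport φ) (hs : tsupport φ ⊆ G.D) (h0 : ∀ X, 0 ≤ φ X) :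
    ∫ X in G.D, dtFreeEnergy (G.R * Tw) G h dh X * φ X
      ≤ ∫ X in G.D, ∑ i, G.fluxF Tw h i X * pderiv i φ X := by
  set c := G.R * Tw with hcdef
  have hdom' : ∀ X ∈ G.D, (G.calR h X : EReal) < xmax := fun X hX => hdom X (subset_closure hX)
  have hE := locBddFun_enskogFactor hm P.isOpen P.rapid P.pos hSc hdom
  have hpc : ∀ i, Continuous (pderiv i φ) := fun i =>
    (hφ.continuous_fderiv one_ne_zero).clm_apply continuous_const
  have hpk : ∀ i, HasCompactSupport (pderiv i φ) := fun i => hk.fderiv_apply (𝕜 := ℝ) _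
  have hps : ∀ i, tsupport (pderiv i φ) ⊆ G.D := fun i => (tsupport_fderiv_apply_subset ℝ _).trans hs
  have hz : ∀ X ∉ G.D, φ X = 0 := fun X hX => image_eq_zero_of_notMem_tsupport fun h => hX (hs h)
  have hpz : ∀ i, ∀ X ∉ G.D, pderiv i φ X = 0 := fun i X hX =>
    image_eq_zero_of_notMem_tsupport fun h => hX (hps i h)
  rw [setIntegral_eq_integral_of_forall_compl_eq_zero fun X hX => by rw [hz X hX, mul_zero],
    setIntegral_eq_integral_of_forall_compl_eq_zero fun X hX =>
      Finset.sum_eq_zero fun i _ => by rw [hpz i X hX, mul_zero]]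
  have hΦ := P.continuousOn_integral_enskog hm hSc hdom'
  have int : ∀ {u k : E → ℝ}, Continuous k → HasCompactSupport k → tsupport k ⊆ G.D →
      ContinuousOn u G.D → Integrable fun X => k X * u X := fun k1 k2 k3 hu =>
    (continuous_mul_of_tsupport k1 k3 P.isOpen hu).integrable_of_hasCompactSupport k2.mul_right
  -- the left-hand side
  have b1 := P.balance_feWeight c hφ hk hs
  have b2 := P.balance_HC hm hσ hSc hdom' hbdry himp hφ hk hs
  have i1 := int hφ.continuous hk hs
    ((P.polyOn_feWeight c).mul_rapidOn P.rapid_dt).continuousOn_integral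
  have hd : ContinuousOn (density dh) G.D := P.rapid_dt.continuousOn_integral
  have hd' : ContinuousOn (density h) G.D := P.rapid.continuousOn_integral
  have hS := (continuousOn_enskog hm P.isOpen P.rapid P.pos hSc hdom).mono subset_closure
  have i2 : Integrable fun X => φ X * (density dh X * ∫ y in (0 : ℝ)..G.calR h X, G.S y) :=
    int hφ.continuous hk hs (hd.mul hΦ)
  have i3 : Integrable fun X => φ X * (density h X * G.S (G.calR h X) * dtCalR G dh X) :=
    int hφ.continuous hk hs ((hd'.mul hS).mul P.continuous_dtCalR.continuousOn)
  have eL : ∫ X, dtFreeEnergy c G h dh X * φ X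
      = (∫ X, φ X * ∫ ξ, feWeight c h X ξ * dh X ξ)
        + c * ((∫ X, φ X * (density dh X * ∫ y in (0 : ℝ)..G.calR h X, G.S y))
        + ∫ X, φ X * (density h X * G.S (G.calR h X) * dtCalR G dh X)) := by
    rw [← integral_add i2 i3, ← integral_const_mul, ← integral_add i1 ((i2.fun_add i3).const_mul c)]
    congr 1 with X
    unfold dtFreeEnergy; ring
  -- the right-hand side
  have hA := P.locBdd_pairInt c
  have hB := P.locBdd_exchangeC hE
  have hF := P.locBdd_exchangeF hE c
  have j1 : Integrable fun X => ∑ i, (∫ ξ, ξ i * feDensity c h X ξ) * pderiv i φ X :=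
    integrable_finsetSum _ fun i _ => by
      have := int (hpc i) (hpk i) (hps i)
        ((polyOn_coord G.D i).mul_rapidOn (P.rapidOn_feDensity c)).continuousOn_integral
      exact this.congr (Eventually.of_forall fun X => mul_comm _ _)
  have hcc : ∀ i, Continuous fun v : E => v i := fun i => by fun_prop
  have e2 : ∀ X, (∫ y in (0 : ℝ)..G.calR h X, G.S y) * fderiv ℝ φ X (momentum (ext G.D h) X)
      = ∑ i, pderiv i φ X * ((∫ y in (0 : ℝ)..G.calR h X, G.S y) * momentum (ext G.D h) X i) := by
    intro X
    rw [clm_apply_eq_sum, Finset.mul_sum]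
    exact Finset.sum_congr rfl fun i _ => by unfold pderiv; ring
  have j2 : Integrable fun X =>
      (∫ y in (0 : ℝ)..G.calR h X, G.S y) * fderiv ℝ φ X (momentum (ext G.D h) X) := by
    simp_rw [e2]
    exact integrable_finsetSum _ fun i _ => int (hpc i) (hpk i) (hps i)
      (hΦ.mul ((hcc i).comp_continuousOn P.continuousOn_momentum))
  have j3 : Integrable fun X => ∑ i, shiftFlux G.σ (exchangeF c G h) i X * pderiv i φ X :=
    integrable_finsetSum _ fun i _ => (hF.locBddFun_shiftFlux G.σ i).integrable_test (hpc i) (hpk i)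
  have eR : ∫ X, ∑ i, G.fluxF Tw h i X * pderiv i φ X
      = (∫ X, ∑ i, (∫ ξ, ξ i * feDensity c h X ξ) * pderiv i φ X)
        + c * (∫ X, (∫ y in (0 : ℝ)..G.calR h X, G.S y) * fderiv ℝ φ X (momentum (ext G.D h) X))
        + G.σ ^ 3 / (2 * G.m) * ∫ X, ∑ i, shiftFlux G.σ (exchangeF c G h) i X * pderiv i φ X := by
    rw [← integral_const_mul, ← integral_const_mul, ← integral_add j1 (j2.const_mul c),
      ← integral_add (j1.fun_add (j2.const_mul c)) (j3.const_mul _)]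
    congr 1 with X
    rw [e2, Finset.mul_sum, Finset.mul_sum, ← Finset.sum_add_distrib, ← Finset.sum_add_distrib]
    refine Finset.sum_congr rfl fun i _ => ?_
    by_cases hX : X ∈ G.D
    · rw [P.fluxF_eq_shiftFlux hE Tw i hX]; ring
    · rw [hpz i X hX]; ring
  -- The fluxes carry the antisymmetric half of the exchange, `φ(Y) - φ(Y - σα)`; the symmetric half
  -- is dissipative by `hdis`.
  have hw := shiftFlux_weak hF G.σ hφ hk
  have hdis := hF.integral_exchange_nonpos (P.exchangeF_add_nonpos hc) hφ.continuous hk h0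
  have k0 := hF.integrable_mul hφ.continuous hk 0
  have k1 := hF.integrable_mul hφ.continuous hk G.σ
  have kA := hA.integrable_mul hφ.continuous hk 0
  have kB := hB.integrable_mul hφ.continuous hk 0
  simp only [zero_smul, sub_zero] at k0 kA kB
  simp_rw [mul_sub] at hw
  rw [integral_sub k0 k1] at hw
  have eF : ∫ q : S2 × E, exchangeF c G h q.2 q.1 * φ q.2 ∂(solidAngle.prod volume)
      = (∫ q : S2 × E, pairInt G.σ (G.g h) (ext G.D h) (gainLoss (feWeight c (ext G.D h))) q.2 q.1
          * φ q.2 ∂(solidAngle.prod volume))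
        - c * ∫ q : S2 × E, exchangeC G h q.2 q.1 * φ q.2 ∂(solidAngle.prod volume) := by
    rw [← integral_const_mul, ← integral_sub kA (kB.const_mul c)]
    congr 1 with q
    unfold exchangeF; ring
  rw [eL, eR, b1, b2]
  set a1 := ∫ q : S2 × E, exchangeF c G h q.2 q.1 * φ q.2 ∂(solidAngle.prod volume)
  set a2 := ∫ q : S2 × E, exchangeF c G h q.2 q.1 * φ (q.2 - G.σ • (q.1 : E))
    ∂(solidAngle.prod volume)
  set fl := ∫ X, ∑ i, shiftFlux G.σ (exchangeF c G h) i X * pderiv i φ X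
  have e3 : G.σ ^ 3 / (2 * G.m) * fl = G.σ ^ 2 / (2 * G.m) * (a1 - a2) := by rw [← hw]; ring
  -- The source is `a1 = ½ (a1 - a2) + ½ (a1 + a2)`, and `a1 + a2 ≤ 0`. The factor `½` explains
  -- `σ²/(2m)` in the fluxes against `σ²/m` in the collision term.
  have e4 : G.σ ^ 2 / G.m * a1 ≤ G.σ ^ 2 / (2 * G.m) * (a1 - a2) := by
    have h1 : G.σ ^ 2 / G.m * a1 = G.σ ^ 2 / (2 * G.m) * (2 * a1) := by ring
    rw [h1]
    exact mul_le_mul_of_nonneg_left (by linarith) (by positivity)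
  rw [e3]
  linear_combination e4 - G.σ ^ 2 / G.m * eF

end inequality

end Snapshot

end

end EESM

namespace EESM

noncomputable section

/-! ### Regular solutions: snapshots and time derivatives -/

/-- The time derivative at a frozen time. -/
def dtf (f : ℝ → E → E → ℝ) (t : ℝ) (X ξ : E) : ℝ := deriv (fun s => f s X ξ) t

namespace IsRegular

variable {D : Set E} {I : Set ℝ} {f : ℝ → E → E → ℝ}

lemma continuousOn_slice {F : ℝ × E × E → ℝ} (hF : ContinuousOn F (I ×ˢ D ×ˢ univ)) {t : ℝ}
    (ht : t ∈ I) : ContinuousOn (fun p : E × E => F (t, p.1, p.2)) (D ×ˢ univ) := by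
  have h : Continuous fun p : E × E => (t, p.1, p.2) := by fun_prop
  exact hF.comp h.continuousOn fun p hp => ⟨ht, hp.1, mem_univ _⟩

lemma rapidOn (hreg : IsRegular D I f) {t : ℝ} (ht : t ∈ I) : RapidOn D (f t) := by
  refine ⟨continuousOn_slice hreg.cont ht, fun r k => ?_⟩
  obtain ⟨C, hC⟩ := hreg.decay {t} (singleton_subset_iff.2 ht) isCompact_singleton r k
  refine ⟨|C|, abs_nonneg C, fun X hX hr ξ => ?_⟩
  rw [abs_of_pos (hreg.pos t ht X hX ξ)]
  exact (hC t rfl X hX hr ξ).trans (le_abs_self C)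

lemma rapidOn_dt (hreg : IsRegular D I f) {t : ℝ} (ht : t ∈ I) : RapidOn D (dtf f t) := by
  refine ⟨continuousOn_slice hreg.cont_dt ht, fun r k => ?_⟩
  obtain ⟨C, hC⟩ := hreg.decay_dt {t} (singleton_subset_iff.2 ht) isCompact_singleton r k
  exact ⟨|C|, abs_nonneg C, fun X hX hr ξ => (hC t rfl X hX hr ξ).trans (le_abs_self C)⟩

lemma polyOn_log (hreg : IsRegular D I f) {t : ℝ} (ht : t ∈ I) :
    PolyOn D fun X ξ => Real.log (f t X ξ) := by
  refine ⟨(continuousOn_slice hreg.cont ht).log fun p hp => (hreg.pos t ht p.1 hp.1 p.2).ne',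
    fun r => ?_⟩
  obtain ⟨C, k, hC⟩ := hreg.log_growth {t} (singleton_subset_iff.2 ht) isCompact_singleton r
  refine ⟨|C|, k, abs_nonneg C, fun X hX hr ξ => (hC t rfl X hX hr ξ).trans ?_⟩
  exact mul_le_mul_of_nonneg_right (le_abs_self C) (pow_pos (wt_pos ξ) k).le

lemma rapidOn_dX (hreg : IsRegular D I f) {t : ℝ} (ht : t ∈ I) {D' : Set E}
    (hc : IsCompact (closure D')) (hD : closure D' ⊆ D) :
    RapidOn D' fun X ξ => fderiv ℝ (fun Y => f t Y ξ) X ξ := by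
  constructor
  · have h : Continuous fun p : E × E => (t, p.1, p.2) := by fun_prop
    have h1 : ContinuousOn (fun p : E × E => fderiv ℝ (fun Y => f t Y p.2) p.1) (D' ×ˢ univ) :=
      hreg.cont_dX.comp h.continuousOn fun p hp => ⟨ht, hD (subset_closure hp.1), mem_univ _⟩
    exact h1.clm_apply continuous_snd.continuousOn
  · intro r k
    obtain ⟨C, hC⟩ := hreg.decay_dX {t} (singleton_subset_iff.2 ht) isCompact_singleton
      (closure D') hD hc (k + 1)
    refine ⟨|C|, abs_nonneg C, fun X hX _ ξ => ?_⟩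
    have hw := wt_pos ξ
    calc wt ξ ^ k * |fderiv ℝ (fun Y => f t Y ξ) X ξ|
        ≤ wt ξ ^ k * (‖fderiv ℝ (fun Y => f t Y ξ) X‖ * wt ξ) := by
          refine mul_le_mul_of_nonneg_left ?_ (by positivity)
          have h1 := (fderiv ℝ (fun Y => f t Y ξ) X).le_opNorm ξ
          have h2 : 0 ≤ ‖fderiv ℝ (fun Y => f t Y ξ) X‖ := norm_nonneg _
          exact h1.trans (mul_le_mul_of_nonneg_left (norm_le_wt ξ) h2)
      _ = wt ξ ^ (k + 1) * ‖fderiv ℝ (fun Y => f t Y ξ) X‖ := by rw [pow_succ]; ring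
      _ ≤ C := hC t rfl X (subset_closure hX) ξ
      _ ≤ |C| := le_abs_self C

lemma snapshot {G : Gas} {I : Set ℝ} {f : ℝ → E → E → ℝ} (hreg : IsRegular G.D I f)
    (hm : 0 < G.m) (hD : IsOpen G.D) {xmax : EReal}
    (hSc : ContinuousOn G.S {x : ℝ | 0 ≤ x ∧ (x : EReal) < xmax})
    (hSn : ∀ x : ℝ, 0 ≤ x → (x : EReal) < xmax → 0 ≤ G.S x)
    (hdom : ∀ t ∈ I, ∀ X ∈ closure G.D, (G.calR (f t) X : EReal) < xmax)
    (hsol : G.IsSolution I f) {t : ℝ} (ht : t ∈ I) : Snapshot G (f t) (dtf f t) where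
  isOpen := hD
  pos := hreg.pos t ht
  rapid := hreg.rapidOn ht
  rapid_dt := hreg.rapidOn_dt ht
  poly_log := hreg.polyOn_log ht
  diff := hreg.diff_X t ht
  rapid_dX _ h1 h2 := hreg.rapidOn_dX ht h1 h2
  eqn X hX ξ := by
    rw [← hsol t ht X hX ξ, clm_apply_eq_sum]; rfl
  kernel := isKernel_g hm hD (hreg.rapidOn ht) (hreg.pos t ht) hSc hSn (hdom t ht)

/-- Differentiation of a velocity average with respect to time. -/
lemma hasDerivAt_integral_velocity {F F' : ℝ → E → ℝ} {K : Set ℝ} {t C : ℝ} (hK : K ∈ 𝓝 t)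
    (hF : ∀ s ∈ K, Integrable (F s)) (hF' : AEStronglyMeasurable (F' t))
    (hb : ∀ s ∈ K, ∀ ξ, wt ξ ^ 4 * |F' s ξ| ≤ C)
    (hd : ∀ s ∈ K, ∀ ξ, HasDerivAt (fun s => F s ξ) (F' s ξ) s) :
    HasDerivAt (fun s => ∫ ξ, F s ξ) (∫ ξ, F' t ξ) t :=
  (hasDerivAt_integral_of_dominated_loc_of_deriv_le hK
    (by filter_upwards [hK] with s hs using (hF s hs).aestronglyMeasurable)
    (hF t (mem_of_mem_nhds hK)) hF'
    (Eventually.of_forall fun ξ s hs => norm_le_of_wt (hb s hs ξ)) (integrable_wt.const_mul C)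
    (Eventually.of_forall fun ξ s hs => hd s hs ξ)).2

lemma hasDerivAt (hreg : IsRegular D I f) {s : ℝ} (hs : s ∈ I) {X : E} (hX : X ∈ D) (ξ : E) :
    HasDerivAt (fun s => f s X ξ) (dtf f s X ξ) s := (hreg.diff_t s hs X hX ξ).hasDerivAt

lemma hasDerivAt_density (hreg : IsRegular D I f) (hI : IsOpen I) {t : ℝ} (ht : t ∈ I) {X : E}
    (hX : X ∈ D) : HasDerivAt (fun s => density (f s) X) (density (dtf f t) X) t := by
  obtain ⟨K, hK, htK, hKI⟩ := exists_compact_subset hI ht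
  obtain ⟨C, hC⟩ := hreg.decay_dt K hKI hK ‖X‖ 4
  exact hasDerivAt_integral_velocity (mem_interior_iff_mem_nhds.1 htK)
    (fun s hs => (hreg.rapidOn (hKI hs)).integrable hX)
    ((hreg.rapidOn_dt ht).integrable hX).aestronglyMeasurable
    (fun s hs ξ => hC s hs X hX le_rfl ξ) fun s hs ξ => hreg.hasDerivAt (hKI hs) hX ξ

lemma hasDerivAt_feDensity (hreg : IsRegular D I f) (hI : IsOpen I) (c : ℝ) {t : ℝ} (ht : t ∈ I)
    {X : E} (hX : X ∈ D) : HasDerivAt (fun s => ∫ ξ, feDensity c (f s) X ξ)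
      (∫ ξ, feWeight c (f t) X ξ * dtf f t X ξ) t := by
  have hw : ∀ s ∈ I, PolyOn D (feWeight c (f s)) := fun s hs =>
    ((polyOn_const D c).mul ((polyOn_const D 1).add (hreg.polyOn_log hs))).add (polyOn_norm_sq D)
  have hr : ∀ s ∈ I, RapidOn D (feDensity c (f s)) := fun s hs =>
    (((polyOn_const D c).mul (hreg.polyOn_log hs)).add (polyOn_norm_sq D)).mul_rapidOn
      (hreg.rapidOn hs)
  obtain ⟨K, hK, htK, hKI⟩ := exists_compact_subset hI ht
  obtain ⟨B, k, hB⟩ := hreg.log_growth K hKI hK ‖X‖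
  -- Of the `k + 6` powers, `k + 2` absorb the growth of the logarithm and of `|ξ|²`, and 4 are left
  -- for integrability.
  obtain ⟨C, hC⟩ := hreg.decay_dt K hKI hK ‖X‖ (k + 6)
  refine hasDerivAt_integral_velocity (F' := fun s ξ => feWeight c (f s) X ξ * dtf f s X ξ)
    (C := (|c| * (1 + |B|) + 1) * C) (mem_interior_iff_mem_nhds.1 htK)
    (fun s hs => (hr s (hKI hs)).integrable hX)
    (((hw t ht).mul_rapidOn (hreg.rapidOn_dt ht)).integrable hX).aestronglyMeasurable
    (fun s hs ξ => ?_) fun s hs ξ => ?_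
  · have h1 := one_le_wt ξ
    have h2 : 1 ≤ wt ξ ^ (k + 2) := one_le_pow₀ h1
    have h3 : wt ξ ^ k ≤ wt ξ ^ (k + 2) := pow_le_pow_right₀ h1 (by omega)
    have h4 : ‖ξ‖ ^ 2 / 2 ≤ wt ξ ^ (k + 2) := by
      have := pow_le_pow_left₀ (norm_nonneg ξ) (norm_le_wt ξ) 2
      have h5 : wt ξ ^ 2 ≤ wt ξ ^ (k + 2) := pow_le_pow_right₀ h1 (by omega)
      nlinarith [sq_nonneg ‖ξ‖]
    have h5 : |feWeight c (f s) X ξ| ≤ (|c| * (1 + |B|) + 1) * wt ξ ^ (k + 2) := by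
      refine (abs_add_le _ _).trans ?_
      rw [abs_mul, abs_of_nonneg (by positivity : 0 ≤ ‖ξ‖ ^ 2 / 2), add_mul, one_mul]
      refine add_le_add ?_ h4
      rw [mul_assoc]
      refine mul_le_mul_of_nonneg_left ((abs_add_le _ _).trans ?_) (abs_nonneg c)
      rw [abs_one, add_mul, one_mul]
      refine add_le_add h2 ((hB s hs X hX le_rfl ξ).trans ?_)
      exact mul_le_mul (le_abs_self B) h3 (by have := wt_pos ξ; unfold wt at this; positivity)
        (abs_nonneg B)
    have h6 := hC s hs X hX le_rfl ξ
    calc wt ξ ^ 4 * |feWeight c (f s) X ξ * dtf f s X ξ|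
        = |feWeight c (f s) X ξ| * (wt ξ ^ 4 * |dtf f s X ξ|) := by rw [abs_mul]; ring
      _ ≤ (|c| * (1 + |B|) + 1) * wt ξ ^ (k + 2) * (wt ξ ^ 4 * |dtf f s X ξ|) :=
        mul_le_mul_of_nonneg_right h5 (by positivity)
      _ = (|c| * (1 + |B|) + 1) * (wt ξ ^ (k + 6) * |dtf f s X ξ|) := by
        rw [show k + 6 = k + 2 + 4 by ring, pow_add _ (k + 2) 4]; ring
      _ ≤ _ := mul_le_mul_of_nonneg_left h6 (by positivity)
  · have h1 := hreg.hasDerivAt (hKI hs) hX ξ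
    have h0 := (hreg.pos s (hKI hs) X hX ξ).ne'
    have h2 := (((h1.log h0).const_mul c).add_const (‖ξ‖ ^ 2 / 2)).mul h1
    refine h2.congr_deriv ?_
    unfold feWeight
    field_simp
    ring

/-- The ball around `X` is bounded, so bounds on `∂f/∂t` that hold up to `∂D` suffice to
differentiate under both integrals, even for balls crossing the wall. -/
lemma hasDerivAt_calR {G : Gas} {I : Set ℝ} {f : ℝ → E → E → ℝ} (hreg : IsRegular G.D I f)
    (hD : IsOpen G.D) (hI : IsOpen I) {t : ℝ} (ht : t ∈ I) (X : E) :
    HasDerivAt (fun s => G.calR (f s) X) (dtCalR G (dtf f t) X) t := by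
  obtain ⟨K, hK, htK, hKI⟩ := exists_compact_subset hI ht
  obtain ⟨C, hC⟩ := hreg.decay_dt K hKI hK (‖X‖ + G.σ) 4
  simp_rw [calR_eq hD]
  refine HasDerivAt.const_mul _ ?_
  have hK' := mem_interior_iff_mem_nhds.1 htK
  set B := ∫ ξ : E, C * (wt ξ ^ 4)⁻¹ with hB
  refine (hasDerivAt_integral_of_dominated_loc_of_deriv_le
    (F := fun s Y => density (ext G.D (f s)) Y * theta (G.σ - ‖Y - X‖))
    (F' := fun s Y => G.D.indicator (density (dtf f s)) Y * theta (G.σ - ‖Y - X‖)) hK' ?_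
    (((hreg.rapidOn ht).locBddFun_density hD).integrable_theta G.σ X)
    (((hreg.rapidOn_dt ht).locBddFun_integral hD).integrable_theta G.σ X).aestronglyMeasurable
    (bound := (Metric.closedBall (0 : E) (‖X‖ + G.σ)).indicator fun _ => |B|)
    (Eventually.of_forall fun Y s hs => ?_) (integrable_indicator_closedBall _ _)
    (Eventually.of_forall fun Y s hs => ?_)).2
  · filter_upwards [hK'] with s hs
    exact (((hreg.rapidOn (hKI hs)).locBddFun_density hD).integrable_theta G.σ X).aestronglyMeasurable
  · have hn : 0 ≤ (Metric.closedBall (0 : E) (‖X‖ + G.σ)).indicator (fun _ => |B|) Y :=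
      indicator_nonneg (fun _ _ => abs_nonneg B) _
    by_cases hY : Y ∈ G.D
    · by_cases hYX : ‖Y - X‖ ≤ G.σ
      · have hYr : ‖Y‖ ≤ ‖X‖ + G.σ := by
          have := norm_le_norm_add_norm_sub' Y X
          linarith
        rw [indicator_of_mem hY, indicator_of_mem (by simpa using hYr), norm_mul]
        have h1 : ‖density (dtf f s) Y‖ ≤ B :=
          norm_integral_le_of_norm_le (integrable_wt.const_mul C)
            (Eventually.of_forall fun ξ => norm_le_of_wt (hC s hs Y hY hYr ξ))
        have h2 : ‖theta (G.σ - ‖Y - X‖)‖ ≤ 1 := by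
          rw [Real.norm_eq_abs, abs_of_nonneg (theta_nonneg _)]; exact theta_le_one _
        calc _ ≤ |B| * 1 := mul_le_mul (h1.trans (le_abs_self B)) h2 (norm_nonneg _) (abs_nonneg B)
          _ = |B| := mul_one _
      · have : theta (G.σ - ‖Y - X‖) = 0 := by unfold theta; rw [if_neg (by linarith)]
        rw [this, mul_zero, norm_zero]; exact hn
    · rw [indicator_of_notMem hY, zero_mul, norm_zero]; exact hn
  · refine HasDerivAt.mul_const ?_ _
    simp_rw [density_ext]
    by_cases hY : Y ∈ G.D
    · simp_rw [indicator_of_mem hY]; exact hreg.hasDerivAt_density hI (hKI hs) hY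
    · simp_rw [indicator_of_notMem hY]; exact hasDerivAt_const _ _

/-- Strict positivity puts `𝓡` in the interior of the range where `S` is continuous, so the
primitive of `S` has a two-sided derivative there. -/
lemma calR_pos {G : Gas} {h : E → E → ℝ} (hm : 0 < G.m) (hσ : 0 < G.σ) (hD : IsOpen G.D)
    (hh : RapidOn G.D h) (hpos : ∀ X ∈ G.D, ∀ ξ, 0 < h X ξ)
    (hρ : ∀ X ∈ G.D, 0 < density h X) {X : E} (hX : X ∈ G.D) : 0 < G.calR h X := by
  rw [calR_eq hD]
  refine mul_pos (by positivity) ?_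
  refine (integral_pos_iff_support_of_nonneg
    (fun Y => mul_nonneg (density_ext_nonneg hpos Y) (theta_nonneg _))
    ((hh.locBddFun_density hD).integrable_theta G.σ X)).2 ?_
  refine lt_of_lt_of_le ((hD.inter Metric.isOpen_ball).measure_pos volume
    ⟨X, hX, Metric.mem_ball_self hσ⟩) (measure_mono fun Y hY => ?_)
  have h1 : theta (G.σ - ‖Y - X‖) = 1 := by
    have := hY.2
    rw [Metric.mem_ball, dist_eq_norm] at this
    unfold theta; rw [if_pos (by linarith)]
  rw [Function.mem_support, h1, mul_one, density_ext, indicator_of_mem hY.1]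
  exact (hρ Y hY.1).ne'

/-- The local free energy is differentiable in time. -/
theorem hasDerivAt_freeEnergy {G : Gas} {I : Set ℝ} {f : ℝ → E → E → ℝ} (hreg : IsRegular G.D I f)
    (hm : 0 < G.m) (hσ : 0 < G.σ) (hD : IsOpen G.D) (hI : IsOpen I) {xmax : EReal}
    (hSc : ContinuousOn G.S {x : ℝ | 0 ≤ x ∧ (x : EReal) < xmax})
    (hSn : ∀ x : ℝ, 0 ≤ x → (x : EReal) < xmax → 0 ≤ G.S x)
    (hdom : ∀ t ∈ I, ∀ X ∈ closure G.D, (G.calR (f t) X : EReal) < xmax)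
    (hsol : G.IsSolution I f) (Tw : ℝ) {t : ℝ} (ht : t ∈ I) {X : E} (hX : X ∈ G.D) :
    HasDerivAt (fun s => G.freeEnergy Tw (f s) X)
      (dtFreeEnergy (G.R * Tw) G (f t) (dtf f t) X) t := by
  have P := fun s hs => hreg.snapshot hm hD hSc hSn hdom hsol (t := s) hs
  have hpos := calR_pos hm hσ hD (P t ht).rapid (P t ht).pos (fun Y hY => (P t ht).density_pos hY) hX
  obtain ⟨b, hb1, hb2⟩ := EReal.lt_iff_exists_real_btwn.1 (hdom t ht X (subset_closure hX))
  have hb1' : G.calR (f t) X < b := EReal.coe_lt_coe_iff.1 hb1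
  have hc : ContinuousOn G.S (Icc 0 b) := hSc.mono fun y hy =>
    ⟨hy.1, lt_of_le_of_lt (EReal.coe_le_coe_iff.2 hy.2) hb2⟩
  have hc' : ContinuousOn G.S (Ioo 0 b) := hc.mono Ioo_subset_Icc_self
  have hΦ : HasDerivAt (fun x => ∫ y in (0 : ℝ)..x, G.S y) (G.S (G.calR (f t) X)) (G.calR (f t) X) :=
    intervalIntegral.integral_hasDerivAt_right
      ((hc.mono (by rw [uIcc_of_le hpos.le]; exact Icc_subset_Icc_right hb1'.le)).intervalIntegrable)
      (hc'.stronglyMeasurableAtFilter isOpen_Ioo _ ⟨hpos, hb1'⟩)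
      (hc'.continuousAt (isOpen_Ioo.mem_nhds ⟨hpos, hb1'⟩))
  have h1 := hreg.hasDerivAt_feDensity hI (G.R * Tw) ht hX
  have h2 := hreg.hasDerivAt_density hI ht hX
  have h3 : HasDerivAt (fun s => ∫ y in (0 : ℝ)..G.calR (f s) X, G.S y)
      (G.S (G.calR (f t) X) * dtCalR G (dtf f t) X) t :=
    HasDerivAt.comp (h := fun s => G.calR (f s) X) t hΦ (hreg.hasDerivAt_calR hD hI ht X)
  have h4 := h1.add ((h2.mul h3).const_mul (G.R * Tw))
  refine (h4.congr_deriv ?_).congr_of_eventuallyEq ?_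
  · unfold dtFreeEnergy; ring
  · filter_upwards [hI.mem_nhds ht] with s hs
    exact (P s hs).freeEnergy_eq Tw hX

end IsRegular

end

end EESM

namespace EESM

noncomputable section

/-! ### From the weak to the pointwise inequality -/

lemma integral_blowup (F : E → ℝ) (X₀ : E) (r : ℝ) :
    ∫ Z, F (X₀ + r • Z) = |(r ^ 3)⁻¹| * ∫ X, F X := by
  have h := Measure.integral_comp_smul (volume : Measure E) (fun Z => F (X₀ + Z)) r
  rw [finrank_euclideanSpace_fin] at h
  rw [h, integral_add_left_eq_self F X₀, smul_eq_mul]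

lemma pderiv_blowup {β : E → ℝ} (hβ : Differentiable ℝ β) (X₀ : E) {r : ℝ} (hr : r ≠ 0) (i : Fin 3)
    (Z : E) : pderiv i (fun X => β (r⁻¹ • (X - X₀))) (X₀ + r • Z) = r⁻¹ * pderiv i β Z := by
  have e : r⁻¹ • (X₀ + r • Z - X₀) = Z := by rw [add_sub_cancel_left, inv_smul_smul₀ hr]
  have h1 : HasFDerivAt (fun X : E => r⁻¹ • (X - X₀)) (r⁻¹ • ContinuousLinearMap.id ℝ E) (X₀ + r • Z) :=
    ((hasFDerivAt_id _).sub_const X₀).const_smul r⁻¹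
  have h2 : HasFDerivAt β (fderiv ℝ β Z) (r⁻¹ • (X₀ + r • Z - X₀)) := by
    rw [e]; exact (hβ Z).hasFDerivAt
  have h3 := h2.comp (X₀ + r • Z) h1
  unfold pderiv
  have h4 : fderiv ℝ (fun X => β (r⁻¹ • (X - X₀))) (X₀ + r • Z)
      = (fderiv ℝ β Z).comp (r⁻¹ • ContinuousLinearMap.id ℝ E) := h3.fderiv
  rw [h4]; simp

lemma integral_pderiv_eq_zero {β : E → ℝ} (hβ : ContDiff ℝ 1 β) (hk : HasCompactSupport β)
    (i : Fin 3) : ∫ Z, pderiv i β Z = 0 := by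
  have hc : Continuous (pderiv i β) :=
    (hβ.continuous_fderiv one_ne_zero).clm_apply continuous_const
  have hI : Integrable (pderiv i β) := hc.integrable_of_hasCompactSupport (hk.fderiv_apply (𝕜 := ℝ) _)
  have h := integral_mul_fderiv_eq_neg_fderiv_mul_of_integrable (μ := (volume : Measure E))
    (f := fun _ : E => (1 : ℝ)) (g := β) (v := EuclideanSpace.single i 1) (by simp)
    (by simp only [one_mul]; exact hI) (by simpa using hβ.continuous.integrable_of_hasCompactSupport hk)
    (fun _ _ => differentiableAt_const _) fun _ _ => hβ.differentiable one_ne_zero _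
  simpa [pderiv] using h

lemma integral_linear_mul_pderiv {β : E → ℝ} (hβ : ContDiff ℝ 1 β) (hk : HasCompactSupport β)
    (i : Fin 3) (L : E →L[ℝ] ℝ) :
    ∫ Z, L Z * pderiv i β Z = -(L (EuclideanSpace.single i 1) * ∫ Z, β Z) := by
  have hc : Continuous (pderiv i β) :=
    (hβ.continuous_fderiv one_ne_zero).clm_apply continuous_const
  have h := integral_mul_fderiv_eq_neg_fderiv_mul_of_integrable (μ := (volume : Measure E))
    (f := fun Z : E => L Z) (g := β) (v := EuclideanSpace.single i 1)
    (by simpa using (hβ.continuous.integrable_of_hasCompactSupport hk).const_mul _)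
    ((L.continuous.mul hc).integrable_of_hasCompactSupport (hk.fderiv_apply (𝕜 := ℝ) _).mul_left)
    ((L.continuous.mul hβ.continuous).integrable_of_hasCompactSupport hk.mul_left)
    (fun _ _ => L.differentiableAt) fun _ _ => hβ.differentiable one_ne_zero _
  rw [← integral_const_mul]
  simpa [pderiv] using h

/-- A weak differential inequality holds pointwise where the flux is differentiable. -/
theorem pointwise_of_weak {D : Set E} (hD : IsOpen D) {e : E → ℝ} {J : Fin 3 → E → ℝ}
    (he : ContinuousOn e D) (hJm : ∀ i, Measurable (D.indicator (J i)))
    (hweak : ∀ φ : E → ℝ, ContDiff ℝ ∞ φ → HasCompactSupport φ → tsupport φ ⊆ D → (∀ X, 0 ≤ φ X) →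
      ∫ X in D, e X * φ X ≤ ∫ X in D, ∑ i, J i X * pderiv i φ X)
    {X₀ : E} (hX₀ : X₀ ∈ D) (hJ : ∀ i, DifferentiableAt ℝ (J i) X₀) :
    e X₀ + ∑ i, pderiv i (J i) X₀ ≤ 0 := by
  let β : ContDiffBump (0 : E) := ⟨1, 2, one_pos, one_lt_two⟩
  have hβs : ContDiff ℝ ∞ β := β.contDiff
  have hβ1 : ContDiff ℝ 1 β := β.contDiff
  have hβk : HasCompactSupport β := β.hasCompactSupport
  have hβ0 : ∀ Z, 0 ≤ β Z := fun Z => β.nonneg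
  have hβpos : 0 < ∫ Z, β Z := β.integral_pos
  have hβz : ∀ Z : E, 2 < ‖Z‖ → Z ∉ tsupport β := by
    intro Z hZ h
    rw [β.tsupport_eq] at h
    have := mem_closedBall_zero_iff.1 h
    exact absurd hZ (not_lt.2 this)
  have hpc : ∀ i, Continuous (pderiv i β) := fun i =>
    (hβ1.continuous_fderiv one_ne_zero).clm_apply continuous_const
  have hpk : ∀ i, HasCompactSupport (pderiv i β) := fun i => hβk.fderiv_apply (𝕜 := ℝ) _
  have hpz : ∀ i, ∀ Z : E, 2 < ‖Z‖ → pderiv i β Z = 0 := fun i Z hZ => by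
    unfold pderiv; rw [fderiv_of_notMem_tsupport (𝕜 := ℝ) (hβz Z hZ)]; rfl
  set e' := D.indicator e with he'
  set J' : Fin 3 → E → ℝ := fun i => D.indicator (J i) with hJ'
  have hem : Measurable e' := measurable_indicator_of_continuousOn hD he
  have hec : ContinuousAt e' X₀ := by
    refine (he.continuousAt (hD.mem_nhds hX₀)).congr ?_
    filter_upwards [hD.mem_nhds hX₀] with X hX using (indicator_of_mem hX _).symm
  have hJd : ∀ i, HasFDerivAt (J' i) (fderiv ℝ (J i) X₀) X₀ := fun i => by
    refine (hJ i).hasFDerivAt.congr_of_eventuallyEq ?_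
    filter_upwards [hD.mem_nhds hX₀] with X hX using indicator_of_mem hX _
  -- Differentiability at the single point `X₀` gives a linear bound relative to `X₀`, which is all
  -- that domination of the difference quotients requires.
  have hlip : ∀ i, ∀ᶠ X in 𝓝 X₀,
      ‖J' i X - J' i X₀‖ ≤ (‖fderiv ℝ (J i) X₀‖ + 1) * ‖X - X₀‖ := fun i => by
    filter_upwards [(hJd i).isLittleO.def one_pos] with X hX
    have h1 := (fderiv ℝ (J i) X₀).le_opNorm (X - X₀)
    have h2 := norm_add_le (J' i X - J' i X₀ - fderiv ℝ (J i) X₀ (X - X₀))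
      (fderiv ℝ (J i) X₀ (X - X₀))
    rw [sub_add_cancel] at h2
    linarith
  obtain ⟨δ, hδ, hδ'⟩ := Metric.eventually_nhds_iff.1
    ((eventually_all.2 hlip).and (hD.mem_nhds hX₀))
  have hdist : ∀ r, 0 < r → r < δ / 2 → ∀ Z : E, ‖Z‖ ≤ 2 → dist (X₀ + r • Z) X₀ < δ := by
    intro r hr hrδ Z hZ
    rw [dist_eq_norm, add_sub_cancel_left, norm_smul, Real.norm_of_nonneg hr.le]
    nlinarith
  have hquot : ∀ i r, 0 < r → r < δ / 2 → ∀ Z : E,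
      ‖r⁻¹ * (J' i (X₀ + r • Z) - J' i X₀) * pderiv i β Z‖
        ≤ (‖fderiv ℝ (J i) X₀‖ + 1) * 2 * ‖pderiv i β Z‖ := by
    intro i r hr hrδ Z
    rw [norm_mul]
    by_cases hZ : ‖Z‖ ≤ 2
    · refine mul_le_mul_of_nonneg_right ?_ (norm_nonneg _)
      have h2 := (hδ' (hdist r hr hrδ Z hZ)).1 i
      rw [add_sub_cancel_left, norm_smul, Real.norm_of_nonneg hr.le] at h2
      rw [norm_mul, Real.norm_of_nonneg (inv_pos.2 hr).le, inv_mul_le_iff₀ hr]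
      refine h2.trans ?_
      have : 0 ≤ (‖fderiv ℝ (J i) X₀‖ + 1) * r := by positivity
      nlinarith
    · rw [hpz i Z (not_le.1 hZ)]; simp
  have hquotm : ∀ i r, Measurable fun Z =>
      r⁻¹ * (J' i (X₀ + r • Z) - J' i X₀) * pderiv i β Z := fun i r =>
    ((((hJm i).comp (by fun_prop)).sub_const _).const_mul _).mul (hpc i).measurable
  have hquotb : ∀ i, Integrable fun Z => (‖fderiv ℝ (J i) X₀‖ + 1) * 2 * ‖pderiv i β Z‖ :=
    fun i => (((hpc i).integrable_of_hasCompactSupport (hpk i)).norm).const_mul _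
  -- The test function is a bump rescaled to radius of order `r` around `X₀`; the change of
  -- variables turns the weak inequality into one on a fixed ball.
  have hscale : ∀ r, 0 < r → r < δ / 2 → ∫ Z, e' (X₀ + r • Z) * β Z
      ≤ ∑ i, ∫ Z, r⁻¹ * (J' i (X₀ + r • Z) - J' i X₀) * pderiv i β Z := by
    intro r hr hrδ
    let φ : E → ℝ := fun X => β (r⁻¹ • (X - X₀))
    have hφs : ContDiff ℝ ∞ φ := hβs.comp (by fun_prop)
    have hφz : ∀ X, X ∉ Metric.closedBall X₀ (2 * r) → φ X = 0 := by
      intro X hX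
      refine image_eq_zero_of_notMem_tsupport (f := β) (hβz _ ?_)
      rw [norm_smul, norm_inv, Real.norm_of_nonneg hr.le, lt_inv_mul_iff₀ hr, ← dist_eq_norm]
      rw [Metric.mem_closedBall, not_le] at hX
      linarith
    have hφt : tsupport φ ⊆ Metric.closedBall X₀ (2 * r) :=
      closure_minimal (fun X hX => by_contra fun h => hX (hφz X h)) Metric.isClosed_closedBall
    have hφD : tsupport φ ⊆ D := fun X hX =>
      (hδ' ((Metric.mem_closedBall.1 (hφt hX)).trans_lt (by linarith))).2
    have hφk : HasCompactSupport φ :=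
      HasCompactSupport.intro (isCompact_closedBall X₀ (2 * r)) hφz
    have hw := hweak φ hφs hφk hφD fun X => hβ0 _
    have h1 : ∫ X in D, e X * φ X = ∫ X, e' X * φ X := by
      rw [← integral_indicator hD.measurableSet]
      congr 1; ext X
      by_cases hX : X ∈ D
      · simp [he', hX]
      · simp [he', hX]
    have h2 : ∫ X in D, ∑ i, J i X * pderiv i φ X = ∫ X, ∑ i, J' i X * pderiv i φ X := by
      rw [← integral_indicator hD.measurableSet]
      congr 1; ext X
      by_cases hX : X ∈ D
      · simp [hJ', hX]
      · simp [hJ', hX]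
    rw [h1, h2] at hw
    have hw' := mul_le_mul_of_nonneg_left hw (abs_nonneg (r ^ 3)⁻¹)
    rw [← integral_blowup (fun X => e' X * φ X) X₀ r,
      ← integral_blowup (fun X => ∑ i, J' i X * pderiv i φ X) X₀ r] at hw'
    have hφ1 : ∀ Z, φ (X₀ + r • Z) = β Z := fun Z => by
      change β (r⁻¹ • (X₀ + r • Z - X₀)) = β Z
      rw [add_sub_cancel_left, inv_smul_smul₀ hr.ne']
    have hφ2 : ∀ i Z, pderiv i φ (X₀ + r • Z) = r⁻¹ * pderiv i β Z := fun i Z =>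
      pderiv_blowup (hβ1.differentiable one_ne_zero) X₀ hr.ne' i Z
    simp only [hφ1, hφ2] at hw'
    refine hw'.trans_eq ?_
    have hA : ∀ i, Integrable fun Z => r⁻¹ * (J' i (X₀ + r • Z) - J' i X₀) * pderiv i β Z :=
      fun i => (hquotb i).mono' (hquotm i r).aestronglyMeasurable
        (Eventually.of_forall (hquot i r hr hrδ))
    have hB : ∀ i, Integrable fun Z => r⁻¹ * J' i X₀ * pderiv i β Z := fun i =>
      ((hpc i).integrable_of_hasCompactSupport (hpk i)).const_mul _
    -- The constant `J(X₀)` may be subtracted because a derivative of the bump integrates to zero;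
    -- this creates the difference quotient that stays bounded as `r → 0`.
    have hsum : ∀ i, (fun Z => J' i (X₀ + r • Z) * (r⁻¹ * pderiv i β Z)) = fun Z =>
        r⁻¹ * (J' i (X₀ + r • Z) - J' i X₀) * pderiv i β Z + r⁻¹ * J' i X₀ * pderiv i β Z :=
      fun i => by ext Z; ring
    rw [integral_finsetSum _ fun i _ => by rw [hsum i]; exact (hA i).fun_add (hB i)]
    refine Finset.sum_congr rfl fun i _ => ?_
    rw [hsum i, integral_add (hA i) (hB i), integral_const_mul, integral_pderiv_eq_zero hβ1 hβk,
      mul_zero, add_zero]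
  have hsmall : ∀ᶠ r : ℝ in 𝓝[>] 0, r < δ / 2 :=
    mem_nhdsWithin_of_mem_nhds (gt_mem_nhds (by positivity))
  have hl1 : Tendsto (fun r : ℝ => ∫ Z, e' (X₀ + r • Z) * β Z) (𝓝[>] 0) (𝓝 (∫ Z, e' X₀ * β Z)) := by
    obtain ⟨δ, hδ, hδ'⟩ := Metric.continuousAt_iff.1 hec 1 one_pos
    refine tendsto_integral_filter_of_dominated_convergence (fun Z => (|e' X₀| + 1) * β Z) ?_ ?_
      ((hβ1.continuous.integrable_of_hasCompactSupport hβk).const_mul _)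
      (Eventually.of_forall fun Z => ?_)
    · exact Eventually.of_forall fun r => ((hem.comp (by fun_prop)).mul
        hβ1.continuous.measurable).aestronglyMeasurable
    · have : ∀ᶠ r : ℝ in 𝓝[>] 0, r < δ / 2 := mem_nhdsWithin_of_mem_nhds (gt_mem_nhds (by positivity))
      filter_upwards [this, self_mem_nhdsWithin] with r hr hr0
      have hr0 : 0 < r := hr0
      refine Eventually.of_forall fun Z => ?_
      rw [norm_mul, Real.norm_of_nonneg (hβ0 Z)]
      by_cases hZ : ‖Z‖ ≤ 2
      · refine mul_le_mul_of_nonneg_right ?_ (hβ0 Z)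
        have h1 : dist (X₀ + r • Z) X₀ < δ := by
          rw [dist_eq_norm, add_sub_cancel_left, norm_smul, Real.norm_of_nonneg hr0.le]
          nlinarith
        have h2 := hδ' h1
        rw [Real.dist_eq] at h2
        have h3 := abs_sub_abs_le_abs_sub (e' (X₀ + r • Z)) (e' X₀)
        rw [Real.norm_eq_abs]; linarith
      · rw [image_eq_zero_of_notMem_tsupport (hβz Z (not_le.1 hZ)), mul_zero, mul_zero]
    · refine Tendsto.mul_const _ ?_
      have h1 : Tendsto (fun r : ℝ => X₀ + r • Z) (𝓝[>] 0) (𝓝 X₀) := by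
        have : Continuous fun r : ℝ => X₀ + r • Z := by fun_prop
        simpa using (this.tendsto 0).mono_left nhdsWithin_le_nhds
      exact hec.tendsto.comp h1
  have hl2 : ∀ i, Tendsto (fun r : ℝ => ∫ Z, r⁻¹ * (J' i (X₀ + r • Z) - J' i X₀) * pderiv i β Z)
      (𝓝[>] 0) (𝓝 (∫ Z, fderiv ℝ (J i) X₀ Z * pderiv i β Z)) := by
    intro i
    refine tendsto_integral_filter_of_dominated_convergence
      (fun Z => (‖fderiv ℝ (J i) X₀‖ + 1) * 2 * ‖pderiv i β Z‖) ?_ ?_ (hquotb i)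
      (Eventually.of_forall fun Z => ?_)
    · exact Eventually.of_forall fun r => (hquotm i r).aestronglyMeasurable
    · filter_upwards [hsmall, self_mem_nhdsWithin] with r hr hr0
      exact Eventually.of_forall (hquot i r hr0 hr)
    · refine Tendsto.mul_const _ ?_
      have h1 : HasDerivAt (fun t : ℝ => J' i (X₀ + t • Z)) (fderiv ℝ (J i) X₀ Z) 0 :=
        (hJd i).hasLineDerivAt Z
      simpa using h1.tendsto_slope_zero_right
  have hfin := le_of_tendsto_of_tendsto hl1 (tendsto_finsetSum Finset.univ fun i _ => hl2 i) (by
    filter_upwards [hsmall, self_mem_nhdsWithin] with r hr hr0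
    exact hscale r hr0 hr)
  -- In the limit the flux is replaced by its linear part at `X₀`. Integrating by parts once more
  -- leaves the divergence times the mass of the bump, which is positive and can be divided out.
  simp_rw [integral_linear_mul_pderiv hβ1 hβk] at hfin
  rw [integral_const_mul, Finset.sum_neg_distrib, ← Finset.sum_mul] at hfin
  have h1 : (e' X₀ + ∑ i, pderiv i (J i) X₀) * ∫ Z, β Z ≤ 0 := by
    unfold pderiv; rw [add_mul]; linarith
  rw [he', indicator_of_mem hX₀] at h1
  exact nonpos_of_mul_nonpos_left h1 hβpos

namespace Snapshot

/-- The free-energy flux is measurable on the domain. -/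
lemma measurable_indicator_fluxF {G : Gas} {h dh : E → E → ℝ} {xmax : EReal}
    (P : Snapshot G h dh) (hm : 0 < G.m)
    (hSc : ContinuousOn G.S {x : ℝ | 0 ≤ x ∧ (x : EReal) < xmax})
    (hdom : ∀ X ∈ closure G.D, (G.calR h X : EReal) < xmax) (Tw : ℝ) (i : Fin 3) :
    Measurable (G.D.indicator fun X => G.fluxF Tw h i X) := by
  have hs := locBddFun_enskogFactor hm P.isOpen P.rapid P.pos hSc hdom
  have h1 := ((polyOn_coord G.D i).mul_rapidOn (P.rapidOn_feDensity (G.R * Tw))).continuousOn_integral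
  have h2 := P.continuousOn_integral_enskog hm hSc fun X hX => hdom X (subset_closure hX)
  have hc : Continuous fun v : E => v i := by fun_prop
  have h3 := hc.comp_continuousOn P.continuousOn_momentum
  have h4 := ((P.locBdd_exchangeF hs (G.R * Tw)).locBddFun_shiftFlux G.σ i).meas
  have h5 := (measurable_indicator_of_continuousOn P.isOpen
    (h1.add ((continuousOn_const (c := G.R * Tw)).mul (h2.mul h3)))).add
    ((h4.const_mul (G.σ ^ 3 / (2 * G.m))).indicator P.isOpen.measurableSet)
  convert h5 using 1
  ext X
  by_cases hX : X ∈ G.D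
  · simp only [Pi.add_apply, indicator_of_mem hX]
    rw [P.fluxF_eq_shiftFlux hs Tw i hX]
    rfl
  · simp [hX]

end Snapshot

end

end EESM

theorem mainTheorem2
    (G : EESM.Gas) (hm : 0 < G.m) (hσ : 0 < G.σ) (hR : 0 < G.R)
    (hD : IsOpen G.D) (hbdry : EESM.HasPiecewiseC1Boundary G.D)
    (xmax : EReal)
    (hScont : ContinuousOn G.S {x : ℝ | 0 ≤ x ∧ (x : EReal) < xmax})
    (hSnonneg : ∀ x : ℝ, 0 ≤ x → (x : EReal) < xmax → 0 ≤ G.S x)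
    (Tw : ℝ) (hTw : 0 < Tw)
    (I : Set ℝ) (hI : IsOpen I) (f : ℝ → EESM.E → EESM.E → ℝ)
    (hreg : EESM.IsRegular G.D I f)
    (hdom : ∀ t ∈ I, ∀ X ∈ closure G.D, (G.calR (f t) X : EReal) < xmax)
    (hsol : G.IsSolution I f)
    (himp : EESM.IsImpermeable G.D I f) :
    -- `F` is differentiable in time
    (∀ t ∈ I, ∀ X ∈ G.D,
      DifferentiableAt ℝ (fun s => G.freeEnergy Tw (f s) X) t) ∧
    -- the pointwise inequality wherever the flux is differentiable in space
    (∀ t ∈ I, ∀ X ∈ G.D,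
      (∀ i, DifferentiableAt ℝ (fun Y => G.fluxF Tw (f t) i Y) X) →
        deriv (fun s => G.freeEnergy Tw (f s) X) t
          + ∑ i, EESM.pderiv i (fun Y => G.fluxF Tw (f t) i Y) X ≤ 0) ∧
    -- the inequality on all of `D`, with the divergence in the sense of distributions
    (∀ t ∈ I,
      LocallyIntegrableOn (fun X => deriv (fun s => G.freeEnergy Tw (f s) X) t) G.D volume ∧
      (∀ i, LocallyIntegrableOn (fun X => G.fluxF Tw (f t) i X) G.D volume) ∧
      ∀ φ : EESM.E → ℝ, ContDiff ℝ ∞ φ → HasCompactSupport φ → tsupport φ ⊆ G.D →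
        (∀ X, 0 ≤ φ X) →
        ∫ X in G.D, deriv (fun s => G.freeEnergy Tw (f s) X) t * φ X
          ≤ ∫ X in G.D, ∑ i, G.fluxF Tw (f t) i X * EESM.pderiv i φ X) := by
  have P := fun t ht => hreg.snapshot hm hD hScont hSnonneg hdom hsol (t := t) ht
  have hder := fun t (ht : t ∈ I) X (hX : X ∈ G.D) =>
    hreg.hasDerivAt_freeEnergy hm hσ hD hI hScont hSnonneg hdom hsol Tw ht hX
  have hcont := fun t ht => (P t ht).continuousOn_dtFreeEnergy hm hScont (hdom t ht) (G.R * Tw)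
  -- Both forms of the inequality rest on this: the distributional one directly, the pointwise one
  -- by blow-up.
  have hweak := fun t ht φ (hφ : ContDiff ℝ ∞ φ) hk hs h0 =>
    (P t ht).weak_inequality hm hσ hScont (hdom t ht) hbdry (himp t ht) (mul_pos hR hTw).le
      (φ := φ) (hφ.of_le (by exact_mod_cast le_top)) hk hs h0
  refine ⟨fun t ht X hX => (hder t ht X hX).differentiableAt, fun t ht X hX hJ => ?_,
    fun t ht => ⟨?_, fun i => (P t ht).locallyIntegrableOn_fluxF hm hScont (hdom t ht) Tw i,
      fun φ hφ hk hs h0 => ?_⟩⟩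
  · rw [(hder t ht X hX).deriv]
    exact EESM.pointwise_of_weak hD (hcont t ht)
      (fun i => (P t ht).measurable_indicator_fluxF hm hScont (hdom t ht) Tw i)
      (hweak t ht) hX hJ
  · exact EESM.locallyIntegrableOn_congr hD (fun X hX => (hder t ht X hX).deriv)
      ((hcont t ht).locallyIntegrableOn hD.measurableSet)
  · refine le_trans (le_of_eq ?_) (hweak t ht φ hφ hk hs h0)
    exact setIntegral_congr_fun hD.measurableSet fun X hX => by
      simp only [(hder t ht X hX).deriv]
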